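/- **Setting.** Let $v_1=(\tfrac{\sqrt3}{2},\tfrac12)^T$, $v_2=(\tfrac{\sqrt3}{2},-\tfrac12)^T$, $\Lambda_h=\mathbb Zv_1\oplus\mathbb Zv_2$ with period cell $\Omega$, dual basis $k_1=\tfrac{4\pi}{\sqrt3}(\tfrac12,\tfrac{\sqrt3}2)^T$, $k_2=\tfrac{4\pi}{\sqrt3}(\tfrac12,-\tfrac{\sqrt3}2)^T$, $K=\tfrac13(k_1-k_2)$, $K'=-K$, and let $R$ be the clockwise rotation by $2\pi/3$. The vertices of the Brillouin zone are $K,RK,R^2K$ ($K$ type) and $K',RK',R^2K'$ ($K'$ type). Put $(\mathcal{PC}f)(x)=\overline{f(-x)}$, $(\mathcal Rf)(x)=f(R^*x)$, $\tau=e^{2\pi i/3}$. A *honeycomb structured medium* is a smooth, Hermitian, $\Lambda_h$-periodic, uniformly elliptic function $A:\mathbb R^2\to\mathbb C^{2\times2}$ such that $\mathcal L^A=-\nabla\cdot A\nabla$ commutes with $\mathcal{PC}$ and with $\mathcal R$. $L^2_k$ is the space of $L^2_{loc}$ functions with $f(x+v)=e^{ik\cdot v}f(x)$ for $v\in\Lambda_h$,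 with inner product $\langle f,g\rangle=\int_\Omega\bar fg$, and $L^2_{k,\sigma}=\{f\in L^2_k:\mathcal Rf=\sigma f\}$. $E_1(k)\le E_2(k)\le\cdots$ are the $L^2_k$-eigenvalues of $\mathcal L^A$, with multiplicity; the graph of $E_b$ is the $b$-th dispersion surface. Let $\mathscr A_jf=\sum_l a_{jl}\tfrac1i\partial_lf+\sum_l\tfrac1i\partial_l(a_{lj}f)$ and $A_m=|\Omega|^{-1}\int_\Omega e^{-i(m_1k_1+m_2k_2)\cdot y}A(y)\,dy$. A pair $(q,E_D)$ is a *Dirac point* of $\mathcal L^A$, joining the surfaces $b$ and $b+1$ with velocity $\upsilon>0$, if (a) $E_D=E_b(q)=E_{b+1}(q)$, and there is $\Phi_1\in L^2_{q,\tau}$ with $\Phi_2=\mathcal{PC}\Phi_1\in L^2_{q,\bar\tau}$, such that $\Phi_1,\Phi_2$ are an orthonormal basis of the $L^2_q$-nullspace of $\mathcal L^A-E_D$; (b) for $|k-q|<\zeta_0$, some $\zeta_0>0$, one has $E_{b+1}(k)-E_D=\upsilon|k-q|(1+e_+(k))$ and $E_b(k)-E_D=-\upsilon|k-q|(1+e_-(k))$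 with Lipschitz $e_\pm$ satisfying $|e_\pm(k)|\le C|k-q|$. **Theorem.** Let $A^{\varepsilon}=I+\varepsilon A^{(1)}$ be a honeycomb structured medium for all real $\varepsilon$ near $0$, and assume that $\kappa:=K^TA^{(1)}_{0,-1}RK\neq0$. Then there are $\varepsilon^0>0$ and maps $\varepsilon\mapsto E_D^\varepsilon,\widetilde E^\varepsilon\in\mathbb R$ and $\varepsilon\mapsto\Phi_1^\varepsilon,\Phi_2^\varepsilon,\widetilde\Phi^\varepsilon$ such that for all $|\varepsilon|<\varepsilon^0$, with $\mathcal L^{\varepsilon}=\mathcal L^{A^\varepsilon}$ and error constants independent of $\varepsilon$: 1. $E_D^\varepsilon=|K|^2+\varepsilon\,(K^TA^{(1)}_{0,0}K-\kappa)+O(\varepsilon^2)$ is a simple $L^2_{K,\tau}$-eigenvalue of $\mathcal L^{\varepsilon}$, with eigenspace spanned by the normalized $\Phi_1^\varepsilon\in L^2_{K,\tau}$. 2. $E_D^\varepsilon$ is a simple $L^2_{K,\bar\tau}$-eigenvalue, with eigenspace spanned by $\Phi_2^\varepsilon=\mathcal{PC}\,\Phi_1^\varepsilon\in L^2_{K,\bar\tau}$.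 3. $\widetilde E^\varepsilon=|K|^2+\varepsilon\,(K^TA^{(1)}_{0,0}K+2\kappa)+O(\varepsilon^2)$ is a simple $L^2_{K,1}$-eigenvalue, with eigenspace spanned by $\widetilde\Phi^\varepsilon\in L^2_{K,1}$, and $\widetilde E^\varepsilon\neq E_D^\varepsilon$ if $\varepsilon\neq0$. 4. $\upsilon_F(\varepsilon)=\left|\tfrac12\overline{\langle\Phi_1^\varepsilon,\mathscr A^{\varepsilon}\Phi_2^\varepsilon\rangle}\cdot(1,i)^T\right|=\tfrac{4\pi}3+O(\varepsilon)$, where $\mathscr A^{\varepsilon}$ is $\mathscr A$ for the medium $A^\varepsilon$; if $\varepsilon\ne0$, then $(K,E_D^\varepsilon)$ is a Dirac point of $\mathcal L^{\varepsilon}$. 5. For each vertex $q$ of $K$ type, $(q,E_D^\varepsilon)$ is a Dirac point with velocity $\upsilon_F(\varepsilon)$; it joins the $1$st and $2$nd dispersion surfaces if $\varepsilon\kappa>0$, and the $2$nd and $3$rd if $\varepsilon\kappa<0$. If $A^{(1)}$ is real-valued, the same holds for all six vertices $q$. For complex $A^{(1)}$, the vertices of $K'$ type are governed by $\kappa':=K^TA^{(1)}_{0,1}RK$: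 if also $\kappa'\ne0$, there are maps $\varepsilon\mapsto E_{D}'^{\,\varepsilon}$, $\upsilon'(\varepsilon)$ with $E_{D}'^{\,\varepsilon}=|K|^2+\varepsilon(K^TA^{(1)}_{0,0}K-\kappa')+O(\varepsilon^2)$ and $\upsilon'(\varepsilon)=\tfrac{4\pi}3+O(\varepsilon)$ such that, for all sufficiently small $|\varepsilon|$ and each vertex $q$ of $K'$ type, $(q,E_{D}'^{\,\varepsilon})$ is a Dirac point of $\mathcal L^\varepsilon$ with velocity $\upsilon'(\varepsilon)$, joining the $1$st and $2$nd surfaces if $\varepsilon\kappa'>0$ and the $2$nd and $3$rd if $\varepsilon\kappa'<0$. -/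

import Mathlib

open MeasureTheory Set Filter Topology
open scoped ContDiff NNReal

noncomputable section

namespace Honeycomb

/-- The plane `ℝ²` with its Euclidean norm. -/
abbrev Plane := EuclideanSpace ℝ (Fin 2)

/-- A `2 × 2` complex matrix valued function on the plane. -/
abbrev Medium := Plane → Matrix (Fin 2) (Fin 2) ℂ

/-! ### The equilateral triangular lattice and its dual -/

/-- Lattice basis vector `v₁`. -/
def v₁ : Plane := !₂[Real.sqrt 3 / 2, 1 / 2]

/-- Lattice basis vector `v₂`. -/
def v₂ : Plane := !₂[Real.sqrt 3 / 2, -(1 / 2)]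

/-- Dual basis vector `k₁`; `kₗ · vₘ = 2π δₗₘ`. -/
def k₁ : Plane := (4 * Real.pi / Real.sqrt 3) • !₂[1 / 2, Real.sqrt 3 / 2]

/-- Dual basis vector `k₂`. -/
def k₂ : Plane := (4 * Real.pi / Real.sqrt 3) • !₂[1 / 2, -(Real.sqrt 3 / 2)]

/-- The lattice vector `m₁ v₁ + m₂ v₂`. -/
def latticeVec (m : ℤ × ℤ) : Plane := (m.1 : ℝ) • v₁ + (m.2 : ℝ) • v₂

/-- The dual lattice vector `m₁ k₁ + m₂ k₂`. -/
def dualVec (m : ℤ × ℤ) : Plane := (m.1 : ℝ) • k₁ + (m.2 : ℝ) • k₂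

/-- The fundamental period parallelogram `Ω`. -/
def cell : Set Plane :=
  {x | ∃ s ∈ Ico (0 : ℝ) 1, ∃ t ∈ Ico (0 : ℝ) 1, x = s • v₁ + t • v₂}

/-- The matrix `R` of the clockwise rotation by `2π/3`. -/
def rotMatrix : Matrix (Fin 2) (Fin 2) ℝ :=
  !![-(1 / 2), Real.sqrt 3 / 2; -(Real.sqrt 3 / 2), -(1 / 2)]

/-- `x ↦ R x`. -/
def rot (x : Plane) : Plane := WithLp.toLp 2 (rotMatrix.mulVec x.ofLp)

/-- `x ↦ R* x`. -/
def rotInv (x : Plane) : Plane := WithLp.toLp 2 (rotMatrix.transpose.mulVec x.ofLp)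

/-- The high symmetry quasi-momentum `K = (k₁ - k₂) / 3`. -/
def K : Plane := (1 / 3 : ℝ) • (k₁ - k₂)

/-- The three vertices `K, RK, R²K` of the Brillouin zone of `K` type. -/
def verticesK : Set Plane := {K, rot K, rot (rot K)}

/-- The three vertices `K', RK', R²K'` of the Brillouin zone of `K' = -K` type. -/
def verticesK' : Set Plane := {-K, rot (-K), rot (rot (-K))}

/-! ### Symmetry operations and honeycomb structured media -/

/-- `(𝒫𝒞 f)(x) = conj (f (-x))`. -/
def PC (f : Plane → ℂ) : Plane → ℂ := fun x => (starRingEnd ℂ) (f (-x))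

/-- `(ℛ f)(x) = f (R* x)`. -/
def rotOp (f : Plane → ℂ) : Plane → ℂ := fun x => f (rotInv x)

/-- The classical partial derivative `∂ⱼ f`. -/
def pderiv {F : Type*} [NormedAddCommGroup F] [NormedSpace ℝ F]
    (j : Fin 2) (f : Plane → F) : Plane → F :=
  fun x => fderiv ℝ f x (EuclideanSpace.single j 1)

/-- The operator `ℒ^A = -∇ · A ∇` acting on smooth functions. -/
def divOp (A : Medium) (f : Plane → ℂ) : Plane → ℂ :=
  fun x => -∑ i, ∑ j, pderiv i (fun y => A y i j * pderiv j f y) x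

/-- Honeycomb structured media: smooth, Hermitian, `Λ_h`-periodic, uniformly elliptic matrix
functions for which `-∇ · A ∇` commutes with `𝒫𝒞` and with `ℛ`. -/
structure IsHoneycombMedium (A : Medium) : Prop where
  smooth : ∀ i j, ContDiff ℝ ∞ (fun x => A x i j)
  hermitian : ∀ x, (A x).IsHermitian
  periodic : ∀ (m : ℤ × ℤ) (x : Plane), A (x + latticeVec m) = A x
  elliptic : ∃ c C : ℝ, 0 < c ∧ 0 < C ∧ ∀ (x : Plane) (ξ : Fin 2 → ℂ),
    c * ∑ i, ‖ξ i‖ ^ 2 ≤ (∑ i, ∑ j, (starRingEnd ℂ) (ξ i) * A x i j * ξ j).re ∧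
    (∑ i, ∑ j, (starRingEnd ℂ) (ξ i) * A x i j * ξ j).re ≤ C * ∑ i, ‖ξ i‖ ^ 2
  pc_invariant : ∀ f : Plane → ℂ, ContDiff ℝ ∞ f → PC (divOp A f) = divOp A (PC f)
  rot_invariant : ∀ f : Plane → ℂ, ContDiff ℝ ∞ f → rotOp (divOp A f) = divOp A (rotOp f)

/-- The medium `A^ε = I + ε A⁽¹⁾`. -/
def lowContrast (A₁ : Medium) (ε : ℝ) : Medium := fun x => 1 + (ε : ℂ) • A₁ x

/-- The Fourier coefficient
`A_m = |Ω|⁻¹ ∫_Ω e^{-i (m₁ k₁ + m₂ k₂) · y} A(y) dy`, entry by entry. -/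
def fourierCoeff (A : Medium) (m : ℤ × ℤ) : Matrix (Fin 2) (Fin 2) ℂ :=
  Matrix.of fun i j => (((volume cell).toReal : ℝ) : ℂ)⁻¹ *
    ∫ y in cell, Complex.exp (-Complex.I * ((inner ℝ (dualVec m) y : ℝ) : ℂ)) * A y i j

/-- The bilinear expression `pᵀ M q` for real vectors `p`, `q` and a complex matrix `M`. -/
def bilin (p : Plane) (M : Matrix (Fin 2) (Fin 2) ℂ) (q : Plane) : ℂ :=
  ∑ i, ∑ j, (p i : ℂ) * M i j * (q j : ℂ)

/-! ### Pseudo-periodic function spaces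

Elements of `L²_k` are represented by functions on the plane, up to equality almost everywhere. -/

/-- The inner product `⟨f, g⟩ = ∫_Ω conj f · g`. -/
def cellInner (f g : Plane → ℂ) : ℂ := ∫ x in cell, (starRingEnd ℂ) (f x) * g x

/-- `f ∈ L²_k`: square integrable on `Ω`, with `f(x + v) = e^{ik·v} f(x)` for `v ∈ Λ_h`. -/
def MemL2 (k : Plane) (f : Plane → ℂ) : Prop :=
  MemLp f 2 (volume.restrict cell) ∧
  ∀ m : ℤ × ℤ, ∀ᵐ x, f (x + latticeVec m) =
    Complex.exp (Complex.I * ((inner ℝ k (latticeVec m) : ℝ) : ℂ)) * f x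

/-- `f ∈ L²_{k,σ}`: `f ∈ L²_k` and `ℛ f = σ f`. -/
def MemL2Rot (k : Plane) (σ : ℂ) (f : Plane → ℂ) : Prop :=
  MemL2 k f ∧ ∀ᵐ x, rotOp f x = σ * f x

/-- `τ = e^{2πi/3}`. -/
def τ : ℂ := Complex.exp (2 * Real.pi * Complex.I / 3)

/-- `g` is a weak partial derivative `∂ⱼ f` on the plane. -/
def HasWeakDeriv (j : Fin 2) (f g : Plane → ℂ) : Prop :=
  LocallyIntegrable f ∧ LocallyIntegrable g ∧
  ∀ η : Plane → ℝ, ContDiff ℝ ∞ η → HasCompactSupport η →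
    ∫ x, pderiv j η x • f x = -∫ x, η x • g x

open Classical in
/-- The weak partial derivative `∂ⱼ f` (unique up to null sets; `0` if there is none). -/
def weakDeriv (j : Fin 2) (f : Plane → ℂ) : Plane → ℂ :=
  if h : ∃ g, HasWeakDeriv j f g then h.choose else 0

/-- `f` belongs to the Sobolev space `H¹_k`. -/
def MemH1 (k : Plane) (f : Plane → ℂ) : Prop :=
  MemL2 k f ∧ ∀ j, HasWeakDeriv j f (weakDeriv j f) ∧ MemL2 k (weakDeriv j f)

/-! ### The Floquet-Bloch eigenvalue problem -/

/-- The sesquilinear form `∫_Ω conj(∇ψ) · A ∇f` of `ℒ^A`. -/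
def form (A : Medium) (ψ f : Plane → ℂ) : ℂ :=
  ∫ x in cell, ∑ i, ∑ j, (starRingEnd ℂ) (weakDeriv i ψ x) * A x i j * weakDeriv j f x

/-- `f` lies in the `L²_k`-nullspace of `ℒ^A - E` (weak formulation in `H¹_k`). -/
def InEigenspace (A : Medium) (k : Plane) (E : ℝ) (f : Plane → ℂ) : Prop :=
  MemH1 k f ∧ ∀ ψ, MemH1 k ψ → form A ψ f = (E : ℂ) * cellInner ψ f

/-- `f` is a Floquet-Bloch eigenfunction of `ℒ^A` with quasi-momentum `k` and energy `E`. -/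
def IsEigenfunction (A : Medium) (k : Plane) (E : ℝ) (f : Plane → ℂ) : Prop :=
  InEigenspace A k E f ∧ ¬ f =ᵐ[volume] 0

/-- `E` is a simple `L²_{k,σ}`-eigenvalue of `ℒ^A` with eigenspace spanned by `Φ`. -/
def IsSimpleEigenpair (A : Medium) (k : Plane) (σ : ℂ) (E : ℝ) (Φ : Plane → ℂ) : Prop :=
  MemL2Rot k σ Φ ∧ IsEigenfunction A k E Φ ∧
  ∀ f, MemL2Rot k σ f → InEigenspace A k E f → ∃ c : ℂ, f =ᵐ[volume] fun x => c * Φ x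

/-- `E = E_b(k)` is the `b`-th (`b ≥ 1`) eigenvalue in the list `E₁(k) ≤ E₂(k) ≤ ⋯` of
`L²_k`-eigenvalues of `ℒ^A`, repeated according to multiplicity: there are `b` orthonormal
eigenfunctions with nondecreasing energies, the last of which is `E`, and every eigenfunction
orthogonal to these has energy at least `E`. -/
def IsBandEnergy (A : Medium) (k : Plane) (b : ℕ) (E : ℝ) : Prop :=
  ∃ (φ : Fin b → Plane → ℂ) (e : Fin b → ℝ),
    (∀ i, InEigenspace A k (e i) (φ i)) ∧
    (∀ i j, cellInner (φ i) (φ j) = if i = j then 1 else 0) ∧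
    Monotone e ∧
    (∃ i : Fin b, (i : ℕ) + 1 = b ∧ e i = E) ∧
    ∀ (E' : ℝ) (f : Plane → ℂ), IsEigenfunction A k E' f →
      (∀ i, cellInner (φ i) f = 0) → E ≤ E'

/-! ### Dirac points -/

/-- `(q, E_D)` is a Dirac point of `ℒ^A` at the intersection of the `b`-th and `(b+1)`-st
dispersion surfaces, with Fermi velocity `υ` (the slope of the cones). -/
structure IsDiracPointOf (A : Medium) (q : Plane) (E_D : ℝ) (b : ℕ) (υ : ℝ) : Prop where
  band_lower : IsBandEnergy A q b E_D
  band_upper : IsBandEnergy A q (b + 1) E_D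
  eigenspace : ∃ Φ₁ Φ₂ : Plane → ℂ, Φ₂ = PC Φ₁ ∧
    MemL2Rot q τ Φ₁ ∧ MemL2Rot q ((starRingEnd ℂ) τ) Φ₂ ∧
    cellInner Φ₁ Φ₁ = 1 ∧ cellInner Φ₂ Φ₂ = 1 ∧ cellInner Φ₁ Φ₂ = 0 ∧
    ∀ f, InEigenspace A q E_D f ↔
      ∃ c₁ c₂ : ℂ, f =ᵐ[volume] fun x => c₁ * Φ₁ x + c₂ * Φ₂ x
  velocity_pos : 0 < υ
  cones : ∃ (ζ₀ : ℝ) (Em Ep em ep : Plane → ℝ), 0 < ζ₀ ∧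
    (∃ L : ℝ≥0, LipschitzOnWith L em (Metric.ball q ζ₀)) ∧
    (∃ L : ℝ≥0, LipschitzOnWith L ep (Metric.ball q ζ₀)) ∧
    (∃ C : ℝ, ∀ k ∈ Metric.ball q ζ₀, |em k| ≤ C * ‖k - q‖ ∧ |ep k| ≤ C * ‖k - q‖) ∧
    ∀ k ∈ Metric.ball q ζ₀,
      IsBandEnergy A k b (Em k) ∧ IsBandEnergy A k (b + 1) (Ep k) ∧
      Ep k - E_D = υ * ‖k - q‖ * (1 + ep k) ∧
      Em k - E_D = -(υ * ‖k - q‖ * (1 + em k))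

/-- `(q, E_D)` is a Dirac point of `ℒ^A`. -/
def IsDiracPoint (A : Medium) (q : Plane) (E_D : ℝ) : Prop :=
  ∃ (b : ℕ) (υ : ℝ), IsDiracPointOf A q E_D b υ

/-- The component
`𝒜ⱼ f = ∑ₗ aⱼₗ (1/i) ∂ₗ f + ∑ₗ (1/i) ∂ₗ (aₗⱼ f)` of `𝒜 = A (1/i)∇ + (1/i)∇·A`. -/
def vecOp (A : Medium) (j : Fin 2) (f : Plane → ℂ) : Plane → ℂ := fun x =>
  ∑ l, A x j l * ((1 / Complex.I) * weakDeriv l f x) +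
    ∑ l, (1 / Complex.I) * weakDeriv l (fun y => A y l j * f y) x

/-- `υ_F = | ½ conj⟨Φ₁, 𝒜 Φ₂⟩ · (1, i)ᵀ |`. -/
def fermiVelocity (A : Medium) (Φ₁ Φ₂ : Plane → ℂ) : ℝ :=
  ‖(1 / 2 : ℂ) * ((starRingEnd ℂ) (cellInner Φ₁ (vecOp A 0 Φ₂)) * 1 +
    (starRingEnd ℂ) (cellInner Φ₁ (vecOp A 1 Φ₂)) * Complex.I)‖

end Honeycomb

end

noncomputable section

namespace Honeycomb

/-! ### The lattice and its fundamental domain -/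

/-! At the vertex K the Laplacian has the lowest eigenvalue |K|², of multiplicity three: the wave
vectors K + m of length |K| are K, RK and R²K, and all others satisfy |K + m|² ≥ 4|K|². The rotation
permutes these three plane waves cyclically, so the eigenspace splits into one line for each of the
characters τ, τ̄, 1. A honeycomb perturbation commutes with the rotation and keeps the three lines
apart; it commutes with 𝒫𝒞, which exchanges τ and τ̄, so two of the three energies stay equal for
every ε. To first order the perturbation acts on the three waves by a real symmetric circulant
matrix with diagonal a = KᵀA₀₀K and off-diagonal entry κ. Its eigenvalues are a − κ, twice, and a +
2κ. The sign of 3εκ thus decides on which side of the double energy the third one lies, that is,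
which two bands meet.

Away from K, the part of the form that is linear in the displacement p = k − K is equivariant under
the rotation. On the τ and τ̄ lines this forces its diagonal entries to vanish and its off-diagonal
entry to be a multiple of p₀ + i p₁. The 2 × 2 block of the double energy is therefore a cone of
slope the modulus of that multiple, up to second order errors in p.

To make this rigorous, functions of every quasi-momentum K + p are encoded by Fourier coefficients
in one weighted space ℓ²(ℤ²) (`bf`, `inEigenspace_bf`). There the form becomes a bounded operator
`formOp`, polynomial in (ε, p), and the inner product becomes `massOp`. The implicit function
theorem for the invariant subspace equation G Y = B Y N (`exists_invariant_continuation`) continues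
the triple eigenspace, and the spectral gap survives (`exists_reduction`). Hence all spectrum below
2|K|² is that of a 3 × 3 matrix N(ε, p), and its ordered eigenvalues are the first three bands
(`IsReduction.mem_range`, `IsReduction.isBandEnergy`). The symmetries make N(ε, 0) diagonal
(`IsReduction.N_single'`, `IsReduction.diagEntry_conjIndex`), and `isBigO_redEnergy` gives its first
order expansion.

For fixed ε ≠ 0 a second continuation separates the double energy from the third
(`IsReduction.exists_dirac_continuation`). The linear term of the resulting 2 × 2 matrix is found
from `IsReduction.fderiv_dirac`, `velocity_diagonal` and `velocity_off_diagonal`. Its eigenvalues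
are solved for explicitly in `cone_formula`, and `LipOrder` keeps track of Lipschitz remainders
through division by |p| and the square root.

The remaining vertices cost little: adding a dual lattice vector does not change L²_k, and complex
conjugation carries the medium at K to the conjugate medium at −K (`IsDiracPointOf.conj`). -/

lemma sqrt_three_mul_self : Real.sqrt 3 * Real.sqrt 3 = 3 := Real.mul_self_sqrt (by norm_num)

lemma sqrt_three_pos : 0 < Real.sqrt 3 := Real.sqrt_pos.2 (by norm_num)

/-- First coordinate with respect to `v₁, v₂`. -/
def coordFst (x : Plane) : ℝ := x 0 / Real.sqrt 3 + x 1

/-- Second coordinate with respect to `v₁, v₂`. -/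
def coordSnd (x : Plane) : ℝ := x 0 / Real.sqrt 3 - x 1

lemma coord_add (x y : Plane) :
    coordFst (x + y) = coordFst x + coordFst y ∧ coordSnd (x + y) = coordSnd x + coordSnd y := by
  simp only [coordFst, coordSnd, PiLp.add_apply]
  constructor <;> ring

lemma coord_comb (s t : ℝ) :
    coordFst (s • v₁ + t • v₂) = s ∧ coordSnd (s • v₁ + t • v₂) = t := by
  have h := sqrt_three_pos.ne'
  constructor <;>
  · simp [coordFst, coordSnd, v₁, v₂]
    field_simp
    ring

lemma comb_coord (x : Plane) : coordFst x • v₁ + coordSnd x • v₂ = x := by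
  have h := sqrt_three_pos.ne'
  ext i
  fin_cases i <;>
  · simp [coordFst, coordSnd, v₁, v₂]
    field_simp
    ring

lemma mem_cell_iff {x : Plane} :
    x ∈ cell ↔ coordFst x ∈ Ico (0 : ℝ) 1 ∧ coordSnd x ∈ Ico (0 : ℝ) 1 := by
  constructor
  · rintro ⟨s, hs, t, ht, rfl⟩
    rw [(coord_comb s t).1, (coord_comb s t).2]
    exact ⟨hs, ht⟩
  · rintro ⟨h1, h2⟩
    exact ⟨_, h1, _, h2, (comb_coord x).symm⟩

lemma measurable_coordFst : Measurable coordFst := by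
  unfold coordFst; fun_prop

lemma measurable_coordSnd : Measurable coordSnd := by
  unfold coordSnd; fun_prop

lemma measurableSet_cell : MeasurableSet cell := by
  have : cell = coordFst ⁻¹' Ico 0 1 ∩ coordSnd ⁻¹' Ico 0 1 := by
    ext x; exact mem_cell_iff
  rw [this]
  exact (measurable_coordFst measurableSet_Ico).inter (measurable_coordSnd measurableSet_Ico)

lemma latticeVec_add (m n : ℤ × ℤ) : latticeVec (m + n) = latticeVec m + latticeVec n := by
  simp only [latticeVec, Prod.fst_add, Prod.snd_add, Int.cast_add, add_smul]; abel

lemma dualVec_add (m n : ℤ × ℤ) : dualVec (m + n) = dualVec m + dualVec n := by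
  simp only [dualVec, Prod.fst_add, Prod.snd_add, Int.cast_add, add_smul]; abel

lemma dualVec_neg (m : ℤ × ℤ) : dualVec (-m) = -dualVec m := by
  simp only [dualVec, Prod.fst_neg, Prod.snd_neg, Int.cast_neg, neg_smul]; abel

lemma dualVec_sub (m n : ℤ × ℤ) : dualVec (m - n) = dualVec m - dualVec n := by
  rw [sub_eq_add_neg, dualVec_add, dualVec_neg, sub_eq_add_neg]

lemma latticeVec_neg (m : ℤ × ℤ) : latticeVec (-m) = -latticeVec m := by
  simp only [latticeVec, Prod.fst_neg, Prod.snd_neg, Int.cast_neg, neg_smul]; abel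

lemma latticeVec_zero : latticeVec 0 = 0 := by simp [latticeVec]

lemma dualVec_zero : dualVec 0 = 0 := by simp [dualVec]

lemma coord_latticeVec (m : ℤ × ℤ) :
    coordFst (latticeVec m) = m.1 ∧ coordSnd (latticeVec m) = m.2 := coord_comb _ _

/-- The lattice as an additive subgroup of the plane. -/
def lattice : AddSubgroup Plane :=
  (AddMonoidHom.mk' latticeVec latticeVec_add).range

lemma latticeVec_mem (m : ℤ × ℤ) : latticeVec m ∈ lattice := ⟨m, rfl⟩

instance : Countable lattice :=
  (Set.countable_range latticeVec).to_subtype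

/-- The lattice part of a point. -/
def cellIndex (x : Plane) : ℤ × ℤ := (⌊coordFst x⌋, ⌊coordSnd x⌋)

/-- The representative in the period cell of a point. -/
def cellRep (x : Plane) : Plane := x - latticeVec (cellIndex x)

lemma coord_sub (x y : Plane) :
    coordFst (x - y) = coordFst x - coordFst y ∧ coordSnd (x - y) = coordSnd x - coordSnd y := by
  simp only [coordFst, coordSnd, PiLp.sub_apply]
  constructor <;> ring

lemma cellRep_mem (x : Plane) : cellRep x ∈ cell := by
  rw [mem_cell_iff, cellRep, (coord_sub _ _).1, (coord_sub _ _).2, (coord_latticeVec _).1,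
    (coord_latticeVec _).2]
  exact ⟨⟨Int.fract_nonneg _, Int.fract_lt_one _⟩, ⟨Int.fract_nonneg _, Int.fract_lt_one _⟩⟩

lemma cellIndex_of_mem {x : Plane} (hx : x ∈ cell) : cellIndex x = 0 := by
  rw [mem_cell_iff] at hx
  ext
  · exact Int.floor_eq_zero_iff.2 hx.1
  · exact Int.floor_eq_zero_iff.2 hx.2

lemma cellRep_of_mem {x : Plane} (hx : x ∈ cell) : cellRep x = x := by
  rw [cellRep, cellIndex_of_mem hx, latticeVec_zero, sub_zero]

lemma cellIndex_add (x : Plane) (m : ℤ × ℤ) : cellIndex (x + latticeVec m) = cellIndex x + m := by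
  ext
  · simp [cellIndex, (coord_add _ _).1, (coord_latticeVec m).1]
  · simp [cellIndex, (coord_add _ _).2, (coord_latticeVec m).2]

lemma cellRep_add (x : Plane) (m : ℤ × ℤ) : cellRep (x + latticeVec m) = cellRep x := by
  rw [cellRep, cellIndex_add, latticeVec_add, cellRep]; abel

lemma measurable_cellIndex : Measurable cellIndex :=
  (Int.measurable_floor.comp measurable_coordFst).prodMk
    (Int.measurable_floor.comp measurable_coordSnd)

lemma measurable_cellRep : Measurable cellRep :=
  measurable_id.sub ((measurable_of_countable latticeVec).comp measurable_cellIndex)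

/-- The only lattice translation that carries a point into the cell is by minus the integer parts of
its coordinates. The cell is half open, so this holds at every point and not merely almost
everywhere. -/
lemma cell_isAddFundamentalDomain : IsAddFundamentalDomain lattice cell volume := by
  refine IsAddFundamentalDomain.mk' measurableSet_cell.nullMeasurableSet fun x => ?_
  refine ⟨⟨latticeVec (-cellIndex x), latticeVec_mem _⟩, ?_, ?_⟩
  · have : latticeVec (-cellIndex x) + x = cellRep x := by
      rw [cellRep, latticeVec_neg]; abel
    simpa only [AddSubgroup.vadd_def, vadd_eq_add, this] using cellRep_mem x
  · rintro ⟨g, n, rfl⟩ h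
    have h' : x + latticeVec n ∈ cell := by
      rw [add_comm]; exact h
    have := cellIndex_of_mem h'
    rw [cellIndex_add] at this
    have hn : n = -cellIndex x := (neg_eq_of_add_eq_zero_right this).symm
    subst hn
    rfl

lemma norm_v₁ : ‖v₁‖ = 1 := by
  rw [EuclideanSpace.norm_eq, Real.sqrt_eq_one]
  simp [v₁, Fin.sum_univ_two, div_pow]
  norm_num

lemma norm_v₂ : ‖v₂‖ = 1 := by
  rw [EuclideanSpace.norm_eq, Real.sqrt_eq_one]
  simp [v₂, Fin.sum_univ_two, div_pow]
  norm_num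

lemma cell_subset_ball : cell ⊆ Metric.ball (0 : Plane) 2 := by
  rintro x ⟨s, hs, t, ht, rfl⟩
  rw [mem_ball_zero_iff]
  calc ‖s • v₁ + t • v₂‖ ≤ ‖s • v₁‖ + ‖t • v₂‖ := norm_add_le _ _
    _ = s + t := by
      rw [norm_smul, norm_smul, norm_v₁, norm_v₂, Real.norm_of_nonneg hs.1,
        Real.norm_of_nonneg ht.1, mul_one, mul_one]
    _ < 2 := by linarith [hs.2, ht.2]

lemma volume_cell_ne_top : volume cell ≠ ⊤ :=
  ((measure_mono cell_subset_ball).trans_lt measure_ball_lt_top).ne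

lemma volume_cell_ne_zero : volume cell ≠ 0 :=
  cell_isAddFundamentalDomain.measure_ne_zero (NeZero.ne _)

/-- The restriction of Lebesgue measure to the period cell. -/
abbrev cellMeasure : Measure Plane := volume.restrict cell

instance : IsFiniteMeasure cellMeasure :=
  ⟨by rw [Measure.restrict_apply_univ]; exact volume_cell_ne_top.lt_top⟩

/-- The area of the period cell. -/
def cellVol : ℝ := (volume cell).toReal

lemma cellVol_pos : 0 < cellVol := ENNReal.toReal_pos volume_cell_ne_zero volume_cell_ne_top

/-! ### Periodic functions -/

/-- Invariance under all lattice translations. -/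
def Periodic {β : Type*} (h : Plane → β) : Prop := ∀ (m : ℤ × ℤ) (x : Plane), h (x + latticeVec m) = h x

lemma Periodic.vadd {β : Type*} {h : Plane → β} (hh : Periodic h) (g : lattice) (x : Plane) :
    h (g +ᵥ x) = h x := by
  obtain ⟨g, m, rfl⟩ := g
  have := hh m x
  rw [add_comm] at this
  exact this

lemma Periodic.apply_cellRep {β : Type*} {h : Plane → β} (hh : Periodic h) (x : Plane) :
    h (cellRep x) = h x := by
  rw [cellRep, sub_eq_add_neg, ← latticeVec_neg]; exact hh _ _

/-- Integrals of periodic functions over the cell do not change under measure preserving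
homeomorphisms which normalize the lattice translations. -/
lemma Periodic.setIntegral_comp {h : Plane → ℂ} (hh : Periodic h) (e : Plane ≃ₜ Plane)
    (he : MeasurePreserving e volume volume) (σ : lattice ≃ lattice)
    (hσ : ∀ (g : lattice) (x : Plane), e (σ g + x) = g + e x) :
    ∫ x in cell, h (e x) = ∫ x in cell, h x := by
  -- The image of the cell under `e` is another fundamental domain, and a periodic function has the
  -- same integral over both.
  have h1 : IsAddFundamentalDomain lattice (e.symm ⁻¹' cell) volume := by
    have hq : Measure.QuasiMeasurePreserving e.symm volume volume :=
      (he.symm e.toMeasurableEquiv).quasiMeasurePreserving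
    refine cell_isAddFundamentalDomain.preimage_of_equiv hq σ.symm.bijective fun g x => ?_
    have := hσ (σ.symm g) (e.symm x)
    simp only [Homeomorph.apply_symm_apply, Equiv.apply_symm_apply] at this
    change e.symm (σ.symm g + x) = g + e.symm x
    rw [← this, Homeomorph.symm_apply_apply]
  rw [cell_isAddFundamentalDomain.setIntegral_eq h1 (fun g x => hh.vadd g x)]
  have := he.setIntegral_preimage_emb e.measurableEmbedding h (e.symm ⁻¹' cell)
  rw [← this]
  congr 2
  ext x; simp

lemma Periodic.setIntegral_add {h : Plane → ℂ} (hh : Periodic h) (s : Plane) :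
    ∫ x in cell, h (x + s) = ∫ x in cell, h x := by
  refine hh.setIntegral_comp (Homeomorph.addRight s) (measurePreserving_add_right volume s)
    (Equiv.refl _) fun g x => ?_
  simp [add_assoc]

lemma Periodic.setIntegral_neg {h : Plane → ℂ} (hh : Periodic h) :
    ∫ x in cell, h (-x) = ∫ x in cell, h x := by
  refine hh.setIntegral_comp (Homeomorph.neg Plane) (Measure.measurePreserving_neg volume)
    (Equiv.neg _) fun g x => ?_
  simp [add_comm]

/-! ### Rotations -/

lemma rot_apply (x : Plane) : rot x 0 = -(1 / 2) * x 0 + Real.sqrt 3 / 2 * x 1 ∧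
    rot x 1 = -(Real.sqrt 3 / 2) * x 0 - 1 / 2 * x 1 := by
  simp [rot, rotMatrix, dotProduct, Fin.sum_univ_two]
  ring

lemma rotInv_apply (x : Plane) : rotInv x 0 = -(1 / 2) * x 0 - Real.sqrt 3 / 2 * x 1 ∧
    rotInv x 1 = Real.sqrt 3 / 2 * x 0 - 1 / 2 * x 1 := by
  simp [rotInv, rotMatrix]
  constructor <;> ring

lemma plane_ext {x y : Plane} (h0 : x 0 = y 0) (h1 : x 1 = y 1) : x = y := by
  ext i; fin_cases i
  · exact h0
  · exact h1

lemma rot_rotInv (x : Plane) : rot (rotInv x) = x := by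
  have h := sqrt_three_mul_self
  apply plane_ext
  · rw [(rot_apply _).1, (rotInv_apply _).1, (rotInv_apply _).2]
    linear_combination (x 0 / 4) * h
  · rw [(rot_apply _).2, (rotInv_apply _).1, (rotInv_apply _).2]
    linear_combination (x 1 / 4) * h

lemma rotInv_rot (x : Plane) : rotInv (rot x) = x := by
  have h := sqrt_three_mul_self
  apply plane_ext
  · rw [(rotInv_apply _).1, (rot_apply _).1, (rot_apply _).2]
    linear_combination (x 0 / 4) * h
  · rw [(rotInv_apply _).2, (rot_apply _).1, (rot_apply _).2]
    linear_combination (x 1 / 4) * h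

lemma rot_add (x y : Plane) : rot (x + y) = rot x + rot y := by
  apply plane_ext <;> simp [rot_apply] <;> ring

lemma rotInv_add (x y : Plane) : rotInv (x + y) = rotInv x + rotInv y := by
  apply plane_ext <;> simp [rotInv_apply] <;> ring

lemma rot_smul (c : ℝ) (x : Plane) : rot (c • x) = c • rot x := by
  apply plane_ext <;> simp [rot_apply] <;> ring

lemma inner_plane (x y : Plane) : inner ℝ x y = x 0 * y 0 + x 1 * y 1 := by
  simp [PiLp.inner_apply, Fin.sum_univ_two, mul_comm]

lemma inner_rot_left (x y : Plane) : inner ℝ (rot x) y = inner ℝ x (rotInv y) := by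
  simp only [inner_plane, (rot_apply x).1, (rot_apply x).2, (rotInv_apply y).1, (rotInv_apply y).2]
  ring

lemma norm_rotInv (x : Plane) : ‖rotInv x‖ = ‖x‖ := by
  have h : inner ℝ (rotInv x) (rotInv x) = inner ℝ x x := by
    rw [← inner_rot_left, rot_rotInv]
  rw [real_inner_self_eq_norm_sq, real_inner_self_eq_norm_sq] at h
  exact (sq_eq_sq₀ (norm_nonneg _) (norm_nonneg _)).1 h

lemma rotInv_smul (c : ℝ) (x : Plane) : rotInv (c • x) = c • rotInv x := by
  apply plane_ext <;> simp [rotInv_apply] <;> ring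

/-- Counterclockwise rotation by `2π/3` as a linear isometry. -/
def rotInvIso : Plane ≃ₗᵢ[ℝ] Plane where
  toFun := rotInv
  invFun := rot
  map_add' := rotInv_add
  map_smul' := rotInv_smul
  left_inv := rot_rotInv
  right_inv := rotInv_rot
  norm_map' := norm_rotInv

lemma rot_latticeVec (m : ℤ × ℤ) : rot (latticeVec m) = latticeVec (-m.1 - m.2, m.1) := by
  have h := sqrt_three_mul_self
  apply plane_ext
  · simp [rot_apply, latticeVec, v₁, v₂]
    linear_combination 0 * h
  · simp [rot_apply, latticeVec, v₁, v₂]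
    linear_combination (-(m.1 + m.2 : ℝ) / 4) * h

lemma rotInv_latticeVec (m : ℤ × ℤ) : rotInv (latticeVec m) = latticeVec (m.2, -m.1 - m.2) := by
  have := rot_latticeVec (m.2, -m.1 - m.2)
  rw [show (-m.2 - (-m.1 - m.2), m.2) = m by ext <;> simp; ring] at this
  rw [← this, rotInv_rot]

lemma Periodic.setIntegral_rotInv {h : Plane → ℂ} (hh : Periodic h) :
    ∫ x in cell, h (rotInv x) = ∫ x in cell, h x := by
  refine hh.setIntegral_comp rotInvIso.toHomeomorph rotInvIso.measurePreserving
    ⟨fun g => ⟨rot g, ?_⟩, fun g => ⟨rotInv g, ?_⟩, ?_, ?_⟩ fun g x => ?_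
  · obtain ⟨g, m, rfl⟩ := g
    exact ⟨_, (rot_latticeVec m).symm⟩
  · obtain ⟨g, m, rfl⟩ := g
    exact ⟨_, (rotInv_latticeVec m).symm⟩
  · intro g; exact Subtype.ext (rotInv_rot g)
  · intro g; exact Subtype.ext (rot_rotInv g)
  · change rotInv (rot g + x) = g + rotInv x
    rw [rotInv_add, rotInv_rot]

/-! ### The dual lattice and the point `K` -/

lemma inner_dual_lattice (n m : ℤ × ℤ) :
    inner ℝ (dualVec n) (latticeVec m) = 2 * Real.pi * (n.1 * m.1 + n.2 * m.2 : ℤ) := by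
  have h := sqrt_three_pos.ne'
  have h3 := sqrt_three_mul_self
  rw [inner_plane]
  simp [dualVec, latticeVec, k₁, k₂, v₁, v₂]
  field_simp
  linear_combination 0 * h3

lemma inner_dual_coord (n : ℤ × ℤ) (x : Plane) :
    inner ℝ (dualVec n) x = 2 * Real.pi * (n.1 * coordFst x + n.2 * coordSnd x) := by
  have h := sqrt_three_pos.ne'
  have h3 := sqrt_three_mul_self
  rw [inner_plane]
  simp [dualVec, k₁, k₂, coordFst, coordSnd]
  field_simp
  linear_combination 0 * h3

lemma K_apply : K 0 = 0 ∧ K 1 = 4 * Real.pi / 3 := by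
  have h := sqrt_three_pos.ne'
  simp [K, k₁, k₂]
  field_simp
  ring

lemma norm_K : ‖K‖ = 4 * Real.pi / 3 := by
  rw [EuclideanSpace.norm_eq, Fin.sum_univ_two, K_apply.1, K_apply.2]
  simp only [norm_zero, Real.norm_eq_abs, sq_abs]
  rw [zero_pow two_ne_zero, zero_add, Real.sqrt_sq (by positivity)]

/-- The permutation of Fourier modes at `K` induced by the rotation. -/
def rotMode : ℤ × ℤ ≃ ℤ × ℤ where
  toFun m := (-m.2, m.1 - m.2 + 1)
  invFun m := (m.2 - m.1 - 1, -m.1)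
  left_inv m := by ext <;> simp; ring
  right_inv m := by ext <;> simp; ring

lemma rotMode_apply (m : ℤ × ℤ) : rotMode m = (-m.2, m.1 - m.2 + 1) := rfl

lemma rot_dualVec (m : ℤ × ℤ) : rot (dualVec m) = dualVec (-m.2, m.1 - m.2) := by
  have h := sqrt_three_pos.ne'
  have h3 := sqrt_three_mul_self
  apply plane_ext
  · simp [rot_apply, dualVec, k₁, k₂]
    field_simp
    linear_combination (m.1 - m.2 : ℝ) * h3
  · simp [rot_apply, dualVec, k₁, k₂]
    field_simp
    linear_combination 0 * h3

/-- This is why the rotation acts on `L²_K`: it moves the quasi-momentum K by a dual lattice vector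
only. -/
lemma rot_K : rot K = K + dualVec (0, 1) := by
  have h := sqrt_three_pos.ne'
  have h3 := sqrt_three_mul_self
  apply plane_ext
  · rw [(rot_apply K).1, PiLp.add_apply, K_apply.1, K_apply.2]
    simp [dualVec, k₂]
    field_simp
    linear_combination h3
  · rw [(rot_apply K).2, PiLp.add_apply, K_apply.1, K_apply.2]
    simp [dualVec, k₂]
    field_simp
    ring

lemma rot_K_add (m : ℤ × ℤ) : rot (K + dualVec m) = K + dualVec (rotMode m) := by
  rw [rot_add, rot_K, rot_dualVec, add_assoc, ← dualVec_add, rotMode_apply]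
  congr 2
  ext
  · simp
  · simp; ring

lemma rot_rot_K : rot (rot K) = K + dualVec (-1, 0) := by
  rw [rot_K, rot_K_add, rotMode_apply]; norm_num

/-- The integer measuring the excess of `|K + m|²` over `|K|²`. -/
def modeHeight (m : ℤ × ℤ) : ℤ := m.1 ^ 2 - m.1 * m.2 + m.2 ^ 2 + m.1 - m.2

/-- The squared lengths lie in |K|²(1 + 3ℤ), so integrality of `modeHeight` is the source of the
spectral gap above |K|². -/
lemma norm_K_add_sq (m : ℤ × ℤ) :
    ‖K + dualVec m‖ ^ 2 = ‖K‖ ^ 2 * (1 + 3 * (modeHeight m : ℝ)) := by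
  have h := sqrt_three_pos.ne'
  have h3 := sqrt_three_mul_self
  rw [← real_inner_self_eq_norm_sq, inner_plane, norm_K, PiLp.add_apply, PiLp.add_apply,
    K_apply.1, K_apply.2]
  simp [dualVec, k₁, k₂, modeHeight]
  field_simp
  linear_combination (-3 * (m.1 + m.2 : ℝ) ^ 2) * h3

/-- The three modes with `|K + m| = |K|`. -/
def coreMode : Fin 3 → ℤ × ℤ := ![(0, 0), (0, 1), (-1, 0)]

/-- Completing squares: this yields both the sign of the height and the finite list of its zeros. -/
lemma modeHeight_key (a b : ℤ) :
    12 * modeHeight (a, b) = 3 * (2 * a - b + 1) ^ 2 + (3 * b - 1) ^ 2 - 4 := by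
  simp only [modeHeight]; ring

lemma modeHeight_nonneg (m : ℤ × ℤ) : 0 ≤ modeHeight m := by
  obtain ⟨a, b⟩ := m
  have := modeHeight_key a b
  have h1 := sq_nonneg (2 * a - b + 1)
  have h2 := sq_nonneg (3 * b - 1)
  -- The two squares give only `12 * modeHeight ≥ -4`, which for an integer already means
  -- nonnegative.
  omega

lemma exists_coreMode {m : ℤ × ℤ} (h : modeHeight m = 0) : ∃ j, m = coreMode j := by
  obtain ⟨a, b⟩ := m
  have key := modeHeight_key a b
  rw [h] at key
  have h1 : (3 * b - 1) ^ 2 < 3 ^ 2 := by nlinarith [sq_nonneg (2 * a - b + 1)]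
  have h2 := abs_lt.1 (abs_lt_of_sq_lt_sq h1 (by norm_num))
  have hb : b = 0 ∨ b = 1 := by omega
  rcases hb with rfl | rfl
  · have h3 : (2 * a + 1) ^ 2 < 2 ^ 2 := by nlinarith
    have h4 := abs_lt.1 (abs_lt_of_sq_lt_sq h3 (by norm_num))
    have ha : a = 0 ∨ a = -1 := by omega
    rcases ha with rfl | rfl
    · exact ⟨0, rfl⟩
    · exact ⟨2, rfl⟩
  · have h3 : (2 * a) ^ 2 < 1 ^ 2 := by nlinarith
    have h4 := abs_lt.1 (abs_lt_of_sq_lt_sq h3 (by norm_num))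
    have ha : a = 0 := by omega
    subst ha
    exact ⟨1, rfl⟩

lemma modeHeight_coreMode (j : Fin 3) : modeHeight (coreMode j) = 0 := by
  fin_cases j <;> simp [coreMode, modeHeight]

lemma modeHeight_rotMode (m : ℤ × ℤ) : modeHeight (rotMode m) = modeHeight m := by
  simp only [modeHeight, rotMode_apply]; ring

/-- Addition in `Fin 3` is cyclic, so this is the 3-cycle K → RK → R²K → K. -/
lemma rotMode_coreMode (j : Fin 3) : rotMode (coreMode j) = coreMode (j + 1) := by
  fin_cases j <;> simp [coreMode, rotMode_apply]

lemma coreMode_injective : Function.Injective coreMode := by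
  intro i j
  fin_cases i <;> fin_cases j <;> simp [coreMode]

end Honeycomb
end

noncomputable section

namespace Honeycomb

/-! ### Fourier series on the period cell -/

/-- The normalized Haar measure on the circle, as in Mathlib's multivariate Fourier series. -/
instance circleMeasureSpace : MeasureSpace UnitAddCircle := ⟨AddCircle.haarAddCircle⟩

/-- The linear parametrization of the plane by lattice coordinates. -/
def coordEquiv : (Fin 2 → ℝ) ≃L[ℝ] Plane :=
  LinearEquiv.toContinuousLinearEquiv
    { toFun := fun s => s 0 • v₁ + s 1 • v₂
      map_add' := fun s t => by simp only [Pi.add_apply, add_smul]; abel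
      map_smul' := fun c s => by simp [mul_smul]
      invFun := fun x => ![coordFst x, coordSnd x]
      left_inv := fun s => by
        ext i; fin_cases i
        · exact (coord_comb _ _).1
        · exact (coord_comb _ _).2
      right_inv := fun x => comb_coord x }

lemma coordEquiv_apply (s : Fin 2 → ℝ) : coordEquiv s = s 0 • v₁ + s 1 • v₂ := rfl

lemma coordEquiv_preimage_cell : coordEquiv ⁻¹' cell = univ.pi fun _ => Ico (0 : ℝ) 1 := by
  ext s
  rw [mem_preimage, mem_cell_iff, coordEquiv_apply, (coord_comb _ _).1, (coord_comb _ _).2]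
  simp [Set.mem_pi, Fin.forall_fin_two]

/-- The map from the torus to the plane given by lattice coordinates in `(0, 1]`. -/
def torusMap (t : UnitAddTorus (Fin 2)) : Plane :=
  coordEquiv (UnitAddTorus.measurableEquivPiIoc (fun _ => 0) t).1

/-- The torus carries its probability Haar measure and the plane Lebesgue measure, so the linear
chart rescales by some constant. Its value is irrelevant; only that it is neither 0 nor infinite is
used. -/
lemma exists_measurePreserving_torusMap : ∃ c : ENNReal, c ≠ 0 ∧ c ≠ ⊤ ∧
    MeasurePreserving torusMap volume (c • cellMeasure) := by
  obtain ⟨c, hc0, hct, hc⟩ : ∃ c : ENNReal, c ≠ 0 ∧ c ≠ ⊤ ∧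
      Measure.map coordEquiv volume = c • (volume : Measure Plane) := by
    have : (Measure.map coordEquiv volume).IsAddHaarMeasure :=
      coordEquiv.isAddHaarMeasure_map volume
    refine ⟨_, ?_, ENNReal.coe_ne_top, Measure.isAddLeftInvariant_eq_smul _ _⟩
    exact ENNReal.coe_ne_zero.2 (Measure.addHaarScalarFactor_pos_of_isAddHaarMeasure _ _).ne'
  refine ⟨c, hc0, hct, ?_⟩
  have h1 := UnitAddTorus.measurePreserving_equivPiIoc (d := Fin 2) (fun _ => 0)
  have hI : MeasurableSet {x : Fin 2 → ℝ | ∀ i, x i ∈ Ioc (0 : ℝ) (0 + 1)} :=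
    MeasurableSet.univ_pi' fun _ => measurableSet_Ioc
  have h2 : MeasurePreserving (Subtype.val : {x : Fin 2 → ℝ // ∀ i, x i ∈ Ioc (0 : ℝ) (0 + 1)} → _)
      (Measure.comap Subtype.val volume)
      (volume.restrict {x : Fin 2 → ℝ | ∀ i, x i ∈ Ioc (0 : ℝ) (0 + 1)}) :=
    ⟨measurable_subtype_coe, map_comap_subtype_coe hI volume⟩
  -- The torus chart lives on (0, 1]² and the cell on [0, 1)²; both agree with the closed square up
  -- to a null set.
  have h3 : (volume.restrict {x : Fin 2 → ℝ | ∀ i, x i ∈ Ioc (0 : ℝ) (0 + 1)}) =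
      volume.restrict (coordEquiv ⁻¹' cell) := by
    rw [coordEquiv_preimage_cell]
    apply Measure.restrict_congr_set
    have e1 := Measure.univ_pi_Ioc_ae_eq_Icc (μ := fun _ : Fin 2 => (volume : Measure ℝ))
      (f := fun _ => 0) (g := fun _ => 1)
    have e2 := Measure.univ_pi_Ico_ae_eq_Icc (μ := fun _ : Fin 2 => (volume : Measure ℝ))
      (f := fun _ => 0) (g := fun _ => 1)
    have e3 : {x : Fin 2 → ℝ | ∀ i, x i ∈ Ioc (0 : ℝ) (0 + 1)} =
        univ.pi fun _ => Ioc (0 : ℝ) 1 := by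
      ext; simp [Set.mem_pi]
    rw [e3]
    exact e1.trans e2.symm
  have h4 : MeasurePreserving coordEquiv (volume.restrict (coordEquiv ⁻¹' cell))
      (c • cellMeasure) := by
    refine ⟨coordEquiv.continuous.measurable, ?_⟩
    rw [← Measure.restrict_map coordEquiv.continuous.measurable measurableSet_cell, hc,
      Measure.restrict_smul]
  rw [← h3] at h4
  exact h4.comp (h2.comp h1)

/-! ### Plane waves. -/

/-- The plane wave `x ↦ e^{i k · x}`. -/
def planeWave (k : Plane) (x : Plane) : ℂ := Complex.exp (Complex.I * ((inner ℝ k x : ℝ) : ℂ))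

lemma continuous_planeWave (k : Plane) : Continuous (planeWave k) := by
  unfold planeWave; fun_prop

lemma contDiff_planeWave (k : Plane) : ContDiff ℝ ∞ (planeWave k) := by
  unfold planeWave
  have : ContDiff ℝ ∞ fun x : Plane => ((inner ℝ k x : ℝ) : ℂ) :=
    Complex.ofRealCLM.contDiff.comp (contDiff_const.inner ℝ contDiff_id)
  exact (contDiff_const.mul this).cexp

lemma norm_planeWave (k x : Plane) : ‖planeWave k x‖ = 1 := by
  rw [planeWave, mul_comm]; exact Complex.norm_exp_ofReal_mul_I _

lemma planeWave_ne_zero (k x : Plane) : planeWave k x ≠ 0 := Complex.exp_ne_zero _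

lemma planeWave_add_left (k l x : Plane) :
    planeWave (k + l) x = planeWave k x * planeWave l x := by
  simp only [planeWave, inner_add_left, Complex.ofReal_add, mul_add, Complex.exp_add]

lemma planeWave_add_right (k x y : Plane) :
    planeWave k (x + y) = planeWave k x * planeWave k y := by
  simp only [planeWave, inner_add_right, Complex.ofReal_add, mul_add, Complex.exp_add]

lemma planeWave_zero_left (x : Plane) : planeWave 0 x = 1 := by simp [planeWave]

lemma conj_planeWave (k x : Plane) : (starRingEnd ℂ) (planeWave k x) = planeWave (-k) x := by
  rw [planeWave, planeWave, ← Complex.exp_conj]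
  simp

lemma planeWave_neg_right (k x : Plane) : planeWave k (-x) = planeWave (-k) x := by
  simp [planeWave]

lemma conj_planeWave_mul_self (k x : Plane) :
    (starRingEnd ℂ) (planeWave k x) * planeWave k x = 1 := by
  rw [conj_planeWave, ← planeWave_add_left, neg_add_cancel, planeWave_zero_left]

lemma planeWave_dual_lattice (n m : ℤ × ℤ) : planeWave (dualVec n) (latticeVec m) = 1 := by
  rw [planeWave, inner_dual_lattice, Complex.exp_eq_one_iff]
  refine ⟨n.1 * m.1 + n.2 * m.2, ?_⟩
  push_cast; ring

lemma periodic_planeWave (n : ℤ × ℤ) : Periodic (planeWave (dualVec n)) := by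
  intro m x
  rw [planeWave_add_right, planeWave_dual_lattice, mul_one]

lemma planeWave_torusMap (n : ℤ × ℤ) (t : UnitAddTorus (Fin 2)) :
    planeWave (dualVec n) (torusMap t) = UnitAddTorus.mFourier ![n.1, n.2] t := by
  set s := (UnitAddTorus.measurableEquivPiIoc (fun _ => 0) t) with hs
  have ht : t = fun i => ((s.1 i : ℝ) : UnitAddCircle) := by
    rw [← UnitAddTorus.coe_symm_measurableEquivPiIoc_apply, hs, MeasurableEquiv.symm_apply_apply]
  have h1 : torusMap t = s.1 0 • v₁ + s.1 1 • v₂ := rfl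
  rw [h1, planeWave, inner_dual_coord, (coord_comb _ _).1, (coord_comb _ _).2]
  conv_rhs => rw [ht]
  simp only [UnitAddTorus.mFourier, ContinuousMap.coe_mk, Fin.prod_univ_two, fourier_coe_apply,
    Matrix.cons_val_zero, Matrix.cons_val_one]
  rw [← Complex.exp_add]
  congr 1
  push_cast
  ring

/-! ### Orthonormality and completeness of the Fourier modes on the cell. -/

/-- The Hilbert space `L²(Ω)`. -/
abbrev CellL2 := Lp ℂ 2 cellMeasure

lemma memLp_of_bound_cell {f : Plane → ℂ} (hf : Continuous f) : MemLp f 2 cellMeasure := by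
  obtain ⟨C, hC⟩ := (isCompact_closedBall (0 : Plane) 2).exists_bound_of_continuousOn hf.continuousOn
  refine MemLp.of_bound hf.aestronglyMeasurable C ?_
  filter_upwards [ae_restrict_mem measurableSet_cell] with x hx
  exact hC x (Metric.ball_subset_closedBall (cell_subset_ball hx))

/-- The normalized Fourier mode `|Ω|^{-1/2} e^{i m · x}`. -/
def fourierMode (m : ℤ × ℤ) (x : Plane) : ℂ := ((Real.sqrt cellVol)⁻¹ : ℝ) * planeWave (dualVec m) x

lemma continuous_fourierMode (m : ℤ × ℤ) : Continuous (fourierMode m) :=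
  continuous_const.mul (continuous_planeWave _)

/-- The normalized Fourier mode as an element of `L²(Ω)`. -/
def fourierModeL2 (m : ℤ × ℤ) : CellL2 := (memLp_of_bound_cell (continuous_fourierMode m)).toLp _

lemma coeFn_fourierModeL2 (m : ℤ × ℤ) : fourierModeL2 m =ᵐ[cellMeasure] fourierMode m :=
  MemLp.coeFn_toLp _

lemma inner_cellL2 (f g : CellL2) : inner ℂ f g = cellInner f g := by
  rw [L2.inner_def, cellInner]
  simp only [RCLike.inner_apply, mul_comm]

lemma cellInner_congr {f f' g g' : Plane → ℂ} (hf : f =ᵐ[cellMeasure] f')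
    (hg : g =ᵐ[cellMeasure] g') : cellInner f g = cellInner f' g' := by
  refine integral_congr_ae ?_
  filter_upwards [hf, hg] with x h1 h2
  rw [h1, h2]

lemma mode_index_injective {m n : ℤ × ℤ} :
    (![m.1, m.2] : Fin 2 → ℤ) = ![n.1, n.2] ↔ m = n := by
  constructor
  · intro h
    ext
    · exact congrFun h 0
    · exact congrFun h 1
  · rintro rfl; rfl

lemma torus_integral_mode (n : ℤ × ℤ) :
    ∫ t : UnitAddTorus (Fin 2), UnitAddTorus.mFourier (![n.1, n.2] : Fin 2 → ℤ) t = if n = 0 then 1 else 0 := by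
  have h := orthonormal_iff_ite.1 (UnitAddTorus.orthonormal_mFourier (d := Fin 2)) 0 ![n.1, n.2]
  rw [L2.inner_def] at h
  have e : (0 : Fin 2 → ℤ) = ![n.1, n.2] ↔ n = 0 := by
    rw [eq_comm, ← mode_index_injective (n := 0)]; simp
  simp only [e] at h
  rw [← h]
  apply integral_congr_ae
  filter_upwards [UnitAddTorus.coeFn_mFourierLp 2 (0 : Fin 2 → ℤ),
    UnitAddTorus.coeFn_mFourierLp 2 ![n.1, n.2]] with t h1 h2
  rw [h1, h2, UnitAddTorus.mFourier_zero]
  simp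

lemma integral_planeWave_cell (n : ℤ × ℤ) :
    ∫ x in cell, planeWave (dualVec n) x = if n = 0 then (cellVol : ℂ) else 0 := by
  by_cases hn : n = 0
  · subst hn
    simp [dualVec_zero, planeWave_zero_left, cellVol, Measure.real]
  · rw [if_neg hn]
    obtain ⟨c, hc0, hct, hc⟩ := exists_measurePreserving_torusMap
    have h := torus_integral_mode n
    rw [if_neg hn] at h
    simp only [← planeWave_torusMap] at h
    have h2 := integral_map (μ := volume) hc.measurable.aemeasurable
      (f := planeWave (dualVec n)) (continuous_planeWave _).aestronglyMeasurable
    rw [hc.map_eq, h, integral_smul_measure] at h2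
    have : c.toReal ≠ 0 := (ENNReal.toReal_pos hc0 hct).ne'
    exact (smul_eq_zero.1 h2).resolve_left this

lemma sqrt_inv_mul_self_cellVol :
    (((Real.sqrt cellVol)⁻¹ : ℝ) : ℂ) * (((Real.sqrt cellVol)⁻¹ : ℝ) : ℂ) = (cellVol : ℂ)⁻¹ := by
  rw [← Complex.ofReal_mul, ← mul_inv, Real.mul_self_sqrt cellVol_pos.le, Complex.ofReal_inv]

lemma cellInner_fourierMode (m n : ℤ × ℤ) :
    cellInner (fourierMode m) (fourierMode n) = if m = n then 1 else 0 := by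
  have h : ∀ x, (starRingEnd ℂ) (fourierMode m x) * fourierMode n x =
      (cellVol : ℂ)⁻¹ * planeWave (dualVec (n - m)) x := by
    intro x
    rw [fourierMode, fourierMode, map_mul, Complex.conj_ofReal, conj_planeWave, dualVec_sub,
      sub_eq_add_neg, planeWave_add_left, ← sqrt_inv_mul_self_cellVol]
    ring
  have hv : (cellVol : ℂ) ≠ 0 := Complex.ofReal_ne_zero.2 cellVol_pos.ne'
  simp only [cellInner, h]
  rw [integral_const_mul, integral_planeWave_cell]
  by_cases hmn : m = n
  · simp [hmn, hv]
  · rw [if_neg (by rw [sub_eq_zero]; exact fun h => hmn h.symm), if_neg hmn, mul_zero]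

lemma orthonormal_fourierModeL2 : Orthonormal ℂ fourierModeL2 := by
  rw [orthonormal_iff_ite]
  intro m n
  rw [inner_cellL2, cellInner_congr (coeFn_fourierModeL2 m) (coeFn_fourierModeL2 n),
    cellInner_fourierMode]

/-- Completeness is pulled back from the torus: composition with `torusMap` turns these inner
products into the Fourier coefficients of a function on the torus, up to nonzero constants, and
there the modes form a Hilbert basis. -/
lemma eq_zero_of_inner_fourierModeL2 (f : CellL2) (hf : ∀ m, inner ℂ (fourierModeL2 m) f = 0) :
    f = 0 := by
  obtain ⟨c, hc0, hct, hc⟩ := exists_measurePreserving_torusMap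
  have hf2 : MemLp f 2 (c • cellMeasure) := (Lp.memLp f).smul_measure hct
  have hg := hf2.comp_measurePreserving hc
  have hz : hg.toLp _ = 0 := by
    apply UnitAddTorus.mFourierBasis.repr.injective
    ext n
    rw [UnitAddTorus.mFourierBasis_repr, map_zero, UnitAddTorus.mFourierCoeff]
    have e1 : ∫ t, UnitAddTorus.mFourier (-n) t • (hg.toLp _) t =
        ∫ t, planeWave (dualVec (-n 0, -n 1)) (torusMap t) * f (torusMap t) := by
      apply integral_congr_ae
      filter_upwards [hg.coeFn_toLp] with t ht
      rw [ht, planeWave_torusMap, smul_eq_mul]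
      congr 3
      ext i; fin_cases i <;> rfl
    have h2 := integral_map (μ := volume) hc.measurable.aemeasurable
      (f := fun x => planeWave (dualVec (-n 0, -n 1)) x * f x)
      ((continuous_planeWave _).aestronglyMeasurable.mul (by rw [hc.map_eq]; exact hf2.1))
    rw [e1, ← h2, hc.map_eq, integral_smul_measure]
    have h3 := hf (n 0, n 1)
    rw [inner_cellL2, cellInner_congr (coeFn_fourierModeL2 _) (ae_eq_refl _)] at h3
    have h4 : ∀ x, (starRingEnd ℂ) (fourierMode (n 0, n 1) x) * f x =
      (((Real.sqrt cellVol)⁻¹ : ℝ) : ℂ) * (planeWave (dualVec (-n 0, -n 1)) x * f x) := by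
      intro x
      rw [fourierMode, map_mul, Complex.conj_ofReal, conj_planeWave, ← dualVec_neg, mul_assoc]
      rfl
    simp only [cellInner, h4] at h3
    rw [integral_const_mul] at h3
    have h5 : (((Real.sqrt cellVol)⁻¹ : ℝ) : ℂ) ≠ 0 :=
      Complex.ofReal_ne_zero.2 (inv_ne_zero (Real.sqrt_pos.2 cellVol_pos).ne')
    rw [(mul_eq_zero.1 h3).resolve_left h5, smul_zero]
    rfl
  have h1 : ∀ᵐ t, f (torusMap t) = 0 := by
    have h6 := hg.coeFn_toLp
    rw [hz] at h6
    filter_upwards [h6, Lp.coeFn_zero ℂ 2 (volume : Measure (UnitAddTorus (Fin 2)))] with t h7 h8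
    rw [h8] at h7
    exact h7.symm
  have h2 : ∀ᵐ x ∂(c • cellMeasure), f x = 0 := by
    rw [← hc.map_eq]
    exact (ae_map_iff hc.measurable.aemeasurable
      ((Lp.stronglyMeasurable f).measurable (measurableSet_singleton 0))).2 h1
  rw [Lp.eq_zero_iff_ae_eq_zero]
  exact (Measure.ae_ennreal_smul_measure_iff hc0).1 h2

/-- The Hilbert basis of Fourier modes of `L²(Ω)`. -/
def fourierBasis : HilbertBasis (ℤ × ℤ) ℂ CellL2 :=
  HilbertBasis.mkOfOrthogonalEqBot orthonormal_fourierModeL2 <| by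
    rw [Submodule.eq_bot_iff]
    intro f hf
    refine eq_zero_of_inner_fourierModeL2 f fun m => ?_
    exact (Submodule.mem_orthogonal _ f).1 hf _ (Submodule.subset_span ⟨m, rfl⟩)

lemma coe_fourierBasis (m : ℤ × ℤ) : fourierBasis m = fourierModeL2 m := by
  rw [fourierBasis, HilbertBasis.coe_mkOfOrthogonalEqBot]

lemma fourierBasis_repr (f : CellL2) (m : ℤ × ℤ) :
    fourierBasis.repr f m = cellInner (fourierMode m) f := by
  rw [HilbertBasis.repr_apply_apply, coe_fourierBasis, inner_cellL2,
    cellInner_congr (coeFn_fourierModeL2 _) (ae_eq_refl _)]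

end Honeycomb
end

noncomputable section

namespace Honeycomb

/-! ### Pseudo-periodic functions -/

/-- The plane is a countable union of translates of the cell, so the exceptional set is a countable
union of null sets. -/
lemma ae_cellRep {P : Plane → Prop} (h : ∀ᵐ x ∂cellMeasure, P x) : ∀ᵐ x, P (cellRep x) := by
  rw [ae_restrict_iff' measurableSet_cell] at h
  have h1 : ∀ m : ℤ × ℤ, ∀ᵐ x : Plane, x - latticeVec m ∈ cell → P (x - latticeVec m) := fun m =>
    (measurePreserving_sub_right volume (latticeVec m)).quasiMeasurePreserving.ae h
  filter_upwards [ae_all_iff.2 h1] with x hx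
  exact hx (cellIndex x) (cellRep_mem x)

lemma ae_cell_of_ae_cellRep {P : Plane → Prop} (h : ∀ᵐ x, P (cellRep x)) :
    ∀ᵐ x ∂cellMeasure, P x := by
  rw [ae_restrict_iff' measurableSet_cell]
  filter_upwards [h] with x hx hc
  rwa [cellRep_of_mem hc] at hx

lemma periodic_comp_cellRep {β : Type*} (u : Plane → β) : Periodic fun x => u (cellRep x) := by
  intro m x
  simp only [cellRep_add]

/-- The pseudo-periodic function `e^{ik·x} u` for `u` given on the period cell. -/
def bloch (k : Plane) (u : Plane → ℂ) (x : Plane) : ℂ := planeWave k x * u (cellRep x)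

lemma bloch_congr {k : Plane} {u w : Plane → ℂ} (h : u =ᵐ[cellMeasure] w) :
    bloch k u =ᵐ[volume] bloch k w := by
  filter_upwards [ae_cellRep h] with x hx
  rw [bloch, bloch, hx]

lemma bloch_injective {k : Plane} {u w : Plane → ℂ} (h : bloch k u =ᵐ[volume] bloch k w) :
    u =ᵐ[cellMeasure] w := by
  apply ae_cell_of_ae_cellRep
  filter_upwards [h] with x hx
  exact mul_left_cancel₀ (planeWave_ne_zero k x) hx

lemma bloch_of_mem {k : Plane} {u : Plane → ℂ} {x : Plane} (hx : x ∈ cell) :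
    bloch k u x = planeWave k x * u x := by rw [bloch, cellRep_of_mem hx]

lemma bloch_add_latticeVec (k : Plane) (u : Plane → ℂ) (m : ℤ × ℤ) (x : Plane) :
    bloch k u (x + latticeVec m) = planeWave k (latticeVec m) * bloch k u x := by
  rw [bloch, cellRep_add, planeWave_add_right, bloch]; ring

lemma norm_bloch (k : Plane) (u : Plane → ℂ) (x : Plane) : ‖bloch k u x‖ = ‖u (cellRep x)‖ := by
  rw [bloch, norm_mul, norm_planeWave, one_mul]

lemma bloch_ae_cell (k : Plane) (u : Plane → ℂ) :
    bloch k u =ᵐ[cellMeasure] fun x => planeWave k x * u x := by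
  filter_upwards [ae_restrict_mem measurableSet_cell] with x hx
  exact bloch_of_mem hx

lemma memLp_planeWave_mul {k : Plane} {u : Plane → ℂ} (hu : MemLp u 2 cellMeasure) :
    MemLp (fun x => planeWave k x * u x) 2 cellMeasure := by
  refine hu.of_le ((continuous_planeWave k).aestronglyMeasurable.mul hu.1) ?_
  exact Eventually.of_forall fun x => by rw [norm_mul, norm_planeWave, one_mul]

lemma memL2_bloch (k : Plane) {u : Plane → ℂ} (hu : MemLp u 2 cellMeasure) :
    MemL2 k (bloch k u) := by
  refine ⟨(memLp_congr_ae (bloch_ae_cell k u)).2 (memLp_planeWave_mul hu), fun m => ?_⟩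
  exact Eventually.of_forall fun x => bloch_add_latticeVec k u m x

/-- Quasi-periodicity holds outside a null set for each of countably many lattice vectors. At a
point good for all of them, it is applied with the vector that carries this point into the cell. -/
lemma MemL2.ae_eq_bloch {k : Plane} {f : Plane → ℂ} (hf : MemL2 k f) :
    f =ᵐ[volume] bloch k fun x => planeWave (-k) x * f x := by
  filter_upwards [ae_all_iff.2 hf.2] with x hx
  have h := hx (-cellIndex x)
  have e : x + latticeVec (-cellIndex x) = cellRep x := by
    rw [latticeVec_neg, cellRep, sub_eq_add_neg]
  rw [e] at h
  rw [bloch, h]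
  change f x = planeWave k x * (planeWave (-k) (cellRep x) *
    (planeWave k (latticeVec (-cellIndex x)) * f x))
  rw [← e, planeWave_add_right, ← conj_planeWave, ← conj_planeWave]
  have h1 := conj_planeWave_mul_self k x
  have h2 := conj_planeWave_mul_self k (latticeVec (-cellIndex x))
  linear_combination (-(f x)) * h1 - f x * ((starRingEnd ℂ) (planeWave k x) * planeWave k x) * (h2)

lemma MemL2.exists_bloch {k : Plane} {f : Plane → ℂ} (hf : MemL2 k f) :
    ∃ u : CellL2, f =ᵐ[volume] bloch k u := by
  have h := memLp_planeWave_mul (k := -k) hf.1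
  exact ⟨h.toLp _, hf.ae_eq_bloch.trans (bloch_congr h.coeFn_toLp.symm)⟩

lemma MemL2.congr {k : Plane} {f g : Plane → ℂ} (hf : MemL2 k f) (h : f =ᵐ[volume] g) :
    MemL2 k g := by
  refine ⟨(memLp_congr_ae (ae_restrict_of_ae h)).1 hf.1, fun m => ?_⟩
  have h1 := (measurePreserving_add_right volume (latticeVec m)).quasiMeasurePreserving.ae h
  filter_upwards [hf.2 m, h, h1] with x h2 h3 h4
  rw [← h4, h2, h3]

lemma memL2_coe (k : Plane) (u : CellL2) : MemL2 k (bloch k u) := memL2_bloch k (Lp.memLp u)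

lemma cellInner_bloch (k : Plane) (u w : CellL2) :
    cellInner (bloch k u) (bloch k w) = inner ℂ u w := by
  rw [inner_cellL2, cellInner_congr (bloch_ae_cell k u) (bloch_ae_cell k w)]
  refine integral_congr_ae (Eventually.of_forall fun x => ?_)
  simp only [map_mul]
  linear_combination ((starRingEnd ℂ) (u x) * w x) * conj_planeWave_mul_self k x

lemma measurable_coe (u : CellL2) : Measurable u := (Lp.stronglyMeasurable u).measurable

lemma measurable_bloch (k : Plane) (u : CellL2) : Measurable (bloch k u) :=
  (continuous_planeWave k).measurable.mul ((measurable_coe u).comp measurable_cellRep)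

lemma integrable_coe (u : CellL2) : Integrable u cellMeasure :=
  (Lp.memLp u).integrable one_le_two

/-! ### Local integrability and pairing with test functions. -/

lemma setLIntegral_cellIndex (m : ℤ × ℤ) {F : Plane → ENNReal} (hF : Periodic F) :
    ∫⁻ x in {x | cellIndex x = m}, F x = ∫⁻ x in cell, F x := by
  have h1 : {x | cellIndex x = m} = (fun x => x + latticeVec (-m)) ⁻¹' cell := by
    ext x
    constructor
    · intro hx
      have := cellRep_mem x
      rw [cellRep, hx, sub_eq_add_neg, ← latticeVec_neg] at this
      exact this
    · intro hx
      have h2 := cellIndex_of_mem hx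
      rw [cellIndex_add] at h2
      exact eq_of_sub_eq_zero (by rw [sub_eq_add_neg]; exact h2)
  have h := (measurePreserving_add_right volume (latticeVec (-m))).setLIntegral_comp_preimage_emb
    (measurableEmbedding_addRight _) F cell
  simp only [hF (-m) _] at h
  rw [h1, h]

lemma abs_coord_le (x : Plane) : |coordFst x| ≤ 2 * ‖x‖ ∧ |coordSnd x| ≤ 2 * ‖x‖ := by
  have h0 : |x 0| ≤ ‖x‖ := PiLp.norm_apply_le x 0
  have h1 : |x 1| ≤ ‖x‖ := PiLp.norm_apply_le x 1
  have h3 : |x 0 / Real.sqrt 3| ≤ |x 0| := by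
    rw [abs_div, abs_of_pos sqrt_three_pos]
    refine div_le_self (abs_nonneg _) ?_
    nlinarith [sqrt_three_mul_self, sqrt_three_pos]
  constructor
  · calc |coordFst x| ≤ |x 0 / Real.sqrt 3| + |x 1| := abs_add_le _ _
      _ ≤ 2 * ‖x‖ := by linarith
  · calc |coordSnd x| ≤ |x 0 / Real.sqrt 3| + |x 1| := abs_sub _ _
      _ ≤ 2 * ‖x‖ := by linarith

lemma exists_setLIntegral_ball_le (R : ℝ) : ∃ n : ℕ, ∀ F : Plane → ENNReal, Periodic F →
    ∫⁻ x in Metric.ball (0 : Plane) R, F x ≤ n * ∫⁻ x in cell, F x := by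
  -- Lattice coordinates of points of the ball are at most 2R in modulus, so the cells with indices
  -- between −N and N cover it.
  set N : ℤ := ⌈2 * R⌉ + 1 with hN
  set S : Finset (ℤ × ℤ) := Finset.Icc (-N) N ×ˢ Finset.Icc (-N) N with hS
  refine ⟨S.card, fun F hF => ?_⟩
  have hfl : ∀ t : ℝ, |t| ≤ 2 * R → ⌊t⌋ ∈ Finset.Icc (-N) N := by
    intro t ht
    have h1 := abs_le.1 ht
    have h2 := Int.le_ceil (2 * R)
    rw [Finset.mem_Icc]
    constructor
    · apply Int.le_floor.2
      push_cast [hN]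
      linarith
    · have h3 := Int.floor_le t
      have : (⌊t⌋ : ℝ) ≤ N := by push_cast [hN]; linarith
      exact_mod_cast this
  have hsub : Metric.ball (0 : Plane) R ⊆ ⋃ m ∈ S, {x | cellIndex x = m} := by
    intro x hx
    rw [mem_ball_zero_iff] at hx
    simp only [mem_iUnion, mem_ofPred_eq, exists_prop, exists_eq_right']
    rw [hS, Finset.mem_product]
    exact ⟨hfl _ ((abs_coord_le x).1.trans (by linarith)),
      hfl _ ((abs_coord_le x).2.trans (by linarith))⟩
  calc ∫⁻ x in Metric.ball (0 : Plane) R, F x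
      ≤ ∫⁻ x in ⋃ m ∈ S, {x | cellIndex x = m}, F x := lintegral_mono_set hsub
    _ ≤ ∑ m ∈ S, ∫⁻ x in {x | cellIndex x = m}, F x := by
        induction S using Finset.induction_on with
        | empty => simp
        | insert a T ha ih =>
          rw [Finset.set_biUnion_insert, Finset.sum_insert ha]
          exact (lintegral_union_le _ _ _).trans (by gcongr)
    _ = S.card * ∫⁻ x in cell, F x := by
        simp only [setLIntegral_cellIndex _ hF, Finset.sum_const, nsmul_eq_mul]

lemma lintegral_ball_bloch_le (R : ℝ) : ∃ n : ℕ, ∀ (k : Plane) (u : CellL2),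
    ∫⁻ x in Metric.ball (0 : Plane) R, ‖bloch k u x‖ₑ ≤ n * ∫⁻ x in cell, ‖u x‖ₑ := by
  obtain ⟨n, hn⟩ := exists_setLIntegral_ball_le R
  refine ⟨n, fun k u => ?_⟩
  have h1 : ∀ x, ‖bloch k u x‖ₑ = ‖u (cellRep x)‖ₑ := fun x => by
    rw [← ofReal_norm, norm_bloch, ofReal_norm]
  simp only [h1]
  refine (hn _ (periodic_comp_cellRep fun y => ‖u y‖ₑ)).trans (le_of_eq ?_)
  congr 1
  refine setLIntegral_congr_fun measurableSet_cell fun x hx => ?_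
  simp only [cellRep_of_mem hx]

lemma lintegral_coe_lt_top (u : CellL2) : ∫⁻ x in cell, ‖u x‖ₑ < ⊤ := (integrable_coe u).2

lemma integrableOn_ball_bloch (R : ℝ) (k : Plane) (u : CellL2) :
    IntegrableOn (bloch k u) (Metric.ball 0 R) := by
  obtain ⟨n, hn⟩ := lintegral_ball_bloch_le R
  refine ⟨(measurable_bloch k u).aestronglyMeasurable, (hn k u).trans_lt ?_⟩
  exact ENNReal.mul_lt_top (ENNReal.natCast_lt_top n) (lintegral_coe_lt_top u)

lemma locallyIntegrable_bloch (k : Plane) (u : CellL2) : LocallyIntegrable (bloch k u) := by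
  intro x
  refine ⟨Metric.ball 0 (‖x‖ + 1), Metric.isOpen_ball.mem_nhds ?_, integrableOn_ball_bloch _ k u⟩
  simp

lemma exists_ball_of_hasCompactSupport {E : Type*} [Zero E] {φ : Plane → E}
    (hφ : HasCompactSupport φ) : ∃ R : ℝ, ∀ x, x ∉ Metric.ball (0 : Plane) R → φ x = 0 := by
  obtain ⟨R, hR⟩ := hφ.isCompact.isBounded.subset_ball 0
  exact ⟨R, fun x hx => image_eq_zero_of_notMem_tsupport fun h => hx (hR h)⟩

lemma integrable_mul_bloch {φ : Plane → ℂ} (hφ : Continuous φ) (hc : HasCompactSupport φ)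
    (k : Plane) (u : CellL2) : Integrable fun x => φ x * bloch k u x :=
  ((locallyIntegrable_bloch k u).integrable_smul_left_of_hasCompactSupport hφ hc :)

/-- Pairing with a fixed test function is continuous for the `L²` norm on the cell. This permits
pairing a Fourier series term by term. -/
lemma exists_norm_integral_mul_bloch_le {φ : Plane → ℂ} (hφ : Continuous φ)
    (hc : HasCompactSupport φ) :
    ∃ C : ℝ, ∀ (k : Plane) (u : CellL2), ‖∫ x, φ x * bloch k u x‖ ≤ C * ‖u‖ := by
  obtain ⟨R, hR⟩ := exists_ball_of_hasCompactSupport hc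
  obtain ⟨M, hM⟩ := hc.exists_bound_of_continuous hφ
  obtain ⟨n, hn⟩ := lintegral_ball_bloch_le R
  have hM0 : 0 ≤ M := (norm_nonneg _).trans (hM 0)
  -- Here `M` bounds the test function, `n` counts the cells covering its support, and the power of
  -- the measure is the Hölder constant comparing `L¹` with `L²` on the cell.
  refine ⟨M * (n * (cellMeasure univ).toReal ^ ((1 : ℝ) / 1 - 1 / 2)), fun k u => ?_⟩
  have h1 : ∫ x, φ x * bloch k u x = ∫ x in Metric.ball (0 : Plane) R, φ x * bloch k u x := by
    rw [setIntegral_eq_integral_of_forall_compl_eq_zero]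
    intro x hx
    rw [hR x hx, zero_mul]
  have h2 : ∫ x in Metric.ball (0 : Plane) R, ‖bloch k u x‖ ≤ n * ∫ x in cell, ‖u x‖ := by
    rw [integral_norm_eq_lintegral_enorm (measurable_bloch k u).aestronglyMeasurable,
      integral_norm_eq_lintegral_enorm (Lp.aestronglyMeasurable u), ← ENNReal.toReal_natCast n,
      ← ENNReal.toReal_mul]
    exact ENNReal.toReal_mono
      (ENNReal.mul_lt_top (ENNReal.natCast_lt_top n) (lintegral_coe_lt_top u)).ne (hn k u)
  have h3 : ∫ x in cell, ‖u x‖ ≤ ‖u‖ * (cellMeasure univ).toReal ^ ((1 : ℝ) / 1 - 1 / 2) := by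
    rw [integral_norm_eq_lintegral_enorm (Lp.aestronglyMeasurable u),
      ← eLpNorm_one_eq_lintegral_enorm, Lp.norm_def, ENNReal.toReal_rpow, ← ENNReal.toReal_mul]
    refine ENNReal.toReal_mono ?_ ?_
    · exact ENNReal.mul_ne_top (Lp.eLpNorm_ne_top u)
        (ENNReal.rpow_ne_top_of_nonneg (by norm_num) (measure_ne_top _ _))
    · have := eLpNorm_le_eLpNorm_mul_rpow_measure_univ (μ := cellMeasure) (p := 1) (q := 2)
        (f := u) one_le_two (Lp.aestronglyMeasurable u)
      simpa using this
  rw [h1]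
  calc ‖∫ x in Metric.ball (0 : Plane) R, φ x * bloch k u x‖
      ≤ ∫ x in Metric.ball (0 : Plane) R, M * ‖bloch k u x‖ := by
        refine norm_integral_le_of_norm_le ((integrableOn_ball_bloch R k u).norm.const_mul M) ?_
        refine Eventually.of_forall fun x => ?_
        rw [norm_mul]
        exact mul_le_mul_of_nonneg_right (hM x) (norm_nonneg _)
    _ = M * ∫ x in Metric.ball (0 : Plane) R, ‖bloch k u x‖ := integral_const_mul _ _
    _ ≤ M * (n * (‖u‖ * (cellMeasure univ).toReal ^ ((1 : ℝ) / 1 - 1 / 2))) := by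
        gcongr
        exact h2.trans (by gcongr)
    _ = _ := by ring

lemma bloch_add_ae (k : Plane) (u w : CellL2) :
    bloch k ⇑(u + w) =ᵐ[volume] fun x => bloch k u x + bloch k w x := by
  filter_upwards [bloch_congr (k := k) (Lp.coeFn_add u w)] with x hx
  rw [hx, bloch, bloch, bloch, Pi.add_apply, mul_add]

lemma bloch_smul_ae (k : Plane) (c : ℂ) (u : CellL2) :
    bloch k ⇑(c • u) =ᵐ[volume] fun x => c * bloch k u x := by
  filter_upwards [bloch_congr (k := k) (Lp.coeFn_smul c u)] with x hx
  rw [hx, bloch, bloch, Pi.smul_apply, smul_eq_mul]; ring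

/-- Pairing of pseudo-periodic functions with a compactly supported function. -/
def testPairing {φ : Plane → ℂ} (hφ : Continuous φ) (hc : HasCompactSupport φ) (k : Plane) :
    CellL2 →L[ℂ] ℂ :=
  LinearMap.mkContinuousOfExistsBound
    { toFun := fun u => ∫ x, φ x * bloch k u x
      map_add' := fun u w => by
        rw [← integral_add (integrable_mul_bloch hφ hc k u) (integrable_mul_bloch hφ hc k w)]
        refine integral_congr_ae ?_
        filter_upwards [bloch_add_ae k u w] with x hx
        rw [hx, mul_add]
      map_smul' := fun c u => by
        rw [RingHom.id_apply, smul_eq_mul, ← integral_const_mul]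
        refine integral_congr_ae ?_
        filter_upwards [bloch_smul_ae k c u] with x hx
        rw [hx]; ring }
    ((exists_norm_integral_mul_bloch_le hφ hc).imp fun C h u => h k u)

lemma testPairing_apply {φ : Plane → ℂ} (hφ : Continuous φ) (hc : HasCompactSupport φ) (k : Plane)
    (u : CellL2) : testPairing hφ hc k u = ∫ x, φ x * bloch k u x := rfl

/-! ### Averages over translated test functions. -/

lemma Periodic.integrableOn_add {H : Plane → ℂ} (hH : Periodic H) (hi : IntegrableOn H cell)
    (x : Plane) : IntegrableOn (fun s => H (x + s)) cell := by
  have hper : Periodic fun s => H (x + s) := fun m s => by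
    change H (x + (s + latticeVec m)) = _
    rw [← add_assoc]; exact hH m _
  have hdom : IsAddFundamentalDomain lattice ((fun s => x + s) ⁻¹' cell) volume := by
    refine cell_isAddFundamentalDomain.preimage_of_equiv
      (measurePreserving_add_left volume x).quasiMeasurePreserving
      (Equiv.refl lattice).bijective fun g y => ?_
    change x + (g + y) = g + (x + y)
    abel
  rw [cell_isAddFundamentalDomain.integrableOn_iff hdom (fun g s => hper.vadd g s)]
  exact ((measurePreserving_add_left volume x).integrableOn_comp_preimage
    (measurableEmbedding_addLeft x)).2 hi

/-- The hypothesis of Fubini's theorem: by periodicity the integral of |H(x + s)| over s in the cell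
does not depend on x, and φ has compact support. -/
lemma integrable_prod_translate {φ : Plane → ℂ} (hφ : Continuous φ) (hc : HasCompactSupport φ)
    {H : Plane → ℂ} (hm : Measurable H) (hH : Periodic H) (hi : IntegrableOn H cell) :
    Integrable (Function.uncurry fun (s x : Plane) => φ x * H (x + s))
      (cellMeasure.prod volume) := by
  have h2n : ∀ x : Plane, ∫ s in cell, ‖H (x + s)‖ = ∫ s in cell, ‖H s‖ := by
    intro x
    have := (show Periodic (fun s => ((‖H s‖ : ℝ) : ℂ)) from fun m s => by
      simp only [hH m s]).setIntegral_add x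
    rw [integral_complex_ofReal, integral_complex_ofReal] at this
    simp only [add_comm x]
    exact_mod_cast this
  have hms : AEStronglyMeasurable (Function.uncurry fun (s x : Plane) => φ x * H (x + s))
      (cellMeasure.prod volume) := by
    refine Measurable.aestronglyMeasurable ?_
    exact (hφ.measurable.comp measurable_snd).mul
      (hm.comp (measurable_snd.add measurable_fst))
  rw [integrable_prod_iff' hms]
  refine ⟨Eventually.of_forall fun x => (hH.integrableOn_add hi x).const_mul (φ x), ?_⟩
  simp only [Function.uncurry, norm_mul, integral_const_mul, h2n]
  exact (hφ.norm.integrable_of_hasCompactSupport hc.norm).mul_const _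

lemma integral_translate (φ H : Plane → ℂ) (s : Plane) :
    ∫ x, φ (x - s) * H x = ∫ x, φ x * H (x + s) := by
  rw [← integral_add_right_eq_self (fun x => φ (x - s) * H x) s]
  simp

lemma integrableOn_cell_translate {φ : Plane → ℂ} (hφ : Continuous φ) (hc : HasCompactSupport φ)
    {H : Plane → ℂ} (hm : Measurable H) (hH : Periodic H) (hi : IntegrableOn H cell) :
    IntegrableOn (fun s => ∫ x, φ (x - s) * H x) cell := by
  simp only [integral_translate]
  exact (integrable_prod_translate hφ hc hm hH hi).integral_prod_left

/-- Averaging the translates of a test function against a periodic function. -/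
lemma integral_cell_translate {φ : Plane → ℂ} (hφ : Continuous φ) (hc : HasCompactSupport φ)
    {H : Plane → ℂ} (hm : Measurable H) (hH : Periodic H) (hi : IntegrableOn H cell) :
    ∫ s in cell, ∫ x, φ (x - s) * H x = (∫ x, φ x) * ∫ x in cell, H x := by
  have h2 : ∀ x : Plane, ∫ s in cell, H (x + s) = ∫ s in cell, H s := by
    intro x
    simp only [add_comm x]
    exact hH.setIntegral_add x
  simp only [integral_translate]
  -- After the exchange the inner integral over the cell is the same for every x and factors out.
  rw [integral_integral_swap (integrable_prod_translate hφ hc hm hH hi)]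
  simp only [integral_const_mul, h2, integral_mul_const]

end Honeycomb
end

noncomputable section

namespace Honeycomb

/-! ### Classical partial derivatives -/

lemma hasFDerivAt_planeWave (k x : Plane) : HasFDerivAt (planeWave k)
    (planeWave k x • (Complex.I • (Complex.ofRealCLM.comp (innerSL ℝ k)))) x := by
  have h1 : HasFDerivAt (fun x : Plane => ((inner ℝ k x : ℝ) : ℂ))
      (Complex.ofRealCLM.comp (innerSL ℝ k)) x :=
    Complex.ofRealCLM.hasFDerivAt.comp x (innerSL ℝ k).hasFDerivAt
  exact (h1.const_mul Complex.I).cexp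

lemma inner_single (k : Plane) (j : Fin 2) : inner ℝ k (EuclideanSpace.single j (1 : ℝ)) = k j := by
  rw [inner_plane]; fin_cases j <;> simp

lemma pderiv_planeWave (j : Fin 2) (k x : Plane) :
    pderiv j (planeWave k) x = Complex.I * k j * planeWave k x := by
  rw [pderiv, (hasFDerivAt_planeWave k x).fderiv]
  simp only [_root_.smul_apply, ContinuousLinearMap.comp_apply, innerSL_apply_apply,
    inner_single, Complex.ofRealCLM_apply, smul_eq_mul]
  ring

lemma pderiv_mul {f g : Plane → ℂ} {x : Plane} (j : Fin 2) (hf : DifferentiableAt ℝ f x)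
    (hg : DifferentiableAt ℝ g x) :
    pderiv j (fun y => f y * g y) x = pderiv j f x * g x + f x * pderiv j g x := by
  simp only [pderiv]
  rw [fderiv_fun_mul hf hg]
  simp only [_root_.add_apply, _root_.smul_apply, smul_eq_mul]
  ring

lemma pderiv_const_mul {f : Plane → ℂ} {x : Plane} (j : Fin 2) (c : ℂ)
    (hf : DifferentiableAt ℝ f x) : pderiv j (fun y => c * f y) x = c * pderiv j f x := by
  simp only [pderiv]
  rw [fderiv_const_mul hf]
  simp

lemma pderiv_comp_sub {E : Type*} [NormedAddCommGroup E] [NormedSpace ℝ E] (f : Plane → E)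
    (j : Fin 2) (s x : Plane) : pderiv j (fun y => f (y - s)) x = pderiv j f (x - s) := by
  simp only [pderiv]
  rw [fderiv_comp_sub]

lemma ContDiff.pderiv_top {E : Type*} [NormedAddCommGroup E] [NormedSpace ℝ E] {f : Plane → E}
    (hf : ContDiff ℝ ∞ f) (j : Fin 2) : ContDiff ℝ ∞ (pderiv j f) :=
  (hf.fderiv_right (m := ∞) le_rfl).clm_apply contDiff_const

lemma hasCompactSupport_pderiv {E : Type*} [NormedAddCommGroup E] [NormedSpace ℝ E]
    {f : Plane → E} (hf : HasCompactSupport f) (j : Fin 2) : HasCompactSupport (pderiv j f) :=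
  (hf.fderiv ℝ).comp_left (g := fun L : Plane →L[ℝ] E => L (EuclideanSpace.single j 1)) rfl

lemma integral_pderiv_mul {f g : Plane → ℂ} (hf : ContDiff ℝ ∞ f) (hc : HasCompactSupport f)
    (hg : ContDiff ℝ ∞ g) (j : Fin 2) :
    ∫ x, pderiv j f x * g x = -∫ x, f x * pderiv j g x := by
  have h := integral_mul_fderiv_eq_neg_fderiv_mul_of_integrable (μ := volume)
    (f := f) (g := g) (v := EuclideanSpace.single j (1 : ℝ)) ?_ ?_ ?_
    (fun x _ => hf.differentiable (by simp) x) (fun x _ => hg.differentiable (by simp) x)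
  · change ∫ x, fderiv ℝ f x (EuclideanSpace.single j 1) * g x = _
    rw [← neg_eq_iff_eq_neg] at h
    exact h.symm
  · exact ((ContDiff.pderiv_top hf j).continuous.mul hg.continuous).integrable_of_hasCompactSupport
      (hasCompactSupport_pderiv hc j).mul_right
  · exact (hf.continuous.mul (ContDiff.pderiv_top hg j).continuous).integrable_of_hasCompactSupport
      hc.mul_right
  · exact (hf.continuous.mul hg.continuous).integrable_of_hasCompactSupport hc.mul_right

lemma integral_pderiv {f : Plane → ℂ} (hf : ContDiff ℝ ∞ f) (hc : HasCompactSupport f)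
    (j : Fin 2) : ∫ x, pderiv j f x = 0 := by
  have h := integral_pderiv_mul hf hc (contDiff_const (c := (1 : ℂ))) j
  simpa [pderiv] using h

/-! ### Weak derivatives of pseudo-periodic functions -/

lemma pderiv_re_im {η : Plane → ℂ} (hη : ContDiff ℝ ∞ η) (j : Fin 2) (x : Plane) :
    pderiv j η x = (pderiv j (fun y => (η y).re) x : ℝ) +
      Complex.I * (pderiv j (fun y => (η y).im) x : ℝ) := by
  have hd : DifferentiableAt ℝ η x := hη.differentiable (by simp) x
  have h1 : pderiv j (fun y => (η y).re) x = (pderiv j η x).re := by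
    have := (Complex.reCLM.hasFDerivAt.comp x hd.hasFDerivAt).fderiv
    exact congrArg (fun L : Plane →L[ℝ] ℝ => L (EuclideanSpace.single j 1)) this
  have h2 : pderiv j (fun y => (η y).im) x = (pderiv j η x).im := by
    have := (Complex.imCLM.hasFDerivAt.comp x hd.hasFDerivAt).fderiv
    exact congrArg (fun L : Plane →L[ℝ] ℝ => L (EuclideanSpace.single j 1)) this
  rw [h1, h2, mul_comm, Complex.re_add_im]

/-- Weak derivatives are defined with real test functions. Complex ones, needed for bumps multiplied
by plane waves, are split into real and imaginary parts. -/
lemma HasWeakDeriv.integral_pderiv_mul {j : Fin 2} {f g : Plane → ℂ} (h : HasWeakDeriv j f g)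
    {η : Plane → ℂ} (hη : ContDiff ℝ ∞ η) (hc : HasCompactSupport η) :
    ∫ x, pderiv j η x * f x = -∫ x, η x * g x := by
  have hre : ContDiff ℝ ∞ fun x => (η x).re := Complex.reCLM.contDiff.comp hη
  have him : ContDiff ℝ ∞ fun x => (η x).im := Complex.imCLM.contDiff.comp hη
  have cre : HasCompactSupport fun x => (η x).re := hc.comp_left (g := Complex.re) rfl
  have cim : HasCompactSupport fun x => (η x).im := hc.comp_left (g := Complex.im) rfl
  have I1 := h.1.integrable_smul_left_of_hasCompactSupport
    (ContDiff.pderiv_top hre j).continuous (hasCompactSupport_pderiv cre j)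
  have I2 := h.1.integrable_smul_left_of_hasCompactSupport
    (ContDiff.pderiv_top him j).continuous (hasCompactSupport_pderiv cim j)
  have I3 := h.2.1.integrable_smul_left_of_hasCompactSupport hre.continuous cre
  have I4 := h.2.1.integrable_smul_left_of_hasCompactSupport him.continuous cim
  have e1 : ∀ x, pderiv j η x * f x = pderiv j (fun y => (η y).re) x • f x +
      Complex.I * (pderiv j (fun y => (η y).im) x • f x) := by
    intro x
    rw [pderiv_re_im hη, Complex.real_smul, Complex.real_smul]; ring
  have e2 : ∀ x, η x * g x = (η x).re • g x + Complex.I * ((η x).im • g x) := by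
    intro x
    rw [Complex.real_smul, Complex.real_smul]
    conv_lhs => rw [← Complex.re_add_im (η x)]
    ring
  simp only [e1, e2]
  rw [integral_add I1 (I2.const_mul _), integral_add I3 (I4.const_mul _), integral_const_mul,
    integral_const_mul, h.2.2 _ hre cre, h.2.2 _ him cim]
  ring

lemma HasWeakDeriv.congr {j : Fin 2} {f g f' g' : Plane → ℂ} (h : HasWeakDeriv j f g)
    (hf : f =ᵐ[volume] f') (hg : g =ᵐ[volume] g') : HasWeakDeriv j f' g' := by
  refine ⟨h.1.congr hf, h.2.1.congr hg, fun η h1 h2 => ?_⟩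
  have e1 : ∫ x, pderiv j η x • f' x = ∫ x, pderiv j η x • f x := by
    refine integral_congr_ae ?_
    filter_upwards [hf] with x hx; rw [hx]
  have e2 : ∫ x, η x • g' x = ∫ x, η x • g x := by
    refine integral_congr_ae ?_
    filter_upwards [hg] with x hx; rw [hx]
  rw [e1, e2, h.2.2 η h1 h2]

lemma HasWeakDeriv.ae_eq {j : Fin 2} {f g g' : Plane → ℂ} (h : HasWeakDeriv j f g)
    (h' : HasWeakDeriv j f g') : g =ᵐ[volume] g' := by
  refine ae_eq_of_integral_contDiff_smul_eq h.2.1 h'.2.1 fun η h1 h2 => ?_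
  exact neg_injective ((h.2.2 η h1 h2).symm.trans (h'.2.2 η h1 h2))

lemma HasWeakDeriv.weakDeriv_spec {j : Fin 2} {f g : Plane → ℂ} (h : HasWeakDeriv j f g) :
    HasWeakDeriv j f (weakDeriv j f) := by
  have hex : ∃ g, HasWeakDeriv j f g := ⟨g, h⟩
  rw [weakDeriv, dif_pos hex]
  exact hex.choose_spec

lemma HasWeakDeriv.weakDeriv_ae_eq {j : Fin 2} {f g : Plane → ℂ} (h : HasWeakDeriv j f g) :
    weakDeriv j f =ᵐ[volume] g := h.weakDeriv_spec.ae_eq h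

/-- A smooth compactly supported function with nonzero integral. -/
lemma exists_bump : ∃ η : Plane → ℂ, ContDiff ℝ ∞ η ∧ HasCompactSupport η ∧ ∫ x, η x ≠ 0 := by
  let b : ContDiffBump (0 : Plane) := ⟨1, 2, one_pos, one_lt_two⟩
  refine ⟨fun x => (b x : ℂ), Complex.ofRealCLM.contDiff.comp b.contDiff,
    b.hasCompactSupport.comp_left (g := fun r : ℝ => (r : ℂ)) Complex.ofReal_zero, ?_⟩
  rw [integral_complex_ofReal]
  exact Complex.ofReal_ne_zero.2 b.integral_pos.ne'

lemma planeWave_mul_bloch (k : Plane) (m : ℤ × ℤ) (u : Plane → ℂ) (x : Plane) :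
    planeWave (-(k + dualVec m)) x * bloch k u x = planeWave (-dualVec m) x * u (cellRep x) := by
  rw [bloch, neg_add, planeWave_add_left, ← conj_planeWave k]
  linear_combination (planeWave (-dualVec m) x * u (cellRep x)) * conj_planeWave_mul_self k x

lemma setIntegral_mode (m : ℤ × ℤ) (u : CellL2) :
    ∫ x in cell, planeWave (-dualVec m) x * u (cellRep x) =
      (Real.sqrt cellVol : ℂ) * fourierBasis.repr u m := by
  have hs : (Real.sqrt cellVol : ℂ) ≠ 0 :=
    Complex.ofReal_ne_zero.2 (Real.sqrt_pos.2 cellVol_pos).ne'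
  rw [fourierBasis_repr, cellInner, ← integral_const_mul]
  refine setIntegral_congr_fun measurableSet_cell fun x hx => ?_
  simp only [fourierMode, map_mul, Complex.conj_ofReal, conj_planeWave, cellRep_of_mem hx]
  push_cast
  field_simp

/-- A plane wave has no compact support, so it is cut off by a translate η(· − s) of a bump, and the
resulting identities are averaged over s in the cell. Averaging replaces η by its integral and ∂ⱼη
by its integral, which is 0; what remains is the relation between the two Fourier coefficients. -/
lemma repr_of_hasWeakDeriv {k : Plane} {j : Fin 2} {u w : CellL2}
    (h : HasWeakDeriv j (bloch k u) (bloch k w)) (m : ℤ × ℤ) :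
    fourierBasis.repr w m = Complex.I * (k + dualVec m) j * fourierBasis.repr u m := by
  obtain ⟨η, hη, hc, hne⟩ := exists_bump
  set p : Plane → ℂ := planeWave (-(k + dualVec m)) with hp
  set c : ℂ := Complex.I * (k + dualVec m) j with hcdef
  have hper : ∀ v : CellL2, Periodic fun x => planeWave (-dualVec m) x * v (cellRep x) := by
    intro v n x
    simp only [cellRep_add, ← dualVec_neg, periodic_planeWave (-m) n x]
  have hmeas : ∀ v : CellL2, Measurable fun x => planeWave (-dualVec m) x * v (cellRep x) :=
    fun v => (continuous_planeWave _).measurable.mul ((measurable_coe v).comp measurable_cellRep)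
  have hint : ∀ v : CellL2, IntegrableOn (fun x => planeWave (-dualVec m) x * v (cellRep x)) cell := by
    intro v
    have := (memLp_planeWave_mul (k := -dualVec m) (Lp.memLp v)).integrable one_le_two
    refine this.congr ?_
    filter_upwards [ae_restrict_mem measurableSet_cell] with x hx
    rw [cellRep_of_mem hx]
  set H : Plane → ℂ := fun x => planeWave (-dualVec m) x * u (cellRep x) with hH
  set G : Plane → ℂ := fun x => planeWave (-dualVec m) x * w (cellRep x) with hG
  have hdη := ContDiff.pderiv_top hη j
  have hdc := hasCompactSupport_pderiv hc j
  have hlu : LocallyIntegrable H := by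
    have := locallyIntegrable_bloch (-dualVec m) u
    exact this
  have hlw : LocallyIntegrable G := locallyIntegrable_bloch (-dualVec m) w
  have key : ∀ s : Plane, (∫ x, pderiv j η (x - s) * H x) - c * (∫ x, η (x - s) * H x) =
      -∫ x, η (x - s) * G x := by
    intro s
    have hs : ContDiff ℝ ∞ fun x => η (x - s) := hη.comp (contDiff_id.sub contDiff_const)
    have hsc : HasCompactSupport fun x => η (x - s) :=
      hc.comp_homeomorph (Homeomorph.subRight s)
    have hdsc : HasCompactSupport fun x => pderiv j η (x - s) :=
      hdc.comp_homeomorph (Homeomorph.subRight s)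
    have hds : Continuous fun x => pderiv j η (x - s) := hdη.continuous.comp (by fun_prop)
    have h1 := h.integral_pderiv_mul (hs.mul (contDiff_planeWave (-(k + dualVec m))))
      (hsc.mul_right)
    have e1 : ∀ x, pderiv j (fun y => η (y - s) * planeWave (-(k + dualVec m)) y) x * bloch k u x =
        pderiv j η (x - s) * H x - c * (η (x - s) * H x) := by
      intro x
      rw [pderiv_mul j (hs.differentiable (by simp) x)
        ((contDiff_planeWave _).differentiable (by simp) x), pderiv_comp_sub, pderiv_planeWave]
      have h2 := planeWave_mul_bloch k m u x
      simp only [PiLp.neg_apply, Complex.ofReal_neg, hH, hcdef]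
      linear_combination (pderiv j η (x - s) - Complex.I * (k + dualVec m) j * η (x - s)) * h2
    have e2 : ∀ x, η (x - s) * planeWave (-(k + dualVec m)) x * bloch k w x =
        η (x - s) * G x := by
      intro x
      have h2 := planeWave_mul_bloch k m w x
      simp only [hG]
      linear_combination η (x - s) * h2
    simp only [e1, e2] at h1
    rw [integral_sub, integral_const_mul] at h1
    · exact h1
    · exact hlu.integrable_smul_left_of_hasCompactSupport hds hdsc
    · exact (hlu.integrable_smul_left_of_hasCompactSupport hs.continuous hsc).const_mul c
  have h3 : (∫ s in cell, ∫ x, pderiv j η (x - s) * H x) -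
      c * (∫ s in cell, ∫ x, η (x - s) * H x) = -∫ s in cell, ∫ x, η (x - s) * G x := by
    rw [← integral_const_mul, ← integral_sub, ← integral_neg]
    · simp only [key]
    · exact integrableOn_cell_translate hdη.continuous hdc (hmeas u) (hper u) (hint u)
    · exact (integrableOn_cell_translate hη.continuous hc (hmeas u) (hper u) (hint u)).const_mul c
  rw [integral_cell_translate hdη.continuous hdc (hmeas u) (hper u) (hint u),
    integral_cell_translate hη.continuous hc (hmeas u) (hper u) (hint u),
    integral_cell_translate hη.continuous hc (hmeas w) (hper w) (hint w),
    integral_pderiv hη hc, setIntegral_mode, setIntegral_mode] at h3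
  have hs : (Real.sqrt cellVol : ℂ) ≠ 0 :=
    Complex.ofReal_ne_zero.2 (Real.sqrt_pos.2 cellVol_pos).ne'
  apply mul_left_cancel₀ hs
  apply mul_left_cancel₀ hne
  linear_combination h3

lemma bloch_fourierMode (k : Plane) (m : ℤ × ℤ) :
    bloch k (fourierModeL2 m) =ᵐ[volume]
      fun x => ((Real.sqrt cellVol)⁻¹ : ℝ) * planeWave (k + dualVec m) x := by
  refine (bloch_congr (coeFn_fourierModeL2 m)).trans (Eventually.of_forall fun x => ?_)
  simp only [bloch, fourierMode, planeWave_add_left, (periodic_planeWave m).apply_cellRep]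
  ring

lemma testPairing_mode {φ : Plane → ℂ} (hφ : ContDiff ℝ ∞ φ) (hc : HasCompactSupport φ)
    (k : Plane) (j : Fin 2) (m : ℤ × ℤ) :
    testPairing (ContDiff.pderiv_top hφ j).continuous (hasCompactSupport_pderiv hc j) k
        (fourierModeL2 m) =
      -(Complex.I * (k + dualVec m) j * testPairing hφ.continuous hc k (fourierModeL2 m)) := by
  rw [testPairing_apply, testPairing_apply]
  have e1 : ∀ ψ : Plane → ℂ, ∫ x, ψ x * bloch k (fourierModeL2 m) x =
      ∫ x, ((Real.sqrt cellVol)⁻¹ : ℝ) * (ψ x * planeWave (k + dualVec m) x) := by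
    intro ψ
    refine integral_congr_ae ?_
    filter_upwards [bloch_fourierMode k m] with x hx
    rw [hx]; ring
  rw [e1, e1, integral_const_mul, integral_const_mul,
    integral_pderiv_mul hφ hc (contDiff_planeWave _)]
  simp only [pderiv_planeWave]
  have e2 : ∀ x, φ x * (Complex.I * (k + dualVec m) j * planeWave (k + dualVec m) x) =
    Complex.I * (k + dualVec m) j * (φ x * planeWave (k + dualVec m) x) := fun x => by ring
  simp only [e2, integral_const_mul]
  ring

/-- For a single mode this is classical integration by parts. It extends to the whole Fourier series
because `testPairing` is a continuous functional. -/
lemma hasWeakDeriv_of_repr {k : Plane} {j : Fin 2} {u w : CellL2}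
    (h : ∀ m, fourierBasis.repr w m = Complex.I * (k + dualVec m) j * fourierBasis.repr u m) :
    HasWeakDeriv j (bloch k u) (bloch k w) := by
  refine ⟨locallyIntegrable_bloch k u, locallyIntegrable_bloch k w, fun η hη hc => ?_⟩
  set φ : Plane → ℂ := fun x => (η x : ℂ) with hφdef
  have hφ : ContDiff ℝ ∞ φ := Complex.ofRealCLM.contDiff.comp hη
  have hφc : HasCompactSupport φ :=
    hc.comp_left (g := fun r : ℝ => (r : ℂ)) Complex.ofReal_zero
  have hd : ∀ x, pderiv j φ x = (pderiv j η x : ℝ) := by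
    intro x
    have := (Complex.ofRealCLM.hasFDerivAt.comp x
      (hη.differentiable (by simp) x).hasFDerivAt).fderiv
    exact congrArg (fun L : Plane →L[ℝ] ℂ => L (EuclideanSpace.single j 1)) this
  have hu := (fourierBasis.hasSum_repr u).mapL
    (testPairing (ContDiff.pderiv_top hφ j).continuous (hasCompactSupport_pderiv hφc j) k)
  have hw := ((fourierBasis.hasSum_repr w).mapL (testPairing hφ.continuous hφc k)).neg
  have heq : testPairing (ContDiff.pderiv_top hφ j).continuous (hasCompactSupport_pderiv hφc j) k u
      = -testPairing hφ.continuous hφc k w := by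
    refine hu.unique (hw.congr_fun fun m => ?_)
    rw [map_smul, map_smul, coe_fourierBasis, testPairing_mode hφ hφc, h m, smul_eq_mul, smul_eq_mul]
    ring
  rw [testPairing_apply, testPairing_apply] at heq
  simp only [hd] at heq
  simpa only [Complex.real_smul] using heq

end Honeycomb
end

noncomputable section

namespace Honeycomb

/-! ### Operators on sequences of Fourier coefficients -/

/-- The Hilbert space `ℓ²(ℤ²)`. -/
abbrev Seq := lp (fun _ : ℤ × ℤ => ℂ) 2

lemma memℓp_diag {d : ℤ × ℤ → ℝ} {C : ℝ} (h : ∀ m, |d m| ≤ C) (y : Seq) :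
    Memℓp (fun m => (d m : ℂ) * y m) 2 := by
  have h1 := (lp.memℓp y).summable (by norm_num)
  refine memℓp_gen (Summable.of_nonneg_of_le (fun m => by positivity) (fun m => ?_)
    (h1.mul_left (C ^ 2)))
  simp only [norm_mul, Complex.norm_real, Real.norm_eq_abs, ENNReal.toReal_ofNat, Real.rpow_ofNat,
    mul_pow]
  have := h m
  gcongr

/-- The diagonal operator on `ℓ²(ℤ²)` with bounded real entries. -/
def diagOp (d : ℤ × ℤ → ℝ) (C : ℝ) (h : ∀ m, |d m| ≤ C) : Seq →L[ℂ] Seq :=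
  LinearMap.mkContinuous
    { toFun := fun y => ⟨fun m => (d m : ℂ) * y m, memℓp_diag h y⟩
      map_add' := fun y z => by
        ext m; exact mul_add _ _ _
      map_smul' := fun c y => by
        ext m; exact mul_left_comm _ _ _ } C <| fun y => by
    have hC : 0 ≤ C := (abs_nonneg _).trans (h 0)
    have h1 := (lp.memℓp y).summable (by norm_num)
    refine lp.norm_le_of_tsum_le (by norm_num) (by positivity) ?_
    have h2 := lp.norm_rpow_eq_tsum (p := 2) (by norm_num) y
    rw [Real.mul_rpow hC (norm_nonneg _), h2, ← tsum_mul_left]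
    refine Summable.tsum_le_tsum (fun m => ?_) ((memℓp_diag h y).summable (by norm_num))
      (h1.mul_left _)
    change ‖(d m : ℂ) * y m‖ ^ _ ≤ _
    simp only [norm_mul, Complex.norm_real, Real.norm_eq_abs, ENNReal.toReal_ofNat,
      Real.rpow_ofNat, mul_pow]
    have := h m
    gcongr

lemma diagOp_apply {d : ℤ × ℤ → ℝ} {C : ℝ} (h : ∀ m, |d m| ≤ C) (y : Seq) (m : ℤ × ℤ) :
    diagOp d C h y m = (d m : ℂ) * y m := rfl

lemma inner_seq (x y : Seq) : inner ℂ x y = ∑' m, (starRingEnd ℂ) (x m) * y m := by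
  rw [lp.inner_eq_tsum]
  simp only [RCLike.inner_apply, mul_comm]

lemma inner_diagOp {d : ℤ × ℤ → ℝ} {C : ℝ} (h : ∀ m, |d m| ≤ C) (x y : Seq) :
    inner ℂ (diagOp d C h x) y = inner ℂ x (diagOp d C h y) := by
  rw [inner_seq, inner_seq]
  refine tsum_congr fun m => ?_
  rw [diagOp_apply, diagOp_apply, map_mul, Complex.conj_ofReal]; ring

/-- The weight `(1 + |K + m|²)^{1/2}`. -/
def weight (m : ℤ × ℤ) : ℝ := Real.sqrt (1 + ‖K + dualVec m‖ ^ 2)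

lemma weight_sq (m : ℤ × ℤ) : weight m ^ 2 = 1 + ‖K + dualVec m‖ ^ 2 :=
  Real.sq_sqrt (by positivity)

lemma weight_pos (m : ℤ × ℤ) : 0 < weight m := Real.sqrt_pos.2 (by positivity)

lemma one_le_weight (m : ℤ × ℤ) : 1 ≤ weight m := Real.one_le_sqrt.2 (by simp)

lemma abs_inv_weight_le (m : ℤ × ℤ) : |(weight m)⁻¹| ≤ 1 := by
  rw [abs_of_pos (inv_pos.2 (weight_pos m))]
  exact inv_le_one_of_one_le₀ (one_le_weight m)

lemma abs_coord_div_weight_le (j : Fin 2) (m : ℤ × ℤ) : |(K + dualVec m) j / weight m| ≤ 1 := by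
  rw [abs_div, abs_of_pos (weight_pos m), div_le_one (weight_pos m)]
  have h1 : |(K + dualVec m) j| ≤ ‖K + dualVec m‖ := PiLp.norm_apply_le (K + dualVec m) j
  refine h1.trans (Real.le_sqrt_of_sq_le ?_)
  linarith

/-- The embedding of `H¹` into `L²` on the Fourier side. -/
def embOp : Seq →L[ℂ] Seq := diagOp (fun m => (weight m)⁻¹) 1 abs_inv_weight_le

/-- The operator `(1/i) ∂ⱼ` at quasi-momentum `K` on the Fourier side, from `H¹` to `L²`. -/
def momOp (j : Fin 2) : Seq →L[ℂ] Seq :=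
  diagOp (fun m => (K + dualVec m) j / weight m) 1 (abs_coord_div_weight_le j)

/-- The operator `(1/i) ∂ⱼ` at quasi-momentum `K + κ` on the Fourier side. -/
def gradOp (κ : Fin 2 → ℂ) (j : Fin 2) : Seq →L[ℂ] Seq := momOp j + κ j • embOp

lemma embOp_apply (y : Seq) (m : ℤ × ℤ) : embOp y m = ((weight m)⁻¹ : ℝ) * y m := rfl

lemma momOp_apply (j : Fin 2) (y : Seq) (m : ℤ × ℤ) :
    momOp j y m = ((K + dualVec m) j / weight m : ℝ) * y m := rfl

lemma gradOp_apply (κ : Fin 2 → ℂ) (j : Fin 2) (y : Seq) (m : ℤ × ℤ) :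
    gradOp κ j y m = ((K + dualVec m) j + κ j) * embOp y m := by
  change momOp j y m + κ j * embOp y m = _
  rw [momOp_apply, embOp_apply]
  push_cast
  ring

lemma inner_embOp (x y : Seq) : inner ℂ (embOp x) y = inner ℂ x (embOp y) := inner_diagOp _ x y

lemma inner_momOp (j : Fin 2) (x y : Seq) : inner ℂ (momOp j x) y = inner ℂ x (momOp j y) :=
  inner_diagOp _ x y

/-- A real quasi-momentum as a complex vector. -/
def toC (κ : Plane) : Fin 2 → ℂ := fun i => (κ i : ℂ)

/-- Symmetry needs a real displacement: `gradOp` is affine over ℂ in κ without any conjugation,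
which is what keeps `formOp` holomorphic in its parameters. -/
lemma inner_gradOp (κ : Plane) (j : Fin 2) (x y : Seq) :
    inner ℂ (gradOp (toC κ) j x) y = inner ℂ x (gradOp (toC κ) j y) := by
  simp only [gradOp, _root_.add_apply, _root_.smul_apply, inner_add_left, inner_add_right,
    inner_smul_left, inner_smul_right, inner_embOp, inner_momOp, toC, Complex.conj_ofReal]

/-- The unitary map from Fourier coefficients to functions on the cell. -/
def synth : Seq ≃ₗᵢ[ℂ] CellL2 := fourierBasis.repr.symm

lemma repr_synth (y : Seq) : fourierBasis.repr (synth y) = y := by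
  rw [synth, LinearIsometryEquiv.apply_symm_apply]

lemma synth_repr (u : CellL2) : synth (fourierBasis.repr u) = u := by
  rw [synth, LinearIsometryEquiv.symm_apply_apply]

lemma inner_synth (x y : Seq) : inner ℂ (synth x) (synth y) = inner ℂ x y :=
  LinearIsometryEquiv.inner_map_map _ _ _

open Classical in
/-- The entries of a medium as bounded functions on the cell. -/
def entry (A : Medium) (i j : Fin 2) : Lp ℂ ⊤ cellMeasure :=
  if h : MemLp (fun x => A x i j) ⊤ cellMeasure then h.toLp _ else 0

/-- Multiplication by a bounded function on `L²(Ω)`. -/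
def mulOp (a : Lp ℂ ⊤ cellMeasure) : CellL2 →L[ℂ] CellL2 :=
  (ContinuousLinearMap.mul ℂ ℂ).holderL cellMeasure ⊤ 2 2 a

lemma coeFn_mulOp (a : Lp ℂ ⊤ cellMeasure) (u : CellL2) :
    mulOp a u =ᵐ[cellMeasure] fun x => a x * u x :=
  (ContinuousLinearMap.mul ℂ ℂ).coeFn_holder a u

/-- Multiplication by an entry of the medium on the Fourier side. -/
def entryOp (A : Medium) (i j : Fin 2) : Seq →L[ℂ] Seq :=
  (synth.symm.toContinuousLinearEquiv : CellL2 →L[ℂ] Seq) ∘L mulOp (entry A i j) ∘L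
    (synth.toContinuousLinearEquiv : Seq →L[ℂ] CellL2)

lemma synth_entryOp (A : Medium) (i j : Fin 2) (y : Seq) :
    synth (entryOp A i j y) = mulOp (entry A i j) (synth y) :=
  LinearIsometryEquiv.apply_symm_apply _ _

/-- Multiplication by an entry of `I + ε A₁` on the Fourier side. -/
def contrastOp (A₁ : Medium) (ε : ℂ) (i j : Fin 2) : Seq →L[ℂ] Seq :=
  (if i = j then (1 : ℂ) else 0) • ContinuousLinearMap.id ℂ Seq + ε • entryOp A₁ i j

/-- The sesquilinear form of `-∇·(I + ε A₁)∇` at quasi-momentum `K + κ`, as a bounded operator. -/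
def formOp (A₁ : Medium) (p : ℂ × (Fin 2 → ℂ)) : Seq →L[ℂ] Seq :=
  ∑ i, ∑ j, gradOp p.2 i ∘L contrastOp A₁ p.1 i j ∘L gradOp p.2 j

/-- The `L²` inner product as a bounded operator. -/
def massOp : Seq →L[ℂ] Seq := embOp ∘L embOp

lemma inner_massOp (x y : Seq) : inner ℂ x (massOp y) = inner ℂ (embOp x) (embOp y) := by
  rw [inner_embOp]; rfl

lemma inner_massOp_left (x y : Seq) : inner ℂ (massOp x) y = inner ℂ x (massOp y) := by
  rw [inner_massOp, ← inner_embOp]; rfl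

lemma embOp_injective : Function.Injective embOp := by
  intro x y h
  ext m
  have h1 : embOp x m = embOp y m := by rw [h]
  rw [embOp_apply, embOp_apply] at h1
  exact mul_left_cancel₀ (Complex.ofReal_ne_zero.2 (inv_ne_zero (weight_pos m).ne')) h1

/-! ### Floquet-Bloch functions in terms of Fourier coefficients -/

/-- The function of quasi-momentum `K + κ` with given weighted Fourier coefficients. -/
def bf (κ : Plane) (c : Seq) : Plane → ℂ := bloch (K + κ) (synth (embOp c))

lemma cellInner_bf (κ : Plane) (c c' : Seq) :
    cellInner (bf κ c) (bf κ c') = inner ℂ c (massOp c') := by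
  rw [bf, bf, cellInner_bloch, inner_synth, inner_massOp]

lemma bf_injective {κ : Plane} {c c' : Seq} (h : bf κ c =ᵐ[volume] bf κ c') : c = c' :=
  embOp_injective (synth.injective (Lp.ext (bloch_injective h)))

lemma bf_add (κ : Plane) (c c' : Seq) :
    bf κ (c + c') =ᵐ[volume] fun x => bf κ c x + bf κ c' x := by
  rw [bf, map_add, map_add]
  exact bloch_add_ae _ _ _

lemma bf_smul (κ : Plane) (a : ℂ) (c : Seq) :
    bf κ (a • c) =ᵐ[volume] fun x => a * bf κ c x := by
  rw [bf, map_smul, map_smul]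
  exact bloch_smul_ae _ _ _

lemma bf_zero (κ : Plane) : bf κ 0 =ᵐ[volume] 0 := by
  have := bf_smul κ 0 0
  rw [zero_smul] at this
  refine this.trans (Eventually.of_forall fun x => ?_)
  simp

lemma hasWeakDeriv_bf (κ : Plane) (c : Seq) (j : Fin 2) :
    HasWeakDeriv j (bf κ c) (bloch (K + κ) ⇑(synth (Complex.I • gradOp (toC κ) j c))) := by
  refine hasWeakDeriv_of_repr fun m => ?_
  rw [repr_synth, repr_synth]
  change Complex.I * gradOp (toC κ) j c m = _
  rw [gradOp_apply, toC]
  simp only [PiLp.add_apply]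
  push_cast
  ring

lemma weakDeriv_bf (κ : Plane) (c : Seq) (j : Fin 2) :
    weakDeriv j (bf κ c) =ᵐ[volume] bloch (K + κ) ⇑(synth (Complex.I • gradOp (toC κ) j c)) :=
  (hasWeakDeriv_bf κ c j).weakDeriv_ae_eq

lemma memH1_bf (κ : Plane) (c : Seq) : MemH1 (K + κ) (bf κ c) :=
  ⟨memL2_coe _ _, fun j => ⟨(hasWeakDeriv_bf κ c j).weakDeriv_spec,
    (memL2_coe _ _).congr (weakDeriv_bf κ c j).symm⟩⟩

/-- The converse of `memH1_bf`: `bf` exhausts `H¹`, since the coefficients of f and of its two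
derivatives are square summable and together make up the weighted norm. -/
lemma MemH1.exists_bf {κ : Plane} {f : Plane → ℂ} (hf : MemH1 (K + κ) f) :
    ∃ c, f =ᵐ[volume] bf κ c := by
  obtain ⟨u, hu⟩ := hf.1.exists_bloch
  have hg : ∀ j, ∃ w : Seq, ∀ m, w m = ((K + dualVec m) j : ℂ) * fourierBasis.repr u m := by
    intro j
    obtain ⟨w, hw⟩ := (hf.2 j).2.exists_bloch
    have h1 := repr_of_hasWeakDeriv ((hf.2 j).1.congr hu hw)
    -- The weight is centred at K for every κ, so that all quasi-momenta share one sequence space.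
    -- The contribution of κ to the derivative is therefore subtracted.
    refine ⟨(-Complex.I) • fourierBasis.repr w - (κ j : ℂ) • fourierBasis.repr u, fun m => ?_⟩
    change -Complex.I * fourierBasis.repr w m - κ j * fourierBasis.repr u m = _
    rw [h1 m]
    simp only [PiLp.add_apply]
    push_cast
    linear_combination (-(K j + κ j + dualVec m j) * fourierBasis.repr u m : ℂ) * Complex.I_mul_I
  obtain ⟨w0, hw0⟩ := hg 0
  obtain ⟨w1, hw1⟩ := hg 1
  set y := fourierBasis.repr u with hy
  -- The square of the weight is 1 + |K + m|², so the required sum is the sum of the three already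
  -- known to converge.
  have hmem : Memℓp (fun m => (weight m : ℂ) * y m) 2 := by
    have s := (lp.memℓp y).summable (by norm_num)
    have s0 := (lp.memℓp w0).summable (by norm_num)
    have s1 := (lp.memℓp w1).summable (by norm_num)
    refine memℓp_gen (((s.add s0).add s1).congr fun m => ?_)
    simp only [hw0, hw1, norm_mul, Complex.norm_real, ENNReal.toReal_ofNat, Real.rpow_ofNat,
      mul_pow, Real.norm_eq_abs, sq_abs, weight_sq]
    rw [EuclideanSpace.norm_sq_eq, Fin.sum_univ_two]
    simp only [Real.norm_eq_abs, sq_abs]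
    ring
  refine ⟨⟨_, hmem⟩, hu.trans (Eventually.of_forall fun x => ?_)⟩
  have : synth (embOp ⟨_, hmem⟩) = u := by
    rw [← synth_repr u]
    congr 1
    ext m
    rw [embOp_apply]
    change _ * ((weight m : ℂ) * y m) = y m
    rw [Complex.ofReal_inv, inv_mul_cancel_left₀ (Complex.ofReal_ne_zero.2 (weight_pos m).ne')]
  rw [bf, this]

lemma MemH1.congr {k : Plane} {f g : Plane → ℂ} (hf : MemH1 k f) (h : f =ᵐ[volume] g) :
    MemH1 k g := by
  refine ⟨hf.1.congr h, fun j => ?_⟩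
  have h1 : HasWeakDeriv j g (weakDeriv j f) := (hf.2 j).1.congr h (ae_eq_refl _)
  exact ⟨h1.weakDeriv_spec, (hf.2 j).2.congr h1.weakDeriv_ae_eq.symm⟩

lemma weakDeriv_congr {k : Plane} {f g : Plane → ℂ} (hf : MemH1 k f) (h : f =ᵐ[volume] g)
    (j : Fin 2) : weakDeriv j f =ᵐ[volume] weakDeriv j g := by
  have h1 : HasWeakDeriv j g (weakDeriv j f) := (hf.2 j).1.congr h (ae_eq_refl _)
  exact h1.weakDeriv_ae_eq.symm

lemma form_congr {A : Medium} {k : Plane} {f g f' g' : Plane → ℂ} (hf : MemH1 k f)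
    (hg : MemH1 k g) (h : f =ᵐ[volume] f') (h' : g =ᵐ[volume] g') :
    form A f g = form A f' g' := by
  refine integral_congr_ae (ae_restrict_of_ae ?_)
  filter_upwards [weakDeriv_congr hf h 0, weakDeriv_congr hf h 1, weakDeriv_congr hg h' 0,
    weakDeriv_congr hg h' 1] with x h0 h1 h2 h3
  simp only [Fin.sum_univ_two, h0, h1, h2, h3]

/-- The multiplication operators of the contrast act as expected. -/
lemma coeFn_synth_contrastOp {A₁ : Medium} (hA : ∀ i j, MemLp (fun x => A₁ x i j) ⊤ cellMeasure)
    (ε : ℝ) (i j : Fin 2) (y : Seq) :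
    synth (contrastOp A₁ ε i j y) =ᵐ[cellMeasure]
      fun x => lowContrast A₁ ε x i j * synth y x := by
  have h1 : synth (contrastOp A₁ ε i j y) =
      (if i = j then (1 : ℂ) else 0) • synth y + (ε : ℂ) • mulOp (entry A₁ i j) (synth y) := by
    rw [← synth_entryOp, ← map_smul, ← map_smul, ← map_add]
    rfl
  rw [h1]
  have h2 : (entry A₁ i j : Plane → ℂ) =ᵐ[cellMeasure] fun x => A₁ x i j := by
    rw [entry, dif_pos (hA i j)]
    exact MemLp.coeFn_toLp _
  filter_upwards [Lp.coeFn_add ((if i = j then (1 : ℂ) else 0) • synth y)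
      ((ε : ℂ) • mulOp (entry A₁ i j) (synth y)),
    Lp.coeFn_smul (if i = j then (1 : ℂ) else 0) (synth y),
    Lp.coeFn_smul (ε : ℂ) (mulOp (entry A₁ i j) (synth y)),
    coeFn_mulOp (entry A₁ i j) (synth y), h2] with x e1 e2 e3 e4 e5
  rw [e1, Pi.add_apply, e2, e3, Pi.smul_apply, Pi.smul_apply, e4, e5]
  simp only [lowContrast, Matrix.add_apply, Matrix.one_apply, Matrix.smul_apply, smul_eq_mul]
  ring

/-- The two Bloch factors cancel against each other, as do the two factors i coming from the
derivatives; what is left is the isometry of `synth`. -/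
lemma form_bf {A₁ : Medium} (hA : ∀ i j, MemLp (fun x => A₁ x i j) ⊤ cellMeasure)
    (ε : ℝ) (κ : Plane) (c c' : Seq) :
    form (lowContrast A₁ ε) (bf κ c) (bf κ c') = inner ℂ c (formOp A₁ (ε, toC κ) c') := by
  have h1 : inner ℂ c (formOp A₁ (ε, toC κ) c') = ∑ i, ∑ j,
      inner ℂ (synth (gradOp (toC κ) i c))
        (synth (contrastOp A₁ ε i j (gradOp (toC κ) j c'))) := by
    simp only [formOp, _root_.sum_apply, inner_sum, inner_synth, inner_gradOp]
    rfl
  have h2 : form (lowContrast A₁ ε) (bf κ c) (bf κ c') = ∫ x in cell, ∑ i, ∑ j,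
      inner ℂ (synth (gradOp (toC κ) i c) x)
        (synth (contrastOp A₁ ε i j (gradOp (toC κ) j c')) x) := by
    refine integral_congr_ae ?_
    have e : ∀ (c : Seq) (i : Fin 2), ∀ᵐ x ∂cellMeasure, weakDeriv i (bf κ c) x =
        planeWave (K + κ) x * (Complex.I * synth (gradOp (toC κ) i c) x) := by
      intro c i
      filter_upwards [ae_restrict_of_ae (weakDeriv_bf κ c i),
        bloch_ae_cell (K + κ) (synth (Complex.I • gradOp (toC κ) i c)),
        Lp.coeFn_smul Complex.I (synth (gradOp (toC κ) i c))] with x h3 h4 h5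
      rw [h3, h4, map_smul, h5, Pi.smul_apply, smul_eq_mul]
    have e' : ∀ᵐ x ∂cellMeasure, ∀ i j : Fin 2,
        synth (contrastOp A₁ ε i j (gradOp (toC κ) j c')) x =
          lowContrast A₁ ε x i j * synth (gradOp (toC κ) j c') x :=
      ae_all_iff.2 fun i => ae_all_iff.2 fun j => coeFn_synth_contrastOp hA ε i j _
    filter_upwards [ae_all_iff.2 (e c), ae_all_iff.2 (e c'), e'] with x h3 h4 h5
    refine Finset.sum_congr rfl fun i _ => Finset.sum_congr rfl fun j _ => ?_
    rw [h3, h4, h5, RCLike.inner_apply]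
    simp only [map_mul, Complex.conj_I]
    have hp := conj_planeWave_mul_self (K + κ) x
    linear_combination (-(Complex.I * Complex.I)) *
      ((starRingEnd ℂ) (synth (gradOp (toC κ) i c) x) * lowContrast A₁ ε x i j *
        synth (gradOp (toC κ) j c') x) * hp - ((starRingEnd ℂ) (synth (gradOp (toC κ) i c) x) *
        lowContrast A₁ ε x i j * synth (gradOp (toC κ) j c') x) * Complex.I_mul_I
  rw [h1, h2, integral_finsetSum]
  · refine Finset.sum_congr rfl fun i _ => ?_
    rw [integral_finsetSum]
    · rfl
    · exact fun j _ => L2.integrable_inner _ _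
  · exact fun i _ => integrable_finsetSum _ fun j _ => L2.integrable_inner _ _

lemma InEigenspace.congr {A : Medium} {k : Plane} {E : ℝ} {f g : Plane → ℂ}
    (hf : InEigenspace A k E f) (h : f =ᵐ[volume] g) : InEigenspace A k E g := by
  refine ⟨hf.1.congr h, fun ψ hψ => ?_⟩
  rw [← form_congr hψ hf.1 (ae_eq_refl _) h, hf.2 ψ hψ,
    cellInner_congr (ae_eq_refl _) (ae_restrict_of_ae h)]

/-- The bridge from functions to sequences: the weak problems at all quasi-momenta become
generalized eigenvalue problems for bounded operators on one fixed Hilbert space. -/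
lemma inEigenspace_bf {A₁ : Medium} (hA : ∀ i j, MemLp (fun x => A₁ x i j) ⊤ cellMeasure)
    (ε : ℝ) (κ : Plane) (E : ℝ) (c : Seq) :
    InEigenspace (lowContrast A₁ ε) (K + κ) E (bf κ c) ↔
      formOp A₁ (ε, toC κ) c = (E : ℂ) • massOp c := by
  constructor
  · intro h
    refine ext_inner_left ℂ fun v => ?_
    rw [← form_bf hA, h.2 _ (memH1_bf κ v), cellInner_bf, inner_smul_right]
  · intro h
    refine ⟨memH1_bf κ c, fun ψ hψ => ?_⟩
    obtain ⟨v, hv⟩ := hψ.exists_bf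
    rw [form_congr hψ (memH1_bf κ c) hv (ae_eq_refl _), form_bf hA, h, inner_smul_right,
      cellInner_congr (ae_restrict_of_ae hv) (ae_eq_refl _), cellInner_bf]

end Honeycomb
end

noncomputable section

namespace Honeycomb

/-! ### Matrix elements of the form -/

/-- Smooth lattice periodic matrix functions. -/
structure SmoothPeriodic (A : Medium) : Prop where
  smooth : ∀ i j, ContDiff ℝ ∞ (fun x => A x i j)
  periodic : Periodic A

lemma SmoothPeriodic.memLp_top {A : Medium} (h : SmoothPeriodic A) (i j : Fin 2) :
    MemLp (fun x => A x i j) ⊤ cellMeasure := by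
  obtain ⟨C, hC⟩ := (isCompact_closedBall (0 : Plane) 2).exists_bound_of_continuousOn
    (h.smooth i j).continuous.continuousOn
  refine memLp_top_of_bound (h.smooth i j).continuous.aestronglyMeasurable C ?_
  filter_upwards [ae_restrict_mem measurableSet_cell] with x hx
  exact hC x (Metric.ball_subset_closedBall (cell_subset_ball hx))

lemma IsHoneycombMedium.smoothPeriodic {A : Medium} (h : IsHoneycombMedium A) :
    SmoothPeriodic A := ⟨h.smooth, h.periodic⟩

lemma SmoothPeriodic.lowContrast {A : Medium} (h : SmoothPeriodic A) (ε : ℝ) :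
    SmoothPeriodic (lowContrast A ε) := by
  refine ⟨fun i j => ?_, fun m x => ?_⟩
  · have : ContDiff ℝ ∞ fun x => (1 : Matrix (Fin 2) (Fin 2) ℂ) i j + (ε : ℂ) * A x i j :=
      contDiff_const.add (contDiff_const.mul (h.smooth i j))
    exact this
  · simp only [Honeycomb.lowContrast, h.periodic m x]

/-- One nonzero admissible ε suffices: solve I + εA₁ for A₁. -/
lemma smoothPeriodic_of_eventually {A₁ : Medium}
    (hA : ∀ᶠ ε : ℝ in 𝓝 0, IsHoneycombMedium (lowContrast A₁ ε)) : SmoothPeriodic A₁ := by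
  obtain ⟨ε, hε, hne⟩ := ((hA.filter_mono nhdsWithin_le_nhds).and
    (self_mem_nhdsWithin : {0}ᶜ ∈ 𝓝[≠] (0 : ℝ))).exists
  have hne' : (ε : ℂ) ≠ 0 := Complex.ofReal_ne_zero.2 hne
  have key : ∀ x i j, A₁ x i j = (ε : ℂ)⁻¹ * (lowContrast A₁ ε x i j -
      (1 : Matrix (Fin 2) (Fin 2) ℂ) i j) := by
    intro x i j
    simp only [lowContrast, Matrix.add_apply, Matrix.smul_apply, smul_eq_mul]
    field_simp
    ring
  refine ⟨fun i j => ?_, fun m x => ?_⟩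
  · simp only [key _ i j]
    exact contDiff_const.mul ((hε.smooth i j).sub contDiff_const)
  · ext i j
    rw [key, key, hε.periodic]

lemma Periodic.pderiv {h : Plane → ℂ} (hh : Periodic h) (j : Fin 2) :
    Periodic (Honeycomb.pderiv j h) := by
  intro m x
  simp only [Honeycomb.pderiv]
  rw [← fderiv_comp_add_right]
  simp only [hh m _]

lemma hasWeakDeriv_of_contDiff {h : Plane → ℂ} (hs : ContDiff ℝ ∞ h) (j : Fin 2) :
    HasWeakDeriv j h (pderiv j h) := by
  refine ⟨hs.continuous.locallyIntegrable, (ContDiff.pderiv_top hs j).continuous.locallyIntegrable,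
    fun η hη hc => ?_⟩
  have hφ : ContDiff ℝ ∞ fun x => (η x : ℂ) := Complex.ofRealCLM.contDiff.comp hη
  have hφc : HasCompactSupport fun x => (η x : ℂ) :=
    hc.comp_left (g := fun r : ℝ => (r : ℂ)) Complex.ofReal_zero
  have hd : ∀ x, pderiv j (fun x => (η x : ℂ)) x = (pderiv j η x : ℝ) := by
    intro x
    have := (Complex.ofRealCLM.hasFDerivAt.comp x
      (hη.differentiable (by simp) x).hasFDerivAt).fderiv
    exact congrArg (fun L : Plane →L[ℝ] ℂ => L (EuclideanSpace.single j 1)) this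
  have h := integral_pderiv_mul hφ hφc hs j
  simp only [hd] at h
  simpa only [Complex.real_smul] using h

lemma Periodic.ae_eq_bloch {h : Plane → ℂ} (hh : Periodic h) (hc : MemLp h 2 cellMeasure) :
    h =ᵐ[volume] bloch 0 ⇑(hc.toLp h) := by
  refine EventuallyEq.trans ?_ (bloch_congr hc.coeFn_toLp.symm)
  refine Eventually.of_forall fun x => ?_
  rw [bloch, planeWave_zero_left, one_mul, hh.apply_cellRep]

/-- The integral is, up to a factor, the zeroth Fourier coefficient of a derivative, and at
quasi-momentum 0 and mode 0 the multiplier vanishes. -/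
lemma integral_pderiv_periodic {h : Plane → ℂ} (hs : ContDiff ℝ ∞ h) (hh : Periodic h)
    (j : Fin 2) : ∫ x in cell, pderiv j h x = 0 := by
  have h1 := memLp_of_bound_cell hs.continuous
  have h2 := memLp_of_bound_cell (ContDiff.pderiv_top hs j).continuous
  have h3 := repr_of_hasWeakDeriv ((hasWeakDeriv_of_contDiff hs j).congr (hh.ae_eq_bloch h1)
    ((hh.pderiv j).ae_eq_bloch h2)) 0
  have h4 := setIntegral_mode 0 (h2.toLp _)
  rw [h3] at h4
  simp only [dualVec_zero, neg_zero, planeWave_zero_left, one_mul, add_zero, PiLp.zero_apply,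
    Complex.ofReal_zero, mul_zero, zero_mul] at h4
  rw [← h4]
  refine integral_congr_ae ?_
  filter_upwards [ae_restrict_mem measurableSet_cell, h2.coeFn_toLp] with x hx h5
  rw [cellRep_of_mem hx, h5]

/-- The matrix elements of `-∇·A∇` with respect to plane waves. -/
def waveMatrix (A : Medium) (k l : Plane) : ℂ :=
  ∫ x in cell, (starRingEnd ℂ) (planeWave k x) * divOp A (planeWave l) x

lemma divOp_planeWave {A : Medium} (hA : SmoothPeriodic A) (l x : Plane) :
    divOp A (planeWave l) x = planeWave l x *
      -∑ i, ∑ j, Complex.I * l j * (pderiv i (fun y => A y i j) x + Complex.I * l i * A x i j) := by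
  rw [divOp, mul_neg, Finset.mul_sum]
  congr 1
  refine Finset.sum_congr rfl fun i _ => ?_
  rw [Finset.mul_sum]
  refine Finset.sum_congr rfl fun j _ => ?_
  simp only [pderiv_planeWave]
  have e : (fun y => A y i j * (Complex.I * l j * planeWave l y)) =
      fun y => Complex.I * l j * (A y i j * planeWave l y) := by ext y; ring
  have d1 : DifferentiableAt ℝ (fun y => A y i j) x := (hA.smooth i j).differentiable (by simp) x
  have d2 : DifferentiableAt ℝ (planeWave l) x := (contDiff_planeWave l).differentiable (by simp) x
  rw [e, pderiv_const_mul _ _ (d1.fun_mul d2), pderiv_mul i d1 d2, pderiv_planeWave]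
  ring

lemma periodic_waveMatrix_integrand {A : Medium} (hA : SmoothPeriodic A) {k l : Plane} {n : ℤ × ℤ}
    (h : l - k = dualVec n) :
    Periodic fun x => (starRingEnd ℂ) (planeWave k x) * divOp A (planeWave l) x := by
  have hA1 : ∀ i j, Periodic fun y => A y i j := fun i j m x => by
    simp only [hA.periodic m x]
  have e : ∀ x, (starRingEnd ℂ) (planeWave k x) * divOp A (planeWave l) x =
      planeWave (dualVec n) x * -∑ i, ∑ j, Complex.I * l j *
        (pderiv i (fun y => A y i j) x + Complex.I * l i * A x i j) := by
    intro x
    rw [divOp_planeWave hA, conj_planeWave, ← mul_assoc, ← planeWave_add_left, ← h]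
    congr 2
    abel_nf
  intro m x
  simp only [e]
  rw [periodic_planeWave n m x]
  congr 2
  refine Finset.sum_congr rfl fun i _ => Finset.sum_congr rfl fun j _ => ?_
  rw [(hA1 i j).pderiv i m x, hA.periodic m x]

lemma integral_conj_pderiv_planeWave {g : Plane → ℂ} (hg : ContDiff ℝ ∞ g) {k : Plane}
    (hp : Periodic fun x => (starRingEnd ℂ) (planeWave k x) * g x) (i : Fin 2) :
    ∫ x in cell, (starRingEnd ℂ) (Complex.I * k i * planeWave k x) * g x =
      -∫ x in cell, (starRingEnd ℂ) (planeWave k x) * pderiv i g x := by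
  have hs : ContDiff ℝ ∞ fun x => (starRingEnd ℂ) (planeWave k x) * g x := by
    simp only [conj_planeWave]
    exact (contDiff_planeWave _).mul hg
  have h := integral_pderiv_periodic hs hp i
  have e : ∀ x, pderiv i (fun x => (starRingEnd ℂ) (planeWave k x) * g x) x =
      (starRingEnd ℂ) (Complex.I * k i * planeWave k x) * g x +
        (starRingEnd ℂ) (planeWave k x) * pderiv i g x := by
    intro x
    simp only [conj_planeWave]
    rw [pderiv_mul i ((contDiff_planeWave _).differentiable (by simp) x)
      (hg.differentiable (by simp) x), pderiv_planeWave]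
    simp only [map_mul, Complex.conj_I, Complex.conj_ofReal, conj_planeWave, PiLp.neg_apply,
      Complex.ofReal_neg]
    ring
  simp only [e] at h
  have c1 : Continuous fun x => (starRingEnd ℂ) (Complex.I * k i * planeWave k x) * g x :=
    (Complex.continuous_conj.comp (continuous_const.mul (continuous_planeWave k))).mul hg.continuous
  have c2 : Continuous fun x => (starRingEnd ℂ) (planeWave k x) * pderiv i g x :=
    (Complex.continuous_conj.comp (continuous_planeWave k)).mul
      (ContDiff.pderiv_top hg i).continuous
  rw [integral_add ((memLp_of_bound_cell c1).integrable one_le_two)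
    ((memLp_of_bound_cell c2).integrable one_le_two)] at h
  exact eq_neg_of_add_eq_zero_left h

/-- Unit vectors of `ℓ²(ℤ²)`. -/
def unitSeq (n : ℤ × ℤ) : Seq := lp.single 2 n (1 : ℂ)

lemma unitSeq_apply (n m : ℤ × ℤ) : unitSeq n m = if m = n then 1 else 0 := by
  rw [unitSeq, lp.coeFn_single, Pi.single_apply]

lemma inner_unitSeq (m : ℤ × ℤ) (y : Seq) : inner ℂ (unitSeq m) y = y m := by
  rw [unitSeq, lp.inner_single_left]
  simp

/-- Reduces identities between bounded operators to their matrix entries, that is, to plane waves,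
on which the differential operator acts classically. -/
lemma hasSum_matrix (S : Seq →L[ℂ] Seq) (y : Seq) (m : ℤ × ℤ) :
    HasSum (fun n => y n * S (unitSeq n) m) (S y m) := by
  have h1 := (lp.hasSum_single (by simp) y).mapL ((innerSL ℂ (unitSeq m)).comp S)
  simp only [ContinuousLinearMap.comp_apply, innerSL_apply_apply, inner_unitSeq] at h1
  refine h1.congr_fun fun n => ?_
  have : lp.single 2 n (y n) = y n • unitSeq n := by
    rw [unitSeq, ← lp.single_smul]; simp
  rw [this, map_smul]
  rfl

/-- The normalization constants of the plane waves. -/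
def waveNorm (n : ℤ × ℤ) : ℝ := (Real.sqrt cellVol)⁻¹ * (weight n)⁻¹

lemma bf_unitSeq (κ : Plane) (n : ℤ × ℤ) :
    bf κ (unitSeq n) =ᵐ[volume] fun x => (waveNorm n : ℂ) * planeWave (K + κ + dualVec n) x := by
  have h1 : synth (embOp (unitSeq n)) = ((weight n)⁻¹ : ℂ) • fourierModeL2 n := by
    apply fourierBasis.repr.injective
    rw [repr_synth, map_smul, ← coe_fourierBasis, HilbertBasis.repr_self]
    ext m
    rw [embOp_apply, unitSeq_apply]
    change _ = _ * unitSeq n m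
    rw [unitSeq_apply]
    by_cases h : m = n <;> simp [h]
  rw [bf, h1]
  refine (bloch_smul_ae _ _ _).trans ?_
  filter_upwards [bloch_fourierMode (K + κ) n] with x hx
  rw [hx, waveNorm]
  push_cast
  ring

lemma weakDeriv_const_mul_planeWave (k : Plane) (a : ℂ) (j : Fin 2) :
    weakDeriv j (fun x => a * planeWave k x) =ᵐ[volume]
      fun x => a * (Complex.I * k j * planeWave k x) := by
  have h := (hasWeakDeriv_of_contDiff (contDiff_const.mul (contDiff_planeWave k) :
    ContDiff ℝ ∞ fun x => a * planeWave k x) j).weakDeriv_ae_eq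
  refine h.trans (Eventually.of_forall fun x => ?_)
  rw [pderiv_const_mul _ _ ((contDiff_planeWave k).differentiable (by simp) x), pderiv_planeWave]

/-- The honeycomb symmetries are hypotheses on `divOp` applied to smooth functions; this lemma
transfers them to the bounded form, since plane waves are smooth. The integration by parts has no
boundary term because the integrands are periodic. -/
lemma formOp_matrix {A₁ : Medium} (hA : SmoothPeriodic A₁) (ε : ℝ) (κ : Plane) (m n : ℤ × ℤ) :
    formOp A₁ (ε, toC κ) (unitSeq n) m = waveNorm m * waveNorm n *
      waveMatrix (lowContrast A₁ ε) (K + κ + dualVec m) (K + κ + dualVec n) := by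
  rw [← inner_unitSeq, ← form_bf hA.memLp_top, form_congr (memH1_bf κ _) (memH1_bf κ _)
    (bf_unitSeq κ m) (bf_unitSeq κ n)]
  set k := K + κ + dualVec m with hk
  set l := K + κ + dualVec n with hl
  set A := lowContrast A₁ ε with hAdef
  have hAs : SmoothPeriodic A := hA.lowContrast ε
  have hkl : l - k = dualVec (n - m) := by rw [hk, hl, dualVec_sub]; abel
  have e1 : form A (fun x => (waveNorm m : ℂ) * planeWave k x)
      (fun x => (waveNorm n : ℂ) * planeWave l x) = ∫ x in cell, ∑ i, ∑ j,
        waveNorm m * waveNorm n * ((starRingEnd ℂ) (Complex.I * k i * planeWave k x) *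
          (A x i j * (Complex.I * l j * planeWave l x))) := by
    refine integral_congr_ae (ae_restrict_of_ae ?_)
    filter_upwards [ae_all_iff.2 (weakDeriv_const_mul_planeWave k (waveNorm m)),
      ae_all_iff.2 (weakDeriv_const_mul_planeWave l (waveNorm n))] with x h1 h2
    refine Finset.sum_congr rfl fun i _ => Finset.sum_congr rfl fun j _ => ?_
    rw [h1, h2, map_mul, Complex.conj_ofReal]
    ring
  have hg : ∀ i j, ContDiff ℝ ∞ fun x => A x i j * (Complex.I * l j * planeWave l x) := fun i j =>
    (hAs.smooth i j).mul (contDiff_const.mul (contDiff_planeWave l))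
  have hp : ∀ i j, Periodic fun x => (starRingEnd ℂ) (planeWave k x) *
      (A x i j * (Complex.I * l j * planeWave l x)) := by
    intro i j
    have e : ∀ x, (starRingEnd ℂ) (planeWave k x) *
      (A x i j * (Complex.I * l j * planeWave l x)) =
        planeWave (dualVec (n - m)) x * (A x i j * (Complex.I * l j)) := by
      intro x
      rw [← hkl, sub_eq_add_neg, planeWave_add_left l (-k), conj_planeWave]
      ring
    intro v x
    simp only [e]
    rw [periodic_planeWave, hAs.periodic v x]
  have I1 : ∀ i j, Integrable (fun x => (waveNorm m : ℂ) * waveNorm n *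
      ((starRingEnd ℂ) (Complex.I * k i * planeWave k x) *
        (A x i j * (Complex.I * l j * planeWave l x)))) cellMeasure := by
    intro i j
    refine ((memLp_of_bound_cell ?_).integrable one_le_two).const_mul _
    exact (Complex.continuous_conj.comp (continuous_const.mul (continuous_planeWave k))).mul
      (hg i j).continuous
  have I2 : ∀ i j, Integrable (fun x => (starRingEnd ℂ) (planeWave k x) *
      pderiv i (fun y => A y i j * (Complex.I * l j * planeWave l y)) x) cellMeasure := by
    intro i j
    refine (memLp_of_bound_cell ?_).integrable one_le_two
    exact (Complex.continuous_conj.comp (continuous_planeWave k)).mul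
      (ContDiff.pderiv_top (hg i j) i).continuous
  rw [e1, integral_finsetSum _ fun i _ => integrable_finsetSum _ fun j _ => I1 i j]
  have e2 : waveMatrix A k l = -∑ i, ∑ j, ∫ x in cell, (starRingEnd ℂ) (planeWave k x) *
      pderiv i (fun y => A y i j * (Complex.I * l j * planeWave l y)) x := by
    rw [waveMatrix]
    simp only [divOp, pderiv_planeWave, mul_neg, Finset.mul_sum]
    rw [integral_neg, integral_finsetSum _ fun i _ => integrable_finsetSum _ fun j _ => I2 i j]
    congr 1
    exact Finset.sum_congr rfl fun i _ => integral_finsetSum _ fun j _ => I2 i j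
  rw [e2, mul_neg, Finset.mul_sum, ← Finset.sum_neg_distrib]
  refine Finset.sum_congr rfl fun i _ => ?_
  rw [integral_finsetSum _ fun j _ => I1 i j, Finset.mul_sum, ← Finset.sum_neg_distrib]
  refine Finset.sum_congr rfl fun j _ => ?_
  rw [integral_const_mul, integral_conj_pderiv_planeWave (hg i j) (hp i j) i, mul_neg]

/-! ### Symmetries of the matrix elements -/

lemma rotOp_planeWave (k : Plane) : rotOp (planeWave k) = planeWave (rot k) := by
  ext x
  rw [rotOp, planeWave, planeWave, inner_rot_left]

lemma PC_planeWave (k : Plane) : PC (planeWave k) = planeWave k := by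
  ext x
  rw [PC, conj_planeWave, planeWave_neg_right, neg_neg]

/-- Substitute x ↦ R*x. The integrand is periodic because l − k is a dual lattice vector, so its
integral over the cell does not change. -/
lemma waveMatrix_rot {A : Medium} (hA : IsHoneycombMedium A) {k l : Plane} {n : ℤ × ℤ}
    (h : l - k = dualVec n) : waveMatrix A (rot k) (rot l) = waveMatrix A k l := by
  rw [waveMatrix, waveMatrix,
    ← (periodic_waveMatrix_integrand hA.smoothPeriodic h).setIntegral_rotInv]
  refine integral_congr_ae (Eventually.of_forall fun x => ?_)
  simp only
  rw [← rotOp_planeWave, ← rotOp_planeWave, ← hA.rot_invariant _ (contDiff_planeWave l)]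
  rfl

/-- Plane waves are fixed by 𝒫𝒞; the substitution x ↦ −x then turns invariance of the operator into
reality of its matrix elements. -/
lemma conj_waveMatrix {A : Medium} (hA : IsHoneycombMedium A) {k l : Plane} {n : ℤ × ℤ}
    (h : l - k = dualVec n) : (starRingEnd ℂ) (waveMatrix A k l) = waveMatrix A k l := by
  conv_rhs => rw [waveMatrix,
    ← (periodic_waveMatrix_integrand hA.smoothPeriodic h).setIntegral_neg]
  rw [waveMatrix, ← integral_conj]
  refine integral_congr_ae (Eventually.of_forall fun x => ?_)
  have h1 := congrFun (hA.pc_invariant _ (contDiff_planeWave l)) (-x)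
  rw [PC_planeWave, PC, neg_neg] at h1
  simp only [map_mul, Complex.conj_conj]
  rw [h1, planeWave_neg_right, conj_planeWave, neg_neg]

/-- The action of the rotation on weighted Fourier coefficients at `K`. -/
def rotSeq (y : Seq) : Seq :=
  ⟨fun m => y (rotMode.symm m), by
    have h := (lp.memℓp y).summable (by norm_num)
    exact memℓp_gen ((rotMode.symm.summable_iff).2 h)⟩

/-- The action of `𝒫𝒞` on Fourier coefficients. -/
def conjSeq (y : Seq) : Seq :=
  ⟨fun m => (starRingEnd ℂ) (y m), by
    have h := (lp.memℓp y).summable (by norm_num)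
    exact memℓp_gen (by simpa only [RCLike.norm_conj] using h)⟩

lemma rotSeq_apply (y : Seq) (m : ℤ × ℤ) : rotSeq y m = y (rotMode.symm m) := rfl

lemma conjSeq_apply (y : Seq) (m : ℤ × ℤ) : conjSeq y m = (starRingEnd ℂ) (y m) := rfl

lemma rotSeq_add (y z : Seq) : rotSeq (y + z) = rotSeq y + rotSeq z := rfl

lemma rotSeq_smul (a : ℂ) (y : Seq) : rotSeq (a • y) = a • rotSeq y := rfl

lemma weight_rotMode (m : ℤ × ℤ) : weight (rotMode m) = weight m := by
  rw [weight, weight, norm_K_add_sq, norm_K_add_sq, modeHeight_rotMode]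

lemma rotSeq_embOp (y : Seq) : rotSeq (embOp y) = embOp (rotSeq y) := by
  ext m
  rw [rotSeq_apply, embOp_apply, embOp_apply, rotSeq_apply,
    ← weight_rotMode (rotMode.symm m), Equiv.apply_symm_apply]

lemma conjSeq_embOp (y : Seq) : conjSeq (embOp y) = embOp (conjSeq y) := by
  ext m
  rw [conjSeq_apply, embOp_apply, embOp_apply, conjSeq_apply, map_mul, Complex.conj_ofReal]

lemma inner_rotSeq (x y : Seq) : inner ℂ (rotSeq x) (rotSeq y) = inner ℂ x y := by
  rw [inner_seq, inner_seq, ← rotMode.tsum_eq]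
  simp only [rotSeq_apply, Equiv.symm_apply_apply]

lemma rotSeq_massOp (y : Seq) : rotSeq (massOp y) = massOp (rotSeq y) := by
  change rotSeq (embOp (embOp y)) = embOp (embOp (rotSeq y))
  rw [rotSeq_embOp, rotSeq_embOp]

lemma conjSeq_massOp (y : Seq) : conjSeq (massOp y) = massOp (conjSeq y) := by
  change conjSeq (embOp (embOp y)) = embOp (embOp (conjSeq y))
  rw [conjSeq_embOp, conjSeq_embOp]

lemma waveNorm_rotMode (m : ℤ × ℤ) : waveNorm (rotMode m) = waveNorm m := by
  rw [waveNorm, waveNorm, weight_rotMode]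

/-- Compared entry by entry: permuting both modes and rotating κ rotates both wave vectors, and
`waveMatrix` does not see a common rotation. -/
lemma formOp_rotSeq {A₁ : Medium} (hA : SmoothPeriodic A₁) {ε : ℝ}
    (hε : IsHoneycombMedium (lowContrast A₁ ε)) (κ : Plane) (y : Seq) :
    formOp A₁ (ε, toC (rot κ)) (rotSeq y) = rotSeq (formOp A₁ (ε, toC κ) y) := by
  ext m
  obtain ⟨m, rfl⟩ := rotMode.surjective m
  have h1 := hasSum_matrix (formOp A₁ (ε, toC (rot κ))) (rotSeq y) (rotMode m)
  have h2 := hasSum_matrix (formOp A₁ (ε, toC κ)) y m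
  rw [rotSeq_apply, Equiv.symm_apply_apply]
  refine h1.unique ((rotMode.symm.hasSum_iff.2 h2).congr_fun fun n => ?_)
  simp only [Function.comp_apply]
  obtain ⟨n, rfl⟩ := rotMode.surjective n
  rw [rotSeq_apply, Equiv.symm_apply_apply, formOp_matrix hA, formOp_matrix hA,
    waveNorm_rotMode, waveNorm_rotMode]
  have e : ∀ q : ℤ × ℤ, K + rot κ + dualVec (rotMode q) = rot (K + κ + dualVec q) := by
    intro q
    rw [add_right_comm, ← rot_K_add, ← rot_add, add_right_comm]
  rw [e, e, waveMatrix_rot hε (n := n - m)]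
  rw [dualVec_sub]; abel

lemma formOp_conjSeq {A₁ : Medium} (hA : SmoothPeriodic A₁) {ε : ℝ}
    (hε : IsHoneycombMedium (lowContrast A₁ ε)) (κ : Plane) (y : Seq) :
    formOp A₁ (ε, toC κ) (conjSeq y) = conjSeq (formOp A₁ (ε, toC κ) y) := by
  ext m
  have h1 := hasSum_matrix (formOp A₁ (ε, toC κ)) (conjSeq y) m
  have h2 := Complex.hasSum_conj'.2 (hasSum_matrix (formOp A₁ (ε, toC κ)) y m)
  refine h1.unique (h2.congr_fun fun n => ?_)
  rw [conjSeq_apply, map_mul, formOp_matrix hA, map_mul, map_mul, Complex.conj_ofReal,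
    Complex.conj_ofReal, conj_waveMatrix hε (n := n - m)]
  rw [dualVec_sub]; abel

/-! ### Symmetries of Floquet-Bloch functions -/

lemma planeWave_K_rotInv (m : ℤ × ℤ) :
    planeWave K (rotInv (latticeVec m)) = planeWave K (latticeVec m) := by
  have : planeWave K (rotInv (latticeVec m)) = planeWave (rot K) (latticeVec m) := by
    rw [planeWave, planeWave, inner_rot_left]
  rw [this, rot_K, planeWave_add_left, planeWave_dual_lattice, mul_one]

/-- A rotated or reflected cell is no longer the cell but still lies in the ball, which is why
integrability on balls is what the symmetry operations require. -/
lemma memLp_ball_bloch (R : ℝ) (k : Plane) (u : CellL2) :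
    MemLp (bloch k u) 2 (volume.restrict (Metric.ball 0 R)) := by
  refine ⟨(measurable_bloch k u).aestronglyMeasurable, ?_⟩
  rw [eLpNorm_lt_top_iff_lintegral_rpow_enorm_lt_top (by norm_num) (by norm_num)]
  obtain ⟨n, hn⟩ := exists_setLIntegral_ball_le R
  have hper : Periodic fun x => ‖bloch k u x‖ₑ ^ (2 : ENNReal).toReal := by
    intro m x
    simp only [← ofReal_norm, norm_bloch, cellRep_add]
  refine (hn _ hper).trans_lt (ENNReal.mul_lt_top (ENNReal.natCast_lt_top n) ?_)
  rw [← eLpNorm_lt_top_iff_lintegral_rpow_enorm_lt_top (by norm_num) (by norm_num)]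
  exact (memL2_coe k u).1.2

lemma memL2_rotOp_bloch (u : CellL2) : MemL2 K (rotOp (bloch K u)) := by
  refine ⟨?_, fun m => Eventually.of_forall fun x => ?_⟩
  · have hmp : MeasurePreserving rotInv (volume.restrict (rotInv ⁻¹' Metric.ball 0 2))
        (volume.restrict (Metric.ball 0 2)) :=
      rotInvIso.measurePreserving.restrict_preimage measurableSet_ball
    have h := (memLp_ball_bloch 2 K u).comp_measurePreserving hmp
    refine h.mono_measure (Measure.restrict_mono_set _ fun x hx => ?_)
    have := cell_subset_ball hx
    rw [mem_ball_zero_iff] at this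
    rwa [mem_preimage, mem_ball_zero_iff, norm_rotInv]
  · change bloch K u (rotInv (x + latticeVec m)) = planeWave K (latticeVec m) *
      bloch K u (rotInv x)
    rw [rotInv_add, rotInv_latticeVec, bloch_add_latticeVec, ← rotInv_latticeVec,
      planeWave_K_rotInv]

lemma memL2_PC_bloch (k : Plane) (u : CellL2) : MemL2 k (PC (bloch k u)) := by
  refine ⟨?_, fun m => Eventually.of_forall fun x => ?_⟩
  · have hmp : MeasurePreserving (fun x : Plane => -x)
        (volume.restrict ((fun x : Plane => -x) ⁻¹' Metric.ball 0 2))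
        (volume.restrict (Metric.ball 0 2)) :=
      (Measure.measurePreserving_neg volume).restrict_preimage measurableSet_ball
    have h := ((memLp_ball_bloch 2 k u).comp_measurePreserving hmp).star
    refine h.mono_measure (Measure.restrict_mono_set _ fun x hx => ?_)
    have := cell_subset_ball hx
    rw [mem_ball_zero_iff] at this
    rwa [mem_preimage, mem_ball_zero_iff, norm_neg]
  · change (starRingEnd ℂ) (bloch k u (-(x + latticeVec m))) = planeWave k (latticeVec m) *
      (starRingEnd ℂ) (bloch k u (-x))
    rw [neg_add, ← latticeVec_neg, bloch_add_latticeVec, map_mul, latticeVec_neg,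
      planeWave_neg_right, conj_planeWave, neg_neg]

lemma repr_bloch (k : Plane) (u : CellL2) (m : ℤ × ℤ) :
    (Real.sqrt cellVol : ℂ) * fourierBasis.repr u m =
      ∫ x in cell, (starRingEnd ℂ) (planeWave (k + dualVec m) x) * bloch k u x := by
  rw [← setIntegral_mode]
  simp only [conj_planeWave, planeWave_mul_bloch]

lemma periodic_conj_planeWave_mul_bloch (k : Plane) (u : Plane → ℂ) (m : ℤ × ℤ) :
    Periodic fun x => (starRingEnd ℂ) (planeWave (k + dualVec m) x) * bloch k u x := by
  intro n x
  simp only [conj_planeWave, planeWave_mul_bloch, cellRep_add, ← dualVec_neg,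
    periodic_planeWave (-m) n x]

lemma sqrt_cellVol_ne_zero : (Real.sqrt cellVol : ℂ) ≠ 0 :=
  Complex.ofReal_ne_zero.2 (Real.sqrt_pos.2 cellVol_pos).ne'

lemma rotOp_bf (c : Seq) : rotOp (bf 0 c) =ᵐ[volume] bf 0 (rotSeq c) := by
  rw [bf, bf, add_zero]
  set u := synth (embOp c) with hu
  obtain ⟨w, hw⟩ := (memL2_rotOp_bloch u).exists_bloch
  refine hw.trans (Eventually.of_forall fun x => ?_)
  have : w = synth (embOp (rotSeq c)) := by
    rw [← synth_repr w, ← rotSeq_embOp, ← repr_synth (embOp c), ← hu]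
    congr 1
    ext m
    apply mul_left_cancel₀ sqrt_cellVol_ne_zero
    obtain ⟨m, rfl⟩ := rotMode.surjective m
    rw [repr_bloch K, rotSeq_apply, Equiv.symm_apply_apply, repr_bloch K,
      ← (periodic_conj_planeWave_mul_bloch K u m).setIntegral_rotInv]
    refine integral_congr_ae (ae_restrict_of_ae ?_)
    filter_upwards [hw] with x hx
    rw [← hx, ← rot_K_add, ← rotOp_planeWave]
    rfl
  rw [this]

lemma PC_bf (κ : Plane) (c : Seq) : PC (bf κ c) =ᵐ[volume] bf κ (conjSeq c) := by
  rw [bf, bf]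
  set u := synth (embOp c) with hu
  obtain ⟨w, hw⟩ := (memL2_PC_bloch (K + κ) u).exists_bloch
  refine hw.trans (Eventually.of_forall fun x => ?_)
  have : w = synth (embOp (conjSeq c)) := by
    rw [← synth_repr w, ← conjSeq_embOp, ← repr_synth (embOp c), ← hu]
    congr 1
    ext m
    apply mul_left_cancel₀ sqrt_cellVol_ne_zero
    rw [repr_bloch (K + κ), conjSeq_apply]
    conv_rhs => rw [← Complex.conj_ofReal, ← map_mul, repr_bloch (K + κ),
      ← (periodic_conj_planeWave_mul_bloch (K + κ) u m).setIntegral_neg, ← integral_conj]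
    refine integral_congr_ae (ae_restrict_of_ae ?_)
    filter_upwards [hw] with x hx
    rw [← hx, map_mul, planeWave_neg_right, conj_planeWave, conj_planeWave, conj_planeWave,
      neg_neg]
    rfl
  rw [this]

lemma rotOp_congr {f g : Plane → ℂ} (h : f =ᵐ[volume] g) : rotOp f =ᵐ[volume] rotOp g :=
  rotInvIso.measurePreserving.quasiMeasurePreserving.ae h

lemma memL2Rot_bf {σ : ℂ} {c : Seq} : MemL2Rot K σ (bf 0 c) ↔ rotSeq c = σ • c := by
  have hK : MemL2 K (bf 0 c) := by
    have := (memH1_bf 0 c).1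
    rwa [add_zero] at this
  constructor
  · intro h
    apply bf_injective (κ := 0)
    filter_upwards [rotOp_bf c, h.2, bf_smul 0 σ c] with x h1 h2 h3
    rw [← h1, h2, h3]
  · intro h
    refine ⟨hK, ?_⟩
    have h2 := bf_smul 0 σ c
    rw [← h] at h2
    exact (rotOp_bf c).trans h2

lemma MemL2Rot.congr {k : Plane} {σ : ℂ} {f g : Plane → ℂ} (hf : MemL2Rot k σ f)
    (h : f =ᵐ[volume] g) : MemL2Rot k σ g := by
  refine ⟨hf.1.congr h, ?_⟩
  filter_upwards [rotOp_congr h, hf.2, h] with x h1 h2 h3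
  rw [← h1, h2, h3]

end Honeycomb
end

noncomputable section

namespace Honeycomb

/-! ### Self-adjointness and derivatives of the form -/

lemma inner_contrastOp {A₁ : Medium} (hA : SmoothPeriodic A₁) {ε : ℝ}
    (hε : IsHoneycombMedium (lowContrast A₁ ε)) (i j : Fin 2) (x y : Seq) :
    inner ℂ (contrastOp A₁ ε i j x) y = inner ℂ x (contrastOp A₁ ε j i y) := by
  rw [← inner_synth, ← inner_synth, L2.inner_def, L2.inner_def]
  refine integral_congr_ae ?_
  filter_upwards [coeFn_synth_contrastOp hA.memLp_top ε i j x,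
    coeFn_synth_contrastOp hA.memLp_top ε j i y] with t h1 h2
  rw [h1, h2, RCLike.inner_apply, RCLike.inner_apply, map_mul, ← (hε.hermitian t).apply i j]
  simp only [starRingEnd_apply, star_star]
  ring

lemma inner_formOp {A₁ : Medium} (hA : SmoothPeriodic A₁) {ε : ℝ}
    (hε : IsHoneycombMedium (lowContrast A₁ ε)) (κ : Plane) (x y : Seq) :
    inner ℂ (formOp A₁ (ε, toC κ) x) y = inner ℂ x (formOp A₁ (ε, toC κ) y) := by
  simp only [formOp, _root_.sum_apply, sum_inner, inner_sum, ContinuousLinearMap.comp_apply,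
    inner_gradOp, inner_contrastOp hA hε]
  rw [Finset.sum_comm]

/-- The derivative of the form with respect to the quasi-momentum at `K`. -/
def velOp (A₁ : Medium) (ε : ℂ) (j : Fin 2) : Seq →L[ℂ] Seq :=
  ∑ l, (embOp ∘L contrastOp A₁ ε j l ∘L momOp l + momOp l ∘L contrastOp A₁ ε l j ∘L embOp)

/-- The second order part of the form in the quasi-momentum. -/
def quadOp (A₁ : Medium) (ε : ℂ) (i j : Fin 2) : Seq →L[ℂ] Seq :=
  embOp ∘L contrastOp A₁ ε i j ∘L embOp

/-- Exact and without remainder, because the quasi-momentum enters once through each of the two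
gradients. -/
lemma formOp_expand (A₁ : Medium) (ε : ℂ) (κ : Fin 2 → ℂ) :
    formOp A₁ (ε, κ) = formOp A₁ (ε, 0) + ∑ j, κ j • velOp A₁ ε j +
      ∑ i, ∑ j, (κ i * κ j) • quadOp A₁ ε i j := by
  ext1 y
  simp only [formOp, velOp, quadOp, gradOp, Fin.sum_univ_two, _root_.add_apply,
    ContinuousLinearMap.comp_apply, _root_.smul_apply, Pi.zero_apply, zero_smul, add_zero, map_add,
    map_smul, smul_add, smul_smul]
  module

/-- The derivative of the form with respect to the contrast at `K`. -/
def contrastDeriv (A₁ : Medium) : Seq →L[ℂ] Seq :=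
  ∑ i, ∑ j, momOp i ∘L entryOp A₁ i j ∘L momOp j

/-- The form of the Laplacian at `K`. -/
def lapOp : Seq →L[ℂ] Seq := ∑ i, momOp i ∘L momOp i

lemma formOp_zero_right (A₁ : Medium) (ε : ℂ) :
    formOp A₁ (ε, 0) = lapOp + ε • contrastDeriv A₁ := by
  ext1 y
  simp only [formOp, lapOp, contrastDeriv, contrastOp, gradOp, Fin.sum_univ_two,
    _root_.add_apply, ContinuousLinearMap.comp_apply, _root_.smul_apply, Pi.zero_apply, zero_smul,
    add_zero, map_add, map_smul, ContinuousLinearMap.id_apply]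
  simp
  abel

lemma lapOp_apply (y : Seq) (m : ℤ × ℤ) :
    lapOp y m = ((‖K + dualVec m‖ ^ 2 / weight m ^ 2 : ℝ) : ℂ) * y m := by
  simp only [lapOp, Fin.sum_univ_two, _root_.add_apply, ContinuousLinearMap.comp_apply]
  change momOp 0 (momOp 0 y) m + momOp 1 (momOp 1 y) m = _
  simp only [momOp_apply]
  rw [EuclideanSpace.norm_sq_eq, Fin.sum_univ_two]
  simp only [Real.norm_eq_abs, sq_abs]
  push_cast
  ring

lemma massOp_apply (y : Seq) (m : ℤ × ℤ) :
    massOp y m = (((weight m ^ 2)⁻¹ : ℝ) : ℂ) * y m := by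
  change embOp (embOp y) m = _
  rw [embOp_apply, embOp_apply]
  push_cast
  ring

lemma synth_unitSeq (n : ℤ × ℤ) : synth (unitSeq n) = fourierModeL2 n := by
  apply fourierBasis.repr.injective
  rw [repr_synth, ← coe_fourierBasis, HilbertBasis.repr_self]
  rfl

lemma entryOp_matrix {A₁ : Medium} (hA : SmoothPeriodic A₁) (i j : Fin 2) (m n : ℤ × ℤ) :
    entryOp A₁ i j (unitSeq n) m = fourierCoeff A₁ (m - n) i j := by
  rw [← repr_synth (entryOp A₁ i j (unitSeq n)), fourierBasis_repr, synth_entryOp, cellInner,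
    fourierCoeff, Matrix.of_apply, ← integral_const_mul]
  refine integral_congr_ae ?_
  have h2 : (entry A₁ i j : Plane → ℂ) =ᵐ[cellMeasure] fun x => A₁ x i j := by
    rw [entry, dif_pos (hA.memLp_top i j)]
    exact MemLp.coeFn_toLp _
  filter_upwards [coeFn_mulOp (entry A₁ i j) (synth (unitSeq n)), h2,
    coeFn_fourierModeL2 n] with x h3 h4 h5
  rw [h3, h4, synth_unitSeq, h5, fourierMode, fourierMode, map_mul, Complex.conj_ofReal,
    conj_planeWave]
  have e : Complex.exp (-Complex.I * ((inner ℝ (dualVec (m - n)) x : ℝ) : ℂ)) =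
      planeWave (-dualVec m) x * planeWave (dualVec n) x := by
    rw [← planeWave_add_left, planeWave]
    congr 1
    rw [dualVec_sub, inner_sub_left, inner_add_left, inner_neg_left]
    push_cast
    ring
  rw [e, ← cellVol, ← sqrt_inv_mul_self_cellVol]
  ring

lemma entryOp_unitSeq {A₁ : Medium} (hA : SmoothPeriodic A₁) (m n : ℤ × ℤ) :
    contrastDeriv A₁ (unitSeq n) m =
      bilin (K + dualVec m) (fourierCoeff A₁ (m - n)) (K + dualVec n) /
        (weight m * weight n : ℝ) := by
  have h1 : ∀ j, momOp j (unitSeq n) = (((K + dualVec n) j / weight n : ℝ) : ℂ) • unitSeq n := by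
    intro j
    ext q
    rw [momOp_apply]
    change _ = _ * unitSeq n q
    rw [unitSeq_apply]
    by_cases h : q = n <;> simp [h]
  simp only [contrastDeriv, bilin, Fin.sum_univ_two, _root_.add_apply,
    ContinuousLinearMap.comp_apply, h1, map_smul]
  have h2 : ∀ (i j : Fin 2) (a : ℂ), (a • momOp i (entryOp A₁ i j (unitSeq n))) m =
      a * (((K + dualVec m) i / weight m : ℝ) * fourierCoeff A₁ (m - n) i j) := by
    intro i j a
    rw [← entryOp_matrix hA, ← momOp_apply]
    rfl
  have hadd : ∀ x y : Seq, (x + y) m = x m + y m := fun x y => rfl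
  have w1 : (weight m : ℂ) ≠ 0 := Complex.ofReal_ne_zero.2 (weight_pos m).ne'
  have w2 : (weight n : ℂ) ≠ 0 := Complex.ofReal_ne_zero.2 (weight_pos n).ne'
  simp only [hadd, h2]
  push_cast
  field_simp

/-! ### The operator `𝒜` -/

/-- The product of the test function with a is again a test function for f, complex valued now; the
classical product rule does the rest. -/
lemma HasWeakDeriv.mul_smooth {j : Fin 2} {f g a : Plane → ℂ} (h : HasWeakDeriv j f g)
    (ha : ContDiff ℝ ∞ a) :
    HasWeakDeriv j (fun x => a x * f x) (fun x => pderiv j a x * f x + a x * g x) := by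
  have hda := ContDiff.pderiv_top ha j
  have l1 : LocallyIntegrable fun x => a x * f x :=
    (locallyIntegrableOn_univ.1 ((locallyIntegrableOn_univ.2 h.1).continuousOn_mul
      ha.continuous.continuousOn isClosed_univ.isLocallyClosed) :)
  have l2 : LocallyIntegrable fun x => a x * g x :=
    (locallyIntegrableOn_univ.1 ((locallyIntegrableOn_univ.2 h.2.1).continuousOn_mul
      ha.continuous.continuousOn isClosed_univ.isLocallyClosed) :)
  have l3 : LocallyIntegrable fun x => pderiv j a x * f x :=
    (locallyIntegrableOn_univ.1 ((locallyIntegrableOn_univ.2 h.1).continuousOn_mul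
      hda.continuous.continuousOn isClosed_univ.isLocallyClosed) :)
  refine ⟨l1, l3.add l2, fun η hη hc => ?_⟩
  set φ : Plane → ℂ := fun x => (η x : ℂ) with hφdef
  have hφ : ContDiff ℝ ∞ φ := Complex.ofRealCLM.contDiff.comp hη
  have hφc : HasCompactSupport φ :=
    hc.comp_left (g := fun r : ℝ => (r : ℂ)) Complex.ofReal_zero
  have hd : ∀ x, pderiv j φ x = (pderiv j η x : ℝ) := by
    intro x
    have := (Complex.ofRealCLM.hasFDerivAt.comp x
      (hη.differentiable (by simp) x).hasFDerivAt).fderiv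
    exact congrArg (fun L : Plane →L[ℝ] ℂ => L (EuclideanSpace.single j 1)) this
  have h1 := h.integral_pderiv_mul (hφ.mul ha) hφc.mul_right
  have e1 : ∀ x, pderiv j (fun y => φ y * a y) x * f x =
      pderiv j η x • (a x * f x) + η x • (pderiv j a x * f x) := by
    intro x
    rw [pderiv_mul j (hφ.differentiable (by simp) x) (ha.differentiable (by simp) x), hd,
      Complex.real_smul, Complex.real_smul]
    ring
  have e2 : ∀ x, φ x * a x * g x = η x • (a x * g x) := by
    intro x
    rw [Complex.real_smul]; ring
  have i1 := l1.integrable_smul_left_of_hasCompactSupport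
    (ContDiff.pderiv_top hη j).continuous (hasCompactSupport_pderiv hc j)
  have i2 := l3.integrable_smul_left_of_hasCompactSupport hη.continuous hc
  have i3 := l2.integrable_smul_left_of_hasCompactSupport hη.continuous hc
  simp only [e1, e2] at h1
  rw [integral_add i1 i2] at h1
  simp only [smul_add]
  rw [integral_add i2 i3, neg_add, ← h1]
  ring

lemma memL2_periodic_mul {a : Plane → ℂ} (ha : Continuous a) (hp : Periodic a) {k : Plane}
    {f : Plane → ℂ} (hf : MemL2 k f) : MemL2 k fun x => a x * f x := by
  obtain ⟨C, hC⟩ := (isCompact_closedBall (0 : Plane) 2).exists_bound_of_continuousOn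
    ha.continuousOn
  refine ⟨MemLp.of_le_mul (c := C) hf.1 (ha.aestronglyMeasurable.mul hf.1.1) ?_, fun m => ?_⟩
  · filter_upwards [ae_restrict_mem measurableSet_cell] with x hx
    rw [norm_mul]
    exact mul_le_mul_of_nonneg_right
      (hC x (Metric.ball_subset_closedBall (cell_subset_ball hx))) (norm_nonneg _)
  · filter_upwards [hf.2 m] with x hx
    rw [hx, hp m x]
    ring

lemma MemL2.add {k : Plane} {f g : Plane → ℂ} (hf : MemL2 k f) (hg : MemL2 k g) :
    MemL2 k fun x => f x + g x := by
  refine ⟨hf.1.add hg.1, fun m => ?_⟩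
  filter_upwards [hf.2 m, hg.2 m] with x h1 h2
  rw [h1, h2, mul_add]

/-- The weak derivatives of `a f` for `a` periodic and `f ∈ H¹` pair with `H¹` functions like the
corresponding momentum operators. -/
lemma cellInner_weakDeriv_mul {A₁ : Medium} (hA : SmoothPeriodic A₁) (ε : ℝ) (i j l : Fin 2)
    (c c' : Seq) :
    cellInner (bf 0 c) (fun x => (1 / Complex.I) *
      weakDeriv l (fun y => lowContrast A₁ ε y i j * bf 0 c' y) x) =
        inner ℂ c (momOp l (contrastOp A₁ ε i j (embOp c'))) ∧
    ∃ w : CellL2, weakDeriv l (fun y => lowContrast A₁ ε y i j * bf 0 c' y) =ᵐ[volume]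
      bloch K w := by
  have hAs := hA.lowContrast ε
  set a : Plane → ℂ := fun y => lowContrast A₁ ε y i j with ha
  have hap : Periodic a := fun m x => by
    simp only [ha]; rw [hAs.periodic m x]
  have hH := memH1_bf 0 c'
  rw [add_zero] at hH
  have hw := (hH.2 l).1.mul_smooth (hAs.smooth i j)
  have hL2 : MemL2 K fun x => pderiv l a x * bf 0 c' x + a x * weakDeriv l (bf 0 c') x :=
    (memL2_periodic_mul (ContDiff.pderiv_top (hAs.smooth i j) l).continuous (hap.pderiv l)
      hH.1).add (memL2_periodic_mul (hAs.smooth i j).continuous hap (hH.2 l).2)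
  obtain ⟨w, hw2⟩ := hL2.exists_bloch
  have haf : (fun x => a x * bf 0 c' x) =ᵐ[volume]
      bloch K ⇑(synth (contrastOp A₁ ε i j (embOp c'))) := by
    refine EventuallyEq.trans ?_ (bloch_congr
      (coeFn_synth_contrastOp hA.memLp_top ε i j (embOp c'))).symm
    refine Eventually.of_forall fun x => ?_
    simp only [bf, bloch, add_zero]
    rw [← hap.apply_cellRep x]
    ring
  have hwd : weakDeriv l (fun x => a x * bf 0 c' x) =ᵐ[volume] bloch K w :=
    hw.weakDeriv_ae_eq.trans hw2
  refine ⟨?_, w, hwd⟩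
  have hr := repr_of_hasWeakDeriv (hw.congr haf hw2)
  have e : cellInner (bf 0 c) (fun x => (1 / Complex.I) *
      weakDeriv l (fun y => a y * bf 0 c' y) x) =
        cellInner (bloch K ⇑(synth (embOp c))) (bloch K ⇑((1 / Complex.I) • w)) := by
    refine cellInner_congr ?_ (ae_restrict_of_ae ?_)
    · rw [bf, add_zero]
    · filter_upwards [hwd, bloch_smul_ae K (1 / Complex.I) w] with x h1 h2
      rw [h1, h2]
  rw [e, cellInner_bloch, ← synth_repr ((1 / Complex.I) • w), inner_synth, inner_embOp]
  congr 1
  ext m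
  rw [embOp_apply, momOp_apply, map_smul]
  change _ * (1 / Complex.I * fourierBasis.repr w m) = _
  rw [hr m, repr_synth]
  push_cast
  field_simp

lemma cellInner_add_right {f g h : Plane → ℂ} (hf : MemLp f 2 cellMeasure)
    (hg : MemLp g 2 cellMeasure) (hh : MemLp h 2 cellMeasure) :
    cellInner f (fun x => g x + h x) = cellInner f g + cellInner f h := by
  simp only [cellInner, mul_add]
  exact integral_add (hf.star.integrable_mul hg) (hf.star.integrable_mul hh)

lemma cellInner_mul_momentum {A₁ : Medium} (hA : SmoothPeriodic A₁) (ε : ℝ) (i j l : Fin 2)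
    (c c' : Seq) :
    cellInner (bf 0 c) (fun x => lowContrast A₁ ε x i j *
      ((1 / Complex.I) * weakDeriv l (bf 0 c') x)) =
        inner ℂ c (embOp (contrastOp A₁ ε i j (momOp l c'))) := by
  rw [← inner_embOp, ← inner_synth, ← cellInner_bloch K]
  refine cellInner_congr ?_ ?_
  · rw [bf, add_zero]
  · have h0 : gradOp (toC 0) l c' = momOp l c' := by
      simp [gradOp, toC]
    have h1 := weakDeriv_bf 0 c' l
    rw [add_zero, h0] at h1
    filter_upwards [ae_restrict_of_ae h1, ae_restrict_of_ae (bloch_congr (k := K)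
      (coeFn_synth_contrastOp hA.memLp_top ε i j (momOp l c'))),
      ae_restrict_of_ae (bloch_smul_ae K Complex.I (synth (momOp l c'))),
      ae_restrict_mem measurableSet_cell] with x h2 h3 h4 hx
    rw [h2, h3, map_smul, h4, bloch_of_mem hx, bloch_of_mem hx]
    field_simp

/-- Identifies 𝒜ⱼ with the derivative of the form in the quasi-momentum, so that the Fermi velocity
is a coefficient of first order perturbation theory. -/
lemma cellInner_vecOp {A₁ : Medium} (hA : SmoothPeriodic A₁) (ε : ℝ) (j : Fin 2) (c c' : Seq) :
    cellInner (bf 0 c) (vecOp (lowContrast A₁ ε) j (bf 0 c')) =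
      inner ℂ c (velOp A₁ ε j c') := by
  have hH := memH1_bf 0 c
  have hH' := memH1_bf 0 c'
  rw [add_zero] at hH hH'
  have hAs := hA.lowContrast ε
  have m1 : ∀ l, MemLp (fun x => lowContrast A₁ ε x j l *
      ((1 / Complex.I) * weakDeriv l (bf 0 c') x)) 2 cellMeasure := by
    intro l
    have hap : Periodic fun x => lowContrast A₁ ε x j l * (1 / Complex.I) := fun m x => by
      simp only; rw [hAs.periodic m x]
    have := (memL2_periodic_mul ((hAs.smooth j l).continuous.mul continuous_const) hap
      (hH'.2 l).2).1
    refine this.ae_eq (Eventually.of_forall fun x => ?_)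
    exact mul_assoc _ _ _
  have m2 : ∀ l, MemLp (fun x => (1 / Complex.I) *
      weakDeriv l (fun y => lowContrast A₁ ε y l j * bf 0 c' y) x) 2 cellMeasure := by
    intro l
    obtain ⟨w, hw⟩ := (cellInner_weakDeriv_mul hA ε l j l c c').2
    exact (((memL2_coe K w).congr hw.symm).1).const_mul _
  have e : vecOp (lowContrast A₁ ε) j (bf 0 c') = fun x =>
      (lowContrast A₁ ε x j 0 * ((1 / Complex.I) * weakDeriv 0 (bf 0 c') x) +
        lowContrast A₁ ε x j 1 * ((1 / Complex.I) * weakDeriv 1 (bf 0 c') x)) +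
      ((1 / Complex.I) * weakDeriv 0 (fun y => lowContrast A₁ ε y 0 j * bf 0 c' y) x +
        (1 / Complex.I) * weakDeriv 1 (fun y => lowContrast A₁ ε y 1 j * bf 0 c' y) x) := by
    ext x
    simp only [vecOp, Fin.sum_univ_two]
  have a1 : MemLp (fun x => lowContrast A₁ ε x j 0 * ((1 / Complex.I) * weakDeriv 0 (bf 0 c') x) +
      lowContrast A₁ ε x j 1 * ((1 / Complex.I) * weakDeriv 1 (bf 0 c') x)) 2 cellMeasure :=
    (m1 0).add (m1 1)
  have a2 : MemLp (fun x =>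
      (1 / Complex.I) * weakDeriv 0 (fun y => lowContrast A₁ ε y 0 j * bf 0 c' y) x +
        (1 / Complex.I) * weakDeriv 1 (fun y => lowContrast A₁ ε y 1 j * bf 0 c' y) x) 2
      cellMeasure := (m2 0).add (m2 1)
  rw [e, cellInner_add_right hH.1.1 a1 a2,
    cellInner_add_right hH.1.1 (m1 0) (m1 1), cellInner_add_right hH.1.1 (m2 0) (m2 1),
    cellInner_mul_momentum hA, cellInner_mul_momentum hA, (cellInner_weakDeriv_mul hA ε _ _ _ c c').1,
    (cellInner_weakDeriv_mul hA ε _ _ _ c c').1]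
  simp only [velOp, Fin.sum_univ_two, _root_.add_apply, ContinuousLinearMap.comp_apply,
    inner_add_right]
  ring

end Honeycomb
end

noncomputable section

namespace Honeycomb

/-! ### Continuation of invariant subspaces -/

section Continuation

variable {P H V : Type*} [NormedAddCommGroup P] [NormedSpace ℂ P] [CompleteSpace P]
  [NormedAddCommGroup H] [NormedSpace ℂ H] [CompleteSpace H]
  [NormedAddCommGroup V] [NormedSpace ℂ V] [CompleteSpace V]

/-- The defect of the invariant subspace equation `G Y = B Y N`, `π Y = 1`. -/
def invariantDefect (G : P → H →L[ℂ] H) (B : H →L[ℂ] H) (π : H →L[ℂ] V)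
    (u : P × ((V →L[ℂ] H) × (V →L[ℂ] V))) : (V →L[ℂ] H) × (V →L[ℂ] V) :=
  (G u.1 ∘L u.2.1 - (B ∘L u.2.1) ∘L u.2.2, π ∘L u.2.1 - ContinuousLinearMap.id ℂ V)

/-- `Q` acts column by column: evaluated at each v it is the bordered operator `S`. Bijectivity of
`S` therefore gives that of `Q`, and the open mapping theorem gives the bounded inverse. -/
lemma isInvertible_of_bordered {T : H →L[ℂ] H} {β : V →L[ℂ] H} {π : H →L[ℂ] V}
    (S : (H × V) ≃L[ℂ] (H × V)) (hS : ∀ h v, S (h, v) = (T h - β v, π h))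
    (Q : ((V →L[ℂ] H) × (V →L[ℂ] V)) →L[ℂ] ((V →L[ℂ] H) × (V →L[ℂ] V)))
    (hQ : ∀ y n, Q (y, n) = (T ∘L y - β ∘L n, π ∘L y)) : Q.IsInvertible := by
  have key : ∀ y n v, S (y v, n v) = ((Q (y, n)).1 v, (Q (y, n)).2 v) := by
    intro y n v
    rw [hS, hQ]; rfl
  have inj : LinearMap.ker Q.toLinearMap = ⊥ := by
    rw [LinearMap.ker_eq_bot']
    rintro ⟨y, n⟩ h
    have h0 : Q (y, n) = 0 := h
    have h1 : ∀ v, (y v, n v) = (0 : H × V) := by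
      intro v
      apply S.injective
      rw [key, h0, map_zero]; rfl
    ext v
    · exact congrArg Prod.fst (h1 v)
    · exact congrArg Prod.snd (h1 v)
  have surj : LinearMap.range Q.toLinearMap = ⊤ := by
    rw [LinearMap.range_eq_top]
    rintro ⟨a, b⟩
    let w : V →L[ℂ] H × V := (S.symm : (H × V) →L[ℂ] (H × V)) ∘L (a.prod b)
    refine ⟨(ContinuousLinearMap.fst ℂ H V ∘L w, ContinuousLinearMap.snd ℂ H V ∘L w), ?_⟩
    have h1 : ∀ v, S (w v) = (a v, b v) := fun v => S.apply_symm_apply _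
    change Q _ = _
    ext v
    · have := (key (ContinuousLinearMap.fst ℂ H V ∘L w) (ContinuousLinearMap.snd ℂ H V ∘L w) v)
      exact (congrArg Prod.fst (this.symm.trans (h1 v)))
    · have := (key (ContinuousLinearMap.fst ℂ H V ∘L w) (ContinuousLinearMap.snd ℂ H V ∘L w) v)
      exact (congrArg Prod.snd (this.symm.trans (h1 v)))
  exact ⟨ContinuousLinearEquiv.ofBijective Q inj surj,
    ContinuousLinearEquiv.coe_ofBijective Q inj surj⟩

/-- The implicit function theorem for the pair (Y, N). The normalization `π Y = 1` is affine, unlike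
orthonormality, so the equation stays holomorphic; the price is that N need not be Hermitian in
these coordinates. -/
theorem exists_invariant_continuation {G : P → H →L[ℂ] H} {B : H →L[ℂ] H} {π : H →L[ℂ] V}
    {ι : V →L[ℂ] H} {l : ℂ} {p₀ : P} (hG : ContDiffAt ℂ 2 G p₀)
    (hι : G p₀ ∘L ι = l • (B ∘L ι)) (hπ : π ∘L ι = ContinuousLinearMap.id ℂ V)
    (S : (H × V) ≃L[ℂ] (H × V))
    (hS : ∀ h v, S (h, v) = ((G p₀ - l • B) h - (B ∘L ι) v, π h)) :
    ∃ (Y : P → V →L[ℂ] H) (N : P → V →L[ℂ] V), ContDiffAt ℂ 2 Y p₀ ∧ ContDiffAt ℂ 2 N p₀ ∧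
      Y p₀ = ι ∧ N p₀ = l • ContinuousLinearMap.id ℂ V ∧
      ∀ᶠ p in 𝓝 p₀, G p ∘L Y p = (B ∘L Y p) ∘L N p ∧
        π ∘L Y p = ContinuousLinearMap.id ℂ V := by
  set u₀ : P × ((V →L[ℂ] H) × (V →L[ℂ] V)) := (p₀, (ι, l • ContinuousLinearMap.id ℂ V)) with hu₀
  have hF : ContDiffAt ℂ 2 (invariantDefect G B π) u₀ := by
    have hG' : ContDiffAt ℂ 2 (fun u : P × ((V →L[ℂ] H) × (V →L[ℂ] V)) => G u.1) u₀ :=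
      ContDiffAt.comp u₀ hG contDiffAt_fst
    have hy : ContDiffAt ℂ 2 (fun u : P × ((V →L[ℂ] H) × (V →L[ℂ] V)) => u.2.1) u₀ :=
      (contDiff_fst.comp contDiff_snd).contDiffAt
    have hn : ContDiffAt ℂ 2 (fun u : P × ((V →L[ℂ] H) × (V →L[ℂ] V)) => u.2.2) u₀ :=
      (contDiff_snd.comp contDiff_snd).contDiffAt
    exact ((hG'.clm_comp hy).sub ((contDiffAt_const.clm_comp hy).clm_comp hn)).prodMk
      ((contDiffAt_const.clm_comp hy).sub contDiffAt_const)
  have h0 : invariantDefect G B π u₀ = 0 := by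
    simp only [invariantDefect, hu₀, hι, hπ, sub_self]
    ext v <;> simp
  have hinv : (fderiv ℂ (invariantDefect G B π) u₀ ∘L
      ContinuousLinearMap.inr ℂ P ((V →L[ℂ] H) × (V →L[ℂ] V))).IsInvertible := by
    refine isInvertible_of_bordered S hS _ fun y n => ?_
    have hd := (hF.differentiableAt (by simp)).hasFDerivAt
    -- The partial derivative is computed along the complex line through `u₀` in the direction (y,
    -- n), where the defect is explicit.
    have hl : HasDerivAt (fun t : ℂ => u₀ + t • ((0 : P), (y, n))) ((0 : P), (y, n)) 0 := by
      simpa using ((hasDerivAt_id (0 : ℂ)).smul_const ((0 : P), (y, n))).const_add u₀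
    have hd' : HasFDerivAt (invariantDefect G B π) (fderiv ℂ (invariantDefect G B π) u₀)
        (u₀ + (0 : ℂ) • ((0 : P), (y, n))) := by
      rwa [zero_smul, add_zero]
    have h1 := hd'.comp_hasDerivAt (0 : ℂ) hl
    have hy : HasDerivAt (fun t : ℂ => ι + t • y) y 0 := by
      simpa using ((hasDerivAt_id (0 : ℂ)).smul_const y).const_add ι
    have hn : HasDerivAt (fun t : ℂ => l • ContinuousLinearMap.id ℂ V + t • n) n 0 := by
      simpa using ((hasDerivAt_id (0 : ℂ)).smul_const n).const_add
        (l • ContinuousLinearMap.id ℂ V)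
    have h2 := (((hasDerivAt_const (0 : ℂ) (G p₀)).clm_comp hy).sub
      ((((hasDerivAt_const (0 : ℂ) B).clm_comp hy)).clm_comp hn)).prodMk
      (((hasDerivAt_const (0 : ℂ) π).clm_comp hy).sub_const (ContinuousLinearMap.id ℂ V))
    have h3 := h1.unique (h2.congr_of_eventuallyEq (Eventually.of_forall fun t => by
      simp [invariantDefect, hu₀]))
    change fderiv ℂ (invariantDefect G B π) u₀ ((0 : P), (y, n)) = _
    rw [h3]
    ext v
    · simp
      abel
    · simp
  refine ⟨fun p => (hF.implicitFunction (by simp) hinv p).1,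
    fun p => (hF.implicitFunction (by simp) hinv p).2,
    (hF.contDiffAt_implicitFunction (by simp) hinv).fst,
    (hF.contDiffAt_implicitFunction (by simp) hinv).snd, ?_, ?_, ?_⟩
  · simp only [hu₀]
    exact congrArg Prod.fst (hF.implicitFunction_apply_self (by simp) hinv)
  · exact congrArg Prod.snd (hF.implicitFunction_apply_self (by simp) hinv)
  · filter_upwards [hF.eventually_apply_implicitFunction (by simp) hinv] with p hp
    rw [h0] at hp
    exact ⟨sub_eq_zero.1 (congrArg Prod.fst hp), sub_eq_zero.1 (congrArg Prod.snd hp)⟩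

end Continuation

end Honeycomb
end

noncomputable section

namespace Honeycomb

/-! ### The unperturbed triple eigenvalue -/

lemma τ_eq : τ = -(1 / 2) + (Real.sqrt 3 / 2 : ℝ) * Complex.I := by
  have h : (2 * Real.pi * Complex.I / 3 : ℂ) = ((Real.pi - Real.pi / 3 : ℝ) : ℂ) * Complex.I := by
    push_cast; ring
  rw [τ, h, Complex.exp_mul_I, ← Complex.ofReal_cos, ← Complex.ofReal_sin, Real.cos_pi_sub,
    Real.sin_pi_sub, Real.cos_pi_div_three, Real.sin_pi_div_three]
  push_cast; ring

lemma conj_τ_eq : (starRingEnd ℂ) τ = -(1 / 2) - (Real.sqrt 3 / 2 : ℝ) * Complex.I := by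
  rw [τ_eq]
  simp only [map_add, map_neg, map_div₀, map_one, map_mul, Complex.conj_ofReal, Complex.conj_I,
    map_ofNat]
  ring

lemma sqrt_three_half_sq : ((Real.sqrt 3 / 2 : ℝ) : ℂ) ^ 2 = 3 / 4 := by
  rw [← Complex.ofReal_pow, div_pow, Real.sq_sqrt (by norm_num)]
  push_cast; norm_num

lemma τ_mul_conj : τ * (starRingEnd ℂ) τ = 1 := by
  rw [conj_τ_eq, τ_eq]
  linear_combination sqrt_three_half_sq - ((Real.sqrt 3 / 2 : ℝ) : ℂ) ^ 2 * Complex.I_sq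

lemma conj_τ : (starRingEnd ℂ) τ = τ ^ 2 := by
  rw [conj_τ_eq, τ_eq]
  linear_combination sqrt_three_half_sq - ((Real.sqrt 3 / 2 : ℝ) : ℂ) ^ 2 * Complex.I_sq

lemma τ_sum : τ ^ 2 + τ + 1 = 0 := by
  rw [← conj_τ, conj_τ_eq, τ_eq]; ring

lemma τ_cube : τ ^ 3 = 1 := by linear_combination (τ - 1) * τ_sum

lemma τ_ne_one : τ ≠ 1 := by
  intro h
  have := τ_sum
  rw [h] at this
  norm_num at this

lemma τ_ne_zero : τ ≠ 0 := by
  intro h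
  have := τ_cube
  rw [h] at this
  norm_num at this

/-- The eigenvalues of the rotation on the three core modes. -/
def rotChar : Fin 3 → ℂ := ![τ, (starRingEnd ℂ) τ, 1]

lemma rotChar_zero : rotChar 0 = τ := rfl

lemma rotChar_one : rotChar 1 = (starRingEnd ℂ) τ := rfl

lemma rotChar_two : rotChar 2 = 1 := rfl

lemma rotChar_injective : Function.Injective rotChar := by
  have h1 := τ_cube
  have h2 := conj_τ
  have h3 := τ_ne_one
  intro a b h
  fin_cases a <;> fin_cases b <;> simp [rotChar] at h ⊢ <;> grind

/-- The characters of the cyclic group of order three. -/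
def coreCoef (a j : Fin 3) : ℂ := (starRingEnd ℂ) (rotChar a) ^ (j : ℕ)

lemma conj_rotChar_zero : (starRingEnd ℂ) (rotChar 0) = τ ^ 2 := conj_τ

/-- Orthogonality of the characters of the group of order three, by rows here and by columns in
`sum_coreCoef_char`. -/
lemma sum_coreCoef_mode (a b : Fin 3) :
    ∑ j, (starRingEnd ℂ) (coreCoef a j) * coreCoef b j = if a = b then 3 else 0 := by
  simp only [Fin.sum_univ_three, coreCoef]
  have h1 := τ_sum
  have h3 := τ_cube
  have h2 := conj_τ
  fin_cases a <;> fin_cases b <;>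
    simp [rotChar_zero, rotChar_one, rotChar_two] <;>
    grind

lemma sum_coreCoef_char (i j : Fin 3) :
    ∑ a, (starRingEnd ℂ) (coreCoef a i) * coreCoef a j = if i = j then 3 else 0 := by
  simp only [Fin.sum_univ_three, coreCoef]
  have h1 := τ_sum
  have h3 := τ_cube
  have h2 := conj_τ
  fin_cases i <;> fin_cases j <;>
    simp [rotChar_zero, rotChar_one, rotChar_two] <;>
    grind

/-- The weight of the core modes. -/
def coreWeight : ℝ := Real.sqrt (1 + ‖K‖ ^ 2)

lemma coreWeight_sq : coreWeight ^ 2 = 1 + ‖K‖ ^ 2 := Real.sq_sqrt (by positivity)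

lemma coreWeight_pos : 0 < coreWeight := Real.sqrt_pos.2 (by positivity)

lemma norm_K_sq_pos : 0 < ‖K‖ ^ 2 := by
  rw [norm_K]; have := Real.pi_pos; positivity

lemma norm_K_add_coreMode (j : Fin 3) : ‖K + dualVec (coreMode j)‖ ^ 2 = ‖K‖ ^ 2 := by
  rw [norm_K_add_sq, modeHeight_coreMode]; simp

lemma weight_coreMode (j : Fin 3) : weight (coreMode j) = coreWeight := by
  rw [weight, norm_K_add_coreMode, coreWeight]

/-- The normalized rotation eigenfunctions spanning the eigenspace of the Laplacian at `K`. -/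
def coreVec (a : Fin 3) : Seq :=
  ((coreWeight / Real.sqrt 3 : ℝ) : ℂ) • ∑ j, coreCoef a j • unitSeq (coreMode j)

lemma coreVec_apply (a : Fin 3) (m : ℤ × ℤ) : coreVec a m =
    ((coreWeight / Real.sqrt 3 : ℝ) : ℂ) * ∑ j, coreCoef a j * if m = coreMode j then 1 else 0 := by
  rw [← inner_unitSeq m (coreVec a), coreVec, inner_smul_right, inner_sum]
  simp only [inner_smul_right, inner_unitSeq, unitSeq_apply]

lemma coreVec_coreMode (a i : Fin 3) :
    coreVec a (coreMode i) = ((coreWeight / Real.sqrt 3 : ℝ) : ℂ) * coreCoef a i := by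
  rw [coreVec_apply]
  simp [coreMode_injective.eq_iff]

lemma coreVec_of_ne {a : Fin 3} {m : ℤ × ℤ} (h : modeHeight m ≠ 0) : coreVec a m = 0 := by
  rw [coreVec_apply]
  have : ∀ j, m ≠ coreMode j := fun j hj => h (by rw [hj, modeHeight_coreMode])
  simp [this]

/-- The inclusion of the eigenspace of the Laplacian at `K`. -/
def coreEmb : (Fin 3 → ℂ) →L[ℂ] Seq :=
  ∑ a, (ContinuousLinearMap.proj (R := ℂ) (φ := fun _ : Fin 3 => ℂ) a).smulRight (coreVec a)

lemma coreEmb_eq (v : Fin 3 → ℂ) : coreEmb v = ∑ a, v a • coreVec a := by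
  simp [coreEmb]

lemma coreEmb_single (a : Fin 3) : coreEmb (Pi.single a 1) = coreVec a := by
  rw [coreEmb_eq, Finset.sum_eq_single a] <;> simp +contextual

lemma coreEmb_apply (v : Fin 3 → ℂ) (m : ℤ × ℤ) : coreEmb v m = ∑ a, v a * coreVec a m := by
  rw [← inner_unitSeq m, coreEmb_eq, inner_sum]
  simp only [inner_smul_right, inner_unitSeq]

/-- The coordinates of the orthogonal projection to the eigenspace of the Laplacian at `K`. -/
def coreProj : Seq →L[ℂ] (Fin 3 → ℂ) :=
  ContinuousLinearMap.pi fun a => innerSL ℂ (coreVec a) ∘L massOp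

lemma coreProj_apply (y : Seq) (a : Fin 3) : coreProj y a = inner ℂ (coreVec a) (massOp y) := rfl

lemma coreProj_eq (y : Seq) (a : Fin 3) : coreProj y a =
    (((coreWeight * Real.sqrt 3)⁻¹ : ℝ) : ℂ) *
      ∑ j, (starRingEnd ℂ) (coreCoef a j) * y (coreMode j) := by
  rw [coreProj_apply, coreVec, inner_smul_left, sum_inner, Complex.conj_ofReal, Finset.mul_sum,
    Finset.mul_sum]
  refine Finset.sum_congr rfl fun j _ => ?_
  rw [inner_smul_left, inner_unitSeq, massOp_apply, weight_coreMode]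
  have h1 := coreWeight_pos.ne'
  have h2 := sqrt_three_pos.ne'
  have : ((coreWeight / Real.sqrt 3 : ℝ) : ℂ) * (((coreWeight ^ 2)⁻¹ : ℝ) : ℂ) =
      (((coreWeight * Real.sqrt 3)⁻¹ : ℝ) : ℂ) := by
    rw [← Complex.ofReal_mul]
    congr 1
    field_simp
  rw [← this]; ring

lemma core_scalar : (((coreWeight * Real.sqrt 3)⁻¹ : ℝ) : ℂ) *
    ((coreWeight / Real.sqrt 3 : ℝ) : ℂ) = 1 / 3 := by
  rw [← Complex.ofReal_mul]
  have h1 := coreWeight_pos.ne'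
  have h2 := sqrt_three_pos.ne'
  have : (coreWeight * Real.sqrt 3)⁻¹ * (coreWeight / Real.sqrt 3) = 1 / 3 := by
    have h3 := sqrt_three_mul_self
    field_simp
    linarith [Real.sq_sqrt (show (0 : ℝ) ≤ 3 by norm_num)]
  rw [this]; norm_num

/-- The factor `coreWeight / √3` in `coreVec` is chosen for this: three modes of mass `coreWeight⁻²`
each make an `L²`-normalized function. -/
lemma coreProj_coreVec (a b : Fin 3) : coreProj (coreVec b) a = if a = b then 1 else 0 := by
  rw [coreProj_eq]
  simp only [coreVec_coreMode]
  have h := sum_coreCoef_mode a b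
  have : ∑ j, (starRingEnd ℂ) (coreCoef a j) *
      (((coreWeight / Real.sqrt 3 : ℝ) : ℂ) * coreCoef b j) =
      ((coreWeight / Real.sqrt 3 : ℝ) : ℂ) * if a = b then 3 else 0 := by
    rw [← h, Finset.mul_sum]
    exact Finset.sum_congr rfl fun j _ => by ring
  rw [this, ← mul_assoc, core_scalar]
  split_ifs <;> norm_num

lemma coreProj_coreEmb (v : Fin 3 → ℂ) : coreProj (coreEmb v) = v := by
  funext a
  rw [coreEmb_eq, map_sum]
  simp [coreProj_coreVec]

lemma coreEmb_coreProj (y : Seq) (i : Fin 3) :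
    coreEmb (coreProj y) (coreMode i) = y (coreMode i) := by
  rw [coreEmb_apply]
  simp only [coreVec_coreMode, coreProj_eq]
  have h : ∀ a, (((coreWeight * Real.sqrt 3)⁻¹ : ℝ) : ℂ) *
      (∑ j, (starRingEnd ℂ) (coreCoef a j) * y (coreMode j)) *
      (((coreWeight / Real.sqrt 3 : ℝ) : ℂ) * coreCoef a i) =
      1 / 3 * ∑ j, ((starRingEnd ℂ) (coreCoef a j) * coreCoef a i) * y (coreMode j) := by
    intro a
    rw [← core_scalar, Finset.mul_sum, Finset.mul_sum, Finset.sum_mul]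
    exact Finset.sum_congr rfl fun j _ => by ring
  simp only [h]
  rw [← Finset.mul_sum, Finset.sum_comm]
  simp only [← Finset.sum_mul, sum_coreCoef_char]
  simp

lemma coreEmb_of_ne (v : Fin 3 → ℂ) {m : ℤ × ℤ} (h : modeHeight m ≠ 0) : coreEmb v m = 0 := by
  rw [coreEmb_apply]
  simp [coreVec_of_ne h]

lemma inner_coreEmb_coreProj (y : Seq) :
    inner ℂ y (massOp (coreEmb (coreProj y))) = ((∑ a, ‖coreProj y a‖ ^ 2 : ℝ) : ℂ) := by
  rw [coreEmb_eq, map_sum, inner_sum]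
  push_cast
  refine Finset.sum_congr rfl fun a _ => ?_
  rw [map_smul, inner_smul_right, inner_massOp, inner_embOp]
  have : inner ℂ y (embOp (embOp (coreVec a))) = (starRingEnd ℂ) (coreProj y a) := by
    rw [coreProj_apply, inner_conj_symm, ← inner_embOp, ← inner_embOp]; rfl
  rw [this, Complex.mul_conj, Complex.normSq_eq_norm_sq]
  push_cast; rfl

/-- The difference between the Laplacian and its lowest eigenvalue at `K`. -/
def lapShift : Seq →L[ℂ] Seq := lapOp - ((‖K‖ ^ 2 : ℝ) : ℂ) • massOp

lemma sub_apply_seq (y z : Seq) (m : ℤ × ℤ) : (y - z) m = y m - z m := rfl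

lemma add_apply_seq (y z : Seq) (m : ℤ × ℤ) : (y + z) m = y m + z m := rfl

lemma smul_apply_seq (c : ℂ) (y : Seq) (m : ℤ × ℤ) : (c • y) m = c * y m := rfl

lemma lapShift_apply (y : Seq) (m : ℤ × ℤ) :
    lapShift y m = ((3 * ‖K‖ ^ 2 * modeHeight m / weight m ^ 2 : ℝ) : ℂ) * y m := by
  change (lapOp y - ((‖K‖ ^ 2 : ℝ) : ℂ) • massOp y) m = _
  rw [sub_apply_seq, smul_apply_seq, lapOp_apply, massOp_apply, norm_K_add_sq]
  push_cast
  ring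

lemma lapShift_coreEmb (v : Fin 3 → ℂ) : lapShift (coreEmb v) = 0 := by
  ext m
  rw [lapShift_apply]
  by_cases h : modeHeight m = 0
  · rw [h]; simp
  · rw [coreEmb_of_ne v h, mul_zero]; rfl

lemma one_le_modeHeight {m : ℤ × ℤ} (h : modeHeight m ≠ 0) : (1 : ℝ) ≤ modeHeight m := by
  exact_mod_cast lt_of_le_of_ne (modeHeight_nonneg m) (Ne.symm h)

lemma weight_sq_modeHeight (m : ℤ × ℤ) :
    weight m ^ 2 = 1 + ‖K‖ ^ 2 * (1 + 3 * modeHeight m) := by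
  rw [weight_sq, norm_K_add_sq]

/-- The bound for the reduced resolvent of the Laplacian. -/
lemma abs_reduced_le (m : ℤ × ℤ) : |weight m ^ 2 / (3 * ‖K‖ ^ 2 * modeHeight m)| ≤
    (1 + ‖K‖ ^ 2) / (3 * ‖K‖ ^ 2) + 1 := by
  have hK := norm_K_sq_pos
  -- On the core modes the quotient is 0 by the convention for division by zero, which is the value
  -- wanted for a reduced resolvent.
  by_cases h : modeHeight m = 0
  · rw [h]; simp; positivity
  -- Off the core the quotient equals (1 + |K|²) / (3|K|²h) + 1 with height h ≥ 1.
  · have h1 := one_le_modeHeight h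
    rw [abs_of_nonneg (by positivity), weight_sq_modeHeight, div_add_one (by positivity),
      div_le_div_iff₀ (by positivity) (by positivity)]
    nlinarith [mul_nonneg hK.le (sub_nonneg.2 h1), mul_nonneg hK.le
      (mul_nonneg hK.le (sub_nonneg.2 h1))]

/-- The reduced resolvent of the Laplacian. -/
def lapReduced : Seq →L[ℂ] Seq := diagOp _ _ abs_reduced_le

lemma lapReduced_apply (y : Seq) (m : ℤ × ℤ) : lapReduced y m =
    ((weight m ^ 2 / (3 * ‖K‖ ^ 2 * modeHeight m) : ℝ) : ℂ) * y m := rfl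

lemma coreProj_eq_zero {y : Seq} (h : ∀ j, y (coreMode j) = 0) : coreProj y = 0 := by
  funext a
  rw [coreProj_eq]
  simp [h]

/-- The bordered operator for the triple eigenvalue. -/
def borderedOp : (Seq × (Fin 3 → ℂ)) →L[ℂ] (Seq × (Fin 3 → ℂ)) :=
  (lapShift ∘L ContinuousLinearMap.fst ℂ _ _ -
    (massOp ∘L coreEmb) ∘L ContinuousLinearMap.snd ℂ _ _).prod
      (coreProj ∘L ContinuousLinearMap.fst ℂ _ _)

lemma borderedOp_apply (y : Seq) (n : Fin 3 → ℂ) :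
    borderedOp (y, n) = (lapShift y - (massOp ∘L coreEmb) n, coreProj y) := rfl

/-- On the core modes `lapShift` vanishes, which forces n = 0. Off the core it is injective, and the
core part of y is controlled by its projection. -/
lemma borderedOp_ker : LinearMap.ker borderedOp.toLinearMap = ⊥ := by
  rw [LinearMap.ker_eq_bot']
  rintro ⟨y, n⟩ h
  have h0 : (lapShift y - massOp (coreEmb n), coreProj y) = (0 : Seq × (Fin 3 → ℂ)) := h
  have h1 : lapShift y = massOp (coreEmb n) := sub_eq_zero.1 (congrArg Prod.fst h0)
  have h2 : coreProj y = 0 := congrArg Prod.snd h0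
  have hn : n = 0 := by
    rw [← coreProj_coreEmb n]
    refine coreProj_eq_zero fun j => ?_
    have h3 : lapShift y (coreMode j) = massOp (coreEmb n) (coreMode j) := by rw [h1]
    rw [lapShift_apply, modeHeight_coreMode, massOp_apply] at h3
    have h4 : (((weight (coreMode j) ^ 2)⁻¹ : ℝ) : ℂ) ≠ 0 :=
      Complex.ofReal_ne_zero.2 (inv_ne_zero (pow_ne_zero _ (weight_pos _).ne'))
    simp only [Int.cast_zero, mul_zero, zero_div, Complex.ofReal_zero, zero_mul] at h3
    exact (mul_eq_zero.1 h3.symm).resolve_left h4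
  have hy : y = 0 := by
    rw [hn, map_zero, map_zero] at h1
    ext m
    by_cases hm : modeHeight m = 0
    · obtain ⟨j, rfl⟩ := exists_coreMode hm
      rw [← coreEmb_coreProj, h2, map_zero]
    · have h3 : lapShift y m = (0 : Seq) m := by rw [h1]
      rw [lapShift_apply] at h3
      refine (mul_eq_zero.1 h3).resolve_left (Complex.ofReal_ne_zero.2 ?_)
      have h4 := one_le_modeHeight hm
      have h5 := norm_K_sq_pos
      have h6 := weight_pos m
      positivity
  rw [hn, hy]; rfl

lemma borderedOp_range : LinearMap.range borderedOp.toLinearMap = ⊤ := by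
  rw [LinearMap.range_eq_top]
  rintro ⟨a, b⟩
  -- `lapReduced a` solves the equation off the core, `coreEmb b` adjusts the projection, and the
  -- second component accounts for the core part of a. On the core `massOp` is division by
  -- `coreWeight ^ 2`, hence the factor.
  refine ⟨(lapReduced a + coreEmb b, -((coreWeight ^ 2 : ℝ) : ℂ) • coreProj a), ?_⟩
  change (lapShift (lapReduced a + coreEmb b) -
    massOp (coreEmb (-((coreWeight ^ 2 : ℝ) : ℂ) • coreProj a)),
      coreProj (lapReduced a + coreEmb b)) = (a, b)
  refine Prod.ext ?_ ?_
  · ext m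
    dsimp only
    rw [sub_apply_seq, map_add, lapShift_coreEmb, add_zero, lapShift_apply, lapReduced_apply,
      massOp_apply, map_smul, smul_apply_seq]
    by_cases hm : modeHeight m = 0
    · obtain ⟨j, rfl⟩ := exists_coreMode hm
      rw [modeHeight_coreMode, coreEmb_coreProj, weight_coreMode]
      have := coreWeight_pos.ne'
      push_cast
      have h : (coreWeight : ℂ) ≠ 0 := Complex.ofReal_ne_zero.2 this
      field_simp
      ring
    · rw [coreEmb_of_ne _ hm, mul_zero, mul_zero, sub_zero, ← mul_assoc, ← Complex.ofReal_mul]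
      have h4 := one_le_modeHeight hm
      have h5 := norm_K_sq_pos.ne'
      have h6 := (weight_pos m).ne'
      have h7 : (modeHeight m : ℝ) ≠ 0 := by positivity
      have : 3 * ‖K‖ ^ 2 * modeHeight m / weight m ^ 2 *
          (weight m ^ 2 / (3 * ‖K‖ ^ 2 * modeHeight m)) = 1 := by
        have : ‖K‖ ≠ 0 := fun h => h5 (by rw [h]; norm_num)
        field_simp
      rw [this, Complex.ofReal_one, one_mul]
  · dsimp only
    rw [map_add, coreProj_coreEmb, coreProj_eq_zero, zero_add]
    intro j
    rw [lapReduced_apply, modeHeight_coreMode]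
    simp

/-- The spectral gap above the triple eigenvalue. -/
lemma lap_gap (y : Seq) : 2 * ‖K‖ ^ 2 / (1 + 4 * ‖K‖ ^ 2) * ‖y‖ ^ 2 ≤
    (inner ℂ y (lapOp y)).re - 2 * ‖K‖ ^ 2 * (inner ℂ y (massOp y)).re +
      3 * ‖K‖ ^ 2 * ∑ a, ‖coreProj y a‖ ^ 2 := by
  have hK := norm_K_sq_pos
  -- The value of (t − 2|K|²) / (1 + t), increasing in t, at t = 4|K|², the smallest possible |K +
  -- m|² above the core.
  set c := 2 * ‖K‖ ^ 2 / (1 + 4 * ‖K‖ ^ 2) with hc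
  -- Every operator here is diagonal in the modes: `coreEmb ∘ coreProj` is restriction to the core.
  -- Positivity is thus checked one mode at a time.
  set z : Seq := lapOp y - ((2 * ‖K‖ ^ 2 : ℝ) : ℂ) • massOp y +
    ((3 * ‖K‖ ^ 2 : ℝ) : ℂ) • massOp (coreEmb (coreProj y)) - (c : ℂ) • y with hz
  have h1 : (inner ℂ y z).re = (inner ℂ y (lapOp y)).re -
      2 * ‖K‖ ^ 2 * (inner ℂ y (massOp y)).re + 3 * ‖K‖ ^ 2 * ∑ a, ‖coreProj y a‖ ^ 2 -
        c * ‖y‖ ^ 2 := by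
    rw [hz, inner_sub_right, inner_add_right, inner_sub_right, inner_smul_right, inner_smul_right,
      inner_smul_right, inner_coreEmb_coreProj, inner_self_eq_norm_sq_to_K]
    simp only [Complex.sub_re, Complex.add_re, Complex.re_ofReal_mul, Complex.ofReal_re]
    congr 1
    have : ((‖y‖ : ℂ) ^ 2).re = ‖y‖ ^ 2 := by rw [← Complex.ofReal_pow, Complex.ofReal_re]
    exact congrArg (c * ·) this
  have h2 : 0 ≤ (inner ℂ y z).re := by
    have hs : Summable fun m => (starRingEnd ℂ) (y m) * z m := by
      simpa [RCLike.inner_apply, mul_comm] using lp.summable_inner (𝕜 := ℂ) y z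
    rw [inner_seq, Complex.re_tsum hs]
    refine tsum_nonneg fun m => ?_
    have hzm : ∃ q : ℝ, 0 ≤ q ∧ z m = q * y m := by
      have hzm' : z m = ((‖K + dualVec m‖ ^ 2 / weight m ^ 2 : ℝ) : ℂ) * y m -
          ((2 * ‖K‖ ^ 2 : ℝ) : ℂ) * ((((weight m ^ 2)⁻¹ : ℝ) : ℂ) * y m) +
          ((3 * ‖K‖ ^ 2 : ℝ) : ℂ) * ((((weight m ^ 2)⁻¹ : ℝ) : ℂ) *
            coreEmb (coreProj y) m) - c * y m := by
        rw [← lapOp_apply, ← massOp_apply, ← massOp_apply]; rfl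
      have hw := weight_sq_modeHeight m
      have hw0 := weight_pos m
      by_cases hm : modeHeight m = 0
      · obtain ⟨j, rfl⟩ := exists_coreMode hm
        -- On the core the multiples of |K|² add up to 1 − 2 + 3 = 2.
        refine ⟨2 * ‖K‖ ^ 2 / (1 + ‖K‖ ^ 2) - c, ?_, ?_⟩
        · rw [hc, sub_nonneg]
          gcongr
          linarith
        · rw [hzm', coreEmb_coreProj, norm_K_add_coreMode, weight_coreMode, coreWeight_sq]
          push_cast
          ring
      · have hh := one_le_modeHeight hm
        refine ⟨(‖K + dualVec m‖ ^ 2 - 2 * ‖K‖ ^ 2) / weight m ^ 2 - c, ?_, ?_⟩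
        · rw [hc, norm_K_add_sq, hw, sub_nonneg, div_le_div_iff₀ (by positivity) (by positivity)]
          nlinarith [mul_nonneg hK.le (sub_nonneg.2 hh), mul_nonneg hK.le
            (mul_nonneg hK.le (sub_nonneg.2 hh))]
        · rw [hzm', coreEmb_of_ne _ hm]
          push_cast
          ring
    obtain ⟨q, hq, hzq⟩ := hzm
    have : (starRingEnd ℂ) (y m) * z m = ((q * Complex.normSq (y m) : ℝ) : ℂ) := by
      rw [hzq]
      push_cast
      rw [← Complex.mul_conj]
      ring
    rw [this, Complex.ofReal_re]
    exact mul_nonneg hq (Complex.normSq_nonneg _)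
  linarith

end Honeycomb
end

noncomputable section

namespace Honeycomb

/-! ### Reduction to three dimensions -/

/-- The range of `Y p` is an invariant subspace of the Floquet-Bloch operator with parameters `p`,
on which it acts as `N p`, and above which there is a spectral gap. -/
structure IsReduction (A₁ : Medium) (Y : ℂ × (Fin 2 → ℂ) → (Fin 3 → ℂ) →L[ℂ] Seq)
    (N : ℂ × (Fin 2 → ℂ) → (Fin 3 → ℂ) →L[ℂ] (Fin 3 → ℂ)) (p : ℂ × (Fin 2 → ℂ)) : Prop where
  eqn : ∀ v, formOp A₁ p (Y p v) = massOp (Y p (N p v))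
  proj : ∀ v, coreProj (Y p v) = v
  gap : ∀ y, (∀ v, inner ℂ (Y p v) (massOp y) = 0) →
    2 * ‖K‖ ^ 2 * (inner ℂ y (massOp y)).re ≤ (inner ℂ y (formOp A₁ p y)).re
  bound : ‖N p - ((‖K‖ ^ 2 : ℝ) : ℂ) • ContinuousLinearMap.id ℂ _‖ < ‖K‖ ^ 2
  contDiffAt_Y : ContDiffAt ℂ 2 Y p
  contDiffAt_N : ContDiffAt ℂ 2 N p

lemma contDiff_formOp (A₁ : Medium) : ContDiff ℂ 2 (formOp A₁) := by
  have hg : ∀ i, ContDiff ℂ 2 fun p : ℂ × (Fin 2 → ℂ) => gradOp p.2 i := fun i =>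
    contDiff_const.add (((contDiff_apply ℂ ℂ i).comp contDiff_snd).smul contDiff_const)
  have hc : ∀ i j, ContDiff ℂ 2 fun p : ℂ × (Fin 2 → ℂ) => contrastOp A₁ p.1 i j := fun i j =>
    contDiff_const.add (contDiff_fst.smul contDiff_const)
  exact ContDiff.sum fun i _ => ContDiff.sum fun j _ =>
    (hg i).clm_comp ((hc i j).clm_comp (hg j))

lemma formOp_zero (A₁ : Medium) : formOp A₁ 0 = lapOp := by
  have := formOp_zero_right A₁ 0
  rwa [zero_smul, add_zero] at this

/-- All but the gap comes from the continuation theorem. The gap persists because `lap_gap` is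
strict in the `H¹` norm: the form moves little in operator norm, and a vector mass-orthogonal to the
range of `Y p` has small core projections, as `Y p` is close to `coreEmb`. -/
theorem exists_reduction (A₁ : Medium) :
    ∃ (Y : ℂ × (Fin 2 → ℂ) → (Fin 3 → ℂ) →L[ℂ] Seq)
      (N : ℂ × (Fin 2 → ℂ) → (Fin 3 → ℂ) →L[ℂ] (Fin 3 → ℂ)),
      Y 0 = coreEmb ∧ N 0 = ((‖K‖ ^ 2 : ℝ) : ℂ) • ContinuousLinearMap.id ℂ _ ∧
      ∀ᶠ p in 𝓝 0, IsReduction A₁ Y N p := by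
  obtain ⟨Y, N, hY, hN, hY0, hN0, he⟩ := exists_invariant_continuation (p₀ := 0)
    (G := formOp A₁) (B := massOp) (π := coreProj) (ι := coreEmb) (l := ((‖K‖ ^ 2 : ℝ) : ℂ))
    (contDiff_formOp A₁).contDiffAt
    (by
      rw [formOp_zero]
      ext1 v
      have := lapShift_coreEmb v
      exact sub_eq_zero.1 this)
    (by ext1 v; exact coreProj_coreEmb v)
    (ContinuousLinearEquiv.ofBijective borderedOp borderedOp_ker borderedOp_range)
    (fun h v => by
      rw [formOp_zero]
      exact borderedOp_apply h v)
  refine ⟨Y, N, hY0, hN0, ?_⟩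
  have hK := norm_K_sq_pos
  set c := 2 * ‖K‖ ^ 2 / (1 + 4 * ‖K‖ ^ 2) with hc
  have hc0 : 0 < c := by positivity
  -- The 9 is the factor 3 in front of the projections in `lap_gap` times the number of core
  -- directions.
  have hsmall : ∀ᶠ p in 𝓝 0, ‖formOp A₁ p - lapOp‖ +
      9 * ‖K‖ ^ 2 * (‖coreEmb - Y p‖ * ‖massOp‖) ^ 2 < c := by
    have ht : ContinuousAt (fun p => ‖formOp A₁ p - lapOp‖ +
        9 * ‖K‖ ^ 2 * (‖coreEmb - Y p‖ * ‖massOp‖) ^ 2) 0 :=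
      (((contDiff_formOp A₁).continuous.continuousAt.sub continuousAt_const).norm).add
        (continuousAt_const.mul
          (((continuousAt_const.sub hY.continuousAt).norm.mul continuousAt_const).pow 2))
    refine ht.eventually_lt continuousAt_const ?_
    simp only [formOp_zero, sub_self, norm_zero, hY0, zero_mul]
    simpa using hc0
  -- Keeps every eigenvalue of `N p` below 2|K|², so that it is separated from the rest of the
  -- spectrum by the gap condition.
  have hbound : ∀ᶠ p in 𝓝 0,
      ‖N p - ((‖K‖ ^ 2 : ℝ) : ℂ) • ContinuousLinearMap.id ℂ _‖ < ‖K‖ ^ 2 := by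
    have ht : ContinuousAt (fun p => ‖N p - ((‖K‖ ^ 2 : ℝ) : ℂ) •
        ContinuousLinearMap.id ℂ _‖) 0 := (hN.continuousAt.sub continuousAt_const).norm
    refine ht.eventually_lt continuousAt_const ?_
    simp only [hN0, sub_self, norm_zero, hK]
  filter_upwards [he, hsmall, hbound, hY.eventually (by simp), hN.eventually (by simp)]
    with p h1 h2 h3 h4 h5
  refine ⟨fun v => congrArg (fun T : (Fin 3 → ℂ) →L[ℂ] Seq => T v) h1.1,
    fun v => congrArg (fun T : (Fin 3 → ℂ) →L[ℂ] (Fin 3 → ℂ) => T v) h1.2, fun y hy => ?_, h3,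
    h4, h5⟩
  have hgap := lap_gap y
  have hproj : ∀ a, ‖coreProj y a‖ ≤ ‖coreEmb - Y p‖ * ‖massOp‖ * ‖y‖ := by
    intro a
    -- Orthogonality to the range of `Y p` allows `coreEmb` to be replaced by `coreEmb - Y p`.
    have e1 : coreProj y a = inner ℂ ((coreEmb - Y p) (Pi.single a 1)) (massOp y) := by
      rw [_root_.sub_apply, inner_sub_left, hy, sub_zero, coreEmb_single, coreProj_apply]
    have e2 : ‖(Pi.single a 1 : Fin 3 → ℂ)‖ ≤ 1 := by
      rw [Pi.norm_single, norm_one]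
    rw [e1]
    calc _ ≤ ‖(coreEmb - Y p) (Pi.single a 1)‖ * ‖massOp y‖ := norm_inner_le_norm _ _
      _ ≤ (‖coreEmb - Y p‖ * 1) * (‖massOp‖ * ‖y‖) := by
        gcongr
        · exact (ContinuousLinearMap.le_opNorm _ _).trans (by gcongr)
        · exact ContinuousLinearMap.le_opNorm _ _
      _ = _ := by ring
  have hsum : ∑ a, ‖coreProj y a‖ ^ 2 ≤ 3 * (‖coreEmb - Y p‖ * ‖massOp‖ * ‖y‖) ^ 2 := by
    refine (Finset.sum_le_sum fun a _ => pow_le_pow_left₀ (norm_nonneg _) (hproj a) 2).trans ?_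
    simp
  have hpert : (inner ℂ y (lapOp y)).re ≤ (inner ℂ y (formOp A₁ p y)).re +
      ‖formOp A₁ p - lapOp‖ * ‖y‖ ^ 2 := by
    have e1 : (inner ℂ y (lapOp y)).re = (inner ℂ y (formOp A₁ p y)).re -
        (inner ℂ y ((formOp A₁ p - lapOp) y)).re := by
      rw [_root_.sub_apply, inner_sub_right, Complex.sub_re]; ring
    have e2 : |(inner ℂ y ((formOp A₁ p - lapOp) y)).re| ≤
        ‖formOp A₁ p - lapOp‖ * ‖y‖ ^ 2 := by
      refine (Complex.abs_re_le_norm _).trans ((norm_inner_le_norm _ _).trans ?_)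
      have := ContinuousLinearMap.le_opNorm (formOp A₁ p - lapOp) y
      nlinarith [norm_nonneg y]
    linarith [(abs_le.1 e2).1]
  have hfin : (‖formOp A₁ p - lapOp‖ + 9 * ‖K‖ ^ 2 * (‖coreEmb - Y p‖ * ‖massOp‖) ^ 2) *
      ‖y‖ ^ 2 ≤ c * ‖y‖ ^ 2 := by gcongr
  nlinarith [mul_le_mul_of_nonneg_left hsum (show 0 ≤ 3 * ‖K‖ ^ 2 by positivity)]

/-! ### Diagonalization on invariant subspaces -/

/-- `N` is Hermitian only for the inner product pulled back along `L`, so the spectral theorem is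
applied on the range of `L`; sorting then puts the eigenvalues in increasing order. -/
lemma exists_diagonalization {n : ℕ} (L : (Fin n → ℂ) →ₗ[ℂ] Seq) (hL : Function.Injective L)
    (N : (Fin n → ℂ) →ₗ[ℂ] (Fin n → ℂ))
    (hN : ∀ u v, inner ℂ (L (N u)) (L v) = inner ℂ (L u) (L (N v))) :
    ∃ (e : Fin n → ℝ) (b : Module.Basis (Fin n) ℂ (Fin n → ℂ)), Monotone e ∧
      (∀ i j, inner ℂ (L (b i)) (L (b j)) = if i = j then 1 else 0) ∧
      ∀ i, N (b i) = (e i : ℂ) • b i := by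
  let φ := LinearEquiv.ofInjective L hL
  let T : LinearMap.range L →ₗ[ℂ] LinearMap.range L := φ.toLinearMap ∘ₗ N ∘ₗ φ.symm.toLinearMap
  have hφ : ∀ v, ((φ v : LinearMap.range L) : Seq) = L v := fun v => rfl
  have hT : T.IsSymmetric := by
    intro x y
    obtain ⟨u, rfl⟩ := φ.surjective x
    obtain ⟨v, rfl⟩ := φ.surjective y
    simp only [T, LinearMap.comp_apply, LinearEquiv.coe_coe, LinearEquiv.symm_apply_apply]
    exact hN u v
  have hn : Module.finrank ℂ (LinearMap.range L) = n := by
    rw [← φ.finrank_eq]; simp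
  let σ := Tuple.sort (hT.eigenvalues hn)
  let β := (hT.eigenvectorBasis hn).reindex σ.symm
  have hβ : ∀ i, β i = hT.eigenvectorBasis hn (σ i) := fun i => by
    rw [OrthonormalBasis.reindex_apply, Equiv.symm_symm]
  refine ⟨fun i => hT.eigenvalues hn (σ i), β.toBasis.map φ.symm, Tuple.monotone_sort _,
    fun i j => ?_, fun i => ?_⟩
  · rw [Module.Basis.map_apply, Module.Basis.map_apply, ← hφ, ← hφ, LinearEquiv.apply_symm_apply,
      LinearEquiv.apply_symm_apply, OrthonormalBasis.coe_toBasis]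
    exact orthonormal_iff_ite.1 β.orthonormal i j
  · rw [Module.Basis.map_apply, OrthonormalBasis.coe_toBasis, hβ]
    apply φ.injective
    rw [map_smul, LinearEquiv.apply_symm_apply]
    exact hT.apply_eigenvectorBasis hn (σ i)

lemma det_sub_of_diagonal {n : ℕ} {e : Fin n → ℝ} {b : Module.Basis (Fin n) ℂ (Fin n → ℂ)}
    {N : (Fin n → ℂ) →ₗ[ℂ] (Fin n → ℂ)} (h : ∀ i, N (b i) = (e i : ℂ) • b i) (x : ℂ) :
    LinearMap.det (x • LinearMap.id - N) = ∏ i, (x - e i) := by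
  rw [← LinearMap.det_toMatrix b]
  have : LinearMap.toMatrix b b (x • LinearMap.id - N) = Matrix.diagonal fun i => x - e i := by
    ext i j
    rw [LinearMap.toMatrix_apply, LinearMap.sub_apply, LinearMap.smul_apply, LinearMap.id_apply, h,
      ← sub_smul, map_smul, Module.Basis.repr_self, Matrix.diagonal_apply]
    simp only [Finsupp.smul_apply, Finsupp.single_apply, smul_eq_mul]
    by_cases hij : i = j
    · subst hij; simp
    · simp [hij, Ne.symm hij]
  rw [this, Matrix.det_diagonal]

/-! ### Spectrum of the reduction and the three lowest bands. -/

/-- The orthonormal eigenvectors and eigenvalues of a reduction. -/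
structure IsSpectral (Y : (Fin 3 → ℂ) →L[ℂ] Seq) (N : (Fin 3 → ℂ) →L[ℂ] (Fin 3 → ℂ))
    (e : Fin 3 → ℝ) (b : Module.Basis (Fin 3) ℂ (Fin 3 → ℂ)) : Prop where
  mono : Monotone e
  orth : ∀ i j, inner ℂ (Y (b i)) (massOp (Y (b j))) = if i = j then 1 else 0
  eigen : ∀ i, N (b i) = (e i : ℂ) • b i

section Reduction

variable {A₁ : Medium} {Y : ℂ × (Fin 2 → ℂ) → (Fin 3 → ℂ) →L[ℂ] Seq}
  {N : ℂ × (Fin 2 → ℂ) → (Fin 3 → ℂ) →L[ℂ] (Fin 3 → ℂ)} {ε : ℝ} {κ : Plane}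

lemma IsReduction.injective {p : ℂ × (Fin 2 → ℂ)} (h : IsReduction A₁ Y N p) :
    Function.Injective (Y p) := fun u v huv => by
  rw [← h.proj u, ← h.proj v, huv]

/-- Both sides are the form between vectors of the range, and the form is symmetric. -/
lemma IsReduction.symmetric (h : IsReduction A₁ Y N (ε, toC κ)) (hA : SmoothPeriodic A₁)
    (hε : IsHoneycombMedium (lowContrast A₁ ε)) (u v : Fin 3 → ℂ) :
    inner ℂ (Y (ε, toC κ) (N (ε, toC κ) u)) (massOp (Y (ε, toC κ) v)) =
      inner ℂ (Y (ε, toC κ) u) (massOp (Y (ε, toC κ) (N (ε, toC κ) v))) := by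
  rw [← h.eqn, ← inner_formOp hA hε, h.eqn, inner_massOp, ← inner_embOp]
  rfl

lemma IsReduction.exists_spectral (h : IsReduction A₁ Y N (ε, toC κ)) (hA : SmoothPeriodic A₁)
    (hε : IsHoneycombMedium (lowContrast A₁ ε)) :
    ∃ e b, IsSpectral (Y (ε, toC κ)) (N (ε, toC κ)) e b := by
  obtain ⟨e, b, h1, h2, h3⟩ := exists_diagonalization
    ((embOp ∘L Y (ε, toC κ)).toLinearMap) (embOp_injective.comp h.injective)
    (N (ε, toC κ)).toLinearMap (fun u v => by
      change inner ℂ (embOp (Y (ε, toC κ) (N (ε, toC κ) u))) (embOp (Y (ε, toC κ) v)) =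
        inner ℂ (embOp (Y (ε, toC κ) u)) (embOp (Y (ε, toC κ) (N (ε, toC κ) v)))
      rw [← inner_massOp, ← inner_massOp, h.symmetric hA hε])
  exact ⟨e, b, h1, fun i j => (inner_massOp _ _).trans (h2 i j), h3⟩

lemma IsReduction.eigenvalue_lt (h : IsReduction A₁ Y N (ε, toC κ)) {e : Fin 3 → ℝ}
    {b : Module.Basis (Fin 3) ℂ (Fin 3 → ℂ)} (hs : IsSpectral (Y (ε, toC κ)) (N (ε, toC κ)) e b)
    (i : Fin 3) : e i < 2 * ‖K‖ ^ 2 := by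
  have hb : 0 < ‖b i‖ := norm_pos_iff.2 (b.ne_zero i)
  have h1 : (N (ε, toC κ) - ((‖K‖ ^ 2 : ℝ) : ℂ) • ContinuousLinearMap.id ℂ (Fin 3 → ℂ)) (b i) =
      ((e i - ‖K‖ ^ 2 : ℝ) : ℂ) • b i := by
    rw [_root_.sub_apply, hs.eigen, Complex.ofReal_sub, sub_smul]; rfl
  have h2 := ContinuousLinearMap.le_opNorm
    (N (ε, toC κ) - ((‖K‖ ^ 2 : ℝ) : ℂ) • ContinuousLinearMap.id ℂ _) (b i)
  rw [h1, norm_smul, Complex.norm_real, Real.norm_eq_abs] at h2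
  have h3 := (le_of_mul_le_mul_right h2 hb).trans_lt h.bound
  linarith [(abs_lt.1 h3).2]

lemma IsSpectral.inner_expand {Y : (Fin 3 → ℂ) →L[ℂ] Seq}
    {N : (Fin 3 → ℂ) →L[ℂ] (Fin 3 → ℂ)} {e : Fin 3 → ℝ}
    {b : Module.Basis (Fin 3) ℂ (Fin 3 → ℂ)} (hs : IsSpectral Y N e b) (i : Fin 3)
    (c : Fin 3 → ℂ) : inner ℂ (Y (b i)) (massOp (∑ j, c j • Y (b j))) = c i := by
  rw [map_sum, inner_sum]
  simp [inner_smul_right, hs.orth]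

/-- Eigenvectors below the gap lie in the invariant subspace. -/
lemma IsReduction.mem_range (h : IsReduction A₁ Y N (ε, toC κ)) (hA : SmoothPeriodic A₁)
    (hε : IsHoneycombMedium (lowContrast A₁ ε)) {E : ℝ} (hE : E < 2 * ‖K‖ ^ 2) {y : Seq}
    (hy : formOp A₁ (ε, toC κ) y = (E : ℂ) • massOp y) :
    ∃ v, y = Y (ε, toC κ) v ∧ N (ε, toC κ) v = (E : ℂ) • v := by
  obtain ⟨e, b, hs⟩ := h.exists_spectral hA hε
  set c : Fin 3 → ℂ := fun i => inner ℂ (Y (ε, toC κ) (b i)) (massOp y) with hc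
  -- By symmetry of the form, the component along an eigenvector vanishes unless its eigenvalue is
  -- E.
  have hce : ∀ i, c i * (e i : ℂ) = c i * E := by
    intro i
    have h1 : inner ℂ (Y (ε, toC κ) (b i)) (formOp A₁ (ε, toC κ) y) = E * c i := by
      rw [hy, inner_smul_right]
    rw [← inner_formOp hA hε, h.eqn, hs.eigen, map_smul, map_smul, inner_smul_left,
      Complex.conj_ofReal] at h1
    have h2 : inner ℂ (massOp (Y (ε, toC κ) (b i))) y = c i := by
      rw [hc]
      dsimp only
      rw [inner_massOp, ← inner_embOp]; rfl
    rw [h2] at h1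
    linear_combination h1
  -- The remainder is mass-orthogonal to the range and still solves the equation with energy E. The
  -- gap gives 2|K|² ≤ E unless it vanishes.
  set z := y - ∑ i, c i • Y (ε, toC κ) (b i) with hz
  have hzo : ∀ v, inner ℂ (Y (ε, toC κ) v) (massOp z) = 0 := by
    intro v
    have h1 : ∀ i, inner ℂ (Y (ε, toC κ) (b i)) (massOp z) = 0 := by
      intro i
      rw [hz, map_sub, inner_sub_right, hs.inner_expand, sub_self]
    rw [← b.sum_repr v, map_sum, sum_inner]
    simp [inner_smul_left, h1]
  have hzA : formOp A₁ (ε, toC κ) z = (E : ℂ) • massOp z := by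
    rw [hz, map_sub, map_sub, smul_sub, hy, map_sum, map_sum, Finset.smul_sum]
    congr 1
    refine Finset.sum_congr rfl fun i _ => ?_
    rw [map_smul, map_smul, h.eqn, hs.eigen, map_smul, map_smul, smul_smul, smul_smul, hce,
      mul_comm]
  have hgap := h.gap z hzo
  rw [hzA, inner_smul_right, Complex.re_ofReal_mul] at hgap
  have hm : (inner ℂ z (massOp z)).re = ‖embOp z‖ ^ 2 := by
    rw [inner_massOp]
    exact inner_self_eq_norm_sq (𝕜 := ℂ) _
  rw [hm] at hgap
  have h0 : embOp z = 0 := by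
    have : ‖embOp z‖ ^ 2 ≤ 0 := by
      by_contra! hpos
      nlinarith
    exact norm_eq_zero.1 ((pow_eq_zero_iff two_ne_zero).1 (le_antisymm this (by positivity)))
  have hz0 : z = 0 := embOp_injective (by rw [h0, map_zero])
  have hyv : y = Y (ε, toC κ) (∑ i, c i • b i) := by
    rw [map_sum]
    simp only [map_smul]
    exact sub_eq_zero.1 hz0
  refine ⟨_, hyv, ?_⟩
  rw [map_sum, Finset.smul_sum]
  refine Finset.sum_congr rfl fun i _ => ?_
  rw [map_smul, hs.eigen, smul_smul, smul_smul, hce, mul_comm]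

lemma IsReduction.formOp_eigen {p : ℂ × (Fin 2 → ℂ)} (h : IsReduction A₁ Y N p) {E : ℂ}
    {v : Fin 3 → ℂ} (hv : N p v = E • v) : formOp A₁ p (Y p v) = E • massOp (Y p v) := by
  rw [h.eqn, hv, map_smul, map_smul]

/-- An eigenfunction of energy below `e i` is below the gap and hence in the range of `Y`.
Orthogonality kills its components up to index i, and the mismatch of energies kills the later ones.
The shift by one is between `Fin 3` and the numbering of bands. -/
lemma IsReduction.isBandEnergy (h : IsReduction A₁ Y N (ε, toC κ)) (hA : SmoothPeriodic A₁)
    (hε : IsHoneycombMedium (lowContrast A₁ ε)) {e : Fin 3 → ℝ}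
    {b : Module.Basis (Fin 3) ℂ (Fin 3 → ℂ)} (hs : IsSpectral (Y (ε, toC κ)) (N (ε, toC κ)) e b)
    (i : Fin 3) : IsBandEnergy (lowContrast A₁ ε) (K + κ) (i + 1) (e i) := by
  have hi : (i : ℕ) + 1 ≤ 3 := i.2
  refine ⟨fun j => bf κ (Y (ε, toC κ) (b (Fin.castLE hi j))), fun j => e (Fin.castLE hi j),
    fun j => ?_, fun j l => ?_, fun j l hjl => hs.mono (by simpa using hjl),
    ⟨Fin.last i, by simp, by congr 1⟩, fun E' f hf ho => ?_⟩
  · rw [inEigenspace_bf hA.memLp_top]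
    exact h.formOp_eigen (hs.eigen _)
  · rw [cellInner_bf, hs.orth]
    simp
  · by_contra! hlt
    have hE : E' < 2 * ‖K‖ ^ 2 := hlt.trans (h.eigenvalue_lt hs i)
    obtain ⟨c, hc⟩ := hf.1.1.exists_bf
    have hfc : InEigenspace (lowContrast A₁ ε) (K + κ) E' (bf κ c) := hf.1.congr hc
    rw [inEigenspace_bf hA.memLp_top] at hfc
    obtain ⟨v, rfl, hv⟩ := h.mem_range hA hε hE hfc
    have hcoef : ∀ j, b.repr v j = 0 := by
      intro j
      have hexp : inner ℂ (Y (ε, toC κ) (b j)) (massOp (Y (ε, toC κ) v)) = b.repr v j := by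
        have := hs.inner_expand j (b.repr v)
        rw [← this]
        conv_lhs => rw [← b.sum_repr v, map_sum]
        simp only [map_smul]
      by_cases hj : (j : ℕ) < i + 1
      · have h1 := ho ⟨j, hj⟩
        rw [cellInner_congr (ae_eq_refl _) (ae_restrict_of_ae hc), cellInner_bf] at h1
        rw [← hexp]
        exact h1
      · have hij : i ≤ j := by
          rw [Fin.le_def]; omega
        have h1 : (E' : ℂ) * b.repr v j = e j * b.repr v j := by
          rw [← hexp]
          have h2 := h.symmetric hA hε (b j) v
          rw [hs.eigen, hv, map_smul, map_smul, map_smul, inner_smul_left, inner_smul_right,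
            Complex.conj_ofReal] at h2
          exact h2.symm
        have h2 : E' ≠ e j := (hlt.trans_le (hs.mono hij)).ne
        have h3 : ((E' : ℂ) - e j) * b.repr v j = 0 := by linear_combination h1
        exact (mul_eq_zero.1 h3).resolve_left
          (sub_ne_zero.2 fun h => h2 (Complex.ofReal_injective h))
    have hv0 : v = 0 := by
      rw [← b.sum_repr v]
      simp [hcoef]
    apply hf.2
    refine hc.trans ?_
    rw [hv0, map_zero]
    exact bf_zero κ

end Reduction

end Honeycomb
end

noncomputable section

namespace Honeycomb

/-! ### Symmetries of the reduction at `K` -/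

lemma toC_zero : toC 0 = 0 := by
  funext i
  simp [toC]

lemma rot_zero : rot 0 = 0 := by
  have := rot_smul 0 0
  simpa using this

lemma formOp_rotSeq_zero {A₁ : Medium} (hA : SmoothPeriodic A₁) {ε : ℝ}
    (hε : IsHoneycombMedium (lowContrast A₁ ε)) (y : Seq) :
    formOp A₁ (ε, toC 0) (rotSeq y) = rotSeq (formOp A₁ (ε, toC 0) y) := by
  have := formOp_rotSeq hA hε 0 y
  rwa [rot_zero] at this

lemma conjSeq_add (y z : Seq) : conjSeq (y + z) = conjSeq y + conjSeq z := by
  ext m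
  simp only [conjSeq_apply, add_apply_seq, map_add]

lemma conjSeq_smul (c : ℂ) (y : Seq) : conjSeq (c • y) = (starRingEnd ℂ) c • conjSeq y := by
  ext m
  simp only [conjSeq_apply, smul_apply_seq, map_mul]

lemma inner_conjSeq (x y : Seq) :
    inner ℂ (conjSeq x) (conjSeq y) = (starRingEnd ℂ) (inner ℂ x y) := by
  rw [inner_seq, inner_seq, Complex.conj_tsum]
  simp only [conjSeq_apply, map_mul]

lemma rotSeq_unitSeq (n : ℤ × ℤ) : rotSeq (unitSeq n) = unitSeq (rotMode n) := by
  ext m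
  rw [rotSeq_apply, unitSeq_apply, unitSeq_apply]
  simp only [Equiv.symm_apply_eq]

lemma conjSeq_unitSeq (n : ℤ × ℤ) : conjSeq (unitSeq n) = unitSeq n := by
  ext m
  rw [conjSeq_apply, unitSeq_apply]
  split_ifs <;> simp

lemma rotChar_mul_conj (a : Fin 3) : rotChar a * (starRingEnd ℂ) (rotChar a) = 1 := by
  have := τ_mul_conj
  fin_cases a <;> simp [rotChar, this, mul_comm]

lemma rotSeq_coreVec (a : Fin 3) : rotSeq (coreVec a) = rotChar a • coreVec a := by
  ext m
  obtain ⟨m, rfl⟩ := rotMode.surjective m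
  rw [rotSeq_apply, Equiv.symm_apply_apply, smul_apply_seq]
  by_cases hm : modeHeight m = 0
  · obtain ⟨j, rfl⟩ := exists_coreMode hm
    rw [rotMode_coreMode, coreVec_coreMode, coreVec_coreMode]
    have h1 := rotChar_mul_conj a
    have h3 : (starRingEnd ℂ) (rotChar a) ^ 3 = 1 := by
      rw [← map_pow]
      have : rotChar a ^ 3 = 1 := by
        have h3 := τ_cube
        fin_cases a
        · exact h3
        · change (starRingEnd ℂ) τ ^ 3 = 1
          rw [← map_pow, h3, map_one]
        · exact one_pow 3
      rw [this, map_one]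
    have key : coreCoef a j = rotChar a * coreCoef a (j + 1) := by
      simp only [coreCoef]
      fin_cases j
      · simp [h1]
      · simp
        linear_combination (-(starRingEnd ℂ) (rotChar a)) * h1
      · simp
        linear_combination (-(starRingEnd ℂ) (rotChar a) ^ 2) * h1 + rotChar a * h3
    rw [key]; ring
  · have hm' : modeHeight (rotMode m) ≠ 0 := by rwa [modeHeight_rotMode]
    rw [coreVec_of_ne hm, coreVec_of_ne hm', mul_zero]

/-- Complex conjugation of the characters of the rotation. -/
def conjIndex : Fin 3 → Fin 3 := ![1, 0, 2]

lemma conjIndex_conjIndex (a : Fin 3) : conjIndex (conjIndex a) = a := by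
  fin_cases a <;> rfl

lemma conj_rotChar (a : Fin 3) : (starRingEnd ℂ) (rotChar a) = rotChar (conjIndex a) := by
  fin_cases a <;> simp [rotChar, conjIndex]

lemma conjSeq_coreVec (a : Fin 3) : conjSeq (coreVec a) = coreVec (conjIndex a) := by
  ext m
  rw [conjSeq_apply]
  by_cases hm : modeHeight m = 0
  · obtain ⟨j, rfl⟩ := exists_coreMode hm
    rw [coreVec_coreMode, coreVec_coreMode, map_mul, Complex.conj_ofReal, coreCoef, coreCoef,
      ← conj_rotChar, map_pow]
  · rw [coreVec_of_ne hm, coreVec_of_ne hm, map_zero]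

lemma coreProj_rotSeq (y : Seq) (a : Fin 3) :
    coreProj (rotSeq y) a = rotChar a * coreProj y a := by
  have h : coreVec a = (starRingEnd ℂ) (rotChar a) • rotSeq (coreVec a) := by
    rw [rotSeq_coreVec, smul_smul, mul_comm, rotChar_mul_conj, one_smul]
  rw [coreProj_apply, ← rotSeq_massOp]
  conv_lhs => rw [h]
  rw [inner_smul_left, inner_rotSeq, Complex.conj_conj, coreProj_apply]

lemma coreProj_conjSeq (y : Seq) (a : Fin 3) :
    coreProj (conjSeq y) a = (starRingEnd ℂ) (coreProj y (conjIndex a)) := by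
  rw [coreProj_apply, coreProj_apply, ← conjSeq_massOp, ← inner_conjSeq, conjSeq_coreVec,
    conjIndex_conjIndex]

/-- The action of the rotation on the coordinates of the reduction. -/
def rotCoord (v : Fin 3 → ℂ) : Fin 3 → ℂ := fun a => rotChar a * v a

/-- The action of `𝒫𝒞` on the coordinates of the reduction. -/
def conjCoord (v : Fin 3 → ℂ) : Fin 3 → ℂ := fun a => (starRingEnd ℂ) (v (conjIndex a))

lemma rotCoord_single (a : Fin 3) : rotCoord (Pi.single a 1) = rotChar a • Pi.single a 1 := by
  funext c
  by_cases h : c = a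
  · subst h; simp [rotCoord]
  · simp [rotCoord, h]

lemma conjCoord_smul_single (c : ℂ) (a : Fin 3) :
    conjCoord (c • Pi.single a 1) = (starRingEnd ℂ) c • Pi.single (conjIndex a) 1 := by
  funext i
  fin_cases a <;> fin_cases i <;> simp [conjCoord, conjIndex]

section Reduction

variable {A₁ : Medium} {Y : ℂ × (Fin 2 → ℂ) → (Fin 3 → ℂ) →L[ℂ] Seq}
  {N : ℂ × (Fin 2 → ℂ) → (Fin 3 → ℂ) →L[ℂ] (Fin 3 → ℂ)} {ε : ℝ}

/-- At K the rotation maps eigenvectors below the gap to eigenvectors of the same energy, hence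
preserves the range of `Y`. Coordinates in the range are read off by `coreProj`, on which the
rotation acts by its characters. -/
lemma IsReduction.rotSeq_apply (h : IsReduction A₁ Y N (ε, toC 0)) (hA : SmoothPeriodic A₁)
    (hε : IsHoneycombMedium (lowContrast A₁ ε)) (v : Fin 3 → ℂ) :
    rotSeq (Y (ε, toC 0) v) = Y (ε, toC 0) (rotCoord v) := by
  obtain ⟨e, b, hs⟩ := h.exists_spectral hA hε
  have h1 : ∀ i, ∃ w, rotSeq (Y (ε, toC 0) (b i)) = Y (ε, toC 0) w := by
    intro i
    obtain ⟨w, hw, -⟩ := h.mem_range hA hε (h.eigenvalue_lt hs i)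
      (y := rotSeq (Y (ε, toC 0) (b i))) (by
        rw [formOp_rotSeq_zero hA hε, h.formOp_eigen (hs.eigen i), rotSeq_smul, rotSeq_massOp])
    exact ⟨w, hw⟩
  choose w hw using h1
  have h2 : rotSeq (Y (ε, toC 0) v) = Y (ε, toC 0) (∑ i, b.repr v i • w i) := by
    conv_lhs => rw [← b.sum_repr v]
    simp only [Fin.sum_univ_three, map_add, map_smul, rotSeq_add, rotSeq_smul, hw]
  rw [h2]
  congr 1
  rw [← h.proj (∑ i, b.repr v i • w i), ← h2]
  funext a
  rw [coreProj_rotSeq, h.proj]; rfl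

lemma IsReduction.conjSeq_apply (h : IsReduction A₁ Y N (ε, toC 0)) (hA : SmoothPeriodic A₁)
    (hε : IsHoneycombMedium (lowContrast A₁ ε)) (v : Fin 3 → ℂ) :
    conjSeq (Y (ε, toC 0) v) = Y (ε, toC 0) (conjCoord v) := by
  obtain ⟨e, b, hs⟩ := h.exists_spectral hA hε
  have h1 : ∀ i, ∃ w, conjSeq (Y (ε, toC 0) (b i)) = Y (ε, toC 0) w := by
    intro i
    obtain ⟨w, hw, -⟩ := h.mem_range hA hε (h.eigenvalue_lt hs i)
      (y := conjSeq (Y (ε, toC 0) (b i))) (by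
        rw [formOp_conjSeq hA hε, h.formOp_eigen (hs.eigen i), conjSeq_smul, conjSeq_massOp,
          Complex.conj_ofReal])
    exact ⟨w, hw⟩
  choose w hw using h1
  have h2 : conjSeq (Y (ε, toC 0) v) =
      Y (ε, toC 0) (∑ i, (starRingEnd ℂ) (b.repr v i) • w i) := by
    conv_lhs => rw [← b.sum_repr v]
    simp only [Fin.sum_univ_three, map_add, map_smul, conjSeq_add, conjSeq_smul, hw]
  rw [h2]
  congr 1
  rw [← h.proj (∑ i, (starRingEnd ℂ) (b.repr v i) • w i), ← h2]
  funext a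
  rw [coreProj_conjSeq, h.proj]; rfl

lemma massOp_injective : Function.Injective massOp := embOp_injective.comp embOp_injective

lemma IsReduction.N_rotCoord (h : IsReduction A₁ Y N (ε, toC 0)) (hA : SmoothPeriodic A₁)
    (hε : IsHoneycombMedium (lowContrast A₁ ε)) (v : Fin 3 → ℂ) :
    N (ε, toC 0) (rotCoord v) = rotCoord (N (ε, toC 0) v) := by
  apply h.injective
  apply massOp_injective
  rw [← h.eqn, ← h.rotSeq_apply hA hε, ← h.rotSeq_apply hA hε, formOp_rotSeq_zero hA hε, h.eqn,
    rotSeq_massOp]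

lemma IsReduction.N_conjCoord (h : IsReduction A₁ Y N (ε, toC 0)) (hA : SmoothPeriodic A₁)
    (hε : IsHoneycombMedium (lowContrast A₁ ε)) (v : Fin 3 → ℂ) :
    N (ε, toC 0) (conjCoord v) = conjCoord (N (ε, toC 0) v) := by
  apply h.injective
  apply massOp_injective
  rw [← h.eqn, ← h.conjSeq_apply hA hε, ← h.conjSeq_apply hA hε, formOp_conjSeq hA hε, h.eqn,
    conjSeq_massOp]

/-- The eigenvalues of the reduction at `K`. -/
def diagEntry (N : ℂ × (Fin 2 → ℂ) → (Fin 3 → ℂ) →L[ℂ] (Fin 3 → ℂ)) (ε : ℝ) (a : Fin 3) : ℂ :=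
  N (ε, toC 0) (Pi.single a 1) a

/-- An operator commuting with a diagonal one whose three entries are distinct is diagonal. -/
lemma IsReduction.N_single' (h : IsReduction A₁ Y N (ε, toC 0)) (hA : SmoothPeriodic A₁)
    (hε : IsHoneycombMedium (lowContrast A₁ ε)) (a : Fin 3) :
    N (ε, toC 0) (Pi.single a 1) = diagEntry N ε a • Pi.single a 1 := by
  funext c
  by_cases hc : c = a
  · subst hc; simp [diagEntry]
  · have h1 := congrFun (h.N_rotCoord hA hε (Pi.single a 1)) c
    rw [rotCoord_single, map_smul] at h1
    have h2 : (rotChar a - rotChar c) * N (ε, toC 0) (Pi.single a 1) c = 0 := by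
      rw [sub_mul, sub_eq_zero]; exact h1
    rw [(mul_eq_zero.1 h2).resolve_left (sub_ne_zero.2 fun e => hc (rotChar_injective e.symm))]
    simp [hc]

lemma IsReduction.gram_ne_zero {p : ℂ × (Fin 2 → ℂ)} (h : IsReduction A₁ Y N p)
    {v : Fin 3 → ℂ} (hv : v ≠ 0) : 0 < (inner ℂ (Y p v) (massOp (Y p v))).re := by
  rw [inner_massOp]
  have h1 : embOp (Y p v) ≠ 0 := by
    intro h0
    apply hv
    apply h.injective
    apply embOp_injective
    rw [h0, map_zero, map_zero]
  have h2 : (inner ℂ (embOp (Y p v)) (embOp (Y p v))).re = ‖embOp (Y p v)‖ ^ 2 :=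
    inner_self_eq_norm_sq (𝕜 := ℂ) _
  rw [h2]
  positivity

lemma IsReduction.conj_diagEntry (h : IsReduction A₁ Y N (ε, toC 0)) (hA : SmoothPeriodic A₁)
    (hε : IsHoneycombMedium (lowContrast A₁ ε)) (a : Fin 3) :
    (starRingEnd ℂ) (diagEntry N ε a) = diagEntry N ε a := by
  have h1 := h.symmetric hA hε (Pi.single a 1) (Pi.single a 1)
  rw [h.N_single' hA hε, map_smul, map_smul, inner_smul_left, inner_smul_right] at h1
  refine mul_right_cancel₀ (fun h0 => ?_) h1
  have h2 := h.gram_ne_zero (v := Pi.single a 1) (by simp)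
  rw [h0] at h2
  exact lt_irrefl _ h2

lemma IsReduction.N_single (h : IsReduction A₁ Y N (ε, toC 0)) (hA : SmoothPeriodic A₁)
    (hε : IsHoneycombMedium (lowContrast A₁ ε)) (a : Fin 3) :
    N (ε, toC 0) (Pi.single a 1) = ((diagEntry N ε a).re : ℂ) • Pi.single a 1 := by
  rw [h.N_single' hA hε, Complex.conj_eq_iff_re.1 (h.conj_diagEntry hA hε a)]

/-- The origin of the double eigenvalue: 𝒫𝒞 commutes with the operator and exchanges the characters
τ and τ̄. -/
lemma IsReduction.diagEntry_conjIndex (h : IsReduction A₁ Y N (ε, toC 0))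
    (hA : SmoothPeriodic A₁) (hε : IsHoneycombMedium (lowContrast A₁ ε)) :
    diagEntry N ε 1 = diagEntry N ε 0 := by
  have h1 := h.N_conjCoord hA hε (Pi.single 0 1)
  rw [h.N_single' hA hε, conjCoord_smul_single, h.conj_diagEntry hA hε] at h1
  have h2 : conjCoord (Pi.single 0 1) = Pi.single 1 1 := by
    have := conjCoord_smul_single 1 0
    rwa [map_one, one_smul, one_smul] at this
  rw [h2] at h1
  have := congrFun h1 1
  simpa [diagEntry, conjIndex] using this

/-! ### First order expansion of the eigenvalues -/

lemma inner_lapOp (x y : Seq) : inner ℂ (lapOp x) y = inner ℂ x (lapOp y) := by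
  simp only [lapOp, _root_.sum_apply, sum_inner, inner_sum, ContinuousLinearMap.comp_apply,
    inner_momOp]

lemma lapOp_coreVec (a : Fin 3) : lapOp (coreVec a) = ((‖K‖ ^ 2 : ℝ) : ℂ) • massOp (coreVec a) := by
  have := lapShift_coreEmb (Pi.single a 1)
  rw [coreEmb_single] at this
  exact sub_eq_zero.1 this

/-- An exact identity: paired with the unperturbed vector, the Laplacian contributes exactly |K|²,
because the normalization fixes the core projection. The explicit factor ε makes an eigenvector
known to order ε sufficient for an energy known up to ε². -/
lemma IsReduction.diagEntry_eq (h : IsReduction A₁ Y N (ε, toC 0)) (a : Fin 3) :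
    diagEntry N ε a = ((‖K‖ ^ 2 : ℝ) : ℂ) +
      ε * inner ℂ (coreVec a) (contrastDeriv A₁ (Y (ε, toC 0) (Pi.single a 1))) := by
  have h1 : diagEntry N ε a =
      inner ℂ (coreVec a) (formOp A₁ (ε, toC 0) (Y (ε, toC 0) (Pi.single a 1))) := by
    rw [h.eqn, ← coreProj_apply, h.proj]; rfl
  have h2 : formOp A₁ (ε, toC 0) (Y (ε, toC 0) (Pi.single a 1)) =
      lapOp (Y (ε, toC 0) (Pi.single a 1)) +
        (ε : ℂ) • contrastDeriv A₁ (Y (ε, toC 0) (Pi.single a 1)) := by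
    conv_lhs => rw [toC_zero, formOp_zero_right]
    rw [toC_zero]; rfl
  rw [h1, h2, inner_add_right, inner_smul_right, ← inner_lapOp, lapOp_coreVec, inner_smul_left,
    Complex.conj_ofReal, inner_massOp_left, ← coreProj_apply, h.proj]
  simp

end Reduction

end Honeycomb
end

noncomputable section

namespace Honeycomb

/-! ### Matrix elements of the contrast -/

section Contrast

variable {A₁ : Medium}

lemma formOp_toC_zero (A₁ : Medium) (ε : ℝ) (y : Seq) :
    formOp A₁ (ε, toC 0) y = lapOp y + (ε : ℂ) • contrastDeriv A₁ y := by
  rw [toC_zero, formOp_zero_right]; rfl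

lemma exists_ne_zero_honeycomb
    (hA : ∀ᶠ ε : ℝ in 𝓝 0, IsHoneycombMedium (lowContrast A₁ ε)) :
    ∃ ε : ℝ, (ε : ℂ) ≠ 0 ∧ IsHoneycombMedium (lowContrast A₁ ε) := by
  obtain ⟨ε, hε, hne⟩ := ((hA.filter_mono nhdsWithin_le_nhds).and
    (self_mem_nhdsWithin : {0}ᶜ ∈ 𝓝[≠] (0 : ℝ))).exists
  exact ⟨ε, Complex.ofReal_ne_zero.2 hne, hε⟩

lemma formOp_toC_zero_zero (A₁ : Medium) (y : Seq) : formOp A₁ ((0 : ℝ), toC 0) y = lapOp y := by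
  rw [formOp_toC_zero, Complex.ofReal_zero, zero_smul, add_zero]

/-- Compare the invariance of the form at ε = 0 with that at one ε ≠ 0. -/
lemma contrastDeriv_rotSeq (hA : ∀ᶠ ε : ℝ in 𝓝 0, IsHoneycombMedium (lowContrast A₁ ε)) (y : Seq) :
    contrastDeriv A₁ (rotSeq y) = rotSeq (contrastDeriv A₁ y) := by
  obtain ⟨ε, hne, hε⟩ := exists_ne_zero_honeycomb hA
  have hs := smoothPeriodic_of_eventually hA
  have h1 := formOp_rotSeq_zero hs hε y
  have h2 := formOp_rotSeq_zero hs hA.self_of_nhds y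
  rw [formOp_toC_zero_zero, formOp_toC_zero_zero] at h2
  rw [formOp_toC_zero, formOp_toC_zero, rotSeq_add, rotSeq_smul, h2] at h1
  exact smul_right_injective _ hne (add_left_cancel h1)

lemma contrastDeriv_conjSeq (hA : ∀ᶠ ε : ℝ in 𝓝 0, IsHoneycombMedium (lowContrast A₁ ε))
    (y : Seq) : contrastDeriv A₁ (conjSeq y) = conjSeq (contrastDeriv A₁ y) := by
  obtain ⟨ε, hne, hε⟩ := exists_ne_zero_honeycomb hA
  have hs := smoothPeriodic_of_eventually hA
  have h1 := formOp_conjSeq hs hε 0 y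
  have h2 := formOp_conjSeq hs hA.self_of_nhds 0 y
  rw [formOp_toC_zero_zero, formOp_toC_zero_zero] at h2
  rw [formOp_toC_zero, formOp_toC_zero, conjSeq_add, conjSeq_smul, h2, Complex.conj_ofReal] at h1
  exact smul_right_injective _ hne (add_left_cancel h1)

lemma inner_contrastDeriv (hA : ∀ᶠ ε : ℝ in 𝓝 0, IsHoneycombMedium (lowContrast A₁ ε))
    (x y : Seq) : inner ℂ (contrastDeriv A₁ x) y = inner ℂ x (contrastDeriv A₁ y) := by
  obtain ⟨ε, hne, hε⟩ := exists_ne_zero_honeycomb hA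
  have h1 := inner_formOp (smoothPeriodic_of_eventually hA) hε 0 x y
  rw [formOp_toC_zero, formOp_toC_zero, inner_add_left, inner_add_right, inner_lapOp,
    inner_smul_left, inner_smul_right, Complex.conj_ofReal] at h1
  exact mul_left_cancel₀ hne (add_left_cancel h1)

/-- The matrix elements of the contrast between core modes. -/
def coreMatrix (A₁ : Medium) (i j : Fin 3) : ℂ :=
  inner ℂ (unitSeq (coreMode i)) (contrastDeriv A₁ (unitSeq (coreMode j)))

lemma coreMatrix_add_one (hA : ∀ᶠ ε : ℝ in 𝓝 0, IsHoneycombMedium (lowContrast A₁ ε))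
    (i j : Fin 3) : coreMatrix A₁ (i + 1) (j + 1) = coreMatrix A₁ i j := by
  rw [coreMatrix, coreMatrix, ← rotMode_coreMode, ← rotMode_coreMode, ← rotSeq_unitSeq,
    ← rotSeq_unitSeq, contrastDeriv_rotSeq hA, inner_rotSeq]

lemma conj_coreMatrix (hA : ∀ᶠ ε : ℝ in 𝓝 0, IsHoneycombMedium (lowContrast A₁ ε))
    (i j : Fin 3) : (starRingEnd ℂ) (coreMatrix A₁ i j) = coreMatrix A₁ i j := by
  rw [coreMatrix, ← inner_conjSeq, conjSeq_unitSeq, ← contrastDeriv_conjSeq hA, conjSeq_unitSeq]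

lemma coreMatrix_symm (hA : ∀ᶠ ε : ℝ in 𝓝 0, IsHoneycombMedium (lowContrast A₁ ε))
    (i j : Fin 3) : coreMatrix A₁ j i = coreMatrix A₁ i j := by
  rw [← conj_coreMatrix hA i j, coreMatrix, coreMatrix, inner_conj_symm, inner_contrastDeriv hA]

/-- The rotation makes the matrix circulant. Its entries are real by 𝒫𝒞 and Hermitian, hence
symmetric, which leaves only two values. -/
lemma coreMatrix_eq (hA : ∀ᶠ ε : ℝ in 𝓝 0, IsHoneycombMedium (lowContrast A₁ ε))
    (i j : Fin 3) :
    coreMatrix A₁ i j = if i = j then coreMatrix A₁ 0 0 else coreMatrix A₁ 0 1 := by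
  have h00 := coreMatrix_add_one hA 0 0
  have h11 := coreMatrix_add_one hA 1 1
  have h01 := coreMatrix_add_one hA 0 1
  have h12 := coreMatrix_add_one hA 1 2
  have s10 := coreMatrix_symm hA 0 1
  have s21 := coreMatrix_symm hA 1 2
  have s02 := coreMatrix_symm hA 2 0
  have e1 : (1 : Fin 3) + 1 = 2 := rfl
  have e2 : (2 : Fin 3) + 1 = 0 := rfl
  simp only [zero_add, e1, e2] at h00 h11 h01 h12
  fin_cases i <;> fin_cases j <;> simp <;> grind

lemma coreMatrix_bilin (hA : SmoothPeriodic A₁) (i j : Fin 3) :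
    ((coreWeight ^ 2 : ℝ) : ℂ) * coreMatrix A₁ i j =
      bilin (K + dualVec (coreMode i)) (fourierCoeff A₁ (coreMode i - coreMode j))
        (K + dualVec (coreMode j)) := by
  rw [coreMatrix, inner_unitSeq, entryOp_unitSeq hA, weight_coreMode, weight_coreMode, ← pow_two]
  have : ((coreWeight ^ 2 : ℝ) : ℂ) ≠ 0 :=
    Complex.ofReal_ne_zero.2 (pow_ne_zero _ coreWeight_pos.ne')
  field_simp

lemma coreMatrix_zero_zero (hA : SmoothPeriodic A₁) :
    ((coreWeight ^ 2 : ℝ) : ℂ) * coreMatrix A₁ 0 0 = bilin K (fourierCoeff A₁ (0, 0)) K := by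
  have h : coreMode 0 = (0, 0) := rfl
  have h0 : dualVec (0, 0) = 0 := dualVec_zero
  rw [coreMatrix_bilin hA, h, h0, add_zero]
  rfl

/-- The index (0, −1) of the nondegeneracy condition is the difference of the modes that represent K
and RK. -/
lemma coreMatrix_zero_one (hA : SmoothPeriodic A₁) :
    ((coreWeight ^ 2 : ℝ) : ℂ) * coreMatrix A₁ 0 1 =
      bilin K (fourierCoeff A₁ (0, -1)) (rot K) := by
  have h : coreMode 0 = (0, 0) := rfl
  have h1 : coreMode 1 = (0, 1) := rfl
  have h0 : dualVec (0, 0) = 0 := dualVec_zero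
  rw [coreMatrix_bilin hA, h, h1, h0, add_zero, ← rot_K]
  rfl

lemma coreWeight_scalar : ((coreWeight / Real.sqrt 3 : ℝ) : ℂ) *
    ((coreWeight / Real.sqrt 3 : ℝ) : ℂ) = ((coreWeight ^ 2 : ℝ) : ℂ) / 3 := by
  rw [← Complex.ofReal_mul]
  have h3 := sqrt_three_mul_self
  have : coreWeight / Real.sqrt 3 * (coreWeight / Real.sqrt 3) = coreWeight ^ 2 / 3 := by
    rw [div_mul_div_comm, h3, pow_two]
  rw [this]; push_cast; ring

lemma inner_coreVec (T : Seq →L[ℂ] Seq) (a b : Fin 3) : inner ℂ (coreVec a) (T (coreVec b)) =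
    ((coreWeight ^ 2 : ℝ) : ℂ) / 3 * ∑ i, ∑ j, (starRingEnd ℂ) (coreCoef a i) * coreCoef b j *
      inner ℂ (unitSeq (coreMode i)) (T (unitSeq (coreMode j))) := by
  rw [coreVec, coreVec, map_smul, map_sum, inner_smul_left, inner_smul_right, Complex.conj_ofReal,
    ← mul_assoc, coreWeight_scalar, sum_inner]
  congr 1
  refine Finset.sum_congr rfl fun i _ => ?_
  rw [inner_sum]
  refine Finset.sum_congr rfl fun j _ => ?_
  rw [map_smul, inner_smul_left, inner_smul_right, mul_assoc]

/-- Characters diagonalize a circulant matrix: the two off-diagonal terms are weighted by 1 + 1 for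
the trivial character and by τ + τ̄ = −1 for the other two. -/
lemma inner_coreVec_contrastDeriv
    (hA : ∀ᶠ ε : ℝ in 𝓝 0, IsHoneycombMedium (lowContrast A₁ ε)) (a : Fin 3) :
    inner ℂ (coreVec a) (contrastDeriv A₁ (coreVec a)) =
      bilin K (fourierCoeff A₁ (0, 0)) K +
        (if a = 2 then 2 else -1) * bilin K (fourierCoeff A₁ (0, -1)) (rot K) := by
  have hs := smoothPeriodic_of_eventually hA
  have h : ∀ i j, inner ℂ (unitSeq (coreMode i)) (contrastDeriv A₁ (unitSeq (coreMode j))) =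
      if i = j then coreMatrix A₁ 0 0 else coreMatrix A₁ 0 1 := coreMatrix_eq hA
  rw [inner_coreVec, ← coreMatrix_zero_zero hs, ← coreMatrix_zero_one hs]
  simp only [h, coreCoef, Fin.sum_univ_three]
  have h1 := τ_sum
  have h3 := τ_cube
  have h2 := conj_τ
  fin_cases a <;> simp [rotChar_zero, rotChar_one, rotChar_two] <;> grind

/-- The nondegeneracy parameter is real. -/
lemma conj_bilin_rot (hA : ∀ᶠ ε : ℝ in 𝓝 0, IsHoneycombMedium (lowContrast A₁ ε)) :
    (starRingEnd ℂ) (bilin K (fourierCoeff A₁ (0, -1)) (rot K)) =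
      bilin K (fourierCoeff A₁ (0, -1)) (rot K) := by
  rw [← coreMatrix_zero_one (smoothPeriodic_of_eventually hA), map_mul, Complex.conj_ofReal,
    conj_coreMatrix hA]

end Contrast

/-! ### The velocity matrix elements -/

section Velocity

variable {A₁ : Medium} {ε : ℝ}

/-- The part of the form that is linear in the quasi-momentum. -/
def velSum (A₁ : Medium) (ε : ℝ) (κ : Plane) : Seq →L[ℂ] Seq := ∑ j, toC κ j • velOp A₁ ε j

/-- The form is quadratic in κ, so its linear part is its odd part. The symmetries of `formOp`
thereby pass to the velocity operators. -/
lemma velSum_eq (A₁ : Medium) (ε : ℝ) (κ : Plane) (y : Seq) : velSum A₁ ε κ y =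
    (1 / 2 : ℂ) • (formOp A₁ (ε, toC κ) y - formOp A₁ (ε, toC (-κ)) y) := by
  rw [formOp_expand A₁ ε (toC κ), formOp_expand A₁ ε (toC (-κ)), velSum]
  simp only [Fin.sum_univ_two, _root_.add_apply, _root_.smul_apply, toC, PiLp.neg_apply,
    Complex.ofReal_neg]
  module

lemma rot_neg (κ : Plane) : rot (-κ) = -rot κ := by
  have := rot_smul (-1) κ
  simpa using this

lemma velSum_rotSeq (hA : SmoothPeriodic A₁) (hε : IsHoneycombMedium (lowContrast A₁ ε))
    (κ : Plane) (y : Seq) : velSum A₁ ε (rot κ) (rotSeq y) = rotSeq (velSum A₁ ε κ y) := by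
  rw [velSum_eq, velSum_eq, ← rot_neg, formOp_rotSeq hA hε, formOp_rotSeq hA hε, rotSeq_smul]
  rfl

lemma inner_velSum (hA : SmoothPeriodic A₁) (hε : IsHoneycombMedium (lowContrast A₁ ε))
    (κ : Plane) (x y : Seq) : inner ℂ (velSum A₁ ε κ x) y = inner ℂ x (velSum A₁ ε κ y) := by
  rw [velSum_eq, velSum_eq, inner_smul_left, inner_smul_right, inner_sub_left, inner_sub_right,
    inner_formOp hA hε, inner_formOp hA hε, map_div₀, map_one, map_ofNat]

lemma inner_velSum_eq (A₁ : Medium) (ε : ℝ) (κ : Plane) (x y : Seq) :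
    inner ℂ x (velSum A₁ ε κ y) = κ 0 * inner ℂ x (velOp A₁ ε 0 y) +
      κ 1 * inner ℂ x (velOp A₁ ε 1 y) := by
  simp only [velSum, Fin.sum_univ_two, _root_.add_apply, _root_.smul_apply, inner_add_right,
    inner_smul_right, toC]

/-- Matrix elements of the velocity between rotation eigenvectors. -/
lemma velocity_rot (hA : SmoothPeriodic A₁) (hε : IsHoneycombMedium (lowContrast A₁ ε))
    {x y : Seq} {a b : Fin 3} (hx : rotSeq x = rotChar a • x) (hy : rotSeq y = rotChar b • y)
    (κ : Plane) : (starRingEnd ℂ) (rotChar a) * rotChar b * inner ℂ x (velSum A₁ ε (rot κ) y) =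
      inner ℂ x (velSum A₁ ε κ y) := by
  have h1 := inner_rotSeq x (velSum A₁ ε κ y)
  rw [← velSum_rotSeq hA hε, hx, hy, map_smul, inner_smul_left, inner_smul_right,
    ← mul_assoc] at h1
  exact h1

/-- The linear functional κ ↦ ⟨x, `velSum` κ y⟩ is multiplied by a nontrivial cube root of unity
when κ is rotated, so it is a multiple of κ₀ + iκ₁. -/
lemma velocity_off_diagonal (hA : SmoothPeriodic A₁)
    (hε : IsHoneycombMedium (lowContrast A₁ ε)) {x y : Seq} (hx : rotSeq x = rotChar 0 • x)
    (hy : rotSeq y = rotChar 1 • y) :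
    inner ℂ x (velOp A₁ ε 1 y) = Complex.I * inner ℂ x (velOp A₁ ε 0 y) := by
  have h1 := velocity_rot hA hε hx hy (EuclideanSpace.single 0 1)
  obtain ⟨r0, r1⟩ := rot_apply (EuclideanSpace.single 0 1)
  simp only [inner_velSum_eq, r0, r1] at h1
  rw [conj_rotChar_zero, rotChar_one, conj_τ] at h1
  simp at h1
  have h3 := τ_cube
  have ht := τ_eq
  have hs := sqrt_three_half_sq
  push_cast at ht hs
  set s : ℂ := (Real.sqrt 3 : ℂ) with hsdef
  set z0 := inner ℂ x (velOp A₁ ε 0 y)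
  set z1 := inner ℂ x (velOp A₁ ε 1 y)
  have hI := Complex.I_sq
  -- The two characters multiply to τ² · τ² = τ.
  have h4 : τ * (-(1 / 2) * z0 - s / 2 * z1) = z0 := by
    linear_combination h1 - τ * h3 * (-(1 / 2) * z0 - s / 2 * z1)
  rw [ht] at h4
  have hs0 : s ≠ 0 := by
    intro h0; rw [h0] at hs; norm_num at hs
  have ht0 : -(1 / 2) + s / 2 * Complex.I ≠ 0 := by rw [← ht]; exact τ_ne_zero
  apply mul_left_cancel₀ (mul_ne_zero ht0 hs0)
  linear_combination (-2) * h4 + 2 * z0 * hs - s ^ 2 / 2 * z0 * hI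

/-- Here the two characters cancel, so the functional is invariant under rotation by 2π/3 and must
vanish. -/
lemma velocity_diagonal (hA : SmoothPeriodic A₁)
    (hε : IsHoneycombMedium (lowContrast A₁ ε)) {x : Seq} {a : Fin 3}
    (hx : rotSeq x = rotChar a • x) (j : Fin 2) : inner ℂ x (velOp A₁ ε j x) = 0 := by
  have h1 := velocity_rot hA hε hx hx (EuclideanSpace.single 0 1)
  have h2 := velocity_rot hA hε hx hx (EuclideanSpace.single 1 1)
  obtain ⟨r0, r1⟩ := rot_apply (EuclideanSpace.single 0 1)
  obtain ⟨r2, r3⟩ := rot_apply (EuclideanSpace.single 1 1)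
  rw [mul_comm ((starRingEnd ℂ) _), rotChar_mul_conj, one_mul] at h1 h2
  simp only [inner_velSum_eq, r0, r1, r2, r3] at h1 h2
  simp at h1 h2
  have hs := sqrt_three_half_sq
  push_cast at hs
  set s : ℂ := (Real.sqrt 3 : ℂ)
  set z0 := inner ℂ x (velOp A₁ ε 0 x)
  set z1 := inner ℂ x (velOp A₁ ε 1 x)
  have e0 : z0 = 0 := by linear_combination (-(1 / 2)) * h1 + s / 6 * h2 - z0 / 3 * hs
  have e1 : z1 = 0 := by linear_combination (-(s / 6)) * h1 - (1 / 2) * h2 - z1 / 3 * hs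
  fin_cases j
  · exact e0
  · exact e1

lemma conj_velocity (hA : SmoothPeriodic A₁) (hε : IsHoneycombMedium (lowContrast A₁ ε))
    (x y : Seq) (j : Fin 2) :
    inner ℂ y (velOp A₁ ε j x) = (starRingEnd ℂ) (inner ℂ x (velOp A₁ ε j y)) := by
  have h : ∀ x y, inner ℂ x (velSum A₁ ε (EuclideanSpace.single j 1) y) =
      inner ℂ x (velOp A₁ ε j y) := by
    intro x y
    rw [inner_velSum_eq]
    fin_cases j <;> simp
  rw [← h, ← h, inner_conj_symm, inner_velSum hA hε]

end Velocity

end Honeycomb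
end

noncomputable section

namespace Honeycomb

/-! ### Simple eigenvalues at `K` -/

/-- The derivative is chosen from the predicate `HasWeakDeriv j f`, which is blind to null sets;
hence an equality at every point. -/
lemma weakDeriv_eq_of_ae {f g : Plane → ℂ} (h : f =ᵐ[volume] g) (j : Fin 2) :
    weakDeriv j f = weakDeriv j g := by
  have : ∀ u, HasWeakDeriv j f u ↔ HasWeakDeriv j g u := fun u =>
    ⟨fun hu => hu.congr h (ae_eq_refl _), fun hu => hu.congr h.symm (ae_eq_refl _)⟩
  have h2 : (fun u => HasWeakDeriv j f u) = fun u => HasWeakDeriv j g u :=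
    funext fun u => propext (this u)
  have h3 : HasWeakDeriv j f = HasWeakDeriv j g := h2
  unfold weakDeriv
  rw [h3]

lemma vecOp_eq_of_ae (A : Medium) (j : Fin 2) {f g : Plane → ℂ} (h : f =ᵐ[volume] g) :
    vecOp A j f = vecOp A j g := by
  have h1 : ∀ l, weakDeriv l (fun y => A y l j * f y) = weakDeriv l fun y => A y l j * g y :=
    fun l => weakDeriv_eq_of_ae (h.mono fun x hx => by simp only [hx]) l
  unfold vecOp
  simp only [weakDeriv_eq_of_ae h, h1]

lemma MemH1.exists_bf_zero {f : Plane → ℂ} (hf : MemH1 K f) : ∃ c, f =ᵐ[volume] bf 0 c := by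
  rw [← add_zero K] at hf
  exact hf.exists_bf

lemma inEigenspace_bf_zero {A₁ : Medium} (hA : SmoothPeriodic A₁) (ε E : ℝ) (c : Seq) :
    InEigenspace (lowContrast A₁ ε) K E (bf 0 c) ↔
      formOp A₁ (ε, toC 0) c = (E : ℂ) • massOp c := by
  have := inEigenspace_bf hA.memLp_top ε 0 E c
  rwa [add_zero] at this

lemma bf_not_ae_zero {κ : Plane} {c : Seq} (hc : c ≠ 0) : ¬ bf κ c =ᵐ[volume] 0 :=
  fun h => hc (bf_injective (h.trans (bf_zero κ).symm))

lemma IsSimpleEigenpair.congr {A : Medium} {k : Plane} {σ : ℂ} {E : ℝ} {Φ Ψ : Plane → ℂ}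
    (h : IsSimpleEigenpair A k σ E Φ) (hΨ : Φ =ᵐ[volume] Ψ) : IsSimpleEigenpair A k σ E Ψ := by
  refine ⟨h.1.congr hΨ, ⟨h.2.1.1.congr hΨ, fun h0 => h.2.1.2 (hΨ.trans h0)⟩, fun f h1 h2 => ?_⟩
  obtain ⟨c, hc⟩ := h.2.2 f h1 h2
  refine ⟨c, hc.trans ?_⟩
  filter_upwards [hΨ] with x hx
  rw [hx]

section Reduction

variable {A₁ : Medium} {Y : ℂ × (Fin 2 → ℂ) → (Fin 3 → ℂ) →L[ℂ] Seq}
  {N : ℂ × (Fin 2 → ℂ) → (Fin 3 → ℂ) →L[ℂ] (Fin 3 → ℂ)} {ε : ℝ}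

/-- The basis of the invariant subspace at `K`. -/
def redVec (Y : ℂ × (Fin 2 → ℂ) → (Fin 3 → ℂ) →L[ℂ] Seq) (ε : ℝ) (a : Fin 3) : Seq :=
  Y (ε, toC 0) (Pi.single a 1)

/-- The eigenvalues of the reduction at `K`, as real numbers. -/
def redEnergy (N : ℂ × (Fin 2 → ℂ) → (Fin 3 → ℂ) →L[ℂ] (Fin 3 → ℂ)) (ε : ℝ) (a : Fin 3) : ℝ :=
  (diagEntry N ε a).re

lemma IsReduction.lt_of_eigen {p : ℂ × (Fin 2 → ℂ)} (h : IsReduction A₁ Y N p) {E : ℝ}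
    {v : Fin 3 → ℂ} (hv0 : v ≠ 0) (hv : N p v = (E : ℂ) • v) : E < 2 * ‖K‖ ^ 2 := by
  have hb : 0 < ‖v‖ := norm_pos_iff.2 hv0
  have h1 : (N p - ((‖K‖ ^ 2 : ℝ) : ℂ) • ContinuousLinearMap.id ℂ (Fin 3 → ℂ)) v =
      ((E - ‖K‖ ^ 2 : ℝ) : ℂ) • v := by
    rw [_root_.sub_apply, hv, Complex.ofReal_sub, sub_smul]; rfl
  have h2 := ContinuousLinearMap.le_opNorm
    (N p - ((‖K‖ ^ 2 : ℝ) : ℂ) • ContinuousLinearMap.id ℂ _) v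
  rw [h1, norm_smul, Complex.norm_real, Real.norm_eq_abs] at h2
  have h3 := (le_of_mul_le_mul_right h2 hb).trans_lt h.bound
  linarith [(abs_lt.1 h3).2]

lemma IsReduction.redEnergy_lt (h : IsReduction A₁ Y N (ε, toC 0)) (hA : SmoothPeriodic A₁)
    (hε : IsHoneycombMedium (lowContrast A₁ ε)) (a : Fin 3) : redEnergy N ε a < 2 * ‖K‖ ^ 2 :=
  h.lt_of_eigen (by simp) (h.N_single hA hε a)

lemma IsReduction.rotSeq_redVec (h : IsReduction A₁ Y N (ε, toC 0)) (hA : SmoothPeriodic A₁)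
    (hε : IsHoneycombMedium (lowContrast A₁ ε)) (a : Fin 3) :
    rotSeq (redVec Y ε a) = rotChar a • redVec Y ε a := by
  rw [redVec, h.rotSeq_apply hA hε, rotCoord_single, map_smul]

lemma IsReduction.conjSeq_redVec (h : IsReduction A₁ Y N (ε, toC 0)) (hA : SmoothPeriodic A₁)
    (hε : IsHoneycombMedium (lowContrast A₁ ε)) (a : Fin 3) :
    conjSeq (redVec Y ε a) = redVec Y ε (conjIndex a) := by
  have := conjCoord_smul_single 1 a
  rw [one_smul, map_one, one_smul] at this
  rw [redVec, h.conjSeq_apply hA hε, this]; rfl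

lemma IsReduction.formOp_redVec (h : IsReduction A₁ Y N (ε, toC 0)) (hA : SmoothPeriodic A₁)
    (hε : IsHoneycombMedium (lowContrast A₁ ε)) (a : Fin 3) :
    formOp A₁ (ε, toC 0) (redVec Y ε a) = (redEnergy N ε a : ℂ) • massOp (redVec Y ε a) :=
  h.formOp_eigen (h.N_single hA hε a)

lemma IsReduction.redVec_ne_zero (h : IsReduction A₁ Y N (ε, toC 0)) (a : Fin 3) :
    redVec Y ε a ≠ 0 := fun h0 => by
  have : (Pi.single a 1 : Fin 3 → ℂ) = 0 := h.injective (by rw [map_zero]; exact h0)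
  simp at this

lemma sum_smul_single {n : ℕ} (v : Fin n → ℂ) :
    v = ∑ a, v a • (Pi.single a 1 : Fin n → ℂ) := by
  funext i
  simp [Finset.sum_apply, Pi.single_apply]

lemma IsReduction.N_apply (h : IsReduction A₁ Y N (ε, toC 0)) (hA : SmoothPeriodic A₁)
    (hε : IsHoneycombMedium (lowContrast A₁ ε)) (v : Fin 3 → ℂ) (a : Fin 3) :
    N (ε, toC 0) v a = (redEnergy N ε a : ℂ) * v a := by
  conv_lhs => rw [sum_smul_single v]
  rw [map_sum, Finset.sum_apply, Finset.sum_eq_single a]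
  · rw [map_smul, h.N_single hA hε]
    simp [redEnergy, mul_comm]
  · intro b _ hb
    rw [map_smul, h.N_single hA hε]
    simp [hb.symm]
  · simp

lemma IsReduction.exists_coords (h : IsReduction A₁ Y N (ε, toC 0)) (hA : SmoothPeriodic A₁)
    (hε : IsHoneycombMedium (lowContrast A₁ ε)) {E : ℝ} (hE : E < 2 * ‖K‖ ^ 2) {y : Seq}
    (hy : formOp A₁ (ε, toC 0) y = (E : ℂ) • massOp y) :
    ∃ v : Fin 3 → ℂ, y = Y (ε, toC 0) v ∧ y = ∑ a, v a • redVec Y ε a ∧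
      ∀ a, v a = 0 ∨ E = redEnergy N ε a := by
  obtain ⟨v, hyv, hv⟩ := h.mem_range hA hε hE hy
  refine ⟨v, hyv, ?_, fun a => ?_⟩
  · rw [hyv]
    conv_lhs => rw [sum_smul_single v]
    simp only [map_sum, map_smul, redVec]
  · have h1 := h.N_apply hA hε v a
    rw [hv] at h1
    have h2 : ((E : ℂ) - redEnergy N ε a) * v a = 0 := by
      rw [sub_mul, sub_eq_zero]; exact h1
    rcases mul_eq_zero.1 h2 with h3 | h3
    · exact Or.inr (Complex.ofReal_injective (sub_eq_zero.1 h3))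
    · exact Or.inl h3

/-- Simplicity within the symmetry class does not depend on the energies being distinct: a function
of given character has a single nonzero coordinate because the three characters differ. -/
lemma IsReduction.isSimpleEigenpair (h : IsReduction A₁ Y N (ε, toC 0)) (hA : SmoothPeriodic A₁)
    (hε : IsHoneycombMedium (lowContrast A₁ ε)) (a : Fin 3) {c : ℂ} (hc : c ≠ 0) :
    IsSimpleEigenpair (lowContrast A₁ ε) K (rotChar a) (redEnergy N ε a)
      (bf 0 (c • redVec Y ε a)) := by
  refine ⟨memL2Rot_bf.2 ?_, ⟨(inEigenspace_bf_zero hA _ _ _).2 ?_, bf_not_ae_zero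
    (smul_ne_zero hc (h.redVec_ne_zero a))⟩, fun f hf1 hf2 => ?_⟩
  · rw [rotSeq_smul, h.rotSeq_redVec hA hε, smul_comm]
  · rw [map_smul, map_smul, h.formOp_redVec hA hε, smul_comm]
  · obtain ⟨y, hy⟩ := hf2.1.exists_bf_zero
    have h1 := memL2Rot_bf.1 (hf1.congr hy)
    have h2 := (inEigenspace_bf_zero hA _ _ _).1 (hf2.congr hy)
    obtain ⟨v, hyv, hsum, -⟩ := h.exists_coords hA hε (h.redEnergy_lt hA hε a) h2
    have h3 : ∀ b, b ≠ a → v b = 0 := by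
      intro b hb
      rw [hyv, h.rotSeq_apply hA hε, ← map_smul] at h1
      have h4 : rotChar b * v b = rotChar a * v b := congrFun (h.injective h1) b
      have h5 : (rotChar b - rotChar a) * v b = 0 := by rw [sub_mul, h4, sub_self]
      exact (mul_eq_zero.1 h5).resolve_left (sub_ne_zero.2 fun e => hb (rotChar_injective e))
    rw [Finset.sum_eq_single a (fun b _ hb => by rw [h3 b hb, zero_smul]) (by simp)] at hsum
    refine ⟨v a * c⁻¹, hy.trans ?_⟩
    have h4 := bf_smul 0 (v a * c⁻¹) (c • redVec Y ε a)
    rw [smul_smul, inv_mul_cancel_right₀ hc, ← hsum] at h4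
    exact h4

/-! ### Normalized Dirac eigenfunctions and the Fermi velocity. -/

/-- The squared `L²` norm of the first basis vector. -/
def redGram (Y : ℂ × (Fin 2 → ℂ) → (Fin 3 → ℂ) →L[ℂ] Seq) (ε : ℝ) : ℝ :=
  (inner ℂ (redVec Y ε 0) (massOp (redVec Y ε 0))).re

lemma IsReduction.redGram_pos (h : IsReduction A₁ Y N (ε, toC 0)) : 0 < redGram Y ε :=
  h.gram_ne_zero (by simp)

lemma inner_massOp_self (y : Seq) :
    inner ℂ y (massOp y) = (((inner ℂ y (massOp y)).re : ℝ) : ℂ) := by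
  have : (starRingEnd ℂ) (inner ℂ y (massOp y)) = inner ℂ y (massOp y) := by
    rw [inner_conj_symm, inner_massOp_left]
  exact (Complex.conj_eq_iff_re.1 this).symm

lemma inner_redVec_zero (Y : ℂ × (Fin 2 → ℂ) → (Fin 3 → ℂ) →L[ℂ] Seq) (ε : ℝ) :
    inner ℂ (redVec Y ε 0) (massOp (redVec Y ε 0)) = (redGram Y ε : ℂ) := inner_massOp_self _

lemma IsReduction.inner_redVec_one (h : IsReduction A₁ Y N (ε, toC 0)) (hA : SmoothPeriodic A₁)
    (hε : IsHoneycombMedium (lowContrast A₁ ε)) :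
    inner ℂ (redVec Y ε 1) (massOp (redVec Y ε 1)) = (redGram Y ε : ℂ) := by
  have h1 : redVec Y ε 1 = conjSeq (redVec Y ε 0) := (h.conjSeq_redVec hA hε 0).symm
  rw [h1, ← conjSeq_massOp, inner_conjSeq, inner_redVec_zero, Complex.conj_ofReal]

/-- The rotation is unitary for the mass form, so different characters are orthogonal. -/
lemma inner_eq_zero_of_rot {x y : Seq} {a b : Fin 3} (hab : a ≠ b)
    (hx : rotSeq x = rotChar a • x) (hy : rotSeq y = rotChar b • y) :
    inner ℂ x (massOp y) = 0 := by
  have h1 := inner_rotSeq x (massOp y)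
  rw [rotSeq_massOp, hx, hy, map_smul, inner_smul_left, inner_smul_right] at h1
  have h2 := rotChar_mul_conj a
  have h3 : (rotChar b - rotChar a) * inner ℂ x (massOp y) = 0 := by
    linear_combination rotChar a * h1 - rotChar b * inner ℂ x (massOp y) * h2
  exact (mul_eq_zero.1 h3).resolve_left (sub_ne_zero.2 fun e => hab (rotChar_injective e.symm))

/-- The coefficients of the normalized eigenfunction `Φ₁`. -/
def diracVec (Y : ℂ × (Fin 2 → ℂ) → (Fin 3 → ℂ) →L[ℂ] Seq) (ε : ℝ) : Seq :=
  (((Real.sqrt (redGram Y ε))⁻¹ : ℝ) : ℂ) • redVec Y ε 0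

/-- The coefficients of the normalized eigenfunction `Φ₂`. -/
def diracVec' (Y : ℂ × (Fin 2 → ℂ) → (Fin 3 → ℂ) →L[ℂ] Seq) (ε : ℝ) : Seq :=
  (((Real.sqrt (redGram Y ε))⁻¹ : ℝ) : ℂ) • redVec Y ε 1

lemma IsReduction.normalization_ne_zero (h : IsReduction A₁ Y N (ε, toC 0)) :
    (((Real.sqrt (redGram Y ε))⁻¹ : ℝ) : ℂ) ≠ 0 :=
  Complex.ofReal_ne_zero.2 (inv_ne_zero (Real.sqrt_pos.2 h.redGram_pos).ne')

lemma IsReduction.normalization_mul (h : IsReduction A₁ Y N (ε, toC 0)) (z : ℂ) :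
    (((Real.sqrt (redGram Y ε))⁻¹ : ℝ) : ℂ) * ((((Real.sqrt (redGram Y ε))⁻¹ : ℝ) : ℂ) * z) =
      z / redGram Y ε := by
  rw [← mul_assoc, ← Complex.ofReal_mul, ← mul_inv, Real.mul_self_sqrt h.redGram_pos.le]
  push_cast
  ring

lemma IsReduction.PC_bf_diracVec (h : IsReduction A₁ Y N (ε, toC 0)) (hA : SmoothPeriodic A₁)
    (hε : IsHoneycombMedium (lowContrast A₁ ε)) :
    PC (bf 0 (diracVec Y ε)) =ᵐ[volume] bf 0 (diracVec' Y ε) := by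
  refine (PC_bf 0 _).trans (Eventually.of_forall fun x => ?_)
  rw [diracVec, conjSeq_smul, h.conjSeq_redVec hA hε, Complex.conj_ofReal]
  rfl

/-- The modulus of the off-diagonal velocity matrix element. -/
def redVelocity (A₁ : Medium) (Y : ℂ × (Fin 2 → ℂ) → (Fin 3 → ℂ) →L[ℂ] Seq) (ε : ℝ) : ℝ :=
  ‖inner ℂ (redVec Y ε 0) (velOp A₁ ε 0 (redVec Y ε 1))‖ / redGram Y ε

/-- With matrix elements related by z₁ = i z₀, the sum z̄₀ + i z̄₁ is 2 z̄₀, and the factor ½ leaves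
the modulus of z₀. -/
lemma IsReduction.fermiVelocity_eq (h : IsReduction A₁ Y N (ε, toC 0)) (hA : SmoothPeriodic A₁)
    (hε : IsHoneycombMedium (lowContrast A₁ ε)) :
    fermiVelocity (lowContrast A₁ ε) (bf 0 (diracVec Y ε)) (PC (bf 0 (diracVec Y ε))) =
      redVelocity A₁ Y ε := by
  have hz := velocity_off_diagonal hA hε (h.rotSeq_redVec hA hε 0) (h.rotSeq_redVec hA hε 1)
  rw [fermiVelocity, vecOp_eq_of_ae _ 0 (h.PC_bf_diracVec hA hε),
    vecOp_eq_of_ae _ 1 (h.PC_bf_diracVec hA hε), cellInner_vecOp hA, cellInner_vecOp hA,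
    diracVec, diracVec']
  simp only [map_smul, inner_smul_left, inner_smul_right, Complex.conj_ofReal,
    h.normalization_mul, hz]
  have hn : redVelocity A₁ Y ε =
      ‖(starRingEnd ℂ) (inner ℂ (redVec Y ε 0) (velOp A₁ ε 0 (redVec Y ε 1)) / redGram Y ε)‖ := by
    rw [Complex.norm_conj, norm_div, Complex.norm_real, Real.norm_eq_abs,
      abs_of_pos h.redGram_pos, redVelocity]
  rw [hn]
  congr 1
  simp only [map_div₀, map_mul, Complex.conj_I, Complex.conj_ofReal]
  linear_combination (-(1 / 2) * ((starRingEnd ℂ)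
    (inner ℂ (redVec Y ε 0) ((velOp A₁ ε 0) (redVec Y ε 1))) / redGram Y ε)) * Complex.I_sq

/-- The eigenspace of the Dirac energy at `K`. -/
lemma IsReduction.dirac_eigenspace (h : IsReduction A₁ Y N (ε, toC 0)) (hA : SmoothPeriodic A₁)
    (hε : IsHoneycombMedium (lowContrast A₁ ε)) (hne : redEnergy N ε 2 ≠ redEnergy N ε 0) :
    ∃ Φ₁ Φ₂ : Plane → ℂ, Φ₂ = PC Φ₁ ∧
      MemL2Rot K τ Φ₁ ∧ MemL2Rot K ((starRingEnd ℂ) τ) Φ₂ ∧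
      cellInner Φ₁ Φ₁ = 1 ∧ cellInner Φ₂ Φ₂ = 1 ∧ cellInner Φ₁ Φ₂ = 0 ∧
      ∀ f, InEigenspace (lowContrast A₁ ε) K (redEnergy N ε 0) f ↔
        ∃ c₁ c₂ : ℂ, f =ᵐ[volume] fun x => c₁ * Φ₁ x + c₂ * Φ₂ x := by
  have hPC := h.PC_bf_diracVec hA hε
  have hg : (redGram Y ε : ℂ) ≠ 0 := Complex.ofReal_ne_zero.2 h.redGram_pos.ne'
  have hE1 : redEnergy N ε 1 = redEnergy N ε 0 := congrArg Complex.re (h.diagEntry_conjIndex hA hε)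
  have hcomb : ∀ c₁ c₂ : ℂ, (bf 0 (c₁ • diracVec Y ε + c₂ • diracVec' Y ε)) =ᵐ[volume]
      fun x => c₁ * bf 0 (diracVec Y ε) x + c₂ * PC (bf 0 (diracVec Y ε)) x := by
    intro c₁ c₂
    filter_upwards [bf_add 0 (c₁ • diracVec Y ε) (c₂ • diracVec' Y ε),
      bf_smul 0 c₁ (diracVec Y ε), bf_smul 0 c₂ (diracVec' Y ε), hPC] with x e1 e2 e3 e4
    rw [e1, e2, e3, e4]
  refine ⟨bf 0 (diracVec Y ε), _, rfl, memL2Rot_bf.2 ?_,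
    (memL2Rot_bf.2 ?_ : MemL2Rot K _ (bf 0 (diracVec' Y ε))).congr hPC.symm, ?_, ?_, ?_,
    fun f => ⟨fun hf => ?_, ?_⟩⟩
  · rw [diracVec, rotSeq_smul, h.rotSeq_redVec hA hε, smul_comm]; rfl
  · rw [diracVec', rotSeq_smul, h.rotSeq_redVec hA hε, smul_comm]; rfl
  · rw [cellInner_bf, diracVec, map_smul, inner_smul_left, inner_smul_right, Complex.conj_ofReal,
      h.normalization_mul, inner_redVec_zero, div_self hg]
  · rw [cellInner_congr (ae_restrict_of_ae hPC) (ae_restrict_of_ae hPC), cellInner_bf, diracVec',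
      map_smul, inner_smul_left, inner_smul_right, Complex.conj_ofReal, h.normalization_mul,
      h.inner_redVec_one hA hε, div_self hg]
  · rw [cellInner_congr (ae_eq_refl _) (ae_restrict_of_ae hPC), cellInner_bf, diracVec, diracVec',
      map_smul, inner_smul_left, inner_smul_right,
      inner_eq_zero_of_rot (show (0 : Fin 3) ≠ 1 by decide) (h.rotSeq_redVec hA hε 0)
        (h.rotSeq_redVec hA hε 1), mul_zero, mul_zero]
  · obtain ⟨y, hy⟩ := hf.1.exists_bf_zero
    have h2 := (inEigenspace_bf_zero hA _ _ _).1 (hf.congr hy)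
    obtain ⟨v, -, hsum, hv⟩ := h.exists_coords hA hε (h.redEnergy_lt hA hε 0) h2
    have hv2 : v 2 = 0 := (hv 2).resolve_right hne.symm
    have hn := h.normalization_ne_zero
    have hye : y = (v 0 * (((Real.sqrt (redGram Y ε))⁻¹ : ℝ) : ℂ)⁻¹) • diracVec Y ε +
        (v 1 * (((Real.sqrt (redGram Y ε))⁻¹ : ℝ) : ℂ)⁻¹) • diracVec' Y ε := by
      rw [diracVec, diracVec', smul_smul, smul_smul, inv_mul_cancel_right₀ hn,
        inv_mul_cancel_right₀ hn, hsum, Fin.sum_univ_three, hv2, zero_smul, add_zero]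
    rw [hye] at hy
    exact ⟨_, _, hy.trans (hcomb _ _)⟩
  · rintro ⟨c₁, c₂, hf⟩
    refine InEigenspace.congr ((inEigenspace_bf_zero hA _ _ _).2 ?_)
      ((hcomb c₁ c₂).trans hf.symm)
    have h1 := h.formOp_redVec hA hε 1
    rw [hE1] at h1
    rw [diracVec, diracVec']
    simp only [map_add, map_smul, h1, h.formOp_redVec hA hε 0]
    module

end Reduction

end Honeycomb
end

noncomputable section

namespace Honeycomb

/-! ### Asymptotics in the contrast -/

open Asymptotics

lemma isBigO_ofReal {E : Type*} [NormedAddCommGroup E] [NormedSpace ℂ E] {f : ℂ → E}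
    (hf : DifferentiableAt ℂ f 0) :
    (fun ε : ℝ => f ε - f 0) =O[𝓝 0] fun ε : ℝ => ε := by
  have h1 : (fun z : ℂ => f z - f 0) =O[𝓝 0] fun z : ℂ => z - 0 := hf.isBigO_sub
  have h2 : Tendsto (fun ε : ℝ => (ε : ℂ)) (𝓝 0) (𝓝 0) := by
    have := Complex.continuous_ofReal.tendsto 0
    rwa [Complex.ofReal_zero] at this
  refine (h1.comp_tendsto h2).trans (IsBigO.of_bound 1 (Eventually.of_forall fun ε => ?_))
  simp

lemma isBigO_one_of_sub {E : Type*} [NormedAddCommGroup E] {a : ℝ → E} {a₀ : E}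
    (ha : (fun ε => a ε - a₀) =O[𝓝 0] fun ε : ℝ => ε) : a =O[𝓝 0] fun _ => (1 : ℝ) := by
  have h1 : (fun ε : ℝ => ε) =O[𝓝 0] fun _ => (1 : ℝ) := continuousAt_id.isBigO_one ℝ
  have h2 := (ha.trans h1).add (isBigO_const_const a₀ (one_ne_zero (α := ℝ)) (𝓝 0))
  simpa using h2

lemma isBigO_inner {a b : ℝ → Seq} {a₀ b₀ : Seq}
    (ha : (fun ε => a ε - a₀) =O[𝓝 0] fun ε : ℝ => ε)
    (hb : (fun ε => b ε - b₀) =O[𝓝 0] fun ε : ℝ => ε) :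
    (fun ε => inner ℂ (a ε) (b ε) - inner ℂ a₀ (b₀)) =O[𝓝 0] fun ε : ℝ => ε := by
  have h1 : (fun ε => inner ℂ (a ε - a₀) (b ε)) =O[𝓝 0] fun ε : ℝ => ε := by
    refine (IsBigO.of_bound 1 (Eventually.of_forall fun ε => ?_)).trans
      ((ha.norm_left.mul (isBigO_one_of_sub hb).norm_left).trans (by simpa using isBigO_refl _ _))
    rw [one_mul, Real.norm_eq_abs, abs_of_nonneg (by positivity)]
    exact norm_inner_le_norm _ _
  have h2 : (fun ε => inner ℂ a₀ (b ε - b₀)) =O[𝓝 0] fun ε : ℝ => ε := by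
    refine (IsBigO.of_bound ‖a₀‖ (Eventually.of_forall fun ε => ?_)).trans hb
    exact norm_inner_le_norm _ _
  refine (h1.add h2).congr_left fun ε => ?_
  rw [inner_sub_left, inner_sub_right]
  ring

lemma differentiable_contrastOp (A₁ : Medium) (i j : Fin 2) :
    Differentiable ℂ fun ε : ℂ => contrastOp A₁ ε i j :=
  (differentiable_const _).add (differentiable_id.smul_const _)

lemma differentiable_velOp (A₁ : Medium) (j : Fin 2) : Differentiable ℂ fun ε => velOp A₁ ε j := by
  have : (fun ε => velOp A₁ ε j) = fun ε => ∑ l, (embOp ∘L contrastOp A₁ ε j l ∘L momOp l +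
    momOp l ∘L contrastOp A₁ ε l j ∘L embOp) := rfl
  rw [this]
  refine Differentiable.fun_sum fun l _ => Differentiable.add ?_ ?_
  · exact (differentiable_const _).clm_comp
      ((differentiable_contrastOp A₁ j l).clm_comp (differentiable_const _))
  · exact (differentiable_const _).clm_comp
      ((differentiable_contrastOp A₁ l j).clm_comp (differentiable_const _))

lemma velOp_zero_unitSeq (A₁ : Medium) (j : Fin 2) (n m : ℤ × ℤ) :
    inner ℂ (unitSeq m) (velOp A₁ 0 j (unitSeq n)) =
      if m = n then ((2 * (K + dualVec n) j / weight n ^ 2 : ℝ) : ℂ) else 0 := by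
  have h1 : velOp A₁ 0 j (unitSeq n) = (2 : ℂ) • embOp (momOp j (unitSeq n)) := by
    have hc : embOp ∘L momOp j = momOp j ∘L embOp := by
      ext1 y
      ext m
      change embOp (momOp j y) m = momOp j (embOp y) m
      simp only [embOp_apply, momOp_apply]
      ring
    have hc' : ∀ y, momOp j (embOp y) = embOp (momOp j y) := fun y =>
      (congrArg (fun T : Seq →L[ℂ] Seq => T y) hc).symm
    fin_cases j <;>
    · simp only [Fin.zero_eta, Fin.mk_one, Fin.isValue] at hc'
      simp [velOp, contrastOp, Fin.sum_univ_two, hc', two_smul]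
  rw [h1, inner_smul_right, inner_unitSeq, embOp_apply, momOp_apply, unitSeq_apply]
  split_ifs with h
  · subst h
    push_cast
    have := Complex.ofReal_ne_zero.2 (weight_pos m).ne'
    field_simp
  · simp

/-- At ε = 0 the velocity is diagonal in plane waves, with entries proportional to the first
coordinates of K, RK and R²K. These are 0 and ±(√3/2)|K|, and their character sum is −i|K|. -/
lemma norm_velocity_zero (A₁ : Medium) :
    ‖inner ℂ (coreVec 0) (velOp A₁ 0 0 (coreVec 1))‖ = 4 * Real.pi / 3 := by
  obtain ⟨k0, k1⟩ := K_apply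
  obtain ⟨r0, r1⟩ := rot_apply K
  obtain ⟨rr0, -⟩ := rot_apply (rot K)
  have e0 : (K + dualVec (coreMode 0)) 0 = 0 := by
    have h0 : dualVec (coreMode 0) = 0 := dualVec_zero
    rw [h0, add_zero, k0]
  have e1 : (K + dualVec (coreMode 1)) 0 = Real.sqrt 3 / 2 * (4 * Real.pi / 3) := by
    have h0 : K + dualVec (coreMode 1) = rot K := rot_K.symm
    rw [h0, r0, k0, k1]; ring
  have e2 : (K + dualVec (coreMode 2)) 0 = -(Real.sqrt 3 / 2 * (4 * Real.pi / 3)) := by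
    have h0 : K + dualVec (coreMode 2) = rot (rot K) := rot_rot_K.symm
    rw [h0, rr0, r0, r1, k0, k1]; ring
  have hw : (coreWeight : ℂ) ≠ 0 := Complex.ofReal_ne_zero.2 coreWeight_pos.ne'
  have key : inner ℂ (coreVec 0) (velOp A₁ 0 0 (coreVec 1)) =
      -(Complex.I * ((4 * Real.pi / 3 : ℝ) : ℂ)) := by
    rw [inner_coreVec]
    simp only [velOp_zero_unitSeq, coreMode_injective.eq_iff, Fin.sum_univ_three, weight_coreMode,
      e0, e1, e2, coreCoef]
    simp [rotChar_zero, rotChar_one]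
    have hs := sqrt_three_half_sq
    have ht := τ_eq
    have h3 := τ_cube
    push_cast at hs ht
    have h4 : τ ^ 2 * τ ^ 2 = τ := by linear_combination τ * h3
    have h5 : τ * τ = -(1 / 2) - Real.sqrt 3 / 2 * Complex.I := by
      linear_combination τ_sum - ht
    rw [h4, h5, ht]
    field_simp
    linear_combination (-8 * Complex.I : ℂ) * hs
  rw [key, norm_neg, norm_mul, Complex.norm_I, one_mul, Complex.norm_real, Real.norm_eq_abs,
    abs_of_pos (by have := Real.pi_pos; positivity)]

section Reduction

variable {A₁ : Medium} {Y : ℂ × (Fin 2 → ℂ) → (Fin 3 → ℂ) →L[ℂ] Seq}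
  {N : ℂ × (Fin 2 → ℂ) → (Fin 3 → ℂ) →L[ℂ] (Fin 3 → ℂ)}

/-- The operator `T` is left general so that eigenvectors, mass, velocity and contrast are covered
at once. -/
lemma differentiableAt_slice (hY : ContDiffAt ℂ 2 Y 0) (T : ℂ → Seq →L[ℂ] Seq)
    (hT : Differentiable ℂ T) (a : Fin 3) :
    (fun ε : ℝ => T ε (redVec Y ε a) - T 0 (Y 0 (Pi.single a 1))) =O[𝓝 0] fun ε : ℝ => ε := by
  have h0 : DifferentiableAt ℂ (fun z : ℂ => (z, (0 : Fin 2 → ℂ))) 0 :=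
    differentiableAt_id.prodMk (differentiableAt_const _)
  have h1 : DifferentiableAt ℂ (fun z : ℂ => Y (z, 0)) 0 :=
    DifferentiableAt.comp (g := Y) (f := fun z : ℂ => (z, (0 : Fin 2 → ℂ))) 0
      (hY.differentiableAt (by simp)) h0
  have h2 := isBigO_ofReal ((hT.differentiableAt.clm_comp h1).clm_apply
    (differentiableAt_const (Pi.single a 1 : Fin 3 → ℂ)))
  refine h2.congr_left fun ε => ?_
  rw [redVec, toC_zero]
  rfl

lemma isBigO_redVec (hY : ContDiffAt ℂ 2 Y 0) (hY0 : Y 0 = coreEmb) (a : Fin 3) :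
    (fun ε : ℝ => redVec Y ε a - coreVec a) =O[𝓝 0] fun ε : ℝ => ε := by
  have := differentiableAt_slice hY (fun _ => ContinuousLinearMap.id ℂ Seq)
    (differentiable_const _) a
  rwa [hY0, coreEmb_single] at this

lemma isBigO_redGram (hY : ContDiffAt ℂ 2 Y 0) (hY0 : Y 0 = coreEmb) :
    (fun ε : ℝ => redGram Y ε - 1) =O[𝓝 0] fun ε : ℝ => ε := by
  have h1 := differentiableAt_slice hY (fun _ => massOp) (differentiable_const _) 0
  rw [hY0, coreEmb_single] at h1
  have h2 := isBigO_inner (isBigO_redVec hY hY0 0) h1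
  refine (IsBigO.of_bound 1 (Eventually.of_forall fun ε => ?_)).trans h2
  rw [one_mul, ← coreProj_apply, coreProj_coreVec, if_pos rfl, inner_redVec_zero,
    ← Complex.ofReal_one, ← Complex.ofReal_sub, Complex.norm_real]

lemma isBigO_redVelocity (hY : ContDiffAt ℂ 2 Y 0) (hY0 : Y 0 = coreEmb) :
    (fun ε : ℝ => redVelocity A₁ Y ε - 4 * Real.pi / 3) =O[𝓝 0] fun ε : ℝ => ε := by
  have h1 := differentiableAt_slice hY (fun ε => velOp A₁ ε 0) (differentiable_velOp A₁ 0) 1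
  rw [hY0, coreEmb_single] at h1
  have h2 := isBigO_inner (isBigO_redVec hY hY0 0) h1
  have h3 : (fun ε : ℝ => ‖inner ℂ (redVec Y ε 0) (velOp A₁ ε 0 (redVec Y ε 1))‖ -
      4 * Real.pi / 3) =O[𝓝 0] fun ε : ℝ => ε := by
    refine (IsBigO.of_bound 1 (Eventually.of_forall fun ε => ?_)).trans h2
    rw [one_mul, ← norm_velocity_zero A₁, Real.norm_eq_abs]
    exact abs_norm_sub_norm_le _ _
  have hg := isBigO_redGram hY hY0
  have hlim : Tendsto (redGram Y) (𝓝 0) (𝓝 1) := by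
    have := (hg.trans_tendsto continuousAt_id.tendsto).add_const 1
    simpa using this
  have hinv : (fun ε => (redGram Y ε)⁻¹) =O[𝓝 0] fun _ => (1 : ℝ) :=
    (hlim.inv₀ one_ne_zero).isBigO_one ℝ
  have h4 := ((h3.sub (hg.const_mul_left (4 * Real.pi / 3))).mul hinv)
  have hne : ∀ᶠ ε in 𝓝 0, redGram Y ε ≠ 0 := hlim.eventually_ne one_ne_zero
  refine (h4.congr' ?_ (Eventually.of_forall fun ε => mul_one ε))
  filter_upwards [hne] with ε hε
  rw [redVelocity]
  field_simp
  ring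

lemma isBigO_redEnergy (hA : ∀ᶠ ε : ℝ in 𝓝 0, IsHoneycombMedium (lowContrast A₁ ε))
    (hY : ContDiffAt ℂ 2 Y 0) (hY0 : Y 0 = coreEmb)
    (hR : ∀ᶠ ε : ℝ in 𝓝 0, IsReduction A₁ Y N (ε, toC 0)) (a : Fin 3) :
    (fun ε : ℝ => (redEnergy N ε a : ℂ) - ((‖K‖ : ℂ) ^ 2 +
      (ε : ℂ) * (bilin K (fourierCoeff A₁ (0, 0)) K +
        (if a = 2 then 2 else -1) * bilin K (fourierCoeff A₁ (0, -1)) (rot K)))) =O[𝓝 0]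
      fun ε : ℝ => ε ^ 2 := by
  have h1 := differentiableAt_slice hY (fun _ => contrastDeriv A₁) (differentiable_const _) a
  rw [hY0, coreEmb_single] at h1
  have h0 : (fun _ : ℝ => coreVec a - coreVec a) =O[𝓝 0] fun ε : ℝ => ε := by
    simpa using isBigO_zero _ _
  have h2 := isBigO_inner h0 h1
  have h3 : (fun ε : ℝ => (ε : ℂ)) =O[𝓝 0] fun ε : ℝ => ε :=
    IsBigO.of_bound 1 (Eventually.of_forall fun ε => by simp)
  refine (h3.mul h2).congr' ?_ (Eventually.of_forall fun ε => (pow_two ε).symm)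
  filter_upwards [hA, hR] with ε hε h
  have h4 : (redEnergy N ε a : ℂ) = diagEntry N ε a :=
    Complex.conj_eq_iff_re.1 (h.conj_diagEntry (smoothPeriodic_of_eventually hA) hε a)
  rw [h4, h.diagEntry_eq, inner_coreVec_contrastDeriv hA]
  push_cast
  change _ * (inner ℂ (coreVec a) (contrastDeriv A₁ (Y (ε, toC 0) (Pi.single a 1))) - _) = _
  ring

end Reduction

end Honeycomb
end

noncomputable section

namespace Honeycomb

/-! ### Functions vanishing to a given order in the Lipschitz sense -/

/-- `f` vanishes at the origin and has Lipschitz constant `O(rⁿ)` on small balls of radius `r`. -/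
def LipOrder {E F : Type*} [NormedAddCommGroup E] [NormedAddCommGroup F] (n : ℕ)
    (f : E → F) : Prop :=
  f 0 = 0 ∧ ∃ C r : ℝ, 0 ≤ C ∧ 0 < r ∧ r ≤ 1 ∧ ∀ x y, ‖x‖ < r → ‖y‖ ≤ ‖x‖ →
    ‖f x - f y‖ ≤ C * ‖x‖ ^ n * ‖x - y‖

namespace LipOrder

variable {E F : Type*} [NormedAddCommGroup E] [NormedAddCommGroup F] {n m : ℕ} {f g : E → F}

lemma exists_bound (hf : LipOrder n f) : ∃ C r : ℝ, 0 ≤ C ∧ 0 < r ∧ r ≤ 1 ∧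
    (∀ x y, ‖x‖ < r → ‖y‖ ≤ ‖x‖ → ‖f x - f y‖ ≤ C * ‖x‖ ^ n * ‖x - y‖) ∧
    ∀ x, ‖x‖ < r → ‖f x‖ ≤ C * ‖x‖ ^ (n + 1) := by
  obtain ⟨h0, C, r, hC, hr, hr1, h⟩ := hf
  refine ⟨C, r, hC, hr, hr1, h, fun x hx => ?_⟩
  have := h x 0 hx (by simp)
  rwa [h0, sub_zero, sub_zero, mul_assoc, ← pow_succ] at this

lemma add (hf : LipOrder n f) (hg : LipOrder n g) : LipOrder n fun x => f x + g x := by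
  obtain ⟨f0, C, r, hC, hr, hr1, h⟩ := hf
  obtain ⟨g0, C', r', hC', hr', -, h'⟩ := hg
  refine ⟨by simp [f0, g0], C + C', min r r', by positivity, lt_min hr hr',
    (min_le_left _ _).trans hr1, fun x y hx hy => ?_⟩
  dsimp only
  have e1 := h x y (hx.trans_le (min_le_left _ _)) hy
  have e2 := h' x y (hx.trans_le (min_le_right _ _)) hy
  calc _ = ‖(f x - f y) + (g x - g y)‖ := by congr 1; abel
    _ ≤ _ := (norm_add_le _ _).trans (add_le_add e1 e2)
    _ = _ := by ring

lemma neg (hf : LipOrder n f) : LipOrder n fun x => -f x := by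
  obtain ⟨f0, C, r, hC, hr, hr1, h⟩ := hf
  refine ⟨by simp [f0], C, r, hC, hr, hr1, fun x y hx hy => ?_⟩
  dsimp only
  rw [neg_sub_neg, norm_sub_rev]
  exact h x y hx hy

lemma sub (hf : LipOrder n f) (hg : LipOrder n g) : LipOrder n fun x => f x - g x := by
  simpa only [sub_eq_add_neg] using hf.add hg.neg

lemma mono (hf : LipOrder n f) (h : m ≤ n) : LipOrder m f := by
  obtain ⟨f0, C, r, hC, hr, hr1, h'⟩ := hf
  refine ⟨f0, C, r, hC, hr, hr1, fun x y hx hy => (h' x y hx hy).trans ?_⟩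
  have := pow_le_pow_of_le_one (norm_nonneg x) (hx.le.trans hr1) h
  gcongr

/-- The extra 1 appears because each factor vanishes at the origin, so its size is one order better
than its Lipschitz constant. -/
lemma mul {𝕜 : Type*} [NormedField 𝕜] {f g : E → 𝕜} (hf : LipOrder n f) (hg : LipOrder m g) :
    LipOrder (n + m + 1) fun x => f x * g x := by
  obtain ⟨C, r, hC, hr, hr1, h, hb⟩ := hf.exists_bound
  obtain ⟨C', r', hC', hr', -, h', hb'⟩ := hg.exists_bound
  refine ⟨by simp [hf.1], 2 * (C * C'), min r r', by positivity, lt_min hr hr',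
    (min_le_left _ _).trans hr1, fun x y hx hy => ?_⟩
  dsimp only
  have e1 := h x y (hx.trans_le (min_le_left _ _)) hy
  have e2 := h' x y (hx.trans_le (min_le_right _ _)) hy
  have e3 := hb y (hy.trans_lt (hx.trans_le (min_le_left _ _)))
  have e4 := hb' x (hx.trans_le (min_le_right _ _))
  have e5 : ‖f y‖ ≤ C * ‖x‖ ^ (n + 1) := e3.trans (by gcongr)
  calc _ = ‖(f x - f y) * g x + f y * (g x - g y)‖ := by congr 1; ring
    _ ≤ ‖f x - f y‖ * ‖g x‖ + ‖f y‖ * ‖g x - g y‖ := by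
      rw [← norm_mul, ← norm_mul]; exact norm_add_le _ _
    _ ≤ (C * ‖x‖ ^ n * ‖x - y‖) * (C' * ‖x‖ ^ (m + 1)) +
        (C * ‖x‖ ^ (n + 1)) * (C' * ‖x‖ ^ m * ‖x - y‖) := by gcongr
    _ = _ := by ring

lemma of_le {G : Type*} [NormedAddCommGroup G] {u : E → G} (hf : LipOrder n f) (h0 : u 0 = 0)
    (h : ∀ x y, ‖u x - u y‖ ≤ ‖f x - f y‖) : LipOrder n u := by
  obtain ⟨-, C, r, hC, hr, hr1, h'⟩ := hf
  exact ⟨h0, C, r, hC, hr, hr1, fun x y hx hy => (h x y).trans (h' x y hx hy)⟩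

lemma re {f : E → ℂ} (hf : LipOrder n f) : LipOrder n fun x => (f x).re :=
  hf.of_le (by rw [hf.1, Complex.zero_re]) fun x y => by
    rw [← Complex.sub_re]
    exact Complex.abs_re_le_norm _

lemma const_mul {𝕜 : Type*} [NormedField 𝕜] {f : E → 𝕜} (hf : LipOrder n f) (c : 𝕜) :
    LipOrder n fun x => c * f x := by
  obtain ⟨f0, C, r, hC, hr, hr1, h⟩ := hf
  refine ⟨by simp [f0], ‖c‖ * C, r, by positivity, hr, hr1, fun x y hx hy => ?_⟩
  dsimp only
  rw [← mul_sub, norm_mul, mul_assoc, mul_assoc]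
  refine mul_le_mul_of_nonneg_left ?_ (norm_nonneg c)
  rw [← mul_assoc]
  exact h x y hx hy

lemma of_linear {f : E → F} (h0 : f 0 = 0) {C : ℝ} (hC : 0 ≤ C)
    (h : ∀ x y, ‖f x - f y‖ ≤ C * ‖x - y‖) : LipOrder 0 f :=
  ⟨h0, C, 1, hC, one_pos, le_rfl, fun x y _ _ => by simpa using h x y⟩

/-- Division by the norm lowers the order by one. -/
lemma div_norm {f : E → ℝ} (hf : LipOrder (n + 1) f) : LipOrder n fun x => f x / ‖x‖ := by
  obtain ⟨C, r, hC, hr, hr1, h, hb⟩ := hf.exists_bound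
  refine ⟨by simp, 2 * C, r, by positivity, hr, hr1, fun x y hx hy => ?_⟩
  dsimp only
  rcases eq_or_ne x 0 with rfl | hx0
  · have : y = 0 := by simpa using hy
    subst this; simp
  have hxp : 0 < ‖x‖ := norm_pos_iff.2 hx0
  rcases eq_or_ne y 0 with rfl | hy0
  · have := hb x hx
    rw [norm_zero, div_zero, sub_zero, sub_zero, norm_div, norm_norm, div_le_iff₀ hxp]
    refine this.trans ?_
    have h2 : 0 ≤ C * ‖x‖ ^ (n + 1 + 1) := by positivity
    calc C * ‖x‖ ^ (n + 1 + 1) ≤ C * ‖x‖ ^ (n + 1 + 1) + C * ‖x‖ ^ (n + 1 + 1) := by linarith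
      _ = _ := by ring
  have hyp : 0 < ‖y‖ := norm_pos_iff.2 hy0
  have e1 := h x y hx hy
  have e2 := hb y (hy.trans_lt hx)
  have e3 : f x / ‖x‖ - f y / ‖y‖ = (f x - f y) / ‖x‖ + f y / ‖y‖ * ((‖y‖ - ‖x‖) / ‖x‖) := by
    field_simp
    ring
  have e4 : ‖f y / ‖y‖‖ ≤ C * ‖x‖ ^ (n + 1) := by
    rw [norm_div, norm_norm, div_le_iff₀ hyp]
    calc _ ≤ C * ‖y‖ ^ (n + 1 + 1) := e2
      _ = C * ‖y‖ ^ (n + 1) * ‖y‖ := by ring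
      _ ≤ _ := by gcongr
  have e5 : ‖(‖y‖ - ‖x‖) / ‖x‖‖ ≤ ‖x - y‖ / ‖x‖ := by
    rw [norm_div, norm_norm, Real.norm_eq_abs]
    gcongr
    rw [norm_sub_rev]
    exact abs_norm_sub_norm_le y x
  have e6 : ‖(f x - f y) / ‖x‖‖ ≤ C * ‖x‖ ^ (n + 1) * ‖x - y‖ / ‖x‖ := by
    rw [norm_div, norm_norm]
    gcongr
  calc _ ≤ ‖(f x - f y) / ‖x‖‖ + ‖f y / ‖y‖‖ * ‖(‖y‖ - ‖x‖) / ‖x‖‖ := by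
        rw [e3, ← norm_mul]; exact norm_add_le _ _
    _ ≤ C * ‖x‖ ^ (n + 1) * ‖x - y‖ / ‖x‖ + C * ‖x‖ ^ (n + 1) * (‖x - y‖ / ‖x‖) := by gcongr
    _ = _ := by
      field_simp
      ring

/-- Square roots near one preserve the Lipschitz order. -/
lemma sqrt_one_add {f : E → ℝ} (hf : LipOrder 0 f) :
    LipOrder 0 fun x => Real.sqrt (1 + f x) - 1 := by
  obtain ⟨C, r, hC, hr, hr1, h, hb⟩ := hf.exists_bound
  -- On this radius |f| ≤ 1/2. Then both square roots are at least 1/2, their sum is at least 1, and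
  -- the constant `C` serves unchanged.
  refine ⟨by simp [hf.1], C, min r (1 / (2 * (C + 1))), hC, lt_min hr (by positivity),
    (min_le_left _ _).trans hr1, fun x y hx hy => ?_⟩
  dsimp only
  have hhalf : ∀ z, ‖z‖ < min r (1 / (2 * (C + 1))) → 1 / 2 ≤ 1 + f z := by
    intro z hz
    have h1 := hb z (hz.trans_le (min_le_left _ _))
    have h2 := hz.trans_le (min_le_right _ _)
    rw [lt_div_iff₀ (by positivity)] at h2
    rw [zero_add, pow_one, Real.norm_eq_abs] at h1
    have h3 := (abs_le.1 h1).1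
    nlinarith [norm_nonneg z]
  have ha := hhalf x hx
  have hb := hhalf y (hy.trans_lt hx)
  refine le_trans ?_ (h x y (hx.trans_le (min_le_left _ _)) hy)
  rw [sub_sub_sub_cancel_right]
  set a := 1 + f x with hadef
  set b := 1 + f y with hbdef
  have e1 : f x - f y = (Real.sqrt a - Real.sqrt b) * (Real.sqrt a + Real.sqrt b) := by
    have e2 := Real.mul_self_sqrt (show 0 ≤ a by linarith)
    have e3 := Real.mul_self_sqrt (show 0 ≤ b by linarith)
    linear_combination e3 - e2 + hadef - hbdef
  have hs : ∀ c : ℝ, 1 / 2 ≤ c → 1 / 2 ≤ Real.sqrt c := fun c hc =>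
    Real.le_sqrt_of_sq_le (by linarith)
  have h1 := hs a ha
  have h2 := hs b hb
  rw [e1, norm_mul]
  refine le_mul_of_one_le_right (norm_nonneg _) ?_
  rw [Real.norm_eq_abs, abs_of_nonneg (by linarith)]
  linarith

/-- Functions of order zero are Lipschitz near the origin. -/
lemma exists_lipschitzOnWith {f : E → ℝ} (hf : LipOrder 0 f) : ∃ (L : ℝ≥0) (r : ℝ), 0 < r ∧
    ∀ ρ, ρ ≤ r → LipschitzOnWith L f (Metric.ball 0 ρ) ∧
      ∀ x ∈ Metric.ball (0 : E) ρ, |f x| ≤ L * ‖x‖ := by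
  obtain ⟨C, r, hC, hr, -, h, hb⟩ := hf.exists_bound
  refine ⟨⟨C, hC⟩, r, hr, fun ρ hρ => ⟨LipschitzOnWith.of_dist_le_mul fun x hx y hy => ?_,
    fun x hx => ?_⟩⟩
  · rw [mem_ball_zero_iff] at hx hy
    rw [dist_eq_norm, dist_eq_norm]
    change _ ≤ C * _
    rcases le_total ‖y‖ ‖x‖ with hxy | hxy
    · simpa using h x y (hx.trans_le hρ) hxy
    · rw [norm_sub_rev, norm_sub_rev x y]
      simpa using h y x (hy.trans_le hρ) hxy
  · rw [mem_ball_zero_iff] at hx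
    change _ ≤ C * _
    simpa using hb x (hx.trans_le hρ)

end LipOrder

/-- The remainder of the first order Taylor expansion of a `C²` function has order one. -/
lemma exists_taylor_bound {E F : Type*} [NormedAddCommGroup E] [NormedSpace ℂ E]
    [NormedAddCommGroup F] [NormedSpace ℂ F] {f : E → F} (hf : ContDiffAt ℂ 2 f 0) :
    LipOrder 1 fun x => f x - f 0 - fderiv ℂ f 0 x := by
  have h1 : ContDiffAt ℂ 1 (fderiv ℂ f) 0 := hf.fderiv_right (by norm_num)
  obtain ⟨C, hC0, hC⟩ := ((h1.differentiableAt (by simp)).isBigO_sub).exists_pos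
  have hd : ∀ᶠ x in 𝓝 (0 : E), DifferentiableAt ℂ f x :=
    (hf.eventually (by simp)).mono fun x hx => hx.differentiableAt (by simp)
  obtain ⟨r, hr, hball⟩ := Metric.eventually_nhds_iff_ball.1 (hC.bound.and hd)
  refine ⟨by simp, C, min r 1, hC0.le, lt_min hr one_pos, min_le_right _ _, fun x y hx hy => ?_⟩
  dsimp only
  let _ : NormedSpace ℝ E := NormedSpace.restrictScalars ℝ ℂ E
  have hx' : ‖x‖ < r := hx.trans_le (min_le_left _ _)
  have hsub : ∀ z ∈ Metric.closedBall (0 : E) ‖x‖, z ∈ Metric.ball (0 : E) r := fun z hz =>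
    Metric.closedBall_subset_ball hx' hz
  -- The mean value inequality on the closed ball of radius ‖x‖. It contains y, which is the use of
  -- the condition ‖y‖ ≤ ‖x‖ in `LipOrder`.
  refine (convex_closedBall (0 : E) ‖x‖).norm_image_sub_le_of_norm_hasFDerivWithin_le (𝕜 := ℂ)
    (f := fun z => f z - f 0 - fderiv ℂ f 0 z) (C := C * ‖x‖ ^ 1)
    (f' := fun z => fderiv ℂ f z - fderiv ℂ f 0)
    (s := Metric.closedBall (0 : E) ‖x‖)
    (fun z hz => ?_) (fun z hz => ?_) (x := y) (y := x)
    (by simpa using hy) (by simp)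
  · have h2 := ((hball z (hsub z hz)).2.hasFDerivAt.sub_const (f 0)).sub
      (fderiv ℂ f 0).hasFDerivAt
    exact h2.hasFDerivWithinAt
  · have h2 := (hball z (hsub z hz)).1
    rw [sub_zero] at h2
    rw [pow_one]
    refine h2.trans ?_
    gcongr
    simpa using hz

end Honeycomb
end

noncomputable section

namespace Honeycomb

/-! ### Reduction to two dimensions near the Dirac energy -/

/-- The inclusion of the Dirac eigenspace. -/
def diracEmb : (Fin 2 → ℂ) →L[ℂ] (Fin 3 → ℂ) :=
  ∑ i, (ContinuousLinearMap.proj (R := ℂ) (φ := fun _ : Fin 2 => ℂ) i).smulRight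
    (Pi.single i.castSucc 1)

/-- The projection to the Dirac eigenspace. -/
def diracProj : (Fin 3 → ℂ) →L[ℂ] (Fin 2 → ℂ) :=
  ContinuousLinearMap.pi fun i => ContinuousLinearMap.proj (R := ℂ) (φ := fun _ : Fin 3 => ℂ)
    i.castSucc

lemma diracEmb_apply (v : Fin 2 → ℂ) : diracEmb v = ![v 0, v 1, 0] := by
  funext i
  fin_cases i <;> simp [diracEmb, Fin.sum_univ_two]

lemma diracProj_apply (v : Fin 3 → ℂ) : diracProj v = ![v 0, v 1] := by
  funext i
  fin_cases i <;> rfl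

lemma diracEmb_single (i : Fin 2) : diracEmb (Pi.single i 1) = Pi.single i.castSucc 1 := by
  rw [diracEmb_apply]
  funext j
  fin_cases i <;> fin_cases j <;> simp

/-- A `3 × 3` determinant with an invariant subspace that is a graph over the first two
coordinates. -/
lemma det_of_invariant_graph (N : (Fin 3 → ℂ) →L[ℂ] (Fin 3 → ℂ))
    (Z : (Fin 2 → ℂ) →L[ℂ] (Fin 3 → ℂ)) (M : (Fin 2 → ℂ) →L[ℂ] (Fin 2 → ℂ))
    (h : ∀ v, N (Z v) = Z (M v)) (hZ : ∀ v, diracProj (Z v) = v) (x : ℂ) :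
    LinearMap.det (x • LinearMap.id - N.toLinearMap) =
      ((x - M (Pi.single 0 1) 0) * (x - M (Pi.single 1 1) 1) -
        M (Pi.single 1 1) 0 * M (Pi.single 0 1) 1) *
      (x - (∑ a, N (Pi.single a 1) a - ∑ i, M (Pi.single i 1) i)) := by
  have hZ' : ∀ v, Z v = ![v 0, v 1, Z v 2] := by
    intro v
    have h1 := hZ v
    rw [diracProj_apply] at h1
    funext i
    fin_cases i
    · exact congrFun h1 0
    · exact congrFun h1 1
    · rfl
  have hN : ∀ v i, N v i = v 0 * N (Pi.single 0 1) i + v 1 * N (Pi.single 1 1) i +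
      v 2 * N (Pi.single 2 1) i := by
    intro v i
    conv_lhs => rw [sum_smul_single v]
    simp only [Fin.sum_univ_three, map_add, map_smul, Pi.add_apply, Pi.smul_apply, smul_eq_mul]
  have hZ2 : ∀ v, Z v 2 = v 0 * Z (Pi.single 0 1) 2 + v 1 * Z (Pi.single 1 1) 2 := by
    intro v
    conv_lhs => rw [sum_smul_single v]
    simp only [Fin.sum_univ_two, map_add, map_smul, Pi.add_apply, Pi.smul_apply, smul_eq_mul]
  have key : ∀ v i, N (Z v) i = Z (M v) i := fun v i => congrFun (h v) i
  have k00 := key (Pi.single 0 1) 0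
  have k01 := key (Pi.single 0 1) 1
  have k02 := key (Pi.single 0 1) 2
  have k10 := key (Pi.single 1 1) 0
  have k11 := key (Pi.single 1 1) 1
  have k12 := key (Pi.single 1 1) 2
  rw [hN, hZ'] at k00 k01 k02 k10 k11 k12
  simp only [Matrix.cons_val_zero, Matrix.cons_val_one, Matrix.cons_val_two,
    hZ' (M _), hZ2 (M _)] at k00 k01 k02 k10 k11 k12
  simp at k00 k01 k02 k10 k11 k12
  rw [← LinearMap.det_toMatrix', Matrix.det_fin_three]
  simp only [LinearMap.toMatrix'_apply, LinearMap.sub_apply, LinearMap.smul_apply,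
    LinearMap.id_apply, ContinuousLinearMap.coe_coe, Pi.sub_apply, Pi.smul_apply, smul_eq_mul,
    Fin.sum_univ_three, Fin.sum_univ_two]
  simp only [Pi.single_apply]
  simp
  set r0 := Z (Pi.single 0 1) 2
  set r1 := Z (Pi.single 1 1) 2
  -- The relation N Z = Z M expresses the first two columns of N through M, the third column and the
  -- slopes `r0`, `r1` of the graph; the determinant is then a polynomial identity.
  have e00 : N (Pi.single 0 1) 0 = M (Pi.single 0 1) 0 - r0 * N (Pi.single 2 1) 0 := by
    linear_combination k00
  have e01 : N (Pi.single 0 1) 1 = M (Pi.single 0 1) 1 - r0 * N (Pi.single 2 1) 1 := by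
    linear_combination k01
  have e02 : N (Pi.single 0 1) 2 = M (Pi.single 0 1) 0 * r0 + M (Pi.single 0 1) 1 * r1 -
      r0 * N (Pi.single 2 1) 2 := by
    linear_combination k02
  have e10 : N (Pi.single 1 1) 0 = M (Pi.single 1 1) 0 - r1 * N (Pi.single 2 1) 0 := by
    linear_combination k10
  have e11 : N (Pi.single 1 1) 1 = M (Pi.single 1 1) 1 - r1 * N (Pi.single 2 1) 1 := by
    linear_combination k11
  have e12 : N (Pi.single 1 1) 2 = M (Pi.single 1 1) 0 * r0 + M (Pi.single 1 1) 1 * r1 -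
      r1 * N (Pi.single 2 1) 2 := by
    linear_combination k12
  rw [e00, e01, e02, e10, e11, e12]
  ring

section Reduction

variable {A₁ : Medium} {Y : ℂ × (Fin 2 → ℂ) → (Fin 3 → ℂ) →L[ℂ] Seq}
  {N : ℂ × (Fin 2 → ℂ) → (Fin 3 → ℂ) →L[ℂ] (Fin 3 → ℂ)} {ε : ℝ}

/-- The bordered operator for the Dirac energy. -/
def diracBordered (N : ℂ × (Fin 2 → ℂ) → (Fin 3 → ℂ) →L[ℂ] (Fin 3 → ℂ)) (ε : ℝ) :
    ((Fin 3 → ℂ) × (Fin 2 → ℂ)) →L[ℂ] ((Fin 3 → ℂ) × (Fin 2 → ℂ)) :=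
  ((N (ε, toC 0) - (redEnergy N ε 0 : ℂ) • ContinuousLinearMap.id ℂ _) ∘L
    ContinuousLinearMap.fst ℂ _ _ - diracEmb ∘L ContinuousLinearMap.snd ℂ _ _).prod
      (diracProj ∘L ContinuousLinearMap.fst ℂ _ _)

lemma diracBordered_apply (h : Fin 3 → ℂ) (v : Fin 2 → ℂ) : diracBordered N ε (h, v) =
    (N (ε, toC 0) h - (redEnergy N ε 0 : ℂ) • h - diracEmb v, diracProj h) := rfl

lemma IsReduction.redEnergy_one (h : IsReduction A₁ Y N (ε, toC 0)) (hA : SmoothPeriodic A₁)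
    (hε : IsHoneycombMedium (lowContrast A₁ ε)) : redEnergy N ε 1 = redEnergy N ε 0 :=
  congrArg Complex.re (h.diagEntry_conjIndex hA hε)

/-- On the Dirac plane `N − E₀` vanishes, and on the third coordinate it is multiplication by E₂ −
E₀. The separation of the third energy enters here. -/
lemma IsReduction.diracBordered_injective (h : IsReduction A₁ Y N (ε, toC 0))
    (hA : SmoothPeriodic A₁) (hε : IsHoneycombMedium (lowContrast A₁ ε))
    (hne : redEnergy N ε 2 ≠ redEnergy N ε 0) : Function.Injective (diracBordered N ε) := by
  rw [injective_iff_map_eq_zero]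
  rintro ⟨u, v⟩ huv
  rw [diracBordered_apply] at huv
  have h1 := congrArg Prod.fst huv
  have h2 := congrArg Prod.snd huv
  dsimp only at h1 h2
  rw [diracProj_apply] at h2
  have u0 : u 0 = 0 := congrFun h2 0
  have u1 : u 1 = 0 := congrFun h2 1
  have hE := h.redEnergy_one hA hε
  have h3 : ∀ i, (redEnergy N ε i : ℂ) * u i - redEnergy N ε 0 * u i - diracEmb v i = 0 := by
    intro i
    rw [← h.N_apply hA hε]
    exact congrFun h1 i
  have a0 := h3 0
  have a1 := h3 1
  have a2 := h3 2
  rw [diracEmb_apply] at a0 a1 a2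
  simp [u0, u1] at a0 a1 a2
  have u2 : u 2 = 0 := by
    rw [← sub_mul] at a2
    refine (mul_eq_zero.1 a2).resolve_left (sub_ne_zero.2 fun e => hne ?_)
    exact Complex.ofReal_injective e
  have hu : u = 0 := by
    funext i
    fin_cases i
    · exact u0
    · exact u1
    · exact u2
  have hv : v = 0 := by
    funext i
    fin_cases i
    · exact a0
    · exact a1
  rw [hu, hv]; rfl

/-- Here ε is fixed and only the displacement moves. The neighbourhood may depend on ε, which is
harmless since the definition of a Dirac point asks for some radius at each ε. -/
lemma IsReduction.exists_dirac_continuation (h : IsReduction A₁ Y N (ε, toC 0))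
    (hA : SmoothPeriodic A₁) (hε : IsHoneycombMedium (lowContrast A₁ ε))
    (hne : redEnergy N ε 2 ≠ redEnergy N ε 0) :
    ∃ (Z : (Fin 2 → ℂ) → (Fin 2 → ℂ) →L[ℂ] (Fin 3 → ℂ))
      (M : (Fin 2 → ℂ) → (Fin 2 → ℂ) →L[ℂ] (Fin 2 → ℂ)),
      ContDiffAt ℂ 2 Z 0 ∧ ContDiffAt ℂ 2 M 0 ∧ Z 0 = diracEmb ∧
      M 0 = (redEnergy N ε 0 : ℂ) • ContinuousLinearMap.id ℂ _ ∧
      ∀ᶠ κ in 𝓝 (0 : Fin 2 → ℂ), (∀ v, N (ε, κ) (Z κ v) = Z κ (M κ v)) ∧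
        ∀ v, diracProj (Z κ v) = v := by
  have h0 : ((ε : ℂ), (0 : Fin 2 → ℂ)) = ((ε : ℂ), toC 0) := by rw [toC_zero]
  have hG : ContDiffAt ℂ 2 (fun κ : Fin 2 → ℂ => N (ε, κ)) 0 := by
    have h1 : ContDiffAt ℂ 2 (fun κ : Fin 2 → ℂ => ((ε : ℂ), κ)) 0 :=
      contDiffAt_const.prodMk contDiffAt_id
    have h2 := h.contDiffAt_N
    rw [← h0] at h2
    exact ContDiffAt.comp (g := N) (f := fun κ : Fin 2 → ℂ => ((ε : ℂ), κ)) 0 h2 h1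
  have hE := h.redEnergy_one hA hε
  let S := (LinearEquiv.ofInjectiveEndo (diracBordered N ε).toLinearMap
    (h.diracBordered_injective hA hε hne)).toContinuousLinearEquiv
  obtain ⟨Z, M, hZ, hM, hZ0, hM0, he⟩ := exists_invariant_continuation (p₀ := (0 : Fin 2 → ℂ))
    (G := fun κ => N (ε, κ)) (B := ContinuousLinearMap.id ℂ _) (π := diracProj) (ι := diracEmb)
    (l := (redEnergy N ε 0 : ℂ)) hG
    (by
      ext v i
      change N (ε, 0) (diracEmb v) i = redEnergy N ε 0 * diracEmb v i
      rw [h0, h.N_apply hA hε, diracEmb_apply]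
      fin_cases i <;> simp [hE])
    (by
      ext1 v
      funext i
      change diracProj (diracEmb v) i = v i
      rw [diracProj_apply, diracEmb_apply]
      fin_cases i <;> rfl) S
    (fun u v => by
      rw [h0]; rfl)
  refine ⟨Z, M, hZ, hM, hZ0, hM0, ?_⟩
  filter_upwards [he] with κ hκ
  exact ⟨fun v => congrArg (fun T : (Fin 2 → ℂ) →L[ℂ] (Fin 3 → ℂ) => T v) hκ.1,
    fun v => congrArg (fun T : (Fin 2 → ℂ) →L[ℂ] (Fin 2 → ℂ) => T v) hκ.2⟩

lemma hasDerivAt_formOp (A₁ : Medium) (ε : ℂ) (k : Fin 2 → ℂ) :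
    HasDerivAt (fun t : ℂ => formOp A₁ (ε, t • k)) (∑ j, k j • velOp A₁ ε j) 0 := by
  have h1 : ∀ t : ℂ, formOp A₁ (ε, t • k) = formOp A₁ (ε, 0) + t • (∑ j, k j • velOp A₁ ε j) +
      (t * t) • ∑ i, ∑ j, (k i * k j) • quadOp A₁ ε i j := by
    intro t
    rw [formOp_expand, Finset.smul_sum, Finset.smul_sum]
    simp only [Finset.smul_sum, smul_smul, Pi.smul_apply, smul_eq_mul, mul_mul_mul_comm]
  have h2 : HasDerivAt (fun t : ℂ => t * t) 0 0 := by
    have := (hasDerivAt_id' (0 : ℂ)).fun_mul (hasDerivAt_id' (0 : ℂ))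
    rwa [mul_zero, zero_mul, add_zero] at this
  have h3 := (((hasDerivAt_id (0 : ℂ)).smul_const (∑ j, k j • velOp A₁ ε j)).const_add
    (formOp A₁ (ε, 0))).add (h2.smul_const (∑ i, ∑ j, (k i * k j) • quadOp A₁ ε i j))
  rw [one_smul, zero_smul, add_zero] at h3
  exact h3.congr_of_eventuallyEq (Eventually.of_forall fun t => by simp only [h1]; rfl)

/-- The first order perturbation theory of the Dirac energy in the quasi-momentum. -/
lemma IsReduction.fderiv_dirac (h : ∀ᶠ p in 𝓝 ((ε : ℂ), toC 0), IsReduction A₁ Y N p)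
    (hA : SmoothPeriodic A₁) (hε : IsHoneycombMedium (lowContrast A₁ ε))
    {Z : (Fin 2 → ℂ) → (Fin 2 → ℂ) →L[ℂ] (Fin 3 → ℂ)}
    {M : (Fin 2 → ℂ) → (Fin 2 → ℂ) →L[ℂ] (Fin 2 → ℂ)}
    (hZ : ContDiffAt ℂ 2 Z 0) (hM : ContDiffAt ℂ 2 M 0) (hZ0 : Z 0 = diracEmb)
    (hM0 : M 0 = (redEnergy N ε 0 : ℂ) • ContinuousLinearMap.id ℂ _)
    (he : ∀ᶠ κ in 𝓝 (0 : Fin 2 → ℂ), ∀ v, N (ε, κ) (Z κ v) = Z κ (M κ v))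
    (k : Fin 2 → ℂ) (a b : Fin 2) :
    redGram Y ε * fderiv ℂ M 0 k (Pi.single b 1) a =
      ∑ j, k j * inner ℂ (redVec Y ε a.castSucc) (velOp A₁ ε j (redVec Y ε b.castSucc)) := by
  have h0 : ((ε : ℂ), (0 : Fin 2 → ℂ)) = ((ε : ℂ), toC 0) := by rw [toC_zero]
  have hb := h.self_of_nhds
  have hin : ContDiffAt ℂ 2 (fun κ : Fin 2 → ℂ => ((ε : ℂ), κ)) 0 :=
    contDiffAt_const.prodMk contDiffAt_id
  have hYd : DifferentiableAt ℂ (fun κ : Fin 2 → ℂ => Y (ε, κ) ∘L Z κ) 0 := by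
    have h2 := hb.contDiffAt_Y
    rw [← h0] at h2
    have h3 : ContDiffAt ℂ 2 (fun κ : Fin 2 → ℂ => Y (ε, κ)) 0 :=
      ContDiffAt.comp (g := Y) (f := fun κ : Fin 2 → ℂ => ((ε : ℂ), κ)) 0 h2 hin
    exact (h3.clm_comp hZ).differentiableAt (by simp)
  have hline : HasDerivAt (fun t : ℂ => t • k) k 0 := by
    simpa using (hasDerivAt_id (0 : ℂ)).smul_const k
  have hYt := hYd.hasFDerivAt.comp_hasDerivAt_of_eq (0 : ℂ) hline (by simp)
  have hMt := (hM.differentiableAt (by simp)).hasFDerivAt.comp_hasDerivAt_of_eq (0 : ℂ) hline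
    (by simp)
  set Y₁ := fderiv ℂ (fun κ : Fin 2 → ℂ => Y (ε, κ) ∘L Z κ) 0 k with hY₁
  set M₁ := fderiv ℂ M 0 k with hM₁
  have hl := (hasDerivAt_formOp A₁ ε k).clm_comp hYt
  have hr := (hasDerivAt_const (0 : ℂ) massOp).clm_comp (hYt.clm_comp hMt)
  have heq : ∀ᶠ t : ℂ in 𝓝 0, formOp A₁ (ε, t • k) ∘L (Y (ε, t • k) ∘L Z (t • k)) =
      massOp ∘L ((Y (ε, t • k) ∘L Z (t • k)) ∘L M (t • k)) := by
    have ht : Tendsto (fun t : ℂ => t • k) (𝓝 0) (𝓝 0) := by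
      have := hline.continuousAt.tendsto
      rwa [zero_smul] at this
    have ht' : Tendsto (fun t : ℂ => ((ε : ℂ), t • k)) (𝓝 0) (𝓝 (ε, toC 0)) := by
      rw [← h0]
      exact tendsto_const_nhds.prodMk_nhds ht
    filter_upwards [ht.eventually he, ht'.eventually h] with t h1 h2
    ext1 v
    change formOp A₁ (ε, t • k) (Y (ε, t • k) (Z (t • k) v)) =
      massOp (Y (ε, t • k) (Z (t • k) (M (t • k) v)))
    rw [h2.eqn, h1]
  -- The intertwining relation is differentiated at 0 in the direction k and then paired with an
  -- eigenvector at K. By symmetry of the form the terms containing the derivative of `Y ∘ Z`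
  -- cancel, as in the Feynman–Hellmann formula.
  have hd := hl.unique (hr.congr_of_eventuallyEq heq)
  have hd' := congrArg (fun T : (Fin 2 → ℂ) →L[ℂ] Seq =>
    inner ℂ (redVec Y ε a.castSucc) (T (Pi.single b 1))) hd
  have hx : ∀ c : Fin 2, Y (ε, toC 0) (diracEmb (Pi.single c 1)) = redVec Y ε c.castSucc :=
    fun c => by rw [diracEmb_single]; rfl
  simp only [_root_.add_apply, ContinuousLinearMap.comp_apply, Function.comp_apply, zero_smul,
    _root_.zero_apply, zero_add, hZ0, hM0, h0, hx, inner_add_right, map_add, map_smul,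
    _root_.smul_apply, ContinuousLinearMap.id_apply, inner_smul_right, inner_zero_right,
    mul_zero, zero_add] at hd'
  have hE : redEnergy N ε a.castSucc = redEnergy N ε 0 := by
    fin_cases a
    · rfl
    · exact hb.redEnergy_one hA hε
  have hsym : inner ℂ (redVec Y ε a.castSucc) (formOp A₁ (ε, toC 0) (Y₁ (Pi.single b 1))) =
      redEnergy N ε 0 * inner ℂ (redVec Y ε a.castSucc) (massOp (Y₁ (Pi.single b 1))) := by
    rw [← inner_formOp hA hε, hb.formOp_redVec hA hε, inner_smul_left, Complex.conj_ofReal, hE,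
      inner_massOp_left]
  have hM1 : inner ℂ (redVec Y ε a.castSucc)
      (massOp (Y (ε, toC 0) (diracEmb (M₁ (Pi.single b 1))))) =
        redGram Y ε * M₁ (Pi.single b 1) a := by
    have hg0 := inner_redVec_zero Y ε
    have hg1 := hb.inner_redVec_one hA hε
    have o01 := inner_eq_zero_of_rot (show (0 : Fin 3) ≠ 1 by decide) (hb.rotSeq_redVec hA hε 0)
      (hb.rotSeq_redVec hA hε 1)
    have o10 := inner_eq_zero_of_rot (show (1 : Fin 3) ≠ 0 by decide) (hb.rotSeq_redVec hA hε 1)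
      (hb.rotSeq_redVec hA hε 0)
    conv_lhs => rw [sum_smul_single (M₁ (Pi.single b 1))]
    simp only [Fin.sum_univ_two, map_add, map_smul, hx, inner_add_right, inner_smul_right]
    fin_cases a
    · change M₁ (Pi.single b 1) 0 * inner ℂ (redVec Y ε 0) (massOp (redVec Y ε 0)) +
        M₁ (Pi.single b 1) 1 * inner ℂ (redVec Y ε 0) (massOp (redVec Y ε 1)) = _
      rw [hg0, o01, mul_zero, add_zero, mul_comm]; rfl
    · change M₁ (Pi.single b 1) 0 * inner ℂ (redVec Y ε 1) (massOp (redVec Y ε 0)) +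
        M₁ (Pi.single b 1) 1 * inner ℂ (redVec Y ε 1) (massOp (redVec Y ε 1)) = _
      rw [hg1, o10, mul_zero, zero_add, mul_comm]; rfl
  rw [hsym, hM1, add_comm] at hd'
  rw [← add_left_cancel hd']
  simp only [_root_.sum_apply, _root_.smul_apply, inner_sum, inner_smul_right]

end Reduction

end Honeycomb
end

noncomputable section

namespace Honeycomb

/-! ### Conical crossings -/

lemma LipOrder.comp {E E' F : Type*} [NormedAddCommGroup E] [NormedAddCommGroup E']
    [NormedAddCommGroup F] {n : ℕ} {f : E → F} (hf : LipOrder n f) {u : E' → E} (h0 : u 0 = 0)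
    (hu : ∀ x y, ‖u x - u y‖ ≤ ‖x - y‖) : LipOrder n fun x => f (u x) := by
  obtain ⟨f0, C, r, hC, hr, hr1, h⟩ := hf
  have hu0 : ∀ x, ‖u x‖ ≤ ‖x‖ := fun x => by simpa [h0] using hu x 0
  refine ⟨by simp [h0, f0], C, r, hC, hr, hr1, fun x y hx hy => ?_⟩
  dsimp only
  rcases le_total ‖u y‖ ‖u x‖ with hxy | hxy
  · refine (h _ _ ((hu0 x).trans_lt hx) hxy).trans ?_
    have h1 := hu0 x
    have h2 := hu x y
    gcongr
  · rw [norm_sub_rev]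
    refine (h _ _ (((hu0 y).trans hy).trans_lt hx) hxy).trans ?_
    have h1 := (hu0 y).trans hy
    have h2 := hu y x
    rw [norm_sub_rev y x] at h2
    gcongr

lemma toC_sub (x y : Plane) : toC (x - y) = toC x - toC y := by
  funext i
  simp [toC]

lemma norm_toC_le (x : Plane) : ‖toC x‖ ≤ ‖x‖ := by
  refine (pi_norm_le_iff_of_nonneg (norm_nonneg x)).2 fun i => ?_
  rw [toC, Complex.norm_real]
  exact PiLp.norm_apply_le x i

/-- Evaluating the two cubics at 0, 1 and −1 compares their coefficients. As a root, μ is one of the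
`e k`; the other two share trace and discriminant with the 2 × 2 block. The order i < j later fixes
the sign of their difference. -/
lemma eigenvalue_split {e : Fin 3 → ℝ} {m₀₀ m₁₁ m₀₁ m₁₀ μ : ℂ}
    (h : ∀ x : ℂ, ∏ i, (x - e i) = ((x - m₀₀) * (x - m₁₁) - m₀₁ * m₁₀) * (x - μ)) :
    ∃ i j k : Fin 3, i < j ∧ i ≠ k ∧ j ≠ k ∧ μ = e k ∧ m₀₀ + m₁₁ = e i + e j ∧
      ((m₀₀ - m₁₁) / 2) ^ 2 + m₀₁ * m₁₀ = (((e j : ℂ) - e i) / 2) ^ 2 := by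
  have h0 := h 0
  have h1 := h 1
  have h2 := h (-1)
  have hμ := h μ
  rw [sub_self, mul_zero] at hμ
  simp only [Fin.prod_univ_three] at h0 h1 h2 hμ
  have hs : m₀₀ + m₁₁ = e 0 + e 1 + e 2 - μ := by
    linear_combination (1 / 2) * h1 + (1 / 2) * h2 - h0
  have hd : m₀₀ * m₁₁ - m₀₁ * m₁₀ + (m₀₀ + m₁₁) * μ =
      (e 0 : ℂ) * e 1 + e 0 * e 2 + e 1 * e 2 := by
    linear_combination (1 / 2) * h2 - (1 / 2) * h1
  rcases mul_eq_zero.1 hμ with h3 | h3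
  · rcases mul_eq_zero.1 h3 with h4 | h4
    · have hk : μ = e 0 := sub_eq_zero.1 h4
      have hs' : m₀₀ + m₁₁ = e 1 + e 2 := by linear_combination hs - hk
      refine ⟨1, 2, 0, by decide, by decide, by decide, hk, hs', ?_⟩
      rw [hk] at hd
      linear_combination ((m₀₀ + m₁₁ + e 1 + e 2) / 4 + e 0) * hs' - hd
    · have hk : μ = e 1 := sub_eq_zero.1 h4
      have hs' : m₀₀ + m₁₁ = e 0 + e 2 := by linear_combination hs - hk
      refine ⟨0, 2, 1, by decide, by decide, by decide, hk, hs', ?_⟩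
      rw [hk] at hd
      linear_combination ((m₀₀ + m₁₁ + e 0 + e 2) / 4 + e 1) * hs' - hd
  · have hk : μ = e 2 := sub_eq_zero.1 h3
    have hs' : m₀₀ + m₁₁ = e 0 + e 1 := by linear_combination hs - hk
    refine ⟨0, 1, 2, by decide, by decide, by decide, hk, hs', ?_⟩
    rw [hk] at hd
    linear_combination ((m₀₀ + m₁₁ + e 0 + e 1) / 4 + e 2) * hs' - hd

section Reduction

variable {A₁ : Medium} {Y : ℂ × (Fin 2 → ℂ) → (Fin 3 → ℂ) →L[ℂ] Seq}
  {N : ℂ × (Fin 2 → ℂ) → (Fin 3 → ℂ) →L[ℂ] (Fin 3 → ℂ)} {ε : ℝ}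

/-- The factorization of the characteristic polynomial near the Dirac energy. -/
lemma IsReduction.exists_cone_data (h : ∀ᶠ p in 𝓝 ((ε : ℂ), toC 0), IsReduction A₁ Y N p)
    (hA : SmoothPeriodic A₁) (hε : IsHoneycombMedium (lowContrast A₁ ε))
    (hne : redEnergy N ε 2 ≠ redEnergy N ε 0) :
    ∃ (R₀₀ R₁₁ R₀₁ R₁₀ μ : Plane → ℂ) (ζ : ℂ), ‖ζ‖ = redVelocity A₁ Y ε ∧
      LipOrder 1 R₀₀ ∧ LipOrder 1 R₁₁ ∧ LipOrder 1 R₀₁ ∧ LipOrder 1 R₁₀ ∧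
      Tendsto μ (𝓝 0) (𝓝 (redEnergy N ε 2)) ∧
      ∀ᶠ κ : Plane in 𝓝 0, ∀ x : ℂ,
        LinearMap.det (x • LinearMap.id - (N (ε, toC κ)).toLinearMap) =
        ((x - (redEnergy N ε 0 + R₀₀ κ)) * (x - (redEnergy N ε 0 + R₁₁ κ)) -
          (ζ * (κ 0 + Complex.I * κ 1) + R₀₁ κ) *
            ((starRingEnd ℂ) ζ * (κ 0 - Complex.I * κ 1) + R₁₀ κ)) * (x - μ κ) := by
  have hb := h.self_of_nhds
  obtain ⟨Z, M, hZ, hM, hZ0, hM0, he⟩ := hb.exists_dirac_continuation hA hε hne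
  have hg : (redGram Y ε : ℂ) ≠ 0 := Complex.ofReal_ne_zero.2 hb.redGram_pos.ne'
  set ζ : ℂ := inner ℂ (redVec Y ε 0) (velOp A₁ ε 0 (redVec Y ε 1)) / redGram Y ε with hζ
  have hoff := velocity_off_diagonal hA hε (hb.rotSeq_redVec hA hε 0) (hb.rotSeq_redVec hA hε 1)
  have hder := fun (κ : Plane) (a b : Fin 2) => IsReduction.fderiv_dirac h hA hε hZ hM hZ0 hM0
    (he.mono fun κ hκ => hκ.1) (toC κ) a b
  have d00 : ∀ κ : Plane, fderiv ℂ M 0 (toC κ) (Pi.single 0 1) 0 = 0 := by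
    intro κ
    have h1 := hder κ 0 0
    rw [Fin.sum_univ_two] at h1
    change _ = _ * inner ℂ (redVec Y ε 0) _ + _ * inner ℂ (redVec Y ε 0) _ at h1
    change _ = _ * inner ℂ (redVec Y ε 0) (velOp A₁ ε 0 (redVec Y ε 0)) +
      _ * inner ℂ (redVec Y ε 0) (velOp A₁ ε 1 (redVec Y ε 0)) at h1
    rw [velocity_diagonal hA hε (hb.rotSeq_redVec hA hε 0),
      velocity_diagonal hA hε (hb.rotSeq_redVec hA hε 0), mul_zero, mul_zero, add_zero] at h1
    exact (mul_eq_zero.1 h1).resolve_left hg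
  have d11 : ∀ κ : Plane, fderiv ℂ M 0 (toC κ) (Pi.single 1 1) 1 = 0 := by
    intro κ
    have h1 := hder κ 1 1
    rw [Fin.sum_univ_two] at h1
    change _ = _ * inner ℂ (redVec Y ε 1) (velOp A₁ ε 0 (redVec Y ε 1)) +
      _ * inner ℂ (redVec Y ε 1) (velOp A₁ ε 1 (redVec Y ε 1)) at h1
    rw [velocity_diagonal hA hε (hb.rotSeq_redVec hA hε 1),
      velocity_diagonal hA hε (hb.rotSeq_redVec hA hε 1), mul_zero, mul_zero, add_zero] at h1
    exact (mul_eq_zero.1 h1).resolve_left hg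
  have d01 : ∀ κ : Plane, fderiv ℂ M 0 (toC κ) (Pi.single 1 1) 0 =
      ζ * (κ 0 + Complex.I * κ 1) := by
    intro κ
    have h1 := hder κ 0 1
    rw [Fin.sum_univ_two] at h1
    change _ = _ * inner ℂ (redVec Y ε 0) (velOp A₁ ε 0 (redVec Y ε 1)) +
      _ * inner ℂ (redVec Y ε 0) (velOp A₁ ε 1 (redVec Y ε 1)) at h1
    rw [hoff] at h1
    apply mul_left_cancel₀ hg
    rw [h1, hζ, show toC κ 0 = (κ 0 : ℂ) from rfl, show toC κ 1 = (κ 1 : ℂ) from rfl]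
    field_simp
  have d10 : ∀ κ : Plane, fderiv ℂ M 0 (toC κ) (Pi.single 0 1) 1 =
      (starRingEnd ℂ) ζ * (κ 0 - Complex.I * κ 1) := by
    intro κ
    have h1 := hder κ 1 0
    rw [Fin.sum_univ_two] at h1
    change _ = _ * inner ℂ (redVec Y ε 1) (velOp A₁ ε 0 (redVec Y ε 0)) +
      _ * inner ℂ (redVec Y ε 1) (velOp A₁ ε 1 (redVec Y ε 0)) at h1
    rw [conj_velocity hA hε (redVec Y ε 0), conj_velocity hA hε (redVec Y ε 0), hoff,
      map_mul, Complex.conj_I] at h1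
    apply mul_left_cancel₀ hg
    rw [h1, hζ, show toC κ 0 = (κ 0 : ℂ) from rfl, show toC κ 1 = (κ 1 : ℂ) from rfl, map_div₀,
      Complex.conj_ofReal]
    field_simp
    ring
  have hrem : ∀ a b : Fin 2, LipOrder 1 fun κ : Plane =>
      (M (toC κ) - M 0 - fderiv ℂ M 0 (toC κ)) (Pi.single b 1) a := by
    intro a b
    have h1 := (exists_taylor_bound hM).comp (u := toC) toC_zero fun x y => by
      rw [← toC_sub]; exact norm_toC_le _
    refine h1.of_le (by simp [toC_zero]) fun x y => ?_
    rw [← Pi.sub_apply, ← _root_.sub_apply]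
    refine (norm_le_pi_norm _ a).trans ((ContinuousLinearMap.le_opNorm _ _).trans ?_)
    rw [Pi.norm_single, norm_one, mul_one]
  have hM0' : ∀ a b : Fin 2, M 0 (Pi.single b 1) a =
      if a = b then (redEnergy N ε 0 : ℂ) else 0 := by
    intro a b
    rw [hM0]
    simp [Pi.single_apply]
  have htoC : Tendsto toC (𝓝 0) (𝓝 0) := by
    refine squeeze_zero_norm norm_toC_le ?_
    simpa using (continuous_norm (E := Plane)).tendsto 0
  have htoC' : Tendsto (fun κ : Plane => ((ε : ℂ), toC κ)) (𝓝 0) (𝓝 ((ε : ℂ), toC 0)) := by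
    rw [toC_zero]
    exact tendsto_const_nhds.prodMk_nhds htoC
  refine ⟨_, _, _, _, fun κ => ∑ a, N (ε, toC κ) (Pi.single a 1) a -
    ∑ i, M (toC κ) (Pi.single i 1) i, ζ, ?_, hrem 0 0, hrem 1 1, hrem 0 1, hrem 1 0, ?_, ?_⟩
  · rw [hζ, norm_div, Complex.norm_real, Real.norm_eq_abs, abs_of_pos hb.redGram_pos]; rfl
  · have h1 : Tendsto (fun κ => ∑ a, N (ε, toC κ) (Pi.single a 1) a) (𝓝 0)
        (𝓝 (∑ a, N (ε, toC 0) (Pi.single a 1) a)) := by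
      refine tendsto_finsetSum _ fun a _ => ?_
      have h2 : Tendsto (fun κ => N (ε, toC κ)) (𝓝 0) (𝓝 (N (ε, toC 0))) :=
        hb.contDiffAt_N.continuousAt.tendsto.comp htoC'
      exact tendsto_pi_nhds.1 (((ContinuousLinearMap.apply ℂ (Fin 3 → ℂ)
        (Pi.single a 1 : Fin 3 → ℂ)).continuous.tendsto _).comp h2) a
    have h2 : Tendsto (fun κ => ∑ i, M (toC κ) (Pi.single i 1) i) (𝓝 0)
        (𝓝 (∑ i, M 0 (Pi.single i 1) i)) := by
      refine tendsto_finsetSum _ fun a _ => ?_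
      have h2 : Tendsto (fun κ => M (toC κ)) (𝓝 0) (𝓝 (M 0)) :=
        hM.continuousAt.tendsto.comp htoC
      exact tendsto_pi_nhds.1 (((ContinuousLinearMap.apply ℂ (Fin 2 → ℂ)
        (Pi.single a 1 : Fin 2 → ℂ)).continuous.tendsto _).comp h2) a
    have h3 := h1.sub h2
    convert h3 using 2
    simp only [hM0', if_true, hb.N_apply hA hε, Fin.sum_univ_three, Fin.sum_univ_two,
      hb.redEnergy_one hA hε, Pi.single_eq_same, mul_one]
    ring
  · filter_upwards [htoC.eventually he] with κ hκ x
    rw [det_of_invariant_graph _ _ _ hκ.1 hκ.2]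
    simp only [_root_.sub_apply, Pi.sub_apply, hM0', d00, d11, d01, d10, if_true]
    simp

end Reduction

end Honeycomb
end

noncomputable section

namespace Honeycomb

/-! ### Explicit solution of the cone with Lipschitz remainders. -/

lemma LipOrder.tendsto {E F : Type*} [NormedAddCommGroup E] [NormedAddCommGroup F] {n : ℕ}
    {f : E → F} (hf : LipOrder n f) : Tendsto f (𝓝 0) (𝓝 0) := by
  obtain ⟨C, r, hC, hr, hr1, -, hb⟩ := hf.exists_bound
  refine squeeze_zero_norm' (a := fun x : E => C * ‖x‖ ^ (n + 1)) ?_ ?_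
  · filter_upwards [Metric.ball_mem_nhds (0 : E) hr] with x hx
    exact hb x (by simpa using hx)
  · have : Continuous fun x : E => C * ‖x‖ ^ (n + 1) := by fun_prop
    simpa using this.tendsto 0

/-- The discriminant governing the splitting of two eigenvalues at a conical crossing. -/
lemma exists_cone_discriminant {R₀₀ R₁₁ R₀₁ R₁₀ : Plane → ℂ} (h00 : LipOrder 1 R₀₀)
    (h11 : LipOrder 1 R₁₁) (h01 : LipOrder 1 R₀₁) (h10 : LipOrder 1 R₁₀) (ζ : ℂ) :
    ∃ q : Plane → ℂ, LipOrder 2 q ∧ ∀ (E : ℂ) (κ : Plane),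
      ((E + R₀₀ κ - (E + R₁₁ κ)) / 2) ^ 2 + (ζ * (κ 0 + Complex.I * κ 1) + R₀₁ κ) *
        ((starRingEnd ℂ) ζ * (κ 0 - Complex.I * κ 1) + R₁₀ κ) =
      ((‖ζ‖ * ‖κ‖) ^ 2 : ℝ) + q κ := by
  have hl : ∀ (c s : ℂ), ‖s‖ ≤ 1 → LipOrder 0 fun κ : Plane => c * (κ 0 + s * κ 1) := by
    intro c s hs
    refine LipOrder.of_linear (by simp) (C := ‖c‖ * 2) (by positivity) fun x y => ?_
    rw [← mul_sub, norm_mul, mul_assoc]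
    refine mul_le_mul_of_nonneg_left ?_ (norm_nonneg _)
    have e0 : ‖((x 0 : ℂ) - y 0)‖ ≤ ‖x - y‖ := by
      rw [← Complex.ofReal_sub, Complex.norm_real]
      exact PiLp.norm_apply_le (x - y) 0
    have e1 : ‖((x 1 : ℂ) - y 1)‖ ≤ ‖x - y‖ := by
      rw [← Complex.ofReal_sub, Complex.norm_real]
      exact PiLp.norm_apply_le (x - y) 1
    calc ‖(x 0 : ℂ) + s * x 1 - (y 0 + s * y 1)‖ = ‖((x 0 : ℂ) - y 0) + s * (x 1 - y 1)‖ := by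
          congr 1; ring
      _ ≤ ‖((x 0 : ℂ) - y 0)‖ + ‖s‖ * ‖((x 1 : ℂ) - y 1)‖ := by
          rw [← norm_mul]; exact norm_add_le _ _
      _ ≤ ‖x - y‖ + 1 * ‖x - y‖ := by gcongr
      _ = 2 * ‖x - y‖ := by ring
  have l1 := hl ζ Complex.I (by simp)
  have l2 := hl ((starRingEnd ℂ) ζ) (-Complex.I) (by simp)
  have hd := (h00.sub h11).const_mul (1 / 2)
  -- A linear term times a remainder has order 0 + 1 + 1 = 2, which decides the total; products of
  -- two remainders have order 3.
  refine ⟨_, (((hd.mul hd).mono (by norm_num)).add ((l1.mul h10).add ((h01.mul l2).add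
    ((h01.mul h10).mono (by norm_num))))), fun E κ => ?_⟩
  have hn : ((‖κ‖ ^ 2 : ℝ) : ℂ) = κ 0 ^ 2 + κ 1 ^ 2 := by
    rw [EuclideanSpace.real_norm_sq_eq, Fin.sum_univ_two]
    push_cast
    rfl
  have hz : ((‖ζ‖ ^ 2 : ℝ) : ℂ) = ζ * (starRingEnd ℂ) ζ := by
    rw [Complex.mul_conj, Complex.normSq_eq_norm_sq]
  rw [mul_pow, Complex.ofReal_mul, hn, hz]
  linear_combination (-ζ * (starRingEnd ℂ) ζ * (κ 1 : ℂ) ^ 2) * Complex.I_sq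

/-- The conical shape of the two eigenvalues that split from a double one. -/
lemma cone_formula {υ t q E₀ e₁ e₂ n : ℝ} (hυ : 0 < υ) (hn : n = 0 → q = 0 ∧ t = 0)
    (hn0 : 0 ≤ n) (hle : e₁ ≤ e₂) (hs : e₁ + e₂ = 2 * E₀ + t)
    (hd : (υ * n) ^ 2 + q = ((e₂ - e₁) / 2) ^ 2) :
    e₂ = E₀ + υ * n * (1 + (1 / (2 * υ) * (t / n) +
      (Real.sqrt (1 + 1 / υ ^ 2 * (q / n / n)) - 1))) ∧
    e₁ = E₀ - υ * n * (1 + (-(1 / (2 * υ) * (t / n)) +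
      (Real.sqrt (1 + 1 / υ ^ 2 * (q / n / n)) - 1))) := by
  -- At the apex the quotients are 0 by the convention for division by zero, and both eigenvalues
  -- equal `E₀`.
  rcases eq_or_ne n 0 with h0 | h0
  · obtain ⟨rfl, rfl⟩ := hn h0
    subst h0
    have : ((e₂ - e₁) / 2) ^ 2 = 0 := by rw [← hd]; ring
    have h1 : e₂ = e₁ := by
      have := pow_eq_zero_iff (two_ne_zero) |>.1 this
      linarith
    constructor <;> simp <;> linarith
  · have hnp : 0 < n := lt_of_le_of_ne hn0 (Ne.symm h0)
    have h1 : υ * n * Real.sqrt (1 + 1 / υ ^ 2 * (q / n / n)) = (e₂ - e₁) / 2 := by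
      have h2 : 1 + 1 / υ ^ 2 * (q / n / n) = (((e₂ - e₁) / 2) / (υ * n)) ^ 2 := by
        rw [div_pow, ← hd]
        field_simp
      rw [h2, Real.sqrt_sq (div_nonneg (by linarith) (by positivity))]
      field_simp
    have h2 : υ * n * (1 / (2 * υ) * (t / n)) = t / 2 := by field_simp
    constructor <;> linarith

section Reduction

variable {A₁ : Medium} {Y : ℂ × (Fin 2 → ℂ) → (Fin 3 → ℂ) →L[ℂ] Seq}
  {N : ℂ × (Fin 2 → ℂ) → (Fin 3 → ℂ) →L[ℂ] (Fin 3 → ℂ)} {ε : ℝ}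

/-- The two energies near the Dirac energy form a cone, and the third one stays away. -/
lemma IsReduction.exists_cones (h : ∀ᶠ p in 𝓝 ((ε : ℂ), toC 0), IsReduction A₁ Y N p)
    (hA : SmoothPeriodic A₁) (hε : IsHoneycombMedium (lowContrast A₁ ε))
    (hne : redEnergy N ε 2 ≠ redEnergy N ε 0) (hυ : 0 < redVelocity A₁ Y ε) :
    ∃ em ep : Plane → ℝ, LipOrder 0 em ∧ LipOrder 0 ep ∧
      ∀ᶠ κ : Plane in 𝓝 0, ∃ (e : Fin 3 → ℝ) (i j k : Fin 3),
        (∀ l : Fin 3, IsBandEnergy (lowContrast A₁ ε) (K + κ) (l + 1) (e l)) ∧ Monotone e ∧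
        i < j ∧ i ≠ k ∧ j ≠ k ∧
        e j = redEnergy N ε 0 + redVelocity A₁ Y ε * ‖κ‖ * (1 + ep κ) ∧
        e i = redEnergy N ε 0 - redVelocity A₁ Y ε * ‖κ‖ * (1 + em κ) ∧
        |e i - redEnergy N ε 0| < |redEnergy N ε 2 - redEnergy N ε 0| / 2 ∧
        |e j - redEnergy N ε 0| < |redEnergy N ε 2 - redEnergy N ε 0| / 2 ∧
        |e k - redEnergy N ε 2| < |redEnergy N ε 2 - redEnergy N ε 0| / 2 := by
  obtain ⟨R₀₀, R₁₁, R₀₁, R₁₀, μ, ζ, hζ, h00, h11, h01, h10, hμ, hdet⟩ :=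
    IsReduction.exists_cone_data h hA hε hne
  obtain ⟨q, hq, hqe⟩ := exists_cone_discriminant h00 h11 h01 h10 ζ
  set υ := redVelocity A₁ Y ε with hυdef
  -- Half the distance between the two energies, so that the pair near the Dirac energy and the
  -- third eigenvalue cannot interleave.
  set δ := |redEnergy N ε 2 - redEnergy N ε 0| / 2 with hδ
  have hδ0 : 0 < δ := half_pos (abs_pos.2 (sub_ne_zero.2 hne))
  have ht : LipOrder 1 fun κ => (R₀₀ κ + R₁₁ κ).re := (h00.add h11).re
  have hta := ht.div_norm.const_mul (1 / (2 * υ))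
  have hqa := (hq.re.div_norm.div_norm.const_mul (1 / υ ^ 2)).sqrt_one_add
  -- The shift of the mean energy enters the two errors with opposite signs, since the lower cone is
  -- written as −υ|κ|(1 + e₋).
  have hm := hta.neg.add hqa
  have hp := hta.add hqa
  have hnorm : Tendsto (fun κ : Plane => ‖κ‖) (𝓝 0) (𝓝 0) := by
    simpa using (continuous_norm (E := Plane)).tendsto 0
  have hsmall : ∀ {f : Plane → ℝ}, LipOrder 0 f →
      ∀ᶠ κ in 𝓝 (0 : Plane), |υ * ‖κ‖ * (1 + f κ)| < δ := by
    intro f hf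
    have h1 : Tendsto (fun κ : Plane => |υ * ‖κ‖ * (1 + f κ)|) (𝓝 0) (𝓝 0) := by
      have := (((hnorm.const_mul υ).mul (hf.tendsto.const_add 1)).abs)
      simpa using this
    exact h1.eventually_lt_const hδ0
  have hin : Tendsto (fun κ : Plane => ((ε : ℂ), toC κ)) (𝓝 0) (𝓝 ((ε : ℂ), toC 0)) := by
    refine tendsto_const_nhds.prodMk_nhds ?_
    rw [toC_zero]
    exact squeeze_zero_norm norm_toC_le hnorm
  refine ⟨_, _, hm, hp, ?_⟩
  filter_upwards [hin.eventually h, hdet, hsmall hm, hsmall hp,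
    hμ.eventually (Metric.ball_mem_nhds _ hδ0)] with κ hκ hd hsm hsp hμκ
  obtain ⟨e, b, hs⟩ := hκ.exists_spectral hA hε
  obtain ⟨i, j, k, hij, hik, hjk, hk, htr, hdisc⟩ := eigenvalue_split fun x =>
    (det_sub_of_diagonal (N := (N (ε, toC κ)).toLinearMap) hs.eigen x).symm.trans (hd x)
  rw [hqe] at hdisc
  have htr' : e i + e j = 2 * redEnergy N ε 0 + (R₀₀ κ + R₁₁ κ).re := by
    have := congrArg Complex.re htr
    simp only [Complex.add_re, Complex.ofReal_re] at this ⊢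
    linarith
  have hdisc' : (υ * ‖κ‖) ^ 2 + (q κ).re = ((e j - e i) / 2) ^ 2 := by
    rw [hζ] at hdisc
    have := congrArg Complex.re hdisc
    rw [Complex.add_re, Complex.ofReal_re] at this
    rw [this]
    norm_cast
  obtain ⟨hj, hi⟩ := cone_formula hυ (fun h0 => by
    rw [norm_eq_zero] at h0
    rw [h0, hq.1, h00.1, h11.1]
    simp) (norm_nonneg κ) (hs.mono hij.le) htr' hdisc'
  refine ⟨e, i, j, k, hκ.isBandEnergy hA hε hs, hs.mono, hij, hik, hjk, hj, hi, ?_, ?_, ?_⟩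
  · rwa [hi, sub_sub_cancel_left, abs_neg]
  · rwa [hj, add_sub_cancel_left]
  · have h1 : ‖μ κ - redEnergy N ε 2‖ < δ := by rw [← dist_eq_norm]; exact hμκ
    rwa [hk, ← Complex.ofReal_sub, Complex.norm_real] at h1

/-- A conical crossing of two consecutive bands is a Dirac point. -/
lemma IsReduction.isDiracPointOf (h : ∀ᶠ p in 𝓝 ((ε : ℂ), toC 0), IsReduction A₁ Y N p)
    (hA : SmoothPeriodic A₁) (hε : IsHoneycombMedium (lowContrast A₁ ε))
    (hne : redEnergy N ε 2 ≠ redEnergy N ε 0) (hυ : 0 < redVelocity A₁ Y ε) :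
    IsDiracPointOf (lowContrast A₁ ε) K (redEnergy N ε 0)
      (if redEnergy N ε 0 < redEnergy N ε 2 then 1 else 2) (redVelocity A₁ Y ε) := by
  obtain ⟨em, ep, hm, hp, hc⟩ := IsReduction.exists_cones h hA hε hne hυ
  set E₀ := redEnergy N ε 0 with hE
  set E₂ := redEnergy N ε 2 with hE2
  set υ := redVelocity A₁ Y ε
  set b : ℕ := if E₀ < E₂ then 1 else 2 with hb
  have hband : ∀ᶠ κ : Plane in 𝓝 0,
      IsBandEnergy (lowContrast A₁ ε) (K + κ) b (E₀ - υ * ‖κ‖ * (1 + em κ)) ∧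
      IsBandEnergy (lowContrast A₁ ε) (K + κ) (b + 1) (E₀ + υ * ‖κ‖ * (1 + ep κ)) := by
    filter_upwards [hc] with κ ⟨e, i, j, k, hbe, hmono, hij, hik, hjk, hj, hi, hsi, hsj, hsk⟩
    rw [← hi, ← hj]
    rw [abs_lt] at hsi hsj hsk
    by_cases hlt : E₀ < E₂
    · have hb1 : b = 1 := if_pos hlt
      rw [abs_of_pos (sub_pos.2 hlt)] at hsi hsj hsk
      -- The third eigenvalue lies above the pair, so the pair has the indices 0 and 1.
      have hk : j < k := by
        by_contra hcon
        have := hmono (not_lt.1 hcon)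
        linarith [hsi.1, hsj.2, hsk.1]
      have hi0 : i = 0 := by omega
      have hj1 : j = 1 := by omega
      subst hi0 hj1
      rw [hb1]
      exact ⟨hbe 0, hbe 1⟩
    · have hb1 : b = 2 := if_neg hlt
      have hlt' : E₂ < E₀ := lt_of_le_of_ne (not_lt.1 hlt) hne
      rw [abs_of_neg (sub_neg.2 hlt')] at hsi hsj hsk
      -- The third eigenvalue lies below the pair, so the pair has the indices 1 and 2.
      have hk : k < i := by
        by_contra hcon
        have := hmono (not_lt.1 hcon)
        linarith [hsi.1, hsj.2, hsk.2]
      have hi0 : i = 1 := by omega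
      have hj1 : j = 2 := by omega
      subst hi0 hj1
      rw [hb1]
      exact ⟨hbe 1, hbe 2⟩
  obtain ⟨r, hr, hball⟩ := Metric.eventually_nhds_iff_ball.1 hband
  obtain ⟨L, r₁, hr₁, hL⟩ := hm.exists_lipschitzOnWith
  obtain ⟨L', r₂, hr₂, hL'⟩ := hp.exists_lipschitzOnWith
  have hb0 := hball 0 (Metric.mem_ball_self hr)
  simp only [norm_zero, mul_zero, zero_mul, sub_zero, add_zero] at hb0
  set ρ := min r (min r₁ r₂) with hρ
  have hshift : ∀ {k : Plane}, k ∈ Metric.ball K ρ → k - K ∈ Metric.ball (0 : Plane) ρ := by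
    intro k hk
    rwa [mem_ball_zero_iff, ← dist_eq_norm]
  have hlip : ∀ {f : Plane → ℝ} {L : ℝ≥0}, LipschitzOnWith L f (Metric.ball 0 ρ) →
      LipschitzOnWith L (fun k => f (k - K)) (Metric.ball K ρ) := by
    intro f L hf
    refine LipschitzOnWith.of_dist_le_mul fun x hx y hy => ?_
    refine (hf.dist_le_mul _ (hshift hx) _ (hshift hy)).trans ?_
    rw [dist_sub_right]
  have hρ1 : ρ ≤ r₁ := (min_le_right _ _).trans (min_le_left _ _)
  have hρ2 : ρ ≤ r₂ := (min_le_right _ _).trans (min_le_right _ _)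
  refine ⟨hb0.1, hb0.2, h.self_of_nhds.dirac_eigenspace hA hε hne, hυ, ρ,
    fun k => E₀ - υ * ‖k - K‖ * (1 + em (k - K)), fun k => E₀ + υ * ‖k - K‖ * (1 + ep (k - K)),
    fun k => em (k - K), fun k => ep (k - K), lt_min hr (lt_min hr₁ hr₂),
    ⟨L, hlip (hL ρ hρ1).1⟩, ⟨L', hlip (hL' ρ hρ2).1⟩, ⟨(max L L' : ℝ≥0), fun k hk => ⟨?_, ?_⟩⟩,
    fun k hk => ?_⟩
  · refine ((hL ρ hρ1).2 _ (hshift hk)).trans ?_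
    gcongr
    exact le_max_left _ _
  · refine ((hL' ρ hρ2).2 _ (hshift hk)).trans ?_
    gcongr
    exact le_max_right _ _
  · have h1 := hball (k - K) (Metric.ball_subset_ball (min_le_left _ _) (hshift hk))
    rw [add_sub_cancel] at h1
    exact ⟨h1.1, h1.2, by ring, by ring⟩

end Reduction

end Honeycomb
end

noncomputable section

namespace Honeycomb

open Asymptotics

/-! ### Bifurcation of the triple eigenvalue for small contrast. -/

lemma IsReduction.cellInner_diracVec {A₁ : Medium}
    {Y : ℂ × (Fin 2 → ℂ) → (Fin 3 → ℂ) →L[ℂ] Seq}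
    {N : ℂ × (Fin 2 → ℂ) → (Fin 3 → ℂ) →L[ℂ] (Fin 3 → ℂ)} {ε : ℝ}
    (h : IsReduction A₁ Y N (ε, toC 0)) :
    cellInner (bf 0 (diracVec Y ε)) (bf 0 (diracVec Y ε)) = 1 := by
  have hg : (redGram Y ε : ℂ) ≠ 0 := Complex.ofReal_ne_zero.2 h.redGram_pos.ne'
  rw [cellInner_bf, diracVec, map_smul, inner_smul_left, inner_smul_right, Complex.conj_ofReal,
    h.normalization_mul, inner_redVec_zero, div_self hg]

/-- The sign of a quantity with a nonzero linear term. -/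
lemma eventually_sign_of_isBigO {f : ℝ → ℝ} {c : ℝ} (hc : c ≠ 0)
    (hf : (fun ε => f ε - c * ε) =O[𝓝 0] fun ε : ℝ => ε ^ 2) :
    ∀ᶠ ε in 𝓝 (0 : ℝ), (0 < c * ε → 0 < f ε) ∧ (c * ε < 0 → f ε < 0) := by
  have h1 : (fun ε : ℝ => ε ^ 2) =o[𝓝 0] fun ε : ℝ => c * ε := by
    refine IsLittleO.const_mul_right hc ?_
    simpa using isLittleO_pow_pow (𝕜 := ℝ) (show 1 < 2 by norm_num)
  filter_upwards [(hf.trans_isLittleO h1).bound (show (0 : ℝ) < 1 / 2 by norm_num)] with ε hε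
  rw [Real.norm_eq_abs, Real.norm_eq_abs] at hε
  refine ⟨fun h => ?_, fun h => ?_⟩
  · rw [abs_of_pos h] at hε
    have := (abs_le.1 hε).1
    linarith
  · rw [abs_of_neg h] at hε
    have := (abs_le.1 hε).2
    linarith

/-- The bifurcation of the triple eigenvalue at `K`, and the Dirac point there. -/
theorem exists_dirac_family (A₁ : Medium)
    (hA : ∀ᶠ ε : ℝ in 𝓝 0, IsHoneycombMedium (lowContrast A₁ ε))
    (hnd : bilin K (fourierCoeff A₁ (0, -1)) (rot K) ≠ 0) :
    ∃ (C : ℝ) (E_D E_t : ℝ → ℝ) (Φ₁ Φ_t : ℝ → Plane → ℂ), ∀ᶠ ε : ℝ in 𝓝 0,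
      (IsSimpleEigenpair (lowContrast A₁ ε) K τ (E_D ε) (Φ₁ ε) ∧
        cellInner (Φ₁ ε) (Φ₁ ε) = 1 ∧
        ‖(E_D ε : ℂ) - ((‖K‖ : ℂ) ^ 2 + (ε : ℂ) * (bilin K (fourierCoeff A₁ (0, 0)) K
          - bilin K (fourierCoeff A₁ (0, -1)) (rot K)))‖ ≤ C * ε ^ 2) ∧
      IsSimpleEigenpair (lowContrast A₁ ε) K ((starRingEnd ℂ) τ) (E_D ε) (PC (Φ₁ ε)) ∧
      (IsSimpleEigenpair (lowContrast A₁ ε) K 1 (E_t ε) (Φ_t ε) ∧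
        ‖(E_t ε : ℂ) - ((‖K‖ : ℂ) ^ 2 + (ε : ℂ) * (bilin K (fourierCoeff A₁ (0, 0)) K
          + 2 * bilin K (fourierCoeff A₁ (0, -1)) (rot K)))‖ ≤ C * ε ^ 2 ∧
        (ε ≠ 0 → E_t ε ≠ E_D ε)) ∧
      |fermiVelocity (lowContrast A₁ ε) (Φ₁ ε) (PC (Φ₁ ε)) - 4 * Real.pi / 3| ≤ C * |ε| ∧
      (0 < ε * (bilin K (fourierCoeff A₁ (0, -1)) (rot K)).re →
        IsDiracPointOf (lowContrast A₁ ε) K (E_D ε) 1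
          (fermiVelocity (lowContrast A₁ ε) (Φ₁ ε) (PC (Φ₁ ε)))) ∧
      (ε * (bilin K (fourierCoeff A₁ (0, -1)) (rot K)).re < 0 →
        IsDiracPointOf (lowContrast A₁ ε) K (E_D ε) 2
          (fermiVelocity (lowContrast A₁ ε) (Φ₁ ε) (PC (Φ₁ ε)))) := by
  obtain ⟨Y, N, hY0, -, hR⟩ := exists_reduction A₁
  have hs := smoothPeriodic_of_eventually hA
  set κ := bilin K (fourierCoeff A₁ (0, -1)) (rot K) with hκ
  have hκr : ((κ.re : ℝ) : ℂ) = κ := Complex.conj_eq_iff_re.1 (conj_bilin_rot hA)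
  have hκ0 : 3 * κ.re ≠ 0 := by
    refine mul_ne_zero (by norm_num) fun h0 => hnd ?_
    rw [← hκr, h0, Complex.ofReal_zero]
  have hY : ContDiffAt ℂ 2 Y 0 := hR.self_of_nhds.contDiffAt_Y
  have hin : Tendsto (fun ε : ℝ => ((ε : ℂ), toC 0)) (𝓝 0) (𝓝 0) := by
    have : Tendsto (fun ε : ℝ => (ε : ℂ)) (𝓝 0) (𝓝 0) := by
      simpa using Complex.continuous_ofReal.tendsto 0
    rw [toC_zero]
    exact this.prodMk_nhds tendsto_const_nhds
  -- For each small ε the reduction must hold on a whole neighbourhood of (ε, 0), since the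
  -- quasi-momentum moves as well.
  have hRR : ∀ᶠ ε : ℝ in 𝓝 0, ∀ᶠ p in 𝓝 ((ε : ℂ), toC 0), IsReduction A₁ Y N p :=
    hin.eventually (eventually_eventually_nhds.2 hR)
  have hRε : ∀ᶠ ε : ℝ in 𝓝 0, IsReduction A₁ Y N (ε, toC 0) :=
    hRR.mono fun ε h => h.self_of_nhds
  have b0 := isBigO_redEnergy hA hY hY0 hRε 0
  have b2 := isBigO_redEnergy hA hY hY0 hRε 2
  have bv := isBigO_redVelocity (A₁ := A₁) hY hY0
  rw [if_neg (by decide)] at b0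
  rw [if_pos rfl] at b2
  -- The first order terms a + 2κ and a − κ differ by 3κ, which is real.
  have hsign : ∀ᶠ ε : ℝ in 𝓝 0,
      (0 < 3 * κ.re * ε → 0 < redEnergy N ε 2 - redEnergy N ε 0) ∧
      (3 * κ.re * ε < 0 → redEnergy N ε 2 - redEnergy N ε 0 < 0) := by
    refine eventually_sign_of_isBigO hκ0 ?_
    refine (IsBigO.of_bound 1 (Eventually.of_forall fun ε => ?_)).trans (b2.sub b0)
    rw [one_mul, ← Complex.norm_real]
    refine le_of_eq (congrArg _ ?_)
    push_cast
    rw [hκr, ← hκ]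
    ring
  have hpos : ∀ᶠ ε : ℝ in 𝓝 0, 0 < redVelocity A₁ Y ε := by
    have h1 : Tendsto (fun ε => redVelocity A₁ Y ε - 4 * Real.pi / 3) (𝓝 0) (𝓝 0) :=
      bv.trans_tendsto tendsto_id
    have h2 := h1.eventually_const_lt (show -(4 * Real.pi / 3) < 0 by
      have := Real.pi_pos
      linarith)
    exact h2.mono fun ε h => by linarith
  obtain ⟨C₀, h0⟩ := b0.bound
  obtain ⟨C₂, h2⟩ := b2.bound
  obtain ⟨C₁, h1⟩ := bv.bound
  refine ⟨max C₀ (max C₁ C₂), fun ε => redEnergy N ε 0, fun ε => redEnergy N ε 2,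
    fun ε => bf 0 (diracVec Y ε), fun ε => bf 0 ((1 : ℂ) • redVec Y ε 2), ?_⟩
  filter_upwards [hA, hRR, hsign, hpos, h0, h1, h2] with ε hε hR hsg hυ h0 h1 h2
  have h := hR.self_of_nhds
  rw [Real.norm_eq_abs, abs_pow, sq_abs] at h0 h2
  rw [Real.norm_eq_abs, Real.norm_eq_abs] at h1
  rw [h.fermiVelocity_eq hs hε]
  have hD := fun hne => IsReduction.isDiracPointOf hR hs hε hne hυ
  have e2 := (h.isSimpleEigenpair hs hε 1 h.normalization_ne_zero).congr
    (h.PC_bf_diracVec hs hε).symm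
  rw [h.redEnergy_one hs hε] at e2
  refine ⟨⟨h.isSimpleEigenpair hs hε 0 h.normalization_ne_zero, h.cellInner_diracVec, ?_⟩, e2,
    ⟨h.isSimpleEigenpair hs hε 2 one_ne_zero, h2.trans ?_, fun hne => ?_⟩, h1.trans ?_,
    fun hlt => ?_, fun hlt => ?_⟩
  · refine le_trans (le_of_eq ?_) (h0.trans (mul_le_mul_of_nonneg_right (le_max_left _ _)
      (sq_nonneg ε)))
    congr 1
    ring
  · exact mul_le_mul_of_nonneg_right ((le_max_right _ _).trans (le_max_right _ _)) (sq_nonneg ε)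
  · rcases lt_or_gt_of_ne (mul_ne_zero hκ0 hne) with h3 | h3
    · exact (sub_neg.1 (hsg.2 h3)).ne
    · exact (sub_pos.1 (hsg.1 h3)).ne'
  · exact mul_le_mul_of_nonneg_right ((le_max_left _ _).trans (le_max_right _ _)) (abs_nonneg ε)
  · have h3 : redEnergy N ε 0 < redEnergy N ε 2 :=
      sub_pos.1 (hsg.1 (by rw [mul_assoc, mul_comm κ.re]; linarith))
    have h4 := hD h3.ne'
    rwa [if_pos h3] at h4
  · have h3 : redEnergy N ε 2 < redEnergy N ε 0 :=
      sub_neg.1 (hsg.2 (by rw [mul_assoc, mul_comm κ.re]; linarith))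
    have h4 := hD h3.ne
    rwa [if_neg h3.not_gt] at h4

end Honeycomb
end

noncomputable section

namespace Honeycomb

/-! ### Quasi-momenta which differ by a dual lattice vector -/

/-- Dual lattice waves equal 1 on the lattice. Equality of the predicates, rather than equivalence,
allows rewriting inside every notion built on them. -/
lemma memL2_add_dualVec (k : Plane) (n : ℤ × ℤ) : MemL2 (k + dualVec n) = MemL2 k := by
  have h : ∀ m, planeWave (k + dualVec n) (latticeVec m) = planeWave k (latticeVec m) := fun m => by
    rw [planeWave_add_left, planeWave_dual_lattice, mul_one]
  simp only [planeWave] at h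
  funext f
  simp only [MemL2, h]

lemma inEigenspace_add_dualVec (A : Medium) (k : Plane) (n : ℤ × ℤ) :
    InEigenspace A (k + dualVec n) = InEigenspace A k := by
  funext E f
  simp only [InEigenspace, MemH1, memL2_add_dualVec]

lemma isBandEnergy_add_dualVec (A : Medium) (k : Plane) (n : ℤ × ℤ) :
    IsBandEnergy A (k + dualVec n) = IsBandEnergy A k := by
  funext b E
  simp only [IsBandEnergy, IsEigenfunction, inEigenspace_add_dualVec]

lemma _root_.LipschitzOnWith.comp_sub_const {E : Type*} [SeminormedAddCommGroup E] {f : E → ℝ}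
    {L : ℝ≥0} {q : E} {r : ℝ} (hf : LipschitzOnWith L f (Metric.ball q r)) (v : E) :
    LipschitzOnWith L (fun k => f (k - v)) (Metric.ball (q + v) r) := by
  have hm : ∀ {k}, k ∈ Metric.ball (q + v) r → k - v ∈ Metric.ball q r := fun {k} hk => by
    rwa [Metric.mem_ball, ← dist_add_right _ _ v, sub_add_cancel]
  exact LipschitzOnWith.of_dist_le_mul fun x hx y hy => by
    simpa using hf.dist_le_mul _ (hm hx) _ (hm hy)

lemma IsDiracPointOf.add_dualVec {A : Medium} {q : Plane} {E : ℝ} {b : ℕ} {υ : ℝ}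
    (h : IsDiracPointOf A q E b υ) (n : ℤ × ℤ) : IsDiracPointOf A (q + dualVec n) E b υ := by
  obtain ⟨h1, h2, h3, h4, ζ₀, Em, Ep, em, ep, hζ, ⟨L, hL⟩, ⟨L', hL'⟩, ⟨C, hC⟩, hb⟩ := h
  have hm : ∀ {k}, k ∈ Metric.ball (q + dualVec n) ζ₀ → k - dualVec n ∈ Metric.ball q ζ₀ :=
    fun {k} hk => by rwa [Metric.mem_ball, ← dist_add_right _ _ (dualVec n), sub_add_cancel]
  have hs : ∀ k, k - dualVec n - q = k - (q + dualVec n) := fun k => by abel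
  refine ⟨by rwa [isBandEnergy_add_dualVec], by rwa [isBandEnergy_add_dualVec], ?_, h4, ζ₀,
    fun k => Em (k - dualVec n), fun k => Ep (k - dualVec n), fun k => em (k - dualVec n),
    fun k => ep (k - dualVec n), hζ, ⟨L, hL.comp_sub_const _⟩, ⟨L', hL'.comp_sub_const _⟩,
    ⟨C, fun k hk => ?_⟩, fun k hk => ?_⟩
  · simpa only [MemL2Rot, memL2_add_dualVec, inEigenspace_add_dualVec] using h3
  · simpa only [hs] using hC _ (hm hk)
  · have := hb _ (hm hk)
    rwa [← isBandEnergy_add_dualVec A (k - dualVec n) n, sub_add_cancel, hs] at this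

lemma rot_neg_K : rot (-K) = -K + dualVec (0, -1) := by
  rw [rot_neg, rot_K, neg_add, ← dualVec_neg]
  congr 2

lemma rot_rot_neg_K : rot (rot (-K)) = -K + dualVec (1, 0) := by
  rw [rot_neg, rot_neg, rot_rot_K, neg_add, ← dualVec_neg]
  congr 2

lemma IsDiracPointOf.verticesK {A : Medium} {E : ℝ} {b : ℕ} {υ : ℝ}
    (h : IsDiracPointOf A K E b υ) : ∀ q ∈ verticesK, IsDiracPointOf A q E b υ := by
  rintro q (rfl | rfl | rfl)
  · exact h
  · rw [rot_K]; exact h.add_dualVec _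
  · rw [rot_rot_K]; exact h.add_dualVec _

lemma IsDiracPointOf.verticesK' {A : Medium} {E : ℝ} {b : ℕ} {υ : ℝ}
    (h : IsDiracPointOf A (-K) E b υ) : ∀ q ∈ verticesK', IsDiracPointOf A q E b υ := by
  rintro q (rfl | rfl | rfl)
  · exact h
  · rw [rot_neg_K]; exact h.add_dualVec _
  · rw [rot_rot_neg_K]; exact h.add_dualVec _

/-! ### Complex conjugation -/

/-- The pointwise conjugate of a function. -/
def conjFun (f : Plane → ℂ) : Plane → ℂ := fun x => (starRingEnd ℂ) (f x)

/-- The entrywise conjugate of a medium. -/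
def conjMedium (A : Medium) : Medium := fun x => (A x).map (starRingEnd ℂ)

lemma conjMedium_apply (A : Medium) (x : Plane) (i j : Fin 2) :
    conjMedium A x i j = (starRingEnd ℂ) (A x i j) := rfl

lemma conjFun_conjFun (f : Plane → ℂ) : conjFun (conjFun f) = f :=
  funext fun _ => Complex.conj_conj _

lemma conjMedium_conjMedium (A : Medium) : conjMedium (conjMedium A) = A := by
  funext x
  ext i j
  exact Complex.conj_conj _

lemma PC_conjFun (f : Plane → ℂ) : PC (conjFun f) = conjFun (PC f) := rfl

lemma rotOp_conjFun (f : Plane → ℂ) : rotOp (conjFun f) = conjFun (rotOp f) := rfl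

lemma PC_PC (f : Plane → ℂ) : PC (PC f) = f := by
  funext x
  simp [PC]

lemma conjMedium_lowContrast (A : Medium) (ε : ℝ) :
    conjMedium (lowContrast A ε) = lowContrast (conjMedium A) ε := by
  funext x
  ext i j
  rw [conjMedium_apply]
  simp only [lowContrast, Matrix.add_apply, Matrix.smul_apply, smul_eq_mul, map_add, map_mul,
    Complex.conj_ofReal, conjMedium_apply, Matrix.one_apply]
  split_ifs <;> simp

lemma pderiv_conjFun (j : Fin 2) (f : Plane → ℂ) : pderiv j (conjFun f) = conjFun (pderiv j f) := by
  funext x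
  have h : fderiv ℝ (conjFun f) x = (Complex.conjCLE : ℂ →L[ℝ] ℂ).comp (fderiv ℝ f x) :=
    ContinuousLinearEquiv.comp_fderiv Complex.conjCLE
  rw [pderiv, h]
  rfl

lemma divOp_conjMedium (A : Medium) (f : Plane → ℂ) :
    divOp (conjMedium A) f = conjFun (divOp A (conjFun f)) := by
  have h : ∀ i j, (fun y => conjMedium A y i j * pderiv j f y) =
      conjFun fun y => A y i j * pderiv j (conjFun f) y := by
    intro i j
    rw [pderiv_conjFun]
    funext y
    simp [conjFun, conjMedium_apply]
  funext x
  simp only [divOp, h, pderiv_conjFun, conjFun, map_neg, map_sum]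

lemma contDiff_conjFun {f : Plane → ℂ} (hf : ContDiff ℝ ∞ f) : ContDiff ℝ ∞ (conjFun f) :=
  Complex.conjCLE.contDiff.comp hf

lemma IsHoneycombMedium.conj {A : Medium} (h : IsHoneycombMedium A) :
    IsHoneycombMedium (conjMedium A) where
  smooth i j := contDiff_conjFun (h.smooth i j)
  hermitian x := by
    ext i j
    rw [Matrix.conjTranspose_apply, conjMedium_apply, conjMedium_apply, ← (h.hermitian x).apply i j]
    rfl
  periodic m x := by rw [conjMedium, h.periodic]; rfl
  elliptic := by
    obtain ⟨c, C, hc, hC, he⟩ := h.elliptic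
    refine ⟨c, C, hc, hC, fun x ξ => ?_⟩
    have h1 := he x fun i => (starRingEnd ℂ) (ξ i)
    have h2 : (∑ i, ∑ j, (starRingEnd ℂ) (ξ i) * conjMedium A x i j * ξ j) = (starRingEnd ℂ)
        (∑ i, ∑ j, (starRingEnd ℂ) ((starRingEnd ℂ) (ξ i)) * A x i j * (starRingEnd ℂ) (ξ j)) := by
      simp only [map_sum, map_mul, Complex.conj_conj, conjMedium_apply]
    rw [h2, Complex.conj_re]
    simpa only [RCLike.norm_conj] using h1
  pc_invariant f hf := by
    rw [divOp_conjMedium, divOp_conjMedium, PC_conjFun, h.pc_invariant _ (contDiff_conjFun hf),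
      PC_conjFun]
  rot_invariant f hf := by
    rw [divOp_conjMedium, divOp_conjMedium, rotOp_conjFun,
      h.rot_invariant _ (contDiff_conjFun hf), rotOp_conjFun]

/-- The reversed index turns (0, −1) into (0, 1), which is how κ′ arises. -/
lemma fourierCoeff_conjMedium (A : Medium) (m : ℤ × ℤ) :
    fourierCoeff (conjMedium A) m = (fourierCoeff A (-m)).map (starRingEnd ℂ) := by
  ext i j
  simp only [fourierCoeff, Matrix.of_apply, Matrix.map_apply, map_mul, map_inv₀,
    Complex.conj_ofReal]
  rw [← integral_conj]
  congr 1
  refine integral_congr_ae (Eventually.of_forall fun x => ?_)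
  simp only [map_mul, ← Complex.exp_conj, map_neg, Complex.conj_I, Complex.conj_ofReal,
    dualVec_neg, inner_neg_left, Complex.ofReal_neg, conjMedium_apply]
  congr 2
  ring

lemma bilin_map_conj (p q : Plane) (M : Matrix (Fin 2) (Fin 2) ℂ) :
    bilin p (M.map (starRingEnd ℂ)) q = (starRingEnd ℂ) (bilin p M q) := by
  simp only [bilin, map_sum, map_mul, Complex.conj_ofReal, Matrix.map_apply]

lemma MemL2.conj {k : Plane} {f : Plane → ℂ} (h : MemL2 k f) : MemL2 (-k) (conjFun f) := by
  refine ⟨h.1.of_le (Complex.continuous_conj.comp_aestronglyMeasurable h.1.1)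
    (Eventually.of_forall fun x => (RCLike.norm_conj _).le), fun m => ?_⟩
  filter_upwards [h.2 m] with x hx
  rw [conjFun, hx, map_mul, ← Complex.exp_conj]
  simp [conjFun]

lemma MemL2Rot.conj {k : Plane} {σ : ℂ} {f : Plane → ℂ} (h : MemL2Rot k σ f) :
    MemL2Rot (-k) ((starRingEnd ℂ) σ) (conjFun f) := by
  refine ⟨h.1.conj, h.2.mono fun x hx => ?_⟩
  rw [rotOp_conjFun, conjFun, hx, map_mul]
  rfl

lemma _root_.MeasureTheory.LocallyIntegrable.conjFun {f : Plane → ℂ} (h : LocallyIntegrable f) :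
    LocallyIntegrable (conjFun f) :=
  h.mono (Complex.continuous_conj.comp_aestronglyMeasurable h.aestronglyMeasurable)
    (Eventually.of_forall fun _ => (RCLike.norm_conj _).le)

lemma HasWeakDeriv.conj {j : Fin 2} {f g : Plane → ℂ} (h : HasWeakDeriv j f g) :
    HasWeakDeriv j (conjFun f) (conjFun g) := by
  refine ⟨h.1.conjFun, h.2.1.conjFun, fun η h1 h2 => ?_⟩
  have e : ∀ (u : Plane → ℝ) (w : Plane → ℂ),
      ∫ x, u x • conjFun w x = (starRingEnd ℂ) (∫ x, u x • w x) := by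
    intro u w
    rw [← integral_conj]
    simp [conjFun]
  rw [e, e, h.2.2 η h1 h2, map_neg]

lemma MemH1.weakDeriv_conjFun {k : Plane} {f : Plane → ℂ} (h : MemH1 k f) (j : Fin 2) :
    weakDeriv j (conjFun f) =ᵐ[volume] conjFun (weakDeriv j f) :=
  (h.2 j).1.conj.weakDeriv_ae_eq

lemma MemH1.conj {k : Plane} {f : Plane → ℂ} (h : MemH1 k f) : MemH1 (-k) (conjFun f) :=
  ⟨h.1.conj, fun j => ⟨(h.2 j).1.conj.weakDeriv_spec,
    (h.2 j).2.conj.congr (h.weakDeriv_conjFun j).symm⟩⟩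

lemma cellInner_conjFun (f g : Plane → ℂ) :
    cellInner (conjFun f) (conjFun g) = (starRingEnd ℂ) (cellInner f g) := by
  rw [cellInner, cellInner, ← integral_conj]
  simp [conjFun]

lemma form_conjFun {k l : Plane} (A : Medium) {f g : Plane → ℂ} (hf : MemH1 k f) (hg : MemH1 l g) :
    form (conjMedium A) (conjFun f) (conjFun g) = (starRingEnd ℂ) (form A f g) := by
  rw [form, form, ← integral_conj]
  refine integral_congr_ae (ae_restrict_of_ae ?_)
  filter_upwards [ae_all_iff.2 hf.weakDeriv_conjFun, ae_all_iff.2 hg.weakDeriv_conjFun]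
    with x h1 h2
  simp only [h1, h2, map_sum, map_mul, conjFun, conjMedium_apply]

lemma InEigenspace.conj {A : Medium} {k : Plane} {E : ℝ} {f : Plane → ℂ}
    (h : InEigenspace A k E f) : InEigenspace (conjMedium A) (-k) E (conjFun f) := by
  refine ⟨h.1.conj, fun ψ hψ => ?_⟩
  have hψ' := hψ.conj
  rw [neg_neg] at hψ'
  rw [← conjFun_conjFun ψ, form_conjFun A hψ' h.1, cellInner_conjFun, h.2 _ hψ', map_mul,
    Complex.conj_ofReal]

lemma IsEigenfunction.conj {A : Medium} {k : Plane} {E : ℝ} {f : Plane → ℂ}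
    (h : IsEigenfunction A k E f) : IsEigenfunction (conjMedium A) (-k) E (conjFun f) :=
  ⟨h.1.conj, fun h0 => h.2 (h0.mono fun x hx => by simpa [conjFun] using hx)⟩

lemma IsBandEnergy.conj {A : Medium} {k : Plane} {b : ℕ} {E : ℝ} (h : IsBandEnergy A k b E) :
    IsBandEnergy (conjMedium A) (-k) b E := by
  obtain ⟨φ, e, h1, h2, h3, h4, h5⟩ := h
  refine ⟨fun i => conjFun (φ i), e, fun i => (h1 i).conj, fun i j => ?_, h3, h4,
    fun E' f hf ho => ?_⟩
  · rw [cellInner_conjFun, h2]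
    split_ifs <;> simp
  · have hf' := hf.conj
    rw [neg_neg, conjMedium_conjMedium] at hf'
    refine h5 E' _ hf' fun i => ?_
    rw [← conjFun_conjFun (φ i), cellInner_conjFun, ho i, map_zero]

lemma _root_.LipschitzOnWith.comp_neg {E : Type*} [SeminormedAddCommGroup E] {f : E → ℝ}
    {L : ℝ≥0} {q : E} {r : ℝ} (hf : LipschitzOnWith L f (Metric.ball q r)) :
    LipschitzOnWith L (fun k => f (-k)) (Metric.ball (-q) r) := by
  have hm : ∀ {k}, k ∈ Metric.ball (-q) r → -k ∈ Metric.ball q r := fun {k} hk => by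
    rwa [Metric.mem_ball, ← dist_neg_neg, neg_neg]
  exact LipschitzOnWith.of_dist_le_mul fun x hx y hy => by
    simpa using hf.dist_le_mul _ (hm hx) _ (hm hy)

/-- Conjugation commutes with the rotation and with 𝒫𝒞 and sends k to −k, but it exchanges the
characters τ and τ̄; so `Φ₁` and `Φ₂` trade places. -/
lemma IsDiracPointOf.conj {A : Medium} {q : Plane} {E : ℝ} {b : ℕ} {υ : ℝ}
    (h : IsDiracPointOf A q E b υ) : IsDiracPointOf (conjMedium A) (-q) E b υ := by
  obtain ⟨h1, h2, ⟨Φ₁, Φ₂, hPC, m1, m2, n1, n2, n12, hE⟩, h4, ζ₀, Em, Ep, em, ep, hζ, ⟨L, hL⟩,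
    ⟨L', hL'⟩, ⟨C, hC⟩, hb⟩ := h
  have hm : ∀ {k}, k ∈ Metric.ball (-q) ζ₀ → -k ∈ Metric.ball q ζ₀ := fun {k} hk => by
    rwa [Metric.mem_ball, ← dist_neg_neg, neg_neg]
  have hs : ∀ k, ‖-k - q‖ = ‖k - -q‖ := fun k => by rw [← norm_neg]; congr 1; abel
  refine ⟨h1.conj, h2.conj, ⟨conjFun Φ₂, conjFun Φ₁, ?_, ?_, m1.conj, ?_, ?_, ?_, fun f => ?_⟩,
    h4, ζ₀, fun k => Em (-k), fun k => Ep (-k), fun k => em (-k), fun k => ep (-k), hζ,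
    ⟨L, hL.comp_neg⟩, ⟨L', hL'.comp_neg⟩, ⟨C, fun k hk => ?_⟩, fun k hk => ?_⟩
  · rw [PC_conjFun, hPC, PC_PC]
  · have := m2.conj
    rwa [Complex.conj_conj] at this
  · rw [cellInner_conjFun, n2, map_one]
  · rw [cellInner_conjFun, n1, map_one]
  · have : cellInner Φ₂ Φ₁ = (starRingEnd ℂ) (cellInner Φ₁ Φ₂) := by
      rw [cellInner, cellInner, ← integral_conj]
      simp [mul_comm]
    rw [cellInner_conjFun, this, n12, map_zero, map_zero]
  · have h5 : InEigenspace (conjMedium A) (-q) E f ↔ InEigenspace A q E (conjFun f) := by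
      refine ⟨fun h => ?_, fun h => ?_⟩
      · have := h.conj
        rwa [neg_neg, conjMedium_conjMedium] at this
      · have := h.conj
        rwa [conjFun_conjFun] at this
    rw [h5, hE]
    constructor
    · rintro ⟨c₁, c₂, hf⟩
      refine ⟨(starRingEnd ℂ) c₂, (starRingEnd ℂ) c₁, hf.mono fun x hx => ?_⟩
      have := congrArg (starRingEnd ℂ) hx
      simp only [conjFun, Complex.conj_conj, map_add, map_mul] at this ⊢
      rw [this, add_comm]
    · rintro ⟨c₁, c₂, hf⟩
      refine ⟨(starRingEnd ℂ) c₂, (starRingEnd ℂ) c₁, hf.mono fun x hx => ?_⟩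
      simp only [conjFun, hx, Complex.conj_conj, map_add, map_mul]
      rw [add_comm]
  · rw [← hs]; exact hC _ (hm hk)
  · have := hb _ (hm hk)
    rw [hs] at this
    have e1 := this.1.conj
    have e2 := this.2.1.conj
    rw [neg_neg] at e1 e2
    exact ⟨e1, e2, this.2.2⟩

end Honeycomb
end

/-! ### Assembly: Dirac points at all six vertices. -/

open Honeycomb in
theorem mainTheorem2 (A₁ : Medium)
    (hA : ∀ᶠ ε : ℝ in 𝓝 0, IsHoneycombMedium (lowContrast A₁ ε))
    (hnd : bilin K (fourierCoeff A₁ (0, -1)) (rot K) ≠ 0) :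
    (∃ (ε₀ C : ℝ) (E_D E_t : ℝ → ℝ) (Φ₁ Φ₂ Φ_t : ℝ → Plane → ℂ), 0 < ε₀ ∧
      ∀ ε : ℝ, |ε| < ε₀ →
        -- (1) the simple eigenvalue in the `τ` subspace
        (IsSimpleEigenpair (lowContrast A₁ ε) K τ (E_D ε) (Φ₁ ε) ∧
          cellInner (Φ₁ ε) (Φ₁ ε) = 1 ∧
          ‖(E_D ε : ℂ) - ((‖K‖ : ℂ) ^ 2 + (ε : ℂ) * (bilin K (fourierCoeff A₁ (0, 0)) K
            - bilin K (fourierCoeff A₁ (0, -1)) (rot K)))‖ ≤ C * ε ^ 2) ∧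
        -- (2) the same simple eigenvalue in the conjugate subspace
        (IsSimpleEigenpair (lowContrast A₁ ε) K ((starRingEnd ℂ) τ) (E_D ε) (Φ₂ ε) ∧
          Φ₂ ε = PC (Φ₁ ε)) ∧
        -- (3) the simple eigenvalue in the `1` subspace
        (IsSimpleEigenpair (lowContrast A₁ ε) K 1 (E_t ε) (Φ_t ε) ∧
          ‖(E_t ε : ℂ) - ((‖K‖ : ℂ) ^ 2 + (ε : ℂ) * (bilin K (fourierCoeff A₁ (0, 0)) K
            + 2 * bilin K (fourierCoeff A₁ (0, -1)) (rot K)))‖ ≤ C * ε ^ 2 ∧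
          (ε ≠ 0 → E_t ε ≠ E_D ε)) ∧
        -- (4) the Fermi velocity, and the Dirac point at `K`
        (|fermiVelocity (lowContrast A₁ ε) (Φ₁ ε) (Φ₂ ε) - 4 * Real.pi / 3| ≤ C * |ε| ∧
          (ε ≠ 0 → IsDiracPoint (lowContrast A₁ ε) K (E_D ε))) ∧
        -- (5) the bands which meet, at the vertices of `K` type
        (0 < ε * (bilin K (fourierCoeff A₁ (0, -1)) (rot K)).re → ∀ q ∈ verticesK,
          IsDiracPointOf (lowContrast A₁ ε) q (E_D ε) 1
            (fermiVelocity (lowContrast A₁ ε) (Φ₁ ε) (Φ₂ ε))) ∧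
        (ε * (bilin K (fourierCoeff A₁ (0, -1)) (rot K)).re < 0 → ∀ q ∈ verticesK,
          IsDiracPointOf (lowContrast A₁ ε) q (E_D ε) 2
            (fermiVelocity (lowContrast A₁ ε) (Φ₁ ε) (Φ₂ ε))) ∧
        -- for real media the same holds at all six vertices
        ((∀ x i j, (A₁ x i j).im = 0) →
          (0 < ε * (bilin K (fourierCoeff A₁ (0, -1)) (rot K)).re → ∀ q ∈ verticesK',
            IsDiracPointOf (lowContrast A₁ ε) q (E_D ε) 1
              (fermiVelocity (lowContrast A₁ ε) (Φ₁ ε) (Φ₂ ε))) ∧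
          (ε * (bilin K (fourierCoeff A₁ (0, -1)) (rot K)).re < 0 → ∀ q ∈ verticesK',
            IsDiracPointOf (lowContrast A₁ ε) q (E_D ε) 2
              (fermiVelocity (lowContrast A₁ ε) (Φ₁ ε) (Φ₂ ε))))) ∧
    -- for complex media the vertices of `K'` type are governed by the coefficient of index `(0, 1)`
    (bilin K (fourierCoeff A₁ (0, 1)) (rot K) ≠ 0 →
      ∃ (ε₀ C : ℝ) (E_D' υ' : ℝ → ℝ), 0 < ε₀ ∧
        ∀ ε : ℝ, |ε| < ε₀ →
          ‖(E_D' ε : ℂ) - ((‖K‖ : ℂ) ^ 2 + (ε : ℂ) * (bilin K (fourierCoeff A₁ (0, 0)) K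
            - bilin K (fourierCoeff A₁ (0, 1)) (rot K)))‖ ≤ C * ε ^ 2 ∧
          |υ' ε - 4 * Real.pi / 3| ≤ C * |ε| ∧
          (0 < ε * (bilin K (fourierCoeff A₁ (0, 1)) (rot K)).re → ∀ q ∈ verticesK',
            IsDiracPointOf (lowContrast A₁ ε) q (E_D' ε) 1 (υ' ε)) ∧
          (ε * (bilin K (fourierCoeff A₁ (0, 1)) (rot K)).re < 0 → ∀ q ∈ verticesK',
            IsDiracPointOf (lowContrast A₁ ε) q (E_D' ε) 2 (υ' ε))) := by
  refine ⟨?_, fun hnd' => ?_⟩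
  · obtain ⟨C, E_D, E_t, Φ₁, Φ_t, h⟩ := exists_dirac_family A₁ hA hnd
    obtain ⟨ε₀, hε₀, h⟩ := Metric.eventually_nhds_iff_ball.1 h
    refine ⟨ε₀, C, E_D, E_t, Φ₁, fun ε => PC (Φ₁ ε), Φ_t, hε₀, fun ε hε => ?_⟩
    obtain ⟨h1, h2, h3, h4, h5, h6⟩ := h ε (by simpa using hε)
    -- The parameter κ is real, so its real part is nonzero and carries its sign.
    have hκr : (bilin K (fourierCoeff A₁ (0, -1)) (rot K)).re ≠ 0 := fun h0 => hnd (by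
      rw [← Complex.conj_eq_iff_re.1 (conj_bilin_rot hA), h0, Complex.ofReal_zero])
    refine ⟨h1, ⟨h2, rfl⟩, h3, ⟨h4, fun hne => ?_⟩, fun hp => (h5 hp).verticesK,
      fun hn => (h6 hn).verticesK, fun hreal => ?_⟩
    · rcases lt_or_gt_of_ne (mul_ne_zero hne hκr) with hn | hp
      · exact ⟨2, _, h6 hn⟩
      · exact ⟨1, _, h5 hp⟩
    -- A real medium is its own conjugate, so conjugation carries the Dirac point from K to −K with
    -- the same energy, bands and velocity.
    · have hc : conjMedium (lowContrast A₁ ε) = lowContrast A₁ ε := by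
        rw [conjMedium_lowContrast]
        congr 1
        funext x
        ext i j
        exact Complex.conj_eq_iff_im.2 (hreal x i j)
      refine ⟨fun hp => ?_, fun hn => ?_⟩
      · have := (h5 hp).conj
        rw [hc] at this
        exact this.verticesK'
      · have := (h6 hn).conj
        rw [hc] at this
        exact this.verticesK'
  · have hcoeff : ∀ m p q, bilin p (fourierCoeff (conjMedium A₁) m) q =
        (starRingEnd ℂ) (bilin p (fourierCoeff A₁ (-m)) q) := fun m p q => by
      rw [fourierCoeff_conjMedium, bilin_map_conj]
    have e1 : -((0, -1) : ℤ × ℤ) = (0, 1) := by simp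
    have e0 : -((0, 0) : ℤ × ℤ) = (0, 0) := by simp
    -- The family is built at K for the conjugate medium and then conjugated, which yields Dirac
    -- points of the original medium at −K.
    obtain ⟨C, E_D, E_t, Φ₁, Φ_t, h⟩ := exists_dirac_family (conjMedium A₁)
      (hA.mono fun ε hε => by rw [← conjMedium_lowContrast]; exact hε.conj)
      (by rwa [hcoeff, e1, map_ne_zero])
    obtain ⟨ε₀, hε₀, h⟩ := Metric.eventually_nhds_iff_ball.1 h
    refine ⟨ε₀, C, E_D,
      fun ε => fermiVelocity (lowContrast (conjMedium A₁) ε) (Φ₁ ε) (PC (Φ₁ ε)), hε₀,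
      fun ε hε => ?_⟩
    obtain ⟨h1, -, -, h4, h5, h6⟩ := h ε (by simpa using hε)
    have hc : conjMedium (lowContrast (conjMedium A₁) ε) = lowContrast A₁ ε := by
      rw [conjMedium_lowContrast, conjMedium_conjMedium]
    rw [hcoeff, e1, Complex.conj_re] at h5 h6
    refine ⟨?_, h4, fun hp => ?_, fun hn => ?_⟩
    · have h7 := h1.2.2
      -- Conjugating inside the norm turns the conjugated coefficients back into those of `A₁`.
      rw [hcoeff, hcoeff, e1, e0, ← RCLike.norm_conj] at h7
      simpa only [map_sub, map_add, map_mul, map_pow, Complex.conj_ofReal, Complex.conj_conj]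
        using h7
    · have := (h5 hp).conj
      rw [hc] at this
      exact this.verticesK'
    · have := (h6 hn).conj
      rw [hc] at this
      exact this.verticesK'
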